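/- Let $k$ be a field of characteristic $0$, $F\simeq k((t))$ with ring of integers $O\simeq k[[t]]$ and maximal ideal $\mathfrak m$. Let $\Gamma$ be a free abelian group of finite rank, $\Gamma^\vee=\mathrm{Hom}(\Gamma,\mathbb Z)$, and $T=\Gamma\otimes\mathbb G_m$ the torus with cocharacter lattice $\Gamma$, so that $\Gamma^\vee$ is its group of characters. $T(O)$ is the group scheme with $R$-points $\Gamma\otimes R[[t]]^\times$, $T(F)$ the group ind-scheme with $R$-points $\Gamma\otimes R((t))^\times$ ($R$ a $k$-algebra); $T(\mathfrak m)=\ker(T(O)\to T)$; $T(F)^\gamma$ is the component of valuation $\gamma\in\Gamma$; and $f^\gamma:=\gamma\otimes f$. Let $c$ be a non-degenerate (i.e. injective as a map $c:\Gamma\to\Gamma^\vee$) symmetric bilinear form $\Gamma\times\Gamma\to\mathbb Z$. Let $T(F)\tilde{}$ be a Heisenberg extension of level $c$: a central $\mathbb G_m$-superextension of $T(F)$ with a splitting $i:T(O)\to T(F)\tilde{}$, such that points over $T(F)^\gamma$ have parity $c(\gamma,\gamma)\bmod 2$ and the commutator pairing (taken with the sign rule, $\tilde a\tilde b=(-1)^{p(a)p(b)}\{a,b\}^c\,\tilde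 b\tilde a$) is $f_1^{\gamma_1},f_2^{\gamma_2}\mapsto\{f_1,f_2\}^{-c(\gamma_1,\gamma_2)}$. Here $\{\,,\}$ is the Contou-Carrère symbol, normalized by $\{at^n e^{\varphi},bt^m e^{\psi}\}=(-1)^{nm}a^mb^{-n}\exp\mathrm{Res}(\varphi\,d\psi)$ for $a,b\in R^\times$ and $\varphi,\psi\in R((t))$ with zero constant term and nilpotent coefficients in negative degrees. A $T(F)\tilde{}$-module is a $k$-vector space with an action of $T(F)\tilde{}$ such that $\mathbb G_m$ acts by the standard homotheties. Let $Z^c=\ker(c:T\to T^\vee)=\mathrm{Hom}(\Gamma^\vee/c(\Gamma),\mathbb G_m)\subset T\subset T(O)$, where $T^\vee=\Gamma^\vee\otimes\mathbb G_m$. **Lemma.** The group $\Gamma^\vee/c(\Gamma)$, hence the group scheme $Z^c$, is finite. Let $s:\Gamma^\vee/c(\Gamma)\to\Gamma^\vee$ be a set-theoretic section. For a $T(F)\tilde{}$-module $M$ let $M^{\check\gamma}$ ($\check\gamma\in\Gamma^\vee$) be the $\check\gamma$-weight space of $T$ (acting via $i$), and put $M^s=\bigoplus_\chi M^{s(\chi)}$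 and $e_s(M)=(M^s)^{T(\mathfrak m)}$. (1) $e_s(M)$ is a $T(O)$-submodule of $M$ on which $T(O)$ acts through $T$, the $\chi$-isotypical component for $Z^c$ being acted on by $T$ via the character $s(\chi)$; and $M$ is the $T(F)\tilde{}$-module induced from the $T(O)$-module $e_s(M)$ (the inclusion $e_s(M)\subset M$ is universal among $T(O)$-morphisms from $e_s(M)$ to $T(F)\tilde{}$-modules). (2) $e_s$ is an equivalence from the category of $T(F)\tilde{}$-modules to the category of $Z^c$-modules. An inverse functor sends $V$ to the $T(F)\tilde{}$-module induced from the $T(O)$-module $V$ on which $T(O)$ acts through $T$ and $T$ acts on the $\chi$-isotypical component of $V$ by $s(\chi)$. (3) Likewise, $e_s$ is an equivalence from the category of $T(F)\tilde{}$-modules in superspaces (points of $T(F)\tilde{}$ acting with their parity) to that of $Z^c$-modules in superspaces, morphisms being the parity preserving ones. (4) For any two sections $s,s'$ the functors $e_s,e_{s'}$ on $T(F)\tilde{}$-modules are (non-canonically) isomorphic. The isomorphism can be chosen such that, on super modules, its restriction to the $\chi$-isotypical component has parity $c(\gamma,\gamma)\bmod 2$ whenever $\gamma\in\Gamma$ and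 $c(\gamma)=s'(\chi)-s(\chi)$. -/

import Mathlib

universe u

open CategoryTheory TensorProduct
open scoped LaurentSeries PowerSeries Polynomial

noncomputable section

namespace Heis

/-! ### Tori and loop groups as functors of points

`k` is a field of characteristic zero and the local field is `F = k((t))`, so the `R`-points of
`F` and of its ring of integers `O` are `R((t))` and `R[[t]]`.  The torus `T = Γ ⊗ 𝔾ₘ` with
cocharacter lattice `Γ` has points `T(A) = Γ ⊗ Aˣ = Hom(Γ^∨, Aˣ)`. -/

section Points

variable (k : Type u) [Field k] (Γ : Type u) [AddCommGroup Γ]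

/-- Coefficientwise map of Laurent series induced by a ring homomorphism. -/
def laurentMap {R S : Type u} [CommRing R] [CommRing S] (φ : R →+* S) : R⸨X⸩ →+* S⸨X⸩ where
  toFun f := HahnSeries.map f φ
  map_zero' := by ext; simp
  map_one' := by
    ext n
    by_cases h : n = 0 <;> simp [HahnSeries.coeff_one, h]
  map_add' f g := by ext; simp
  map_mul' f g := HahnSeries.map_mul (φ : R →ₙ+* S)

theorem constantCoeff_map' {R S : Type u} [CommRing R] [CommRing S] (φ : R →+* S) (f : R⟦X⟧) :
    PowerSeries.constantCoeff (PowerSeries.map φ f) = φ (PowerSeries.constantCoeff f) := by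
  rw [← PowerSeries.coeff_zero_eq_constantCoeff_apply, PowerSeries.coeff_map,
    PowerSeries.coeff_zero_eq_constantCoeff_apply]

theorem ofPowerSeries_map {R S : Type u} [CommRing R] [CommRing S] (φ : R →+* S) (f : R⟦X⟧) :
    HahnSeries.ofPowerSeries ℤ S (PowerSeries.map φ f) =
      laurentMap φ (HahnSeries.ofPowerSeries ℤ R f) := by
  apply HahnSeries.ext
  ext n
  change (HahnSeries.ofPowerSeries ℤ S (PowerSeries.map φ f)).coeff n =
    φ ((HahnSeries.ofPowerSeries ℤ R f).coeff n)
  rw [PowerSeries.coeff_coe, PowerSeries.coeff_coe]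
  split_ifs <;> simp

/-- The functor `R ↦ R`. -/
@[reducible] def constRing : CommAlgCat.{u} k ⥤ CommRingCat.{u} where
  obj R := CommRingCat.of R
  map φ := CommRingCat.ofHom φ.hom.toRingHom

/-- The functor `R ↦ R[[t]]`. -/
@[reducible] def arcRing : CommAlgCat.{u} k ⥤ CommRingCat.{u} where
  obj R := CommRingCat.of R⟦X⟧
  map φ := CommRingCat.ofHom (PowerSeries.map φ.hom.toRingHom)
  map_id R := by
    ext f : 2
    exact congrArg (fun g => g f) (PowerSeries.map_id (R := R))
  map_comp f g := by ext; simp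

/-- The functor `R ↦ R((t))`. -/
@[reducible] def loopRing : CommAlgCat.{u} k ⥤ CommRingCat.{u} where
  obj R := CommRingCat.of R⸨X⸩
  map φ := CommRingCat.ofHom (laurentMap φ.hom.toRingHom)
  map_id R := by
    ext f : 2
    apply HahnSeries.ext
    ext n
    rfl
  map_comp f g := by
    ext f : 2
    apply HahnSeries.ext
    ext n
    rfl

/-- Constants `R → R[[t]]`. -/
def constToArc : constRing k ⟶ arcRing k where
  app R := CommRingCat.ofHom (PowerSeries.C (R := R))
  naturality R S φ := by
    ext r : 2
    exact (PowerSeries.map_C φ.hom.toRingHom r).symm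

/-- Reduction at the closed point, `R[[t]] → R`. -/
def arcToConst : arcRing k ⟶ constRing k where
  app R := CommRingCat.ofHom (PowerSeries.constantCoeff (R := R))
  naturality R S φ := by
    ext f : 2
    exact constantCoeff_map' φ.hom.toRingHom f

/-- The inclusion `R[[t]] → R((t))`. -/
def arcToLoop : arcRing k ⟶ loopRing k where
  app R := CommRingCat.ofHom (HahnSeries.ofPowerSeries ℤ R)
  naturality R S φ := by
    ext f : 2
    exact ofPowerSeries_map φ.hom.toRingHom f

variable {k}

/-- The group functor `R ↦ Γ ⊗ A(R)ˣ = Hom(Γ^∨, A(R)ˣ)` for a functor `A` from `k`-algebras to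
commutative rings. -/
@[reducible] def torusOver (A : CommAlgCat.{u} k ⥤ CommRingCat.{u}) :
    CommAlgCat.{u} k ⥤ GrpCat.{u} where
  obj R := GrpCat.of (Multiplicative (Module.Dual ℤ Γ) →* (A.obj R)ˣ)
  map φ := GrpCat.ofHom (MonoidHom.compHom (Units.map ((A.map φ).hom : A.obj _ →* A.obj _)))
  map_id R := by ext x : 2; ext y; simp
  map_comp f g := by ext x : 2; ext y; simp

/-- Functoriality of `torusOver` in the ring functor. -/
def torusOverMap {A B : CommAlgCat.{u} k ⥤ CommRingCat.{u}} (η : A ⟶ B) :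
    torusOver Γ A ⟶ torusOver Γ B where
  app R := GrpCat.ofHom (MonoidHom.compHom (Units.map ((η.app R).hom : A.obj R →* B.obj R)))
  naturality R S φ := by
    ext x : 2
    ext y
    exact congrArg (fun g => g.hom ((x y : (A.obj R)ˣ) : A.obj R)) (η.naturality φ)

variable (k)

/-- The torus `T`. -/
abbrev torus : CommAlgCat.{u} k ⥤ GrpCat.{u} := torusOver Γ (constRing k)

/-- The group scheme `T(O)`. -/
abbrev torusArc : CommAlgCat.{u} k ⥤ GrpCat.{u} := torusOver Γ (arcRing k)

/-- The group ind-scheme `T(F)`. -/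
abbrev torusLoop : CommAlgCat.{u} k ⥤ GrpCat.{u} := torusOver Γ (loopRing k)

/-- `T ⊂ T(O)`. -/
abbrev constArc : torus k Γ ⟶ torusArc k Γ := torusOverMap Γ (constToArc k)

/-- The projection `T(O) → T`, whose kernel is `T(𝔪)`. -/
abbrev arcConst : torusArc k Γ ⟶ torus k Γ := torusOverMap Γ (arcToConst k)

/-- `T(O) ⊂ T(F)`. -/
abbrev arcLoop : torusArc k Γ ⟶ torusLoop k Γ := torusOverMap Γ (arcToLoop k)

variable {Γ}

/-- The homomorphism `T → T^∨ = Hom(Γ, 𝔾ₘ)` induced by a symmetric form `c : Γ → Γ^∨`, on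
`R`-points. -/
def levelHom (c : Γ →ₗ[ℤ] Γ →ₗ[ℤ] ℤ) (R : CommAlgCat.{u} k) :
    (Multiplicative (Module.Dual ℤ Γ) →* (R : Type u)ˣ) →* (Multiplicative Γ →* (R : Type u)ˣ) :=
  MonoidHom.compHom' (AddMonoidHom.toMultiplicative c.toAddMonoidHom)

/-- The group scheme `Z^c = Ker(c : T → T^∨)`. -/
@[reducible] def Zc (c : Γ →ₗ[ℤ] Γ →ₗ[ℤ] ℤ) : CommAlgCat.{u} k ⥤ GrpCat.{u} where
  obj R := GrpCat.of (levelHom k c R).ker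
  map {R S} φ := GrpCat.ofHom ((((torus k Γ).map φ).hom.comp
    (levelHom k c R).ker.subtype).codRestrict (levelHom k c S).ker (fun x => by
      have hx : levelHom k c R x.1 = 1 := x.2
      change levelHom k c S _ = 1
      ext y
      have h := congrArg (fun z : Multiplicative Γ →* (R : Type u)ˣ => φ.hom (z y : R)) hx
      exact h.trans (map_one φ.hom)))
  map_id R := by
    ext x : 2
    apply Subtype.ext
    exact congrArg (fun g => g.hom x.1) ((torus k Γ).map_id R)
  map_comp f g := by
    ext x : 2
    apply Subtype.ext
    exact congrArg (fun g => g.hom x.1) ((torus k Γ).map_comp f g)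

/-- `Z^c ⊂ T`. -/
def zcTorus (c : Γ →ₗ[ℤ] Γ →ₗ[ℤ] ℤ) : Zc k c ⟶ torus k Γ where
  app R := GrpCat.ofHom (levelHom k c R).ker.subtype
  naturality _ _ _ := rfl

/-- `Z^c ⊂ T ⊂ T(O)`. -/
abbrev zcArc (c : Γ →ₗ[ℤ] Γ →ₗ[ℤ] ℤ) : Zc k c ⟶ torusArc k Γ := zcTorus k c ≫ constArc k Γ

/-- The element `f^γ = γ ⊗ f` of `T(F)`, i.e. the homomorphism `λ ↦ f ^ λ(γ)` on `Γ^∨`. -/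
def loopPow {R : CommAlgCat.{u} k} (f : (R : Type u)⸨X⸩ˣ) (γ : Γ) : (torusLoop k Γ).obj R :=
  (zpowersHom (R : Type u)⸨X⸩ˣ f).comp
    (AddMonoidHom.toMultiplicative (Module.Dual.eval ℤ Γ γ).toAddMonoidHom)

/-- `f ∈ R((t))` has valuation `n` (at every point of `Spec R`): the coefficient at `tⁿ` is
invertible and all lower ones are nilpotent. -/
def HasValuation {R : Type u} [CommRing R] (f : R⸨X⸩) (n : ℤ) : Prop :=
  IsUnit (f.coeff n) ∧ ∀ j < n, IsNilpotent (f.coeff j)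

/-- `x` is a point of the component `T(F)^γ`, the preimage of `γ` under the valuation
`T(F) → Γ`. -/
def HasDegree {R : CommAlgCat.{u} k} (x : (torusLoop k Γ).obj R) (γ : Γ) : Prop :=
  ∀ l : Module.Dual ℤ Γ,
    HasValuation (R := R) (((show Multiplicative (Module.Dual ℤ Γ) →* (R : Type u)⸨X⸩ˣ from x)
      (Multiplicative.ofAdd l) : (R : Type u)⸨X⸩ˣ) : (R : Type u)⸨X⸩) (l γ)

end Points

/-! ### The Contou-Carrère symbol -/

section Symbol

variable (k : Type u) [Field k] [CharZero k]

/-- The exponential of a nilpotent element of a `k`-algebra. -/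
def nilExp {A : Type u} [CommRing A] [Algebra k A] (x : A) : A :=
  letI : Module ℚ A := Module.compHom A (algebraMap ℚ k)
  IsNilpotent.exp x

theorem isUnit_nilExp {A : Type u} [CommRing A] [Algebra k A] {x : A} (hx : IsNilpotent x) :
    IsUnit (nilExp k x) :=
  letI : Module ℚ A := Module.compHom A (algebraMap ℚ k)
  IsNilpotent.isUnit_exp hx

/-- Coordinates `(n, a, φ)` of an invertible Laurent series `f = a tⁿ exp(φ)` over a
`ℚ`-algebra `R`.  Here `a ∈ Rˣ`, and `φ` is a Laurent series without constant term: its part of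
positive degree is `pos`, and its part of negative degree is `∑ neg_j t^(-j)`, with nilpotent
coefficients.  Every invertible Laurent series is of this form Zariski-locally on `Spec R`. -/
structure LoopCoord (R : Type u) [CommRing R] where
  order : ℤ
  lead : Rˣ
  pos : R⟦X⟧
  neg : R[X]
  pos_zero : PowerSeries.constantCoeff pos = 0
  neg_zero : neg.coeff 0 = 0
  neg_nilpotent : ∀ j, IsNilpotent (neg.coeff j)

namespace LoopCoord

variable {R : Type u} [CommRing R]

/-- The Laurent series `a tⁿ exp(φ)` with given coordinates. -/
def value [Algebra k R] (d : LoopCoord R) : R⸨X⸩ :=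
  HahnSeries.single d.order (d.lead : R) *
    HahnSeries.ofPowerSeries ℤ R ((PowerSeries.exp k).subst d.pos : R⟦X⟧) *
    nilExp k (∑ j ∈ Finset.range (d.neg.natDegree + 1),
      HahnSeries.single (-(j : ℤ)) (d.neg.coeff j) : R⸨X⸩)

/-- `Res(φ dψ) = ∑_j j φ_{-j} ψ_j`, the sum over all integers `j`. -/
def res (d e : LoopCoord R) : R :=
  (∑ j ∈ Finset.range (d.neg.natDegree + 1),
      (j : R) * (d.neg.coeff j * PowerSeries.coeff j e.pos)) -
    ∑ j ∈ Finset.range (e.neg.natDegree + 1),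
      (j : R) * (PowerSeries.coeff j d.pos * e.neg.coeff j)

theorem isNilpotent_res (d e : LoopCoord R) : IsNilpotent (d.res e) := by
  unfold res
  refine Commute.isNilpotent_sub (Commute.all _ _)
    (isNilpotent_sum fun j _ => ?_) (isNilpotent_sum fun j _ => ?_)
  · exact Commute.isNilpotent_mul_left (Commute.all _ _)
      (Commute.isNilpotent_mul_right (Commute.all _ _) (d.neg_nilpotent j))
  · exact Commute.isNilpotent_mul_left (Commute.all _ _)
      (Commute.isNilpotent_mul_left (Commute.all _ _) (e.neg_nilpotent j))

/-- The Contou-Carrère symbol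
`{a tⁿ exp(φ), b tᵐ exp(ψ)} = (-1)^{nm} aᵐ b⁻ⁿ exp(Res(φ dψ))` over a `ℚ`-algebra. -/
def symbol [Algebra k R] (d e : LoopCoord R) : Rˣ :=
  (-1) ^ (d.order * e.order) * d.lead ^ e.order * e.lead ^ (-d.order) *
    (isUnit_nilExp k (d.isNilpotent_res e)).unit

end LoopCoord

end Symbol

/-! ### Heisenberg extensions -/

section Extension

variable (k : Type u) [Field k] [CharZero k] {Γ : Type u} [AddCommGroup Γ]

/-- The localization map `R → R[1/r]` as a morphism of `k`-algebras. -/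
def locMap (R : CommAlgCat.{u} k) (r : R) : R ⟶ CommAlgCat.of k (Localization.Away r) :=
  CommAlgCat.ofHom (IsScalarTower.toAlgHom k R (Localization.Away r))

/-- A group functor on `k`-algebras that is a sheaf for the Zariski topology. -/
def IsZariskiSheaf (G : CommAlgCat.{u} k ⥤ GrpCat.{u}) : Prop :=
  ∀ (R : CommAlgCat.{u} k) (n : ℕ) (r : Fin n → R), Ideal.span (Set.range r) = ⊤ →
    ∀ x : ∀ i, G.obj (CommAlgCat.of k (Localization.Away (r i))),
      (∀ (i j : Fin n) (S : CommAlgCat.{u} k)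
          (a : CommAlgCat.of k (Localization.Away (r i)) ⟶ S)
          (b : CommAlgCat.of k (Localization.Away (r j)) ⟶ S),
          locMap k R (r i) ≫ a = locMap k R (r j) ≫ b → G.map a (x i) = G.map b (x j)) →
      ∃! g : G.obj R, ∀ i, G.map (locMap k R (r i)) g = x i

/-- A Heisenberg extension of level `c`: a central `𝔾ₘ`-superextension of the group ind-scheme
`T(F)` with a splitting over `T(O)`, such that the parity of a point of `T(F)^γ` is
`c(γ, γ)` mod 2 and the commutator pairing is `f₁^γ₁, f₂^γ₂ ↦ {f₁, f₂}^{-c(γ₁, γ₂)}`.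

The parity being prescribed, the extension is the group functor of invertible homogeneous
elements; the commutator pairing of a superextension compares `g₁ g₂` with
`(-1)^{p(g₁) p(g₂)} g₂ g₁`.  The commutator formula is imposed on all pairs of points with
globally defined coordinates, over all `R`, hence holds everywhere by localization. -/
structure HeisenbergExtension (c : Γ →ₗ[ℤ] Γ →ₗ[ℤ] ℤ) where
  /-- The group functor of points of `T(F)~`. -/
  G : CommAlgCat.{u} k ⥤ GrpCat.{u}
  isSheaf : IsZariskiSheaf k G
  /-- The projection to `T(F)`. -/
  proj : G ⟶ torusLoop k Γ
  /-- The subgroup `𝔾ₘ`. -/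
  scalar : ∀ R : CommAlgCat.{u} k, (R : Type u)ˣ →* G.obj R
  scalar_natural : ∀ {R S : CommAlgCat.{u} k} (φ : R ⟶ S) (a : (R : Type u)ˣ),
    G.map φ (scalar R a) = scalar S (Units.map (φ.hom : (R : Type u) →* S) a)
  scalar_injective : ∀ R, Function.Injective (scalar R)
  scalar_central : ∀ (R : CommAlgCat.{u} k) (a : (R : Type u)ˣ) (g : G.obj R),
    scalar R a * g = g * scalar R a
  proj_eq_one_iff : ∀ (R : CommAlgCat.{u} k) (g : G.obj R),
    proj.app R g = 1 ↔ ∃ a, scalar R a = g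
  /-- The projection is surjective locally for the Zariski topology. -/
  proj_surjective : ∀ (R : CommAlgCat.{u} k) (x : (torusLoop k Γ).obj R),
    ∃ (n : ℕ) (r : Fin n → R), Ideal.span (Set.range r) = ⊤ ∧
      ∀ i, ∃ g : G.obj (CommAlgCat.of k (Localization.Away (r i))),
        proj.app _ g = (torusLoop k Γ).map (locMap k R (r i)) x
  /-- The splitting over `T(O)`. -/
  splitting : torusArc k Γ ⟶ G
  splitting_proj : splitting ≫ proj = arcLoop k Γ
  commutator : ∀ (R : CommAlgCat.{u} k) (d₁ d₂ : LoopCoord R) (f₁ f₂ : (R : Type u)⸨X⸩ˣ)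
    (γ₁ γ₂ : Γ) (g₁ g₂ : G.obj R),
    (f₁ : (R : Type u)⸨X⸩) = d₁.value k → (f₂ : (R : Type u)⸨X⸩) = d₂.value k →
    proj.app R g₁ = loopPow k f₁ γ₁ → proj.app R g₂ = loopPow k f₂ γ₂ →
    g₁ * g₂ = scalar R
      ((-1) ^ (c (d₁.order • γ₁) (d₁.order • γ₁) * c (d₂.order • γ₂) (d₂.order • γ₂)) *
        (d₁.symbol k d₂) ^ (-c γ₁ γ₂)) * (g₂ * g₁)

end Extension

/-! ### Representations of group functors -/

section Representations

variable {k : Type u} [Field k]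

/-- A representation of a group functor `G` on a `k`-vector space `V`: actions of `G(R)` on
`R ⊗ V` by `R`-linear automorphisms, natural in the `k`-algebra `R`. -/
structure FRep (G : CommAlgCat.{u} k ⥤ GrpCat.{u}) where
  V : Type u
  [addCommGroup : AddCommGroup V]
  [module : Module k V]
  act : ∀ R : CommAlgCat.{u} k, G.obj R →* Module.End R ((R : Type u) ⊗[k] V)
  natural : ∀ {R S : CommAlgCat.{u} k} (φ : R ⟶ S) (g : G.obj R) (x : (R : Type u) ⊗[k] V),
    φ.hom.toLinearMap.rTensor V (act R g x) =
      act S (G.map φ g) (φ.hom.toLinearMap.rTensor V x)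

namespace FRep

attribute [instance] FRep.addCommGroup FRep.module

variable {G G' : CommAlgCat.{u} k ⥤ GrpCat.{u}}

/-- Morphisms of representations: equivariant `k`-linear maps. -/
@[ext] structure Hom (M N : FRep G) where
  lin : M.V →ₗ[k] N.V
  equivariant : ∀ (R : CommAlgCat.{u} k) (g : G.obj R) (x : (R : Type u) ⊗[k] M.V),
    lin.baseChange R (M.act R g x) = N.act R g (lin.baseChange R x)

instance : Category (FRep G) where
  Hom := Hom
  id M := ⟨LinearMap.id, fun R g x => by simp⟩
  comp f g := ⟨g.lin ∘ₗ f.lin, fun R a x => by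
    simp only [LinearMap.baseChange_comp, LinearMap.comp_apply, f.equivariant, g.equivariant]⟩

/-- The linear map underlying a morphism. -/
def lin {M N : FRep G} (f : M ⟶ N) : M.V →ₗ[k] N.V := Hom.lin f

theorem hom_ext {M N : FRep G} {f g : M ⟶ N} (h : lin f = lin g) : f = g := Hom.ext h

/-- Restriction along a homomorphism of group functors. -/
def restrict (η : G' ⟶ G) : FRep G ⥤ FRep G' where
  obj M :=
    { V := M.V
      act := fun R => (M.act R).comp (η.app R).hom
      natural := fun {R S} φ g x => by
        have h : η.app S (G'.map φ g) = G.map φ (η.app R g) :=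
          congrArg (fun z => z.hom g) (η.naturality φ)
        have h2 := M.natural φ (η.app R g) x
        rw [← h] at h2
        exact h2 }
  map {M N} f := ⟨(f : Hom M N).lin, fun R g x => (f : Hom M N).equivariant R (η.app R g) x⟩

section Sub

variable (M : FRep G) (N : Submodule k M.V)

/-- An invariant subspace of a representation. -/
def IsInvariant : Prop :=
  ∀ (R : CommAlgCat.{u} k) (g : G.obj R), ∀ m ∈ N,
    M.act R g ((1 : R) ⊗ₜ[k] m) ∈ N.baseChange R

variable {M N}

theorem baseChange_subtype_injective (R : CommAlgCat.{u} k) :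
    Function.Injective (N.subtype.baseChange (R : Type u)) := by
  intro x y h
  exact Submodule.toBaseChange_injective (A := (R : Type u)) N (Subtype.ext h)

theorem IsInvariant.mem (hN : M.IsInvariant N) (R : CommAlgCat.{u} k) (g : G.obj R)
    (y : (R : Type u) ⊗[k] M.V) (hy : y ∈ N.baseChange R) : M.act R g y ∈ N.baseChange R := by
  rw [Submodule.baseChange_eq_span] at hy
  induction hy using Submodule.span_induction with
  | mem y h =>
    obtain ⟨m, hm, rfl⟩ := h
    exact hN R g m hm
  | zero => simp
  | add a b _ _ ha hb => rw [map_add]; exact add_mem ha hb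
  | smul r a _ ha => rw [map_smul]; exact Submodule.smul_mem _ _ ha

/-- The action of a group element on `R ⊗ N` for an invariant subspace `N`. -/
def subAct (hN : M.IsInvariant N) (R : CommAlgCat.{u} k) (g : G.obj R) :
    Module.End R ((R : Type u) ⊗[k] N) :=
  (Submodule.toBaseChange.toLinearEquiv (R : Type u) N).symm.toLinearMap ∘ₗ
    ((M.act R g).restrict (hN.mem R g)) ∘ₗ
      (Submodule.toBaseChange.toLinearEquiv (R : Type u) N).toLinearMap

theorem subAct_spec (hN : M.IsInvariant N) (R : CommAlgCat.{u} k) (g : G.obj R)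
    (x : (R : Type u) ⊗[k] N) :
    N.subtype.baseChange R (subAct hN R g x) = M.act R g (N.subtype.baseChange R x) := by
  have h := (Submodule.toBaseChange.toLinearEquiv (R : Type u) N).apply_symm_apply
    ((M.act R g).restrict (hN.mem R g)
      (Submodule.toBaseChange.toLinearEquiv (R : Type u) N x))
  exact congrArg Subtype.val h

/-- The subrepresentation on an invariant subspace. -/
def sub (hN : M.IsInvariant N) : FRep G where
  V := N
  act R :=
    { toFun := subAct hN R
      map_one' := by
        refine LinearMap.ext fun x => baseChange_subtype_injective R ?_
        rw [subAct_spec, map_one]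
        rfl
      map_mul' := fun a b => by
        refine LinearMap.ext fun x => baseChange_subtype_injective R ?_
        rw [subAct_spec, map_mul, Module.End.mul_apply, Module.End.mul_apply, subAct_spec,
          subAct_spec] }
  natural {R S} φ g x := by
    apply baseChange_subtype_injective S
    have key : ∀ z : (R : Type u) ⊗[k] N,
        N.subtype.baseChange (S : Type u) (φ.hom.toLinearMap.rTensor N z) =
          φ.hom.toLinearMap.rTensor M.V (N.subtype.baseChange (R : Type u) z) := by
      intro z
      induction z using TensorProduct.induction_on with
      | zero => simp
      | tmul r n => simp
      | add a b ha hb => simp only [map_add, ha, hb]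
    change N.subtype.baseChange (S : Type u) (φ.hom.toLinearMap.rTensor N (subAct hN R g x)) =
      N.subtype.baseChange (S : Type u)
        (subAct hN S (G.map φ g) (φ.hom.toLinearMap.rTensor N x))
    rw [key, subAct_spec, subAct_spec, key, M.natural]

/-- The inclusion of a subrepresentation. -/
def subIncl (hN : M.IsInvariant N) : sub hN ⟶ M :=
  Hom.mk N.subtype fun R g x => subAct_spec hN R g x

theorem subMap_spec {M' : FRep G} {N' : Submodule k M'.V} (f : M ⟶ M')
    (hf : ∀ m ∈ N, lin f m ∈ N') (R : CommAlgCat.{u} k) (z : (R : Type u) ⊗[k] N) :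
    N'.subtype.baseChange (R : Type u) (((lin f).restrict hf).baseChange R z) =
      (lin f).baseChange R (N.subtype.baseChange (R : Type u) z) := by
  induction z using TensorProduct.induction_on with
  | zero => simp
  | tmul r n => simp
  | add a b ha hb => simp only [map_add, ha, hb]

theorem subMap_equivariant {M' : FRep G} {N' : Submodule k M'.V} (hN : M.IsInvariant N)
    (hN' : M'.IsInvariant N') (f : M ⟶ M') (hf : ∀ m ∈ N, lin f m ∈ N')
    (R : CommAlgCat.{u} k) (g : G.obj R) (x : (R : Type u) ⊗[k] N) :
    ((lin f).restrict hf).baseChange R (subAct hN R g x) =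
      subAct hN' R g (((lin f).restrict hf).baseChange R x) := by
  apply baseChange_subtype_injective R
  rw [subMap_spec, subAct_spec, subAct_spec, subMap_spec]
  exact Hom.equivariant (show Hom M M' from f) R g _

/-- The restriction of a morphism to subrepresentations. -/
def subMap {M' : FRep G} {N' : Submodule k M'.V} (hN : M.IsInvariant N) (hN' : M'.IsInvariant N')
    (f : M ⟶ M') (hf : ∀ m ∈ N, lin f m ∈ N') : sub hN ⟶ sub hN' :=
  Hom.mk ((lin f).restrict hf) fun R g x => subMap_equivariant hN hN' f hf R g x

end Sub

end FRep

/-! ### The functors `e_s` -/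

section ArcRepresentations

variable {Γ : Type u} [AddCommGroup Γ]

/-- The value at `x ∈ T(R)` of the character of `T` given by `l ∈ Γ^∨`. -/
def charEval {R : CommAlgCat.{u} k} (l : Module.Dual ℤ Γ) (x : (torus k Γ).obj R) : R :=
  (((show Multiplicative (Module.Dual ℤ Γ) →* (R : Type u)ˣ from x)
    (Multiplicative.ofAdd l) : (R : Type u)ˣ) : R)

/-- The component `M^l`, `l ∈ Γ^∨`, of the weight decomposition of a `T(O)`-module under `T`. -/
def weightSpace (M : FRep (torusArc k Γ)) (l : Module.Dual ℤ Γ) : Submodule k M.V where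
  carrier := {m | ∀ (R : CommAlgCat.{u} k) (x : (torus k Γ).obj R),
    M.act R ((constArc k Γ).app R x) ((1 : R) ⊗ₜ[k] m) = charEval l x ⊗ₜ[k] m}
  zero_mem' := by intro R x; simp
  add_mem' := by
    intro a b ha hb R x
    rw [TensorProduct.tmul_add, map_add, ha, hb, TensorProduct.tmul_add]
  smul_mem' := by
    intro r a ha R x
    rw [TensorProduct.tmul_smul, LinearMap.map_smul_of_tower, ha, TensorProduct.tmul_smul]

/-- The invariants `M^{T(𝔪)}` of a `T(O)`-module, where `T(𝔪) = Ker(T(O) → T)`. -/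
def unipotentInvariants (M : FRep (torusArc k Γ)) : Submodule k M.V where
  carrier := {m | ∀ (R : CommAlgCat.{u} k) (x : (torusArc k Γ).obj R),
    (arcConst k Γ).app R x = 1 → M.act R x ((1 : R) ⊗ₜ[k] m) = (1 : R) ⊗ₜ[k] m}
  zero_mem' := by intro R x _; simp
  add_mem' := by
    intro a b ha hb R x hx
    rw [TensorProduct.tmul_add, map_add, ha R x hx, hb R x hx]
  smul_mem' := by
    intro r a ha R x hx
    rw [TensorProduct.tmul_smul, LinearMap.map_smul_of_tower, ha R x hx]

/-- The group `Γ^∨/c(Γ)` of characters of `Z^c`. -/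
abbrev CharQuot (c : Γ →ₗ[ℤ] Γ →ₗ[ℤ] ℤ) : Type u := Module.Dual ℤ Γ ⧸ LinearMap.range c

/-- Set-theoretic sections `s : Γ^∨/c(Γ) → Γ^∨`. -/
abbrev LevelSection (c : Γ →ₗ[ℤ] Γ →ₗ[ℤ] ℤ) : Type u :=
  {s : CharQuot c → Module.Dual ℤ Γ // ∀ χ, (LinearMap.range c).mkQ (s χ) = χ}

variable {c : Γ →ₗ[ℤ] Γ →ₗ[ℤ] ℤ}

/-- `(M^s)^{T(𝔪)}`, where `M^s` is the sum of the weight spaces `M^{s(χ)}`. -/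
def eSpace (s : LevelSection c) (M : FRep (torusArc k Γ)) : Submodule k M.V :=
  (⨆ χ, weightSpace M (s.1 χ)) ⊓ unipotentInvariants M

theorem torusArc_comm {R : CommAlgCat.{u} k} (x y : (torusArc k Γ).obj R) : x * y = y * x :=
  mul_comm (show Multiplicative (Module.Dual ℤ Γ) →* (R : Type u)⟦X⟧ˣ from x) y

theorem arcConst_constArc {R : CommAlgCat.{u} k} (x : (torus k Γ).obj R) :
    (arcConst k Γ).app R ((constArc k Γ).app R x) = x := by
  refine MonoidHom.ext fun y => Units.ext ?_
  exact PowerSeries.constantCoeff_C _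

/-- The translate of a `T(𝔪)`-invariant vector by a point of `T(k)` is invariant. -/
theorem translate_mem (M : FRep (torusArc k Γ)) (t : (torus k Γ).obj (CommAlgCat.of k k))
    {m m' : M.V} (hm : m ∈ unipotentInvariants M)
    (h : M.act (CommAlgCat.of k k) ((constArc k Γ).app _ t) ((1 : k) ⊗ₜ[k] m) =
      (1 : k) ⊗ₜ[k] m') : m' ∈ unipotentInvariants M := by
  intro R x hx
  let φ : CommAlgCat.of k k ⟶ R := CommAlgCat.ofHom (Algebra.ofId k R)
  have h1 : ∀ v : M.V, φ.hom.toLinearMap.rTensor M.V ((1 : k) ⊗ₜ[k] v) = (1 : R) ⊗ₜ[k] v := by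
    intro v
    rw [LinearMap.rTensor_tmul]
    exact congrArg (· ⊗ₜ[k] v) (map_one φ.hom)
  have h2 := M.natural φ ((constArc k Γ).app _ t) ((1 : k) ⊗ₜ[k] m)
  rw [h, h1, h1] at h2
  rw [h2, ← Module.End.mul_apply, ← map_mul, torusArc_comm, map_mul, Module.End.mul_apply,
    hm R x hx]

theorem exists_separating [CharZero k] {l l' : Module.Dual ℤ Γ} (h : l ≠ l') :
    ∃ t : (torus k Γ).obj (CommAlgCat.of k k), (charEval l t : k) ≠ charEval l' t := by
  obtain ⟨γ, hγ⟩ : ∃ γ, l γ ≠ l' γ := by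
    by_contra hcon
    push Not at hcon
    exact h (LinearMap.ext hcon)
  refine ⟨(zpowersHom kˣ (Units.mk0 (2 : k) two_ne_zero)).comp
    (AddMonoidHom.toMultiplicative (Module.Dual.eval ℤ Γ γ).toAddMonoidHom), ?_⟩
  change (((Units.mk0 (2 : k) two_ne_zero) ^ (l γ) : kˣ) : k) ≠
    (((Units.mk0 (2 : k) two_ne_zero) ^ (l' γ) : kˣ) : k)
  rw [Units.val_zpow_eq_zpow_val, Units.val_zpow_eq_zpow_val, Units.val_mk0]
  intro hcon
  have h2 : ((2 : ℚ) ^ (l γ)) = (2 : ℚ) ^ (l' γ) := by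
    have : (((2 : ℚ) ^ (l γ) : ℚ) : k) = (((2 : ℚ) ^ (l' γ) : ℚ) : k) := by
      push_cast
      exact hcon
    exact_mod_cast this
  exact hγ (zpow_right_injective₀ (by norm_num) (by norm_num) h2)

theorem mem_of_sum_mem [CharZero k] (M : FRep (torusArc k Γ)) {ι : Type u}
    (l : ι → Module.Dual ℤ Γ) (hl : Function.Injective l) (S : Finset ι) :
    ∀ m : ι → M.V, (∀ i, m i ∈ weightSpace M (l i)) →
      ∑ i ∈ S, m i ∈ unipotentInvariants M → ∀ i ∈ S, m i ∈ unipotentInvariants M := by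
  classical
  induction S using Finset.induction_on with
  | empty => simp
  | insert a S ha ih =>
    intro m hm hsum
    have key : ∀ i ∈ S, m i ∈ unipotentInvariants M := by
      intro i hi
      obtain ⟨t, ht⟩ := exists_separating (k := k)
        (fun h => ha (hl h ▸ hi) : l i ≠ l a)
      have h1 : ∑ j ∈ insert a S, (charEval (l j) t : k) • m j ∈ unipotentInvariants M := by
        refine translate_mem M t hsum ?_
        rw [TensorProduct.tmul_sum, map_sum, TensorProduct.tmul_sum]
        refine Finset.sum_congr rfl fun j _ => ?_
        rw [hm j, TensorProduct.tmul_smul, TensorProduct.smul_tmul']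
        exact congrArg (· ⊗ₜ[k] m j) (mul_one _).symm
      have h2 := sub_mem h1 (Submodule.smul_mem _ (charEval (l a) t : k) hsum)
      rw [Finset.smul_sum, ← Finset.sum_sub_distrib, Finset.sum_insert ha, sub_self, zero_add] at h2
      have h3 := ih (fun j => (charEval (l j) t : k) • m j - (charEval (l a) t : k) • m j)
        (fun j => sub_mem (Submodule.smul_mem _ _ (hm j)) (Submodule.smul_mem _ _ (hm j))) h2 i hi
      simp only [← sub_smul] at h3
      exact (Submodule.smul_mem_iff _ (sub_ne_zero.2 ht)).1 h3
    intro i hi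
    rcases Finset.mem_insert.1 hi with rfl | hi
    · rw [Finset.sum_insert ha] at hsum
      exact (Submodule.add_mem_iff_left _ (sum_mem key)).1 hsum
    · exact key i hi

theorem eSpace_invariant [CharZero k] (s : LevelSection c) (M : FRep (torusArc k Γ)) :
    M.IsInvariant (eSpace s M) := by
  intro R g m hm
  obtain ⟨f, hf, hsum⟩ := (Submodule.mem_iSup_iff_exists_finsupp _ _).1 hm.1
  have hinj : Function.Injective s.1 := fun χ ψ h => by rw [← s.2 χ, ← s.2 ψ, h]
  have hmem : ∀ χ ∈ f.support, f χ ∈ unipotentInvariants M := by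
    refine mem_of_sum_mem M s.1 hinj f.support f hf ?_
    have := hm.2
    rw [← hsum] at this
    exact this
  have hred : (arcConst k Γ).app R
      (((constArc k Γ).app R ((arcConst k Γ).app R g))⁻¹ * g) = 1 := by
    rw [map_mul]
    refine (congrArg (· * _) (map_inv ((arcConst k Γ).app R).hom _)).trans ?_
    change ((arcConst k Γ).app R ((constArc k Γ).app R ((arcConst k Γ).app R g)))⁻¹ * _ = _
    rw [arcConst_constArc]
    exact inv_mul_cancel (G := (torus k Γ).obj R) _
  have h1 : M.act R g ((1 : R) ⊗ₜ[k] m) =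
      M.act R ((constArc k Γ).app R ((arcConst k Γ).app R g)) ((1 : R) ⊗ₜ[k] m) := by
    conv_lhs => rw [← mul_inv_cancel_left ((constArc k Γ).app R ((arcConst k Γ).app R g)) g]
    rw [map_mul, Module.End.mul_apply, hm.2 R _ hred]
  have h2 : m = ∑ χ ∈ f.support, f χ := hsum.symm
  rw [h1, h2, TensorProduct.tmul_sum, map_sum]
  refine sum_mem fun χ hχ => ?_
  rw [hf χ]
  exact Submodule.tmul_mem_baseChange_of_mem _
    ⟨Submodule.mem_iSup_of_mem χ (hf χ), hmem χ hχ⟩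

theorem map_mem_eSpace (s : LevelSection c) {M N : FRep (torusArc k Γ)} (f : M ⟶ N) :
    ∀ m ∈ eSpace s M, FRep.lin f m ∈ eSpace s N := by
  have key : ∀ (R : CommAlgCat.{u} k) (x : (torusArc k Γ).obj R) (m : M.V),
      N.act R x ((1 : R) ⊗ₜ[k] FRep.lin f m) =
        (FRep.lin f).baseChange R (M.act R x ((1 : R) ⊗ₜ[k] m)) := fun R x m =>
    (FRep.Hom.equivariant (show FRep.Hom M N from f) R x ((1 : R) ⊗ₜ[k] m)).symm
  rintro m ⟨h1, h2⟩
  refine ⟨?_, fun R x hx => ?_⟩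
  · have hle : (⨆ χ, weightSpace M (s.1 χ)) ≤
        (⨆ χ, weightSpace N (s.1 χ)).comap (FRep.lin f) := by
      refine iSup_le fun χ v hv => Submodule.mem_iSup_of_mem χ fun R x => ?_
      rw [key, hv R x, LinearMap.baseChange_tmul]
    exact hle h1
  · rw [key, h2 R x hx, LinearMap.baseChange_tmul]

/-- The functor `M ↦ (M^s)^{T(𝔪)}` on `T(O)`-modules. -/
def eArc [CharZero k] (s : LevelSection c) : FRep (torusArc k Γ) ⥤ FRep (torusArc k Γ) where
  obj M := FRep.sub (eSpace_invariant s M)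
  map f := FRep.subMap (eSpace_invariant s _) (eSpace_invariant s _) f (map_mem_eSpace s f)

/-- The inclusion `(M^s)^{T(𝔪)} ⊂ M`. -/
def eArcIncl [CharZero k] (s : LevelSection c) : eArc (k := k) s ⟶ 𝟭 _ where
  app M := FRep.subIncl (eSpace_invariant s M)

end ArcRepresentations

/-! ### Modules over a Heisenberg extension -/

section Modules

variable [CharZero k] {Γ : Type u} [AddCommGroup Γ] {c : Γ →ₗ[ℤ] Γ →ₗ[ℤ] ℤ}

/-- The category of `T(F)~`-modules: `k`-vector spaces with an action of `T(F)~` for which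
`𝔾ₘ` acts by homotheties. -/
abbrev HeisMod (H : HeisenbergExtension k c) :=
  ObjectProperty.FullSubcategory (fun M : FRep H.G =>
    ∀ (R : CommAlgCat.{u} k) (a : (R : Type u)ˣ) (x : (R : Type u) ⊗[k] M.V),
      M.act R (H.scalar R a) x = (a : R) • x)

/-- Restriction of a `T(F)~`-module to `T(O)`. -/
abbrev resArc (H : HeisenbergExtension k c) : HeisMod H ⥤ FRep (torusArc k Γ) :=
  ObjectProperty.ι _ ⋙ FRep.restrict H.splitting

/-- The category of `Z^c`-modules. -/
abbrev ZcMod (k : Type u) [Field k] (c : Γ →ₗ[ℤ] Γ →ₗ[ℤ] ℤ) := FRep (Zc k c)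

/-- Restriction of a `T(O)`-module to `Z^c ⊂ T ⊂ T(O)`. -/
abbrev resZc (k : Type u) [Field k] (c : Γ →ₗ[ℤ] Γ →ₗ[ℤ] ℤ) :
    FRep (torusArc k Γ) ⥤ ZcMod k c :=
  FRep.restrict (zcArc k c)

/-- `e_s(M) = (M^s)^{T(𝔪)}` as a `T(O)`-module. -/
abbrev eO (H : HeisenbergExtension k c) (s : LevelSection c) :
    HeisMod H ⥤ FRep (torusArc k Γ) :=
  resArc H ⋙ eArc s

/-- The functor `e_s : M ↦ (M^s)^{T(𝔪)}` from `T(F)~`-modules to `Z^c`-modules. -/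
abbrev eFunctor (H : HeisenbergExtension k c) (s : LevelSection c) : HeisMod H ⥤ ZcMod k c :=
  eO H s ⋙ resZc k c

/-- The inclusion `e_s(M) ⊂ M` of `T(O)`-modules. -/
abbrev eIncl (H : HeisenbergExtension k c) (s : LevelSection c) : eO H s ⟶ resArc H :=
  Functor.whiskerLeft (resArc H) (eArcIncl s)

/-- The morphism of `T(O)`-modules `j : W → M` exhibits the `T(F)~`-module `M` as the module
induced from `W`: morphisms `M → N` of `T(F)~`-modules are the same as morphisms `W → N` of
`T(O)`-modules. -/
def IsInduced (H : HeisenbergExtension k c) {W : FRep (torusArc k Γ)} {M : HeisMod H}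
    (j : W ⟶ (resArc H).obj M) : Prop :=
  ∀ (N : HeisMod H) (f : W ⟶ (resArc H).obj N), ∃! g : M ⟶ N, j ≫ (resArc H).map g = f

/-- The subspace of a `Z^c`-module on which `Z^c` acts by the character `l|_{Z^c}`, for
`l ∈ Γ^∨`; it is the isotypical component of the class of `l` in `Γ^∨/c(Γ) = Hom(Z^c, 𝔾ₘ)`. -/
def isotypic (V : ZcMod k c) (l : Module.Dual ℤ Γ) : Submodule k V.V where
  carrier := {v | ∀ (R : CommAlgCat.{u} k) (z : (Zc k c).obj R),
    V.act R z ((1 : R) ⊗ₜ[k] v) = charEval l ((zcTorus k c).app R z) ⊗ₜ[k] v}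
  zero_mem' := by intro R x; simp
  add_mem' := by
    intro a b ha hb R x
    rw [TensorProduct.tmul_add, map_add, ha, hb, TensorProduct.tmul_add]
  smul_mem' := by
    intro r a ha R x
    rw [TensorProduct.tmul_smul, LinearMap.map_smul_of_tower, ha, TensorProduct.tmul_smul]

/-- `T(O)` acts on `W` through `T = T(O)/T(𝔪)`, and `T` acts by the character `s(χ)` on the
`χ`-isotypical component of `W` as a `Z^c`-module, for every `χ`. -/
def ActsThrough (s : LevelSection c) (W : FRep (torusArc k Γ)) : Prop :=
  unipotentInvariants W = ⊤ ∧
    ∀ χ, isotypic ((resZc k c).obj W) (s.1 χ) ≤ weightSpace W (s.1 χ)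

/-! ### Supermodules -/

/-- A super representation of a purely even group functor.  A superspace is a vector space with
its parity involution, equal to `1` on the even part and to `-1` on the odd part. -/
structure SuperFRep (G : CommAlgCat.{u} k ⥤ GrpCat.{u}) where
  rep : FRep G
  parity : rep ⟶ rep
  parity_sq : parity ≫ parity = 𝟙 rep

/-- Morphisms of super representations are the parity preserving ones. -/
@[ext] structure SuperFRep.Hom {G : CommAlgCat.{u} k ⥤ GrpCat.{u}} (M N : SuperFRep G) where
  hom : M.rep ⟶ N.rep
  comm : M.parity ≫ hom = hom ≫ N.parity

instance {G : CommAlgCat.{u} k ⥤ GrpCat.{u}} : Category (SuperFRep G) where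
  Hom := SuperFRep.Hom
  id M := ⟨𝟙 _, by simp⟩
  comp f g := ⟨f.hom ≫ g.hom, by
    rw [← Category.assoc, f.comm, Category.assoc, g.comm, Category.assoc]⟩

/-- A `T(F)~`-module in superspaces: points of `T(F)~` over `T(F)^γ` act by operators of parity
`c(γ, γ)`. -/
structure SuperHeisMod (H : HeisenbergExtension k c) where
  mod : HeisMod H
  parity : mod.obj.V →ₗ[k] mod.obj.V
  parity_sq : parity ∘ₗ parity = LinearMap.id
  parity_act : ∀ (R : CommAlgCat.{u} k) (g : H.G.obj R) (γ : Γ), HasDegree k (H.proj.app R g) γ →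
    ∀ x : (R : Type u) ⊗[k] mod.obj.V,
      parity.baseChange R (mod.obj.act R g x) =
        (-1 : (R : Type u)ˣ) ^ c γ γ • mod.obj.act R g (parity.baseChange R x)

/-- Morphisms of super `T(F)~`-modules are the parity preserving ones. -/
@[ext] structure SuperHeisMod.Hom {H : HeisenbergExtension k c} (M N : SuperHeisMod H) where
  hom : M.mod ⟶ N.mod
  comm : FRep.lin hom.hom ∘ₗ M.parity = N.parity ∘ₗ FRep.lin hom.hom

instance (H : HeisenbergExtension k c) : Category (SuperHeisMod H) where
  Hom := SuperHeisMod.Hom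
  id M := ⟨𝟙 _, rfl⟩
  comp f g := ⟨f.hom ≫ g.hom, by
    change (FRep.lin g.hom.hom ∘ₗ FRep.lin f.hom.hom) ∘ₗ _ =
      _ ∘ₗ (FRep.lin g.hom.hom ∘ₗ FRep.lin f.hom.hom)
    rw [LinearMap.comp_assoc, f.comm, ← LinearMap.comp_assoc, g.comm, LinearMap.comp_assoc]⟩

theorem hasDegree_arcLoop {R : CommAlgCat.{u} k} (x : (torusArc k Γ).obj R) :
    HasDegree k ((arcLoop k Γ).app R x) 0 := by
  intro l
  let y : (R : Type u)⟦X⟧ˣ :=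
    (show Multiplicative (Module.Dual ℤ Γ) →* (R : Type u)⟦X⟧ˣ from x) (Multiplicative.ofAdd l)
  have h : ∀ n : ℤ, (HahnSeries.ofPowerSeries ℤ R (y : (R : Type u)⟦X⟧)).coeff n =
      if n < 0 then 0 else PowerSeries.coeff n.natAbs (y : (R : Type u)⟦X⟧) :=
    fun n => PowerSeries.coeff_coe _ n
  rw [map_zero]
  change HasValuation (HahnSeries.ofPowerSeries ℤ R (y : (R : Type u)⟦X⟧)) 0
  refine ⟨?_, fun j hj => ?_⟩
  · rw [h]
    have hy : IsUnit (PowerSeries.constantCoeff (y : (R : Type u)⟦X⟧)) := y.isUnit.map _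
    simpa using hy
  · rw [h, if_pos hj]
    exact IsNilpotent.zero

/-- The parity involution of a super `T(F)~`-module commutes with `T(O)`. -/
def SuperHeisMod.parityArc {H : HeisenbergExtension k c} (M : SuperHeisMod H) :
    (resArc H).obj M.mod ⟶ (resArc H).obj M.mod :=
  FRep.Hom.mk M.parity fun R g x => by
    have h := M.parity_act R (H.splitting.app R g) 0 (by
      have h1 : H.proj.app R (H.splitting.app R g) = (arcLoop k Γ).app R g :=
        congrArg (fun η => (η.app R).hom g) H.splitting_proj
      rw [h1]
      exact hasDegree_arcLoop g) x
    have h0 : (-1 : (R : Type u)ˣ) ^ c (0 : Γ) (0 : Γ) = 1 := by simp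
    rw [h0, one_smul] at h
    exact h

/-- The functor `e_s` on super modules: `e_s(M) ⊂ M` with the induced parity. -/
def eSuper (H : HeisenbergExtension k c) (s : LevelSection c) :
    SuperHeisMod H ⥤ SuperFRep (Zc k c) where
  obj M :=
    { rep := (eFunctor H s).obj M.mod
      parity := (eArc s ⋙ resZc k c).map M.parityArc
      parity_sq := by
        rw [← Functor.map_comp]
        have h : M.parityArc ≫ M.parityArc = 𝟙 _ := FRep.hom_ext M.parity_sq
        rw [h]
        exact (eArc s ⋙ resZc k c).map_id _ }
  map {M N} f :=
    { hom := (eFunctor H s).map f.hom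
      comm := by
        have h : M.parityArc ≫ (resArc H).map f.hom = (resArc H).map f.hom ≫ N.parityArc :=
          FRep.hom_ext f.comm
        have h2 := congrArg (eArc s ⋙ resZc k c).map h
        rw [Functor.map_comp, Functor.map_comp] at h2
        exact h2 }

end Modules

end Representations

end Heis

end

open Heis

/-!
A Heisenberg extension is an infinite-dimensional analogue of the Heisenberg group, and the theorem
is its Stone–von Neumann theorem: the negative part of `T(F)` acts by multiplication operators, and
`T(𝔪)` by the translations dual to them.

*Normal forms.* By the Contou-Carrère factorization of invertible Laurent series, every point of
`T(F)` is locally, and uniquely, a product of some `t^γ`, a point `x` of `T(O)`, and a point `ν` of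
the formal group of exponentials of nilpotent polynomials in `t⁻¹` without constant term. The
negative part lifts to `T(F)~` as a homomorphism: each of its one-parameter subgroups is lifted by
solving a flow equation over truncated polynomial rings (`HeisenbergExtension.exists_negLift`), and
the lifts commute with each other because their symbols are trivial (`exists_lifts`). Hence points
of `T(F)~` have local normal forms `a t^γ x ν`, whose multiplication `Lifts.nf_mul` involves only
the characters `c(γ)` of `T`, a cocycle in `kˣ`, and the residue pairing of `ν` with the logarithmic
coordinates `y_p(x)` of `T(𝔪)`. As `c` is non-degenerate and `k` has characteristic zero, these are
coordinates: `T(𝔪)` is the vector group with the coordinates `y_p`.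

*Invariants generate.* On a module the negative part acts through commuting infinitesimal generators
`b_p`, which a point of `T(𝔪)` translates to `b_p + y_p` (`Lifts.act_arc_b`). Evaluation of the
universal point of `T(𝔪)` at `y = -b` therefore maps every vector to an invariant one, and every
vector is recovered from such invariants by applying polynomials in the `b_p` (`Frame.vac_mem`,
`Frame.contract_vac`). The lifts of `t^γ` shift the weights of `T` by `-c(γ)`. So a subspace stable
under the `b_p` and these lifts is everything once it contains `e_s(M)` (`Lifts.eq_top_of_stable`).

*Models.* For a family `l` of characters of `T`, the polynomials in variables `X_p`, one copy for
every index and every `γ ∈ Γ`, carry an action of all points that have a normal form; it glues to a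
module `model`. It is free on vectors on which `T(O)` acts by the characters `l`
(`exists_model_hom`), and its `T(𝔪)`-invariants are the constant polynomials. A basis of
`e_s(M)` gives a morphism from a model to `M`; it is surjective by the preceding paragraph, and
injective because its kernel has no vectors on which `T(O)` acts by a character `s(χ)`
(`exists_model_iso`). Thus every module is induced from `e_s(M)`, which gives full faithfulness of
`e_s`; essential surjectivity comes from the models.

*Super modules.* The diagonal of `c` modulo two is linear, so `c(γ, γ) ≡ c(γ, δ)` for some `δ ∈ Γ`
(`exists_diagonal`), and then the point `(-1)^δ` of `T` acts on every module by a parity.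
Multiplying by it turns parities into involutions of the module, to which the equivalence applies.

*Change of section.* The lift of `t^γ`, where `c(γ) = s(χ) - s'(χ)`, maps the part of `e_s(M)` of
weight `s(χ)` to the part of `e_{s'}(M)` of weight `s'(χ)`, and it has parity `c(γ, γ)`.
-/

set_option linter.unusedSectionVars false

noncomputable section

namespace Heis

/-! ### Exponentials and logarithmic derivatives -/

section NilExp

variable (k : Type u) [Field k] [CharZero k]

theorem nilExp_zero {A : Type u} [CommRing A] [Algebra k A] : nilExp k (0 : A) = 1 := by
  let _ : Module ℚ A := Module.compHom A (algebraMap ℚ k)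
  exact IsNilpotent.exp_zero

theorem nilExp_add {A : Type u} [CommRing A] [Algebra k A] {x y : A} (hx : IsNilpotent x)
    (hy : IsNilpotent y) : nilExp k (x + y) = nilExp k x * nilExp k y := by
  let _ : Module ℚ A := Module.compHom A (algebraMap ℚ k)
  exact IsNilpotent.exp_add_of_commute (Commute.all _ _) hx hy

theorem nilExp_neg_mul {A : Type u} [CommRing A] [Algebra k A] {x : A} (hx : IsNilpotent x) :
    nilExp k (-x) * nilExp k x = 1 := by
  rw [← nilExp_add k hx.neg hx, neg_add_cancel, nilExp_zero]

theorem map_nilExp {A B : Type u} [CommRing A] [Algebra k A] [CommRing B] [Algebra k B]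
    (φ : A →+* B) {x : A} (hx : IsNilpotent x) : φ (nilExp k x) = nilExp k (φ x) := by
  let _ : Module ℚ A := Module.compHom A (algebraMap ℚ k)
  let _ : Module ℚ B := Module.compHom B (algebraMap ℚ k)
  exact IsNilpotent.map_exp hx φ

/-- The exponential agrees with `1 + y` to first order, the quotient of the remainder by `y ^ 2`
being a polynomial in `y`. -/
theorem nilExp_eq {A : Type u} [CommRing A] [Algebra k A] {y : A} (hy : IsNilpotent y) :
    ∃ w ∈ Algebra.adjoin k {y}, nilExp k y = 1 + y + y ^ 2 * w := by
  let _ : Module ℚ A := Module.compHom A (algebraMap ℚ k)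
  obtain ⟨n, hn⟩ := hy
  refine ⟨∑ i ∈ Finset.range n, (algebraMap ℚ k ((i + 2).factorial : ℚ)⁻¹) • y ^ i, ?_, ?_⟩
  · refine Subalgebra.sum_mem _ fun i _ => Subalgebra.smul_mem _ ?_ _
    exact Subalgebra.pow_mem _ (Algebra.self_mem_adjoin_singleton k y) _
  · have h : nilExp k y = ∑ i ∈ Finset.range (n + 2), (i.factorial : ℚ)⁻¹ • y ^ i :=
      IsNilpotent.exp_eq_sum (pow_eq_zero_of_le (by omega) hn)
    rw [h, Finset.sum_range_succ', Finset.sum_range_succ', Finset.mul_sum]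
    have h2 : ∀ (q : ℚ) (a : A), q • a = (algebraMap ℚ k q) • a := fun _ _ => rfl
    simp only [h2, mul_smul_comm, ← pow_add]
    simp only [zero_add, Nat.factorial_zero, Nat.factorial_one, Nat.cast_one, inv_one, map_one,
      one_smul, pow_zero, pow_one]
    rw [add_comm, add_comm _ y, ← add_assoc]
    congr 1
    refine Finset.sum_congr rfl fun i _ => ?_
    rw [add_comm 2 i]

theorem nilExp_of_sq_eq_zero {A : Type u} [CommRing A] [Algebra k A] {y : A} (hy : y ^ 2 = 0) :
    nilExp k y = 1 + y := by
  obtain ⟨w, -, h⟩ := nilExp_eq k (y := y) ⟨2, hy⟩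
  rw [h, hy, zero_mul, add_zero]

theorem eq_zero_of_nilExp_eq_one {A : Type u} [CommRing A] [Algebra k A] {y : A}
    (hy : IsNilpotent y) (h : nilExp k y = 1) : y = 0 := by
  obtain ⟨w, -, hw⟩ := nilExp_eq k hy
  have h1 : y * (1 + y * w) = 0 := by
    rw [h] at hw
    linear_combination -hw
  have h2 : IsUnit (1 + y * w) := ((Commute.all y w).isNilpotent_mul_right hy).isUnit_one_add
  exact (h2.mul_left_eq_zero).1 h1

end NilExp

section DLog

variable {R S : Type u} [CommRing R] [CommRing S]

open PowerSeries

/-- The logarithmic derivative `u' / u` of an invertible power series. -/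
def dlog (u : R⟦X⟧ˣ) : R⟦X⟧ := d⁄dX R (u : R⟦X⟧) * (u⁻¹ : R⟦X⟧ˣ)

theorem dlog_mul (u v : R⟦X⟧ˣ) : dlog (u * v) = dlog u + dlog v := by
  simp only [dlog, Units.val_mul, Derivation.leibniz, mul_inv, smul_eq_mul]
  linear_combination (d⁄dX R (v : R⟦X⟧)) * (v⁻¹ : R⟦X⟧ˣ) * u.mul_inv +
    (d⁄dX R (u : R⟦X⟧)) * (u⁻¹ : R⟦X⟧ˣ) * v.mul_inv

/-- `dlog` as a group homomorphism. -/
def dlogHom : R⟦X⟧ˣ →* Multiplicative R⟦X⟧ where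
  toFun u := Multiplicative.ofAdd (dlog u)
  map_one' := by simp [dlog]
  map_mul' u v := by rw [dlog_mul]; rfl

theorem dlog_zpow (u : R⟦X⟧ˣ) (n : ℤ) : dlog (u ^ n) = n • dlog u :=
  congrArg Multiplicative.toAdd (map_zpow (dlogHom (R := R)) u n)

theorem derivative_map (φ : R →+* S) (f : R⟦X⟧) :
    d⁄dX S (PowerSeries.map φ f) = PowerSeries.map φ (d⁄dX R f) := by
  ext n
  simp [coeff_derivative]

theorem dlog_map (φ : R →+* S) (u : R⟦X⟧ˣ) :
    dlog (Units.map (PowerSeries.map φ : R⟦X⟧ →* S⟦X⟧) u) = PowerSeries.map φ (dlog u) := by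
  rw [dlog, dlog, map_mul, ← derivative_map]
  rfl

variable (k : Type u) [Field k] [CharZero k] [Algebra k R]

theorem eq_C_of_derivative_eq_zero (k : Type u) [Field k] [CharZero k] [Algebra k R] {f : R⟦X⟧}
    (h : d⁄dX R f = 0) : f = C (constantCoeff f) := by
  ext n
  cases n with
  | zero => simp
  | succ n =>
    have h1 : coeff n (d⁄dX R f) = 0 := by rw [h]; simp
    rw [coeff_derivative] at h1
    have h2 : IsUnit ((n : R) + 1) := by
      have : ((n : R) + 1) = algebraMap k R ((n : k) + 1) := by simp
      rw [this]
      exact (IsUnit.mk0 _ (Nat.cast_add_one_ne_zero n)).map _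
    rw [coeff_C, if_neg n.succ_ne_zero]
    exact (h2.mul_left_eq_zero).1 h1

theorem eq_C_of_dlog_eq_zero (k : Type u) [Field k] [CharZero k] [Algebra k R] {u : R⟦X⟧ˣ}
    (h : dlog u = 0) :
    (u : R⟦X⟧) = C (constantCoeff (u : R⟦X⟧)) := by
  refine eq_C_of_derivative_eq_zero k ?_
  exact (u⁻¹.isUnit.mul_left_eq_zero).1 h

theorem eq_one_of_dlog_eq_zero (k : Type u) [Field k] [CharZero k] [Algebra k R] {u : R⟦X⟧ˣ}
    (h : dlog u = 0)
    (h1 : constantCoeff (u : R⟦X⟧) = 1) : u = 1 := by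
  refine Units.ext ?_
  rw [eq_C_of_dlog_eq_zero k h, h1]
  simp

/-- The exponential of a power series without constant term. -/
def pexp (f : R⟦X⟧) : R⟦X⟧ := (PowerSeries.exp k).subst f

theorem derivative_pexp {f : R⟦X⟧} (hf : constantCoeff f = 0) :
    d⁄dX R (pexp k f) = pexp k f * d⁄dX R f := by
  have hs : HasSubst f := HasSubst.of_constantCoeff_zero' hf
  have h : pexp k f = (PowerSeries.map (algebraMap k R) (PowerSeries.exp k)).subst f := by
    rw [pexp, PowerSeries.map_algebraMap_eq_subst_X,
      PowerSeries.subst_comp_subst_apply HasSubst.X' hs, PowerSeries.subst_X hs]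
  rw [h, PowerSeries.derivative_subst hs, derivative_map, PowerSeries.derivative_exp]

theorem constantCoeff_pexp {f : R⟦X⟧} (hf : constantCoeff f = 0) :
    constantCoeff (pexp k f) = 1 := by
  have hs : HasSubst f := HasSubst.of_constantCoeff_zero' hf
  have h : pexp k f = (PowerSeries.exp k - 1).subst f + (1 : k⟦X⟧).subst f := by
    rw [← PowerSeries.subst_add hs, sub_add_cancel]
    rfl
  have h1 : (1 : k⟦X⟧).subst f = (1 : R⟦X⟧) := by
    rw [← PowerSeries.coe_substAlgHom hs, map_one]
  rw [h, h1, map_add, map_one]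
  have h2 := PowerSeries.constantCoeff_subst_eq_zero hf (PowerSeries.exp k - 1) (by simp)
  exact (congrArg (· + 1) h2).trans (zero_add 1)

/-- The primitive without constant term of a power series. -/
def primitive (g : R⟦X⟧) : R⟦X⟧ :=
  PowerSeries.mk fun n => n.casesOn 0 fun n => ((n : k) + 1)⁻¹ • coeff n g

@[simp] theorem constantCoeff_primitive (g : R⟦X⟧) : constantCoeff (primitive k g) = 0 := by
  rw [← coeff_zero_eq_constantCoeff_apply, primitive, coeff_mk]
  rfl

theorem coeff_succ_primitive (g : R⟦X⟧) (n : ℕ) :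
    coeff (n + 1) (primitive k g) = ((n : k) + 1)⁻¹ • coeff n g := by
  rw [primitive, coeff_mk]

theorem derivative_primitive (g : R⟦X⟧) : d⁄dX R (primitive k g) = g := by
  ext n
  rw [coeff_derivative, coeff_succ_primitive, smul_mul_assoc, mul_comm]
  have : ((n : R) + 1) = algebraMap k R ((n : k) + 1) := by simp
  rw [this, ← Algebra.smul_def, smul_smul, inv_mul_cancel₀ (Nat.cast_add_one_ne_zero n), one_smul]

/-- The invertible power series with constant term `1` and logarithmic derivative `g`. -/
def expPrim (g : R⟦X⟧) : R⟦X⟧ˣ :=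
  (PowerSeries.isUnit_iff_constantCoeff.2 (by
    rw [constantCoeff_pexp k (constantCoeff_primitive k g)]
    exact isUnit_one) : IsUnit (pexp k (primitive k g))).unit

theorem coe_expPrim (g : R⟦X⟧) : (expPrim k g : R⟦X⟧) = pexp k (primitive k g) := rfl

theorem constantCoeff_expPrim (g : R⟦X⟧) : constantCoeff (expPrim k g : R⟦X⟧) = 1 :=
  constantCoeff_pexp k (constantCoeff_primitive k g)

theorem dlog_expPrim (g : R⟦X⟧) : dlog (expPrim k g) = g := by
  rw [dlog, coe_expPrim, derivative_pexp k (constantCoeff_primitive k g), derivative_primitive,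
    ← coe_expPrim, mul_right_comm, Units.mul_inv, one_mul]

theorem eq_of_dlog_eq (k : Type u) [Field k] [CharZero k] [Algebra k R] {u v : R⟦X⟧ˣ}
    (h : dlog u = dlog v)
    (h1 : constantCoeff (u : R⟦X⟧) = constantCoeff (v : R⟦X⟧)) : u = v := by
  have h0 : dlog (u * v⁻¹) = 0 := by
    have := dlog_mul (u * v⁻¹) v
    rw [inv_mul_cancel_right, h] at this
    exact (add_eq_right.1 this.symm)
  have h2 : u * v⁻¹ = 1 := by
    refine eq_one_of_dlog_eq_zero k h0 ?_
    rw [Units.val_mul, map_mul, h1, ← map_mul, Units.mul_inv, map_one]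
  exact mul_inv_eq_one.1 h2

theorem expPrim_add (g h : R⟦X⟧) : expPrim k (g + h) = expPrim k g * expPrim k h := by
  refine eq_of_dlog_eq k ?_ ?_
  · rw [dlog_mul, dlog_expPrim, dlog_expPrim, dlog_expPrim]
  · rw [Units.val_mul, map_mul]
    simp only [constantCoeff_expPrim, one_mul]

end DLog

/-! ### Invertible Laurent series -/

section Laurent

variable {R : Type u} [CommRing R]

/-- The ideal of Laurent series with all coefficients in an ideal. -/
def coeffIdeal (I : Ideal R) : Ideal R⸨X⸩ where
  carrier := {f | ∀ n, f.coeff n ∈ I}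
  zero_mem' n := by simp
  add_mem' ha hb n := by
    rw [HahnSeries.coeff_add]
    exact I.add_mem (ha n) (hb n)
  smul_mem' c f hf n := by
    rw [smul_eq_mul, HahnSeries.coeff_mul]
    exact I.sum_mem fun _ _ => I.mul_mem_left _ (hf _)

theorem mul_mem_coeffIdeal {I J : Ideal R} {f g : R⸨X⸩} (hf : f ∈ coeffIdeal I)
    (hg : g ∈ coeffIdeal J) : f * g ∈ coeffIdeal (I * J) := by
  intro n
  rw [HahnSeries.coeff_mul]
  exact Ideal.sum_mem _ fun _ _ => Ideal.mul_mem_mul (hf _) (hg _)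

theorem coeffIdeal_mono {I J : Ideal R} (h : I ≤ J) : coeffIdeal I ≤ coeffIdeal J :=
  fun _ hf n => h (hf n)

/-- The Laurent polynomial `∑ ν_n t^(-(n+1))`. -/
def negSeries : (ℕ →₀ R) →+ R⸨X⸩ :=
  Finsupp.liftAddHom fun n => (HahnSeries.single.addMonoidHom (-((n : ℤ) + 1)) : R →+ R⸨X⸩)

theorem negSeries_single (n : ℕ) (r : R) :
    negSeries (Finsupp.single n r) = HahnSeries.single (-((n : ℤ) + 1)) r := by
  rw [negSeries, Finsupp.liftAddHom_apply_single]
  rfl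

theorem coeff_negSeries (ν : ℕ →₀ R) (n : ℕ) : (negSeries ν).coeff (-((n : ℤ) + 1)) = ν n := by
  induction ν using Finsupp.induction_linear with
  | zero => simp
  | add f g hf hg => rw [map_add, HahnSeries.coeff_add, hf, hg, Finsupp.add_apply]
  | single m r =>
    rw [negSeries_single]
    by_cases h : n = m
    · rw [h, HahnSeries.coeff_single_same, Finsupp.single_eq_same]
    · rw [HahnSeries.coeff_single_of_ne (by omega), Finsupp.single_eq_of_ne h]

theorem coeff_negSeries_of_nonneg (ν : ℕ →₀ R) {n : ℤ} (hn : 0 ≤ n) :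
    (negSeries ν).coeff n = 0 := by
  induction ν using Finsupp.induction_linear with
  | zero => simp
  | add f g hf hg => rw [map_add, HahnSeries.coeff_add, hf, hg, add_zero]
  | single m r => rw [negSeries_single, HahnSeries.coeff_single_of_ne (by omega)]

theorem negSeries_injective : Function.Injective (negSeries (R := R)) := fun f g h => by
  ext n
  rw [← coeff_negSeries, h, coeff_negSeries]

theorem laurentMap_negSeries {S : Type u} [CommRing S] (φ : R →+* S) (ν : ℕ →₀ R) :
    laurentMap φ (negSeries ν) = negSeries (ν.mapRange φ (map_zero φ)) := by
  induction ν using Finsupp.induction_linear with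
  | zero => simp
  | add f g hf hg =>
    rw [map_add, map_add, hf, hg, Finsupp.mapRange_add (hf' := map_add φ), map_add]
  | single m r =>
    rw [negSeries_single, Finsupp.mapRange_single, negSeries_single]
    exact HahnSeries.map_single (φ : ZeroHom R S)

theorem isNilpotent_negSeries {ν : ℕ →₀ R} (hν : ∀ n, IsNilpotent (ν n)) :
    IsNilpotent (negSeries ν) := by
  induction ν using Finsupp.induction with
  | zero => simp
  | single_add m r f hm _ ih =>
    rw [map_add]
    refine Commute.isNilpotent_add (Commute.all _ _) ?_ (ih fun n => ?_)
    · rw [negSeries_single]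
      obtain ⟨N, hN⟩ := hν m
      rw [Finsupp.add_apply, Finsupp.single_eq_same, Finsupp.notMem_support_iff.1 hm,
        add_zero] at hN
      exact ⟨N, by rw [HahnSeries.single_pow, hN]; simp⟩
    · by_cases h : n = m
      · rw [h, Finsupp.notMem_support_iff.1 hm]; exact IsNilpotent.zero
      · have := hν n
        rwa [Finsupp.add_apply, Finsupp.single_eq_of_ne h, zero_add] at this

/-- The coefficients of a Laurent series in negative degrees. -/
def negPart (f : R⸨X⸩) : ℕ →₀ R :=
  Finsupp.ofSupportFinite (fun n => f.coeff (-((n : ℤ) + 1))) (by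
    refine (Set.finite_Iio (-f.order).toNat).subset fun n hn => ?_
    by_contra h
    exact hn (HahnSeries.coeff_eq_zero_of_lt_order (by
      simp only [Set.mem_Iio, not_lt] at h
      omega)))

/-- The part of a Laurent series in nonnegative degrees. -/
def posPart (f : R⸨X⸩) : R⟦X⟧ := PowerSeries.mk fun n => f.coeff n

theorem negPart_apply (f : R⸨X⸩) (n : ℕ) : negPart f n = f.coeff (-((n : ℤ) + 1)) := rfl

theorem coeff_ofPowerSeries_of_neg (h : R⟦X⟧) {n : ℤ} (hn : n < 0) :
    (HahnSeries.ofPowerSeries ℤ R h).coeff n = 0 := by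
  have := PowerSeries.coeff_coe h n
  rwa [if_pos hn] at this

theorem coeff_ofPowerSeries_nat (h : R⟦X⟧) (n : ℕ) :
    (HahnSeries.ofPowerSeries ℤ R h).coeff n = PowerSeries.coeff n h := by
  have := PowerSeries.coeff_coe h n
  rwa [if_neg (by omega), Int.natAbs_natCast] at this

theorem negSeries_add_posPart (f : R⸨X⸩) :
    negSeries (negPart f) + HahnSeries.ofPowerSeries ℤ R (posPart f) = f := by
  ext n
  rw [HahnSeries.coeff_add]
  rcases lt_or_ge n 0 with hn | hn
  · obtain ⟨m, rfl⟩ : ∃ m : ℕ, n = -((m : ℤ) + 1) := ⟨(-n - 1).toNat, by omega⟩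
    rw [coeff_negSeries, coeff_ofPowerSeries_of_neg _ hn, add_zero]
    rfl
  · obtain ⟨m, rfl⟩ : ∃ m : ℕ, n = m := ⟨n.toNat, by omega⟩
    rw [coeff_negSeries_of_nonneg _ hn, coeff_ofPowerSeries_nat, zero_add, posPart,
      PowerSeries.coeff_mk]

theorem negSeries_mem_coeffIdeal {I : Ideal R} {ν : ℕ →₀ R} (hν : ∀ n, ν n ∈ I) :
    negSeries ν ∈ coeffIdeal I := by
  intro n
  rcases lt_or_ge n 0 with hn | hn
  · obtain ⟨m, rfl⟩ : ∃ m : ℕ, n = -((m : ℤ) + 1) := ⟨(-n - 1).toNat, by omega⟩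
    rw [coeff_negSeries]
    exact hν m
  · rw [coeff_negSeries_of_nonneg _ hn]
    exact I.zero_mem

variable (k : Type u) [Field k] [CharZero k] [Algebra k R]

theorem exists_one_add_factor (I : Ideal R) (hI : IsNilpotent I) (d : ℕ) :
    ∀ m, 1 ≤ m → I ^ (m + d) = ⊥ → ∀ x ∈ coeffIdeal (I ^ m),
      ∃ (h : R⟦X⟧ˣ) (ν : ℕ →₀ R), (∀ n, IsNilpotent (ν n)) ∧
        1 + x = HahnSeries.ofPowerSeries ℤ R h * nilExp k (negSeries ν) := by
  induction d with
  | zero =>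
    intro m _ hm x hx
    refine ⟨1, 0, fun n => by simp, ?_⟩
    have : x = 0 := HahnSeries.ext (funext fun n => by
      have := hx n
      rw [add_zero] at hm
      rw [hm] at this
      simpa using this)
    simp [this, nilExp_zero]
  | succ d ih =>
    intro m hm1 hm x hx
    have hnil : ∀ r ∈ I ^ m, IsNilpotent r := fun r hr => by
      obtain ⟨N, hN⟩ := hI
      refine ⟨N, ?_⟩
      have := Ideal.pow_mem_pow (Ideal.pow_le_self (by omega) hr) N
      rw [hN] at this
      simpa using this
    have hν : ∀ n, IsNilpotent (negPart x n) := fun n => hnil _ (hx _)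
    have hy : IsNilpotent (negSeries (negPart x)) := isNilpotent_negSeries hν
    have hyI : negSeries (negPart x) ∈ coeffIdeal (I ^ m) :=
      negSeries_mem_coeffIdeal fun n => hx _
    have hu : IsUnit (1 + posPart x) := by
      rw [PowerSeries.isUnit_iff_constantCoeff, map_add, map_one]
      refine (hnil _ ?_).isUnit_one_add
      rw [← PowerSeries.coeff_zero_eq_constantCoeff_apply, posPart, PowerSeries.coeff_mk]
      exact hx _
    obtain ⟨w, -, hw⟩ := nilExp_eq k hy.neg
    set y := negSeries (negPart x) with hy_def
    set p := HahnSeries.ofPowerSeries ℤ R (posPart x) with hp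
    have hxy : y + p = x := negSeries_add_posPart x
    set v := HahnSeries.ofPowerSeries ℤ R ((hu.unit⁻¹ : R⟦X⟧ˣ) : R⟦X⟧) with hv
    have hvp : v * (1 + p) = 1 := by
      rw [hv, hp, ← map_one (HahnSeries.ofPowerSeries ℤ R), ← map_add, ← map_mul,
        IsUnit.val_inv_mul, map_one]
    have hle : I ^ m * I ^ m ≤ I ^ (m + 1) := by
      rw [← pow_add]
      exact Ideal.pow_le_pow_right (by omega)
    obtain ⟨h, ν, hν2, hx'⟩ := ih (m + 1) (by omega) (by rwa [Nat.add_right_comm, Nat.add_assoc])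
      (v * (-(x * y) + (1 + x) * (y * y * w))) (by
        refine Ideal.mul_mem_left _ _ (add_mem (neg_mem ?_) (Ideal.mul_mem_left _ _ ?_))
        · exact coeffIdeal_mono hle (mul_mem_coeffIdeal hx hyI)
        · exact Ideal.mul_mem_right _ _ (coeffIdeal_mono hle (mul_mem_coeffIdeal hyI hyI)))
    refine ⟨hu.unit * h, negPart x + ν, fun n => ?_, ?_⟩
    · exact Commute.isNilpotent_add (Commute.all _ _) (hν n) (hν2 n)
    · rw [map_add, nilExp_add k hy (isNilpotent_negSeries hν2)]
      have h1 := nilExp_neg_mul k hy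
      have h2 : HahnSeries.ofPowerSeries ℤ R ((hu.unit * h : R⟦X⟧ˣ) : R⟦X⟧) =
          (1 + p) * HahnSeries.ofPowerSeries ℤ R h := by
        rw [Units.val_mul, map_mul, IsUnit.unit_spec, map_add, map_one]
      rw [h2]
      have h3 : (1 + x) * nilExp k (-y) =
          (1 + p) * (1 + v * (-(x * y) + (1 + x) * (y * y * w))) := by
        rw [hw]
        linear_combination (-(-(x * y) + (1 + x) * (y * y * w))) * hvp - hxy
      rw [hx'] at h3
      linear_combination (-(1 + x)) * h1 + nilExp k y * h3

/-- An invertible Laurent series of valuation `n` is, up to the factor `t ^ n`, the product of an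
invertible power series and the exponential of a nilpotent polynomial in `t⁻¹` without constant
term. -/
theorem HasValuation.exists_factor {f : R⸨X⸩} {n : ℤ} (hf : HasValuation f n) :
    ∃ (h : R⟦X⟧ˣ) (ν : ℕ →₀ R), (∀ n, IsNilpotent (ν n)) ∧
      f = HahnSeries.single n 1 * HahnSeries.ofPowerSeries ℤ R h * nilExp k (negSeries ν) := by
  set g : R⸨X⸩ := HahnSeries.single (-n) 1 * f with hg
  have hgc : ∀ j, g.coeff j = f.coeff (j + n) := fun j => by
    have h := HahnSeries.coeff_single_mul_add (r := (1 : R)) (x := f) (a := j + n) (b := -n)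
    rwa [add_neg_cancel_right, one_mul] at h
  have hfg : f = HahnSeries.single n 1 * g := by
    rw [hg, ← mul_assoc, HahnSeries.single_mul_single, add_neg_cancel, mul_one]
    exact (one_mul f).symm
  have hnil : ∀ j, IsNilpotent (negPart g j) := fun j => by
    rw [negPart_apply, hgc]
    exact hf.2 _ (by omega)
  set I : Ideal R := Ideal.span (Set.range (negPart g)) with hI
  have hInil : IsNilpotent I := by
    refine (Ideal.FG.isNilpotent_iff_le_nilradical ?_).2 ?_
    · have hfin : (Set.range (negPart g)).Finite := by
        refine ((negPart g).support.finite_toSet.image (negPart g)).insert 0 |>.subset ?_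
        rintro _ ⟨j, rfl⟩
        by_cases h : negPart g j = 0
        · exact Or.inl h
        · exact Or.inr ⟨j, Finsupp.mem_support_iff.2 h, rfl⟩
      exact ⟨hfin.toFinset, by rw [Set.Finite.coe_toFinset]⟩
    · rw [hI, Ideal.span_le]
      rintro _ ⟨j, rfl⟩
      exact hnil j
  have hu : IsUnit (posPart g) := by
    rw [PowerSeries.isUnit_iff_constantCoeff, ← PowerSeries.coeff_zero_eq_constantCoeff_apply,
      posPart, PowerSeries.coeff_mk, hgc]
    simpa using hf.1
  set v := HahnSeries.ofPowerSeries ℤ R ((hu.unit⁻¹ : R⟦X⟧ˣ) : R⟦X⟧) with hv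
  have hvp : HahnSeries.ofPowerSeries ℤ R (posPart g) * v = 1 := by
    rw [hv, ← map_mul, IsUnit.mul_val_inv, map_one]
  obtain ⟨N, hN⟩ := hInil
  obtain ⟨h, ν, hν, h1⟩ := exists_one_add_factor k I ⟨N, hN⟩ N 1 le_rfl
    (by rw [add_comm, pow_succ, hN]; exact zero_mul I) (v * negSeries (negPart g))
    (by
      rw [pow_one]
      exact Ideal.mul_mem_left _ _ (negSeries_mem_coeffIdeal fun j =>
        Ideal.subset_span ⟨j, rfl⟩))
  refine ⟨hu.unit * h, ν, hν, ?_⟩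
  have h2 : HahnSeries.ofPowerSeries ℤ R ((hu.unit * h : R⟦X⟧ˣ) : R⟦X⟧) =
      HahnSeries.ofPowerSeries ℤ R (posPart g) * HahnSeries.ofPowerSeries ℤ R h := by
    rw [Units.val_mul, map_mul, IsUnit.unit_spec]
  have h3 := negSeries_add_posPart g
  rw [hfg, mul_assoc, h2]
  congr 1
  linear_combination (HahnSeries.ofPowerSeries ℤ R (posPart g)) * h1 - h3 -
    negSeries (negPart g) * hvp

/-- The exponential of a nilpotent polynomial in `t⁻¹` without constant term is a power series
in `t` only if the polynomial is zero. -/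
theorem eq_zero_of_nilExp_negSeries_eq {ν : ℕ →₀ R} (hν : ∀ n, IsNilpotent (ν n)) {h : R⟦X⟧}
    (hh : nilExp k (negSeries ν) = HahnSeries.ofPowerSeries ℤ R h) : ν = 0 := by
  have hy := isNilpotent_negSeries hν
  set y := negSeries ν with hy_def
  have hmul : ∀ (m : ℤ) (f g : R⸨X⸩), (∀ n, m ≤ n → f.coeff n = 0) → (∀ n, 0 < n → g.coeff n = 0) →
      ∀ n, m ≤ n → (f * g).coeff n = 0 := by
    intro m f g hf hg n hn
    rw [HahnSeries.coeff_mul]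
    refine Finset.sum_eq_zero fun ij hij => ?_
    have h1 := (Finset.mem_antidiagonal.1 hij).2.2
    rcases lt_or_ge 0 ij.2 with h2 | h2
    · rw [hg _ h2, mul_zero]
    · rw [hf _ (by omega), zero_mul]
  let S : Subalgebra k R⸨X⸩ :=
    { carrier := {f | ∀ n, 1 ≤ n → f.coeff n = 0}
      mul_mem' := fun {f g} hf hg => hmul 1 f g hf hg
      add_mem' := fun {f g} hf hg n hn => by rw [HahnSeries.coeff_add, hf n hn, hg n hn, add_zero]
      algebraMap_mem' := fun r n hn => by
        rw [HahnSeries.algebraMap_apply']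
        obtain ⟨m, rfl⟩ : ∃ m : ℕ, n = m := ⟨n.toNat, by omega⟩
        rw [coeff_ofPowerSeries_nat, PowerSeries.algebraMap_apply, PowerSeries.coeff_C,
          if_neg (by omega)] }
  obtain ⟨w, hw, hexp⟩ := nilExp_eq k hy
  have hyS : y ∈ S := fun n hn => coeff_negSeries_of_nonneg _ (by omega)
  have hwS : w ∈ S := Algebra.adjoin_le (Set.singleton_subset_iff.2 hyS) hw
  have h1 : y * (1 + y * w) = nilExp k y - 1 := by rw [hexp]; ring
  have h2 : nilExp k y = 1 := by
    rw [← sub_eq_zero]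
    ext n
    rcases lt_or_ge n 0 with hn | hn
    · rw [hh, HahnSeries.coeff_sub, coeff_ofPowerSeries_of_neg _ hn, HahnSeries.coeff_one,
        if_neg hn.ne, sub_zero]
      rfl
    · rw [← h1]
      exact hmul 0 y _ (fun n hn => coeff_negSeries_of_nonneg _ hn)
        (fun n hn => S.add_mem S.one_mem (S.mul_mem hyS hwS) n hn) n hn
  have h3 := eq_zero_of_nilExp_eq_one k hy h2
  exact negSeries_injective (h3.trans (map_zero _).symm)

/-- Modulo a prime, an invertible Laurent series has a valuation. -/
theorem exists_valuation_mod_prime {f g : R⸨X⸩} (hfg : f * g = 1) (q : Ideal R) [q.IsPrime] :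
    ∃ n : ℤ, f.coeff n ∉ q ∧ g.coeff (-n) ∉ q ∧ (∀ j < n, f.coeff j ∈ q) ∧
      ∀ j < -n, g.coeff j ∈ q := by
  let φ := laurentMap (Ideal.Quotient.mk q)
  have hc : ∀ (a : R⸨X⸩) (j : ℤ), a.coeff j ∈ q ↔ (φ a).coeff j = 0 := fun a j =>
    Ideal.Quotient.eq_zero_iff_mem.symm
  have h1 : φ f * φ g = 1 := by rw [← map_mul, hfg, map_one]
  have hf : φ f ≠ 0 := fun h => by simp [h] at h1
  have hg : φ g ≠ 0 := fun h => by simp [h] at h1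
  have h2 : (φ f).order + (φ g).order = 0 := by
    rw [← HahnSeries.order_mul hf hg, h1, HahnSeries.order_one]
  refine ⟨(φ f).order, ?_, ?_, ?_, ?_⟩
  · rw [hc]; exact HahnSeries.coeff_order_eq_zero.not.2 hf
  · rw [hc, ← eq_neg_of_add_eq_zero_right h2]; exact HahnSeries.coeff_order_eq_zero.not.2 hg
  · intro j hj; rw [hc]; exact HahnSeries.coeff_eq_zero_of_lt_order hj
  · intro j hj
    rw [hc]
    exact HahnSeries.coeff_eq_zero_of_lt_order (by rwa [eq_neg_of_add_eq_zero_right h2])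

/-- Zariski locally on the base, an invertible Laurent series has a valuation. -/
theorem exists_valuation_away {f g : R⸨X⸩} (hfg : f * g = 1) (p : Ideal R) [p.IsPrime] :
    ∃ r ∉ p, ∃ n : ℤ, ∀ (S : Type u) [CommRing S] (φ : R →+* S), IsUnit (φ r) →
      HasValuation (laurentMap φ f) n := by
  obtain ⟨n, hn1, hn2, -, -⟩ := exists_valuation_mod_prime hfg p
  refine ⟨f.coeff n * g.coeff (-n), fun h => ?_, n, fun S _ φ hr => ⟨?_, fun j hj => ?_⟩⟩
  · exact (‹p.IsPrime›.mem_or_mem h).elim hn1 hn2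
  · rw [map_mul] at hr
    exact isUnit_of_mul_isUnit_left hr
  · change IsNilpotent (φ (f.coeff j))
    rw [← mem_nilradical, nilradical_eq_sInf, Ideal.mem_sInf]
    intro Q hQ
    have hQ : Q.IsPrime := hQ
    have hrQ : φ (f.coeff n * g.coeff (-n)) ∉ Q := fun h =>
      hQ.ne_top (Ideal.eq_top_of_isUnit_mem _ h hr)
    have hq : f.coeff n * g.coeff (-n) ∉ Q.comap φ := hrQ
    obtain ⟨m, -, -, h3, h4⟩ := exists_valuation_mod_prime hfg (Q.comap φ)
    have h5 : m ≤ n := by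
      by_contra hlt
      exact hq (Ideal.mul_mem_right _ _ (h3 n (by omega)))
    have h6 : n ≤ m := by
      by_contra hlt
      exact hq (Ideal.mul_mem_left _ _ (h4 (-n) (by omega)))
    exact h3 j (by omega)

end Laurent


/-! ### Zariski-local arguments -/

section Locality

variable {k : Type u} [Field k]

/-- A property of algebras over `R` holds Zariski locally on `R`: every prime has a basic open
neighbourhood `D(r)` such that it holds for all algebras over `R` in which `r` is invertible. -/
def LocallyOn (R : CommAlgCat.{u} k) (Q : ∀ S : CommAlgCat.{u} k, (R ⟶ S) → Prop) : Prop :=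
  ∀ p : Ideal R, p.IsPrime → ∃ r ∉ p, ∀ (S : CommAlgCat.{u} k) (φ : R ⟶ S),
    IsUnit (φ.hom r) → Q S φ

variable {R : CommAlgCat.{u} k} {Q Q' : ∀ S : CommAlgCat.{u} k, (R ⟶ S) → Prop}

theorem LocallyOn.mono (h : LocallyOn R Q) (hQ : ∀ S φ, Q S φ → Q' S φ) : LocallyOn R Q' :=
  fun p hp => (h p hp).imp fun _ hr => ⟨hr.1, fun S φ hu => hQ S φ (hr.2 S φ hu)⟩

theorem LocallyOn.and (h : LocallyOn R Q) (h' : LocallyOn R Q') :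
    LocallyOn R fun S φ => Q S φ ∧ Q' S φ := by
  intro p hp
  obtain ⟨r, hr, h1⟩ := h p hp
  obtain ⟨r', hr', h2⟩ := h' p hp
  refine ⟨r * r', fun hmem => (hp.mem_or_mem hmem).elim hr hr', fun S φ hu => ?_⟩
  rw [map_mul] at hu
  exact ⟨h1 S φ (isUnit_of_mul_isUnit_left hu), h2 S φ (isUnit_of_mul_isUnit_right hu)⟩

theorem LocallyOn.forall {ι : Type*} [Finite ι]
    {Q : ι → ∀ S : CommAlgCat.{u} k, (R ⟶ S) → Prop} (h : ∀ i, LocallyOn R (Q i)) :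
    LocallyOn R fun S φ => ∀ i, Q i S φ := by
  classical
  have := Fintype.ofFinite ι
  intro p hp
  choose r hr h1 using fun i => h i p hp
  refine ⟨∏ i, r i, fun hmem => ?_, fun S φ hu i => h1 i S φ ?_⟩
  · obtain ⟨i, -, hi⟩ := hp.prod_mem_iff.1 hmem
    exact hr i hi
  · rw [map_prod] at hu
    exact isUnit_of_dvd_unit (Finset.dvd_prod_of_mem (fun j => φ.hom (r j)) (Finset.mem_univ i)) hu

/-- A property that holds locally on the members of a cover holds locally. -/
theorem LocallyOn.trans {n : ℕ} {r : Fin n → R} (hr : Ideal.span (Set.range r) = ⊤)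
    (h : ∀ i S (φ : R ⟶ S), IsUnit (φ.hom (r i)) → Q S φ) : LocallyOn R Q := by
  intro p hp
  by_contra hcon
  push Not at hcon
  refine hp.ne_top (top_unique (hr ▸ Ideal.span_le.2 ?_))
  rintro _ ⟨i, rfl⟩
  by_contra hi
  obtain ⟨S, φ, hu, hQ⟩ := hcon _ hi
  exact hQ (h i S φ hu)

theorem LocallyOn.span_eq_top (h : LocallyOn R Q) :
    Ideal.span {r : R | ∀ (S : CommAlgCat.{u} k) (φ : R ⟶ S), IsUnit (φ.hom r) → Q S φ} = ⊤ := by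
  by_contra hne
  obtain ⟨m, hm, hle⟩ := Ideal.exists_le_maximal _ hne
  obtain ⟨r, hr, h1⟩ := h m hm.isPrime
  exact hr (hle (Ideal.subset_span h1))

theorem LocallyOn.exists_cover (h : LocallyOn R Q) :
    ∃ (n : ℕ) (r : Fin n → R), Ideal.span (Set.range r) = ⊤ ∧
      ∀ i (S : CommAlgCat.{u} k) (φ : R ⟶ S), IsUnit (φ.hom (r i)) → Q S φ := by
  obtain ⟨t, ht, h1⟩ := (Ideal.span_eq_top_iff_finite _).1 h.span_eq_top
  refine ⟨t.card, fun i => (t.equivFin.symm i : R), ?_, fun i => ht (t.equivFin.symm i).2⟩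
  have : Set.range (fun i => (t.equivFin.symm i : R)) = (t : Set R) := by
    ext x
    constructor
    · rintro ⟨i, rfl⟩
      exact (t.equivFin.symm i).2
    · intro hx
      exact ⟨t.equivFin ⟨x, hx⟩, by simp⟩
  rw [this, h1]

theorem isUnit_locMap (r : R) : IsUnit ((locMap k R r).hom r) :=
  IsLocalization.Away.algebraMap_isUnit (S := Localization.Away r) r

/-- The factorization through `R → R[1/r]` of a morphism inverting `r`. -/
def awayLift {r : R} {S : CommAlgCat.{u} k} (φ : R ⟶ S) (hu : IsUnit (φ.hom r)) :
    CommAlgCat.of k (Localization.Away r) ⟶ S :=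
  CommAlgCat.ofHom
    { toRingHom := IsLocalization.Away.lift (S := Localization.Away r) r (g := φ.hom.toRingHom) hu
      commutes' := fun a => by
        change IsLocalization.Away.lift (S := Localization.Away r) r (g := φ.hom.toRingHom) hu
          (algebraMap k (Localization.Away r) a) = _
        rw [IsScalarTower.algebraMap_apply k R (Localization.Away r),
          IsLocalization.Away.lift_eq]
        exact φ.hom.commutes a }

theorem locMap_awayLift {r : R} {S : CommAlgCat.{u} k} (φ : R ⟶ S) (hu : IsUnit (φ.hom r)) :
    locMap k R r ≫ awayLift φ hu = φ := by
  ext x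
  exact IsLocalization.Away.lift_eq r hu x

theorem eq_of_locally {x y : R} (h : LocallyOn R fun _ φ => φ.hom x = φ.hom y) : x = y := by
  refine Localization.algebraMap_injective_of_span_eq_top _ h.span_eq_top (funext fun a => ?_)
  exact a.2 _ (locMap k R a.1) (isUnit_locMap a.1)

/-- Elements of algebras over `R`, given locally and compatibly, come from an element of `R`. -/
theorem exists_glue (hQ : LocallyOn R Q) (w : ∀ S : CommAlgCat.{u} k, (R ⟶ S) → S)
    (hw : ∀ S φ (S' : CommAlgCat.{u} k) (ψ : S ⟶ S'), Q S φ → ψ.hom (w S φ) = w S' (φ ≫ ψ)) :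
    ∃ a : R, ∀ S φ, Q S φ → φ.hom a = w S φ := by
  obtain ⟨a, ha, -⟩ := Localization.existsUnique_algebraMap_eq_of_span_eq_top _ hQ.span_eq_top
    (fun r => w (CommAlgCat.of k (Localization.Away r.1)) (locMap k R r.1)) (fun r r' => by
      have hu : IsUnit ((locMap k R (r.1 * r'.1)).hom r.1) := by
        have := isUnit_locMap (r.1 * r'.1)
        rw [map_mul] at this
        exact isUnit_of_mul_isUnit_left this
      have hu' : IsUnit ((locMap k R (r.1 * r'.1)).hom r'.1) := by
        have := isUnit_locMap (r.1 * r'.1)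
        rw [map_mul] at this
        exact isUnit_of_mul_isUnit_right this
      have h1 := hw _ _ _ (awayLift _ hu) (r.2 _ _ (isUnit_locMap r.1))
      have h2 := hw _ _ _ (awayLift _ hu') (r'.2 _ _ (isUnit_locMap r'.1))
      rw [locMap_awayLift] at h1 h2
      exact h1.trans h2.symm)
  refine ⟨a, fun S φ hS => eq_of_locally fun p hp => ?_⟩
  have hp' : (p.comap φ.hom.toRingHom).IsPrime := Ideal.comap_isPrime _ _
  obtain ⟨r, hr, h1⟩ := hQ _ hp'
  refine ⟨φ.hom r, hr, fun S' ψ hu => ?_⟩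
  have hu' : IsUnit ((φ ≫ ψ).hom r) := hu
  have h2 := hw _ _ _ (awayLift _ hu') (h1 _ _ (isUnit_locMap r))
  rw [locMap_awayLift, ← hw S φ S' ψ hS, ← ha ⟨r, h1⟩] at h2
  refine Eq.trans ?_ h2
  exact congrArg (fun f => f.hom a) (locMap_awayLift _ hu').symm

variable {V : Type u} [AddCommGroup V] [Module k V]

/-- The map `R ⊗ V → S ⊗ V` induced by a morphism `R → S`. -/
abbrev bmap (V : Type u) [AddCommGroup V] [Module k V] {R S : CommAlgCat.{u} k} (φ : R ⟶ S) :
    (R : Type u) ⊗[k] V →ₗ[k] (S : Type u) ⊗[k] V :=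
  φ.hom.toLinearMap.rTensor V

theorem bmap_tmul {S : CommAlgCat.{u} k} (φ : R ⟶ S) (r : R) (v : V) :
    bmap V φ (r ⊗ₜ v) = φ.hom r ⊗ₜ v := rfl

theorem bmap_smul {S : CommAlgCat.{u} k} (φ : R ⟶ S) (r : R) (x : (R : Type u) ⊗[k] V) :
    bmap V φ (r • x) = φ.hom r • bmap V φ x := by
  induction x using TensorProduct.induction_on with
  | zero => simp
  | tmul a v => rw [TensorProduct.smul_tmul', bmap_tmul, bmap_tmul, TensorProduct.smul_tmul',
      smul_eq_mul, map_mul, smul_eq_mul]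
  | add a b ha hb => rw [smul_add, map_add, ha, hb, map_add, smul_add]

theorem bmap_comp {S S' : CommAlgCat.{u} k} (φ : R ⟶ S) (ψ : S ⟶ S') (x : (R : Type u) ⊗[k] V) :
    bmap V (φ ≫ ψ) x = bmap V ψ (bmap V φ x) := by
  induction x using TensorProduct.induction_on with
  | zero => simp
  | tmul a v => rfl
  | add a b ha hb => rw [map_add, ha, hb, map_add, map_add]

theorem repr_bmap {I : Type*} (b : Module.Basis I k V) {S : CommAlgCat.{u} k} (φ : R ⟶ S)
    (x : (R : Type u) ⊗[k] V) (i : I) :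
    (b.baseChange S).repr (bmap V φ x) i = φ.hom ((b.baseChange R).repr x i) := by
  induction x using TensorProduct.induction_on with
  | zero => simp
  | tmul a v =>
    rw [bmap_tmul, Module.Basis.baseChange_repr_tmul, Module.Basis.baseChange_repr_tmul]
    exact (map_smul φ.hom _ _).symm
  | add a c ha hc => simp only [map_add, Finsupp.add_apply, ha, hc]

theorem eq_of_locally_bmap {x y : (R : Type u) ⊗[k] V}
    (h : LocallyOn R fun _ φ => bmap V φ x = bmap V φ y) : x = y := by
  let b := Module.Basis.ofVectorSpace k V
  refine (b.baseChange (R : Type u)).repr.injective (Finsupp.ext fun i => ?_)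
  refine eq_of_locally (h.mono fun S φ hx => ?_)
  rw [← repr_bmap, ← repr_bmap, hx]

/-- Vectors in base changes of `V`, given locally and compatibly, come from a vector over `R`. -/
theorem exists_glue_bmap (hQ : LocallyOn R Q)
    (w : ∀ S : CommAlgCat.{u} k, (R ⟶ S) → (S : Type u) ⊗[k] V)
    (hw : ∀ S φ (S' : CommAlgCat.{u} k) (ψ : S ⟶ S'), Q S φ →
      bmap V ψ (w S φ) = w S' (φ ≫ ψ)) :
    ∃ a : (R : Type u) ⊗[k] V, ∀ S φ, Q S φ → bmap V φ a = w S φ := by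
  classical
  let b := Module.Basis.ofVectorSpace k V
  have key := fun i => exists_glue hQ (fun S φ => (b.baseChange (S : Type u)).repr (w S φ) i)
    (fun S φ S' ψ hS => by rw [← repr_bmap, hw S φ S' ψ hS])
  choose a ha using key
  obtain ⟨n, r, hr, h1⟩ := hQ.exists_cover
  let s : Finset _ := Finset.univ.biUnion fun i : Fin n =>
    ((b.baseChange (Localization.Away (r i))).repr
      (w (CommAlgCat.of k (Localization.Away (r i))) (locMap k R (r i)))).support
  have hfin : ∀ i ∉ s, a i = 0 := by
    intro i hi
    refine eq_of_locally (LocallyOn.trans hr fun j S φ hu => ?_)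
    have h2 := ha i _ _ (h1 j _ _ (isUnit_locMap (r j)))
    have h3 : (b.baseChange (Localization.Away (r j))).repr
        (w (CommAlgCat.of k (Localization.Away (r j))) (locMap k R (r j))) i = 0 := by
      by_contra hne
      exact hi (Finset.mem_biUnion.2 ⟨j, Finset.mem_univ j, Finsupp.mem_support_iff.2 hne⟩)
    have h4 := h2.trans h3
    rw [map_zero, ← locMap_awayLift φ hu]
    change (awayLift φ hu).hom ((locMap k R (r j)).hom (a i)) = 0
    rw [h4]
    exact map_zero (awayLift φ hu).hom
  refine ⟨(b.baseChange (R : Type u)).repr.symm (Finsupp.onFinset s a fun i hi => by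
    by_contra hs; exact hi (hfin i hs)), fun S φ hS => ?_⟩
  refine (b.baseChange (S : Type u)).repr.injective (Finsupp.ext fun i => ?_)
  rw [repr_bmap, LinearEquiv.apply_symm_apply, Finsupp.onFinset_apply]
  exact ha i S φ hS

end Locality


/-! ### Points of tori -/

section Points

variable {k : Type u} [Field k] {Γ : Type u} [AddCommGroup Γ]
  {A B : CommAlgCat.{u} k ⥤ CommRingCat.{u}} {R S : CommAlgCat.{u} k}

/-- The value at a point of `Γ ⊗ Aˣ = Hom(Γ^∨, Aˣ)` of the character `l ∈ Γ^∨`. -/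
def ev (x : (torusOver Γ A).obj R) (l : Module.Dual ℤ Γ) : (A.obj R)ˣ :=
  (show Multiplicative (Module.Dual ℤ Γ) →* (A.obj R)ˣ from x) (Multiplicative.ofAdd l)

theorem ev_ext {x y : (torusOver Γ A).obj R} (h : ∀ l, ev x l = ev y l) : x = y :=
  MonoidHom.ext fun l => h (Multiplicative.toAdd l)

theorem ev_mul (x y : (torusOver Γ A).obj R) (l : Module.Dual ℤ Γ) :
    ev (x * y) l = ev x l * ev y l := rfl

theorem ev_one (l : Module.Dual ℤ Γ) : ev (1 : (torusOver Γ A).obj R) l = 1 := rfl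

theorem ev_add (x : (torusOver Γ A).obj R) (l l' : Module.Dual ℤ Γ) :
    ev x (l + l') = ev x l * ev x l' :=
  map_mul (show Multiplicative (Module.Dual ℤ Γ) →* (A.obj R)ˣ from x) _ _

theorem ev_zsmul (x : (torusOver Γ A).obj R) (n : ℤ) (l : Module.Dual ℤ Γ) :
    ev x (n • l) = ev x l ^ n :=
  map_zpow (show Multiplicative (Module.Dual ℤ Γ) →* (A.obj R)ˣ from x) _ _

theorem ev_map (φ : R ⟶ S) (x : (torusOver Γ A).obj R) (l : Module.Dual ℤ Γ) :
    ev ((torusOver Γ A).map φ x) l = Units.map ((A.map φ).hom : A.obj R →* A.obj S) (ev x l) := rfl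

theorem ev_torusOverMap (η : A ⟶ B) (x : (torusOver Γ A).obj R) (l : Module.Dual ℤ Γ) :
    ev ((torusOverMap Γ η).app R x) l =
      Units.map ((η.app R).hom : A.obj R →* B.obj R) (ev x l) := rfl

/-- The point of `Γ ⊗ Aˣ` with given values of the characters. -/
def mkPoint (f : Module.Dual ℤ Γ → (A.obj R)ˣ) (hf : ∀ l l', f (l + l') = f l * f l') :
    (torusOver Γ A).obj R :=
  MonoidHom.mk' (fun l => f (Multiplicative.toAdd l)) fun _ _ => hf _ _

theorem ev_mkPoint (f : Module.Dual ℤ Γ → (A.obj R)ˣ) (hf : ∀ l l', f (l + l') = f l * f l')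
    (l : Module.Dual ℤ Γ) : ev (mkPoint (Γ := Γ) f hf) l = f l := rfl

theorem point_mul_one (x : (torusOver Γ A).obj R) : x * 1 = x :=
  ev_ext fun l => mul_one (ev x l)

theorem point_one_mul (x : (torusOver Γ A).obj R) : 1 * x = x :=
  ev_ext fun l => one_mul (ev x l)

theorem ev_loopPow (f : (R : Type u)⸨X⸩ˣ) (γ : Γ) (l : Module.Dual ℤ Γ) :
    ev (loopPow k f γ : (torusLoop k Γ).obj R) l = f ^ l γ := rfl

end Points

section Frame

variable {k : Type u} [Field k] [CharZero k] {Γ : Type u} [AddCommGroup Γ]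

/-- A basis `e` of `Γ` together with the coordinates `q` on `k ⊗ Γ^∨` with respect to the basis
`c(e_i)` of this space. -/
structure Frame (k : Type u) [Field k] {Γ : Type u} [AddCommGroup Γ]
    (c : Γ →ₗ[ℤ] Γ →ₗ[ℤ] ℤ) where
  ι : Type u
  [fintype : Fintype ι]
  [decEq : DecidableEq ι]
  e : Module.Basis ι ℤ Γ
  q : ι → Module.Dual ℤ Γ →+ k
  q_c : ∀ i j, q i (c (e j)) = if i = j then 1 else 0
  exists_multiple : ∀ l, ∃ N : ℕ, N ≠ 0 ∧ ∃ γ, N • l = c γ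

attribute [instance] Frame.fintype Frame.decEq

theorem finite_charQuot [Module.Free ℤ Γ] [Module.Finite ℤ Γ] {c : Γ →ₗ[ℤ] Γ →ₗ[ℤ] ℤ}
    (hc : Function.Injective c) : Finite (CharQuot c) := by
  refine Submodule.finiteQuotientOfFreeOfRankEq _ ?_
  rw [LinearMap.finrank_range_of_inj hc]
  exact (Module.finrank_linearMap_self ℤ ℤ Γ).symm

theorem exists_frame [Module.Free ℤ Γ] [Module.Finite ℤ Γ] {c : Γ →ₗ[ℤ] Γ →ₗ[ℤ] ℤ}
    (hc : Function.Injective c) : Nonempty (Frame k c) := by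
  classical
  have hfin := finite_charQuot hc
  set N := Nat.card (CharQuot c) with hN
  have hN0 : N ≠ 0 := Nat.card_pos.ne'
  have hmem : ∀ l : Module.Dual ℤ Γ, N • l ∈ LinearMap.range c := fun l => by
    rw [← Submodule.Quotient.mk_eq_zero, Submodule.Quotient.mk_smul]
    exact card_nsmul_eq_zero'
  let e := Module.Free.chooseBasis ℤ Γ
  let ce := LinearEquiv.ofInjective c hc
  have hinv : ∀ γ h, ce.symm ⟨c γ, h⟩ = γ := fun γ h => ce.symm_apply_apply γ
  let inv : Module.Dual ℤ Γ →+ Γ :=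
    { toFun := fun l => ce.symm ⟨N • l, hmem l⟩
      map_zero' := by
        rw [← hinv 0 (LinearMap.mem_range_self c 0)]
        simp
      map_add' := fun l l' => by
        rw [← map_add]
        congr 1
        exact Subtype.ext (smul_add N l l') }
  have hinv' : ∀ γ, inv (c γ) = N • γ := fun γ => by
    rw [← hinv (N • γ) (LinearMap.mem_range_self c _)]
    change ce.symm _ = ce.symm _
    congr 1
    exact Subtype.ext (map_nsmul c N γ).symm
  refine ⟨⟨_, e, fun i => (AddMonoidHom.mulLeft (N : k)⁻¹).comp
    ((Int.castAddHom k).comp ((e.coord i).toAddMonoidHom.comp inv)), fun i j => ?_,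
    fun l => ⟨N, hN0, ce.symm ⟨N • l, hmem l⟩, ?_⟩⟩⟩
  · change (N : k)⁻¹ * ((e.coord i (inv (c (e j))) : ℤ) : k) = _
    rw [hinv', map_nsmul, Module.Basis.coord_apply, Module.Basis.repr_self, Finsupp.single_apply]
    have : (N : k) ≠ 0 := Nat.cast_ne_zero.2 hN0
    by_cases h : j = i
    · simp [h, this]
    · have h' : ¬ i = j := fun h' => h h'.symm
      simp [h, h']
  · exact (congrArg Subtype.val (ce.apply_symm_apply ⟨N • l, hmem l⟩)).symm

variable {c : Γ →ₗ[ℤ] Γ →ₗ[ℤ] ℤ} (F : Frame k c)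

namespace Frame

/-- The index set of the coordinates on `T(𝔪)` and on the negative part of `T(F)`: the pair
`(i, n)` corresponds to the degree `± (n + 1)` and the basis vector `e_i`. -/
abbrev P : Type u := F.ι × ℕ

/-- An additive map on `Γ^∨` is determined by its values on `c(Γ)`. -/
theorem eq_sum_q {W : Type*} [AddCommGroup W] [Module k W] (f : Module.Dual ℤ Γ →+ W)
    (l : Module.Dual ℤ Γ) : f l = ∑ i, F.q i l • f (c (F.e i)) := by
  obtain ⟨N, hN, γ, hγ⟩ := F.exists_multiple l
  have h0 : N • l = ∑ i, F.e.repr γ i • c (F.e i) := by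
    rw [hγ]
    conv_lhs => rw [← F.e.sum_repr γ]
    rw [map_sum]
    exact Finset.sum_congr rfl fun i _ => map_zsmul c _ _
  have hq : ∀ i, (N : k) * F.q i l = (F.e.repr γ i : k) := by
    intro i
    rw [← nsmul_eq_mul, ← map_nsmul, h0]
    simp [F.q_c]
  have hN' : (N : k) ≠ 0 := Nat.cast_ne_zero.2 hN
  have h1 : (N : k) • f l = (N : k) • ∑ i, F.q i l • f (c (F.e i)) := by
    rw [Nat.cast_smul_eq_nsmul, ← map_nsmul, h0, map_sum, Finset.smul_sum]
    refine Finset.sum_congr rfl fun i _ => ?_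
    rw [smul_smul, hq, Int.cast_smul_eq_zsmul, map_zsmul]
  exact smul_right_injective W hN' h1

variable {R S : CommAlgCat.{u} k}

/-- The coordinates on `T(O)` that vanish on `T`: the `(i, n)`-th one is the coefficient at `tⁿ`
of the logarithmic derivative of the function `c(e_i)`. -/
def logCoord (x : (torusArc k Γ).obj R) (p : F.P) : R :=
  PowerSeries.coeff p.2 (dlog (R := R) (ev x (c (F.e p.1))))

theorem logCoord_mul (x y : (torusArc k Γ).obj R) :
    F.logCoord (x * y) = F.logCoord x + F.logCoord y := by
  ext p
  rw [logCoord, ev_mul, dlog_mul, map_add]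
  rfl

theorem logCoord_one : F.logCoord (1 : (torusArc k Γ).obj R) = 0 := by
  have h := F.logCoord_mul (1 : (torusArc k Γ).obj R) 1
  rw [point_mul_one] at h
  exact left_eq_add.1 h

theorem logCoord_map (φ : R ⟶ S) (x : (torusArc k Γ).obj R) (p : F.P) :
    F.logCoord ((torusArc k Γ).map φ x) p = φ.hom (F.logCoord x p) := by
  have h := dlog_map φ.hom.toRingHom (ev x (c (F.e p.1)))
  exact (congrArg (PowerSeries.coeff p.2) h).trans (PowerSeries.coeff_map _ _ _)

theorem logCoord_constArc (x : (torus k Γ).obj R) : F.logCoord ((constArc k Γ).app R x) = 0 := by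
  ext p
  have h : d⁄dX R (PowerSeries.C ((ev x (c (F.e p.1)) : (R : Type u)ˣ) : R)) = 0 :=
    PowerSeries.derivative_C
  have h2 : dlog (R := R) (ev ((constArc k Γ).app R x) (c (F.e p.1))) = 0 :=
    (congrArg (· * _) h).trans (zero_mul _)
  rw [logCoord, h2, map_zero]
  rfl

/-- The value of `Σ_i q_i(l) Σ_n y_{(i,n)} tⁿ`. -/
def logSeries (y : F.P → R) (l : Module.Dual ℤ Γ) : (R : Type u)⟦X⟧ :=
  ∑ i, F.q i l • PowerSeries.mk fun n => y (i, n)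

/-- The point of `T(𝔪)` with given coordinates. -/
def arcPt (y : F.P → R) : (torusArc k Γ).obj R :=
  mkPoint (A := arcRing k) (fun l => expPrim k (F.logSeries y l)) fun l l' => by
    rw [← expPrim_add]
    congr 1
    simp only [logSeries, map_add, add_smul, Finset.sum_add_distrib]

theorem ev_arcPt (y : F.P → R) (l : Module.Dual ℤ Γ) :
    ev (F.arcPt y) l = expPrim k (F.logSeries y l) := rfl

theorem arcConst_arcPt (y : F.P → R) : (arcConst k Γ).app R (F.arcPt y) = 1 :=
  ev_ext fun l => Units.ext (constantCoeff_expPrim k (F.logSeries y l))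

theorem logCoord_arcPt (y : F.P → R) : F.logCoord (F.arcPt y) = y := by
  ext p
  rw [logCoord, ev_arcPt, dlog_expPrim, logSeries]
  simp only [F.q_c, ite_smul, one_smul, zero_smul, Finset.sum_ite_eq', Finset.mem_univ, if_true,
    PowerSeries.coeff_mk]

theorem arc_ext {x x' : (torusArc k Γ).obj R}
    (h0 : (arcConst k Γ).app R x = (arcConst k Γ).app R x') (h : F.logCoord x = F.logCoord x') :
    x = x' := by
  refine ev_ext fun l => eq_of_dlog_eq k ?_ ?_
  · let f : (torusArc k Γ).obj R → (Module.Dual ℤ Γ →+ (R : Type u)⟦X⟧) := fun x =>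
      AddMonoidHom.mk' (fun l => dlog (R := R) (ev x l)) fun l l' => by rw [ev_add, dlog_mul]
    have h1 : ∀ x l, f x l = dlog (R := R) (ev x l) := fun _ _ => rfl
    rw [← h1, ← h1, F.eq_sum_q (f x), F.eq_sum_q (f x')]
    refine Finset.sum_congr rfl fun i _ => ?_
    congr 1
    ext n
    exact congrFun h (i, n)
  · exact congrArg Units.val (congrArg (fun z => ev z l) h0)

theorem arcPt_logCoord (x : (torusArc k Γ).obj R) :
    (constArc k Γ).app R ((arcConst k Γ).app R x) * F.arcPt (F.logCoord x) = x := by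
  refine F.arc_ext ?_ ?_
  · rw [map_mul, arcConst_constArc, arcConst_arcPt, point_mul_one]
  · rw [logCoord_mul, logCoord_constArc, logCoord_arcPt, zero_add]

theorem arcPt_add (y y' : F.P → R) : F.arcPt (y + y') = F.arcPt y * F.arcPt y' := by
  refine F.arc_ext ?_ ?_
  · rw [map_mul, arcConst_arcPt, arcConst_arcPt, arcConst_arcPt, point_one_mul]
  · rw [logCoord_mul, logCoord_arcPt, logCoord_arcPt, logCoord_arcPt]

theorem arcPt_zero : F.arcPt (0 : F.P → R) = 1 := by
  refine F.arc_ext ?_ ?_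
  · rw [arcConst_arcPt, map_one]
  · rw [logCoord_arcPt, logCoord_one]

theorem arcConst_map (φ : R ⟶ S) (x : (torusArc k Γ).obj R) :
    (arcConst k Γ).app S ((torusArc k Γ).map φ x) =
      (torus k Γ).map φ ((arcConst k Γ).app R x) :=
  congrArg (fun f => f.hom x) ((arcConst k Γ).naturality φ)

theorem arcPt_map (φ : R ⟶ S) (y : F.P → R) :
    (torusArc k Γ).map φ (F.arcPt y) = F.arcPt fun p => φ.hom (y p) := by
  refine F.arc_ext ?_ ?_
  · rw [arcConst_map, arcConst_arcPt, arcConst_arcPt, map_one]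
  · ext p
    rw [logCoord_map, logCoord_arcPt, logCoord_arcPt]

end Frame

end Frame


/-! ### The structure of the points of `T(F)` -/

section LaurentUnique

variable {R : Type u} [CommRing R]

theorem single_mul_single_neg (n : ℤ) :
    (HahnSeries.single n (1 : R) * HahnSeries.single (-n) 1 : R⸨X⸩) = 1 := by
  rw [HahnSeries.single_mul_single, add_neg_cancel, mul_one]
  rfl

/-- The uniformizer `t`. -/
def tUnit : R⸨X⸩ˣ :=
  ⟨HahnSeries.single 1 1, HahnSeries.single (-1) 1, single_mul_single_neg 1, by
    rw [mul_comm]; exact single_mul_single_neg 1⟩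

theorem coe_tUnit_zpow (n : ℤ) : ((tUnit ^ n : R⸨X⸩ˣ) : R⸨X⸩) = HahnSeries.single n 1 := by
  have hnat : ∀ m : ℕ, ((tUnit ^ m : R⸨X⸩ˣ) : R⸨X⸩) = HahnSeries.single (m : ℤ) 1 := fun m => by
    rw [Units.val_pow_eq_pow_val]
    change (HahnSeries.single (1 : ℤ) (1 : R)) ^ m = _
    rw [HahnSeries.single_pow, one_pow, nsmul_eq_mul, mul_one]
  obtain ⟨m, rfl | rfl⟩ := n.eq_nat_or_neg
  · rw [zpow_natCast, hnat]
  · have h : (tUnit ^ m : R⸨X⸩ˣ) * ⟨HahnSeries.single (-(m : ℤ)) 1, HahnSeries.single (m : ℤ) 1, by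
        rw [mul_comm]; exact single_mul_single_neg _, single_mul_single_neg _⟩ = 1 :=
      Units.ext (by rw [Units.val_mul, hnat]; exact single_mul_single_neg _)
    rw [zpow_neg, zpow_natCast, inv_eq_of_mul_eq_one_right h]

theorem coeff_single_mul_ofPowerSeries (m : ℤ) (h : R⟦X⟧) :
    (HahnSeries.single m (1 : R) * HahnSeries.ofPowerSeries ℤ R h).coeff m =
      PowerSeries.constantCoeff h := by
  have h1 := HahnSeries.coeff_single_mul_add (r := (1 : R))
    (x := HahnSeries.ofPowerSeries ℤ R h) (a := (0 : ℕ)) (b := m)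
  rw [coeff_ofPowerSeries_nat, one_mul] at h1
  simpa using h1

variable (k : Type u) [Field k] [CharZero k] [Algebra k R]

/-- The factorization `t ^ m * h * exp(ν)` of an invertible Laurent series is unique: the quotient
of two of them writes the exponential of a nilpotent polynomial in `t⁻¹` as a power of `t` times an
invertible power series. -/
theorem laurent_factor_unique [Nontrivial R] {m m' : ℤ} {h h' : R⟦X⟧ˣ} {ν ν' : ℕ →₀ R}
    (hν : ∀ n, IsNilpotent (ν n)) (hν' : ∀ n, IsNilpotent (ν' n))
    (heq : HahnSeries.single m 1 * HahnSeries.ofPowerSeries ℤ R h * nilExp k (negSeries ν) =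
      HahnSeries.single m' 1 * HahnSeries.ofPowerSeries ℤ R h' * nilExp k (negSeries ν')) :
    m = m' ∧ h = h' ∧ ν = ν' := by
  have hy := isNilpotent_negSeries hν
  have hy' := isNilpotent_negSeries hν'
  have hsub : ∀ n, IsNilpotent ((ν - ν') n) := fun n =>
    Commute.isNilpotent_sub (Commute.all _ _) (hν n) (hν' n)
  have hexp : nilExp k (negSeries (ν - ν')) * nilExp k (negSeries ν') = nilExp k (negSeries ν) := by
    rw [← nilExp_add k (isNilpotent_negSeries hsub) hy', ← map_add, sub_add_cancel]
  have hh : HahnSeries.ofPowerSeries ℤ R h *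
      HahnSeries.ofPowerSeries ℤ R ((h⁻¹ : R⟦X⟧ˣ) : R⟦X⟧) = 1 := by
    rw [← map_mul, Units.mul_inv, map_one]
  have hs := single_mul_single_neg (R := R) m
  have hs' : (HahnSeries.single (m' - m) (1 : R) : R⸨X⸩) =
      HahnSeries.single m' 1 * HahnSeries.single (-m) 1 := by
    rw [HahnSeries.single_mul_single, mul_one, sub_eq_add_neg]
  have h0 := nilExp_neg_mul k hy'
  have key : nilExp k (negSeries (ν - ν')) = HahnSeries.single (m' - m) 1 *
      HahnSeries.ofPowerSeries ℤ R ((h' * h⁻¹ : R⟦X⟧ˣ) : R⟦X⟧) := by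
    rw [Units.val_mul, map_mul, hs']
    set a := HahnSeries.ofPowerSeries ℤ R (h : R⟦X⟧)
    set b := HahnSeries.ofPowerSeries ℤ R ((h⁻¹ : R⟦X⟧ˣ) : R⟦X⟧)
    set a' := HahnSeries.ofPowerSeries ℤ R (h' : R⟦X⟧)
    set s : R⸨X⸩ := HahnSeries.single m 1
    set s' : R⸨X⸩ := HahnSeries.single m' 1
    set r : R⸨X⸩ := HahnSeries.single (-m) 1
    calc nilExp k (negSeries (ν - ν')) =
        (nilExp k (negSeries (ν - ν')) * nilExp k (negSeries ν')) * nilExp k (-negSeries ν') := by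
          linear_combination (-nilExp k (negSeries (ν - ν'))) * h0
      _ = (s * a * nilExp k (negSeries ν)) * (r * b * nilExp k (-negSeries ν')) := by
          rw [hexp]
          linear_combination
            (-nilExp k (negSeries ν) * nilExp k (-negSeries ν')) * (hh * (s * r) + hs)
      _ = s' * r * (a' * b) := by
          rw [heq]
          linear_combination (s' * a' * r * b) * h0
  have hm : m' - m = 0 := by
    obtain ⟨M, hM⟩ := Ideal.exists_maximal R
    let φ := Ideal.Quotient.mk M
    have : Nontrivial (R ⧸ M) := Ideal.Quotient.nontrivial_iff.2 hM.ne_top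
    have hred : IsReduced (R ⧸ M) :=
      have := Ideal.Quotient.isDomain M
      inferInstance
    have h1 := congrArg (laurentMap φ) key
    have h2 : laurentMap φ (nilExp k (negSeries (ν - ν'))) = 1 := by
      rw [map_nilExp k _ (isNilpotent_negSeries hsub), laurentMap_negSeries]
      have : (ν - ν').mapRange φ (map_zero φ) = 0 := by
        ext n
        exact ((hsub n).map φ).eq_zero
      rw [this, map_zero, nilExp_zero]
    have h3 : laurentMap φ (HahnSeries.single (m' - m) (1 : R)) = HahnSeries.single (m' - m) 1 := by
      refine (HahnSeries.map_single (φ : ZeroHom R (R ⧸ M))).trans ?_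
      congr 1
    rw [h2, map_mul, ← ofPowerSeries_map, h3] at h1
    have h4 := congrArg (fun f : (R ⧸ M)⸨X⸩ => f.coeff (m' - m)) h1
    simp only [coeff_single_mul_ofPowerSeries, constantCoeff_map'] at h4
    have h5 : IsUnit (φ (PowerSeries.constantCoeff ((h' * h⁻¹ : R⟦X⟧ˣ) : R⟦X⟧))) :=
      ((h' * h⁻¹).isUnit.map PowerSeries.constantCoeff).map φ
    by_contra hne
    rw [HahnSeries.coeff_one, if_neg hne] at h4
    exact h5.ne_zero h4.symm
  obtain rfl : m' = m := by omega
  rw [sub_self] at key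
  have key' : nilExp k (negSeries (ν - ν')) =
      HahnSeries.ofPowerSeries ℤ R ((h' * h⁻¹ : R⟦X⟧ˣ) : R⟦X⟧) :=
    key.trans (one_mul _)
  have hν0 := eq_zero_of_nilExp_negSeries_eq k hsub key'
  refine ⟨rfl, ?_, sub_eq_zero.1 hν0⟩
  rw [hν0, map_zero, nilExp_zero, ← map_one (HahnSeries.ofPowerSeries ℤ R)] at key'
  have h6 : h' * h⁻¹ = 1 := Units.ext (HahnSeries.ofPowerSeries_injective key').symm
  exact (mul_inv_eq_one.1 h6).symm

end LaurentUnique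

section LoopPoints

variable {k : Type u} [Field k] [CharZero k] {Γ : Type u} [AddCommGroup Γ]
  {c : Γ →ₗ[ℤ] Γ →ₗ[ℤ] ℤ} (F : Frame k c) {R S : CommAlgCat.{u} k}

/-- The map of nilradicals induced by a morphism. -/
def nilMap (φ : R ⟶ S) : nilradical R →+ nilradical S where
  toFun a := ⟨φ.hom a, (show IsNilpotent (a : R) from a.2).map φ.hom⟩
  map_zero' := Subtype.ext (map_zero φ.hom)
  map_add' _ _ := Subtype.ext (map_add φ.hom _ _)

theorem isNilpotent_single (n : ℕ) (a : nilradical R) :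
    IsNilpotent (HahnSeries.single (-((n : ℤ) + 1)) (a : R) : (R : Type u)⸨X⸩) := by
  rw [← negSeries_single]
  refine isNilpotent_negSeries fun m => ?_
  rw [Finsupp.single_apply]
  split_ifs
  · exact a.2
  · exact IsNilpotent.zero

/-- `a ↦ exp(a t^(-(n+1)))` for nilpotent `a`. -/
def negUnit (n : ℕ) : nilradical R →+ Additive ((R : Type u)⸨X⸩ˣ) where
  toFun a := Additive.ofMul (isUnit_nilExp k (isNilpotent_single n a)).unit
  map_zero' := Units.ext (by
    change nilExp k (HahnSeries.single (-((n : ℤ) + 1)) (0 : R) : (R : Type u)⸨X⸩) = 1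
    rw [map_zero, nilExp_zero])
  map_add' a b := Units.ext (by
    change nilExp k (HahnSeries.single (-((n : ℤ) + 1)) ((a : R) + b) : (R : Type u)⸨X⸩) =
      nilExp k (HahnSeries.single (-((n : ℤ) + 1)) (a : R)) *
        nilExp k (HahnSeries.single (-((n : ℤ) + 1)) (b : R))
    rw [← nilExp_add k (isNilpotent_single n a) (isNilpotent_single n b)]
    exact congrArg _ (map_add (HahnSeries.single.addMonoidHom (-((n : ℤ) + 1))) (a : R) (b : R)))

theorem coe_negUnit (n : ℕ) (a : nilradical R) :
    ((Additive.toMul (negUnit n a) : (R : Type u)⸨X⸩ˣ) : (R : Type u)⸨X⸩) =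
      nilExp k (HahnSeries.single (-((n : ℤ) + 1)) (a : R)) := rfl

theorem map_negUnit (φ : R ⟶ S) (n : ℕ) (a : nilradical R) :
    Units.map (laurentMap φ.hom.toRingHom : (R : Type u)⸨X⸩ →* (S : Type u)⸨X⸩)
      (Additive.toMul (negUnit n a)) = Additive.toMul (negUnit n (nilMap φ a)) := by
  refine Units.ext ?_
  change laurentMap φ.hom.toRingHom (nilExp k _) = nilExp k _
  rw [map_nilExp k _ (isNilpotent_single n a)]
  congr 1
  exact HahnSeries.map_single (φ.hom.toRingHom : ZeroHom R S)

namespace Frame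

/-- The coordinates of the points of the negative part of `T(F)`. -/
abbrev N (R : CommAlgCat.{u} k) : Type u := F.P →₀ nilradical R

/-- Functoriality of the coordinates of points of the negative part. -/
def mapN (φ : R ⟶ S) : F.N R →+ F.N S := Finsupp.mapRange.addMonoidHom (nilMap φ)

theorem mapN_single (φ : R ⟶ S) (p : F.P) (a : nilradical R) :
    F.mapN φ (Finsupp.single p a) = Finsupp.single p (nilMap φ a) :=
  Finsupp.mapRange_single (hf := map_zero (nilMap φ))

theorem coe_mapN_apply (φ : R ⟶ S) (ν : F.N R) (p : F.P) :
    ((F.mapN φ ν p : nilradical S) : S) = φ.hom (ν p : R) := rfl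

/-- The value of the character `l` at the point of the negative part with given coordinates. -/
def negVal (l : Module.Dual ℤ Γ) : F.N R →+ Additive ((R : Type u)⸨X⸩ˣ) :=
  Finsupp.liftAddHom fun p => l (F.e p.1) • negUnit p.2

theorem negVal_single (l : Module.Dual ℤ Γ) (p : F.P) (a : nilradical R) :
    F.negVal l (Finsupp.single p a) = l (F.e p.1) • negUnit p.2 a :=
  Finsupp.liftAddHom_apply_single _ _ _

/-- The point of the negative part of `T(F)` with given coordinates. -/
def negPoint (ν : F.N R) : (torusLoop k Γ).obj R :=
  mkPoint (A := loopRing k) (fun l => Additive.toMul (F.negVal l ν)) fun l l' => by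
    rw [← toMul_add]
    congr 1
    rw [← AddMonoidHom.add_apply]
    congr 1
    refine Finsupp.addHom_ext fun p a => ?_
    rw [AddMonoidHom.add_apply, negVal_single, negVal_single, negVal_single, LinearMap.add_apply]
    exact add_zsmul _ _ _

theorem ev_negPoint (ν : F.N R) (l : Module.Dual ℤ Γ) :
    ev (F.negPoint ν) l = Additive.toMul (F.negVal l ν) := rfl

theorem negPoint_add (ν ν' : F.N R) : F.negPoint (ν + ν') = F.negPoint ν * F.negPoint ν' :=
  ev_ext fun l => by rw [ev_mul, ev_negPoint, ev_negPoint, ev_negPoint, map_add]; rfl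

theorem negPoint_zero : F.negPoint (0 : F.N R) = 1 :=
  ev_ext fun l => by rw [ev_negPoint, map_zero]; rfl

theorem negPoint_single (p : F.P) (a : nilradical R) :
    F.negPoint (Finsupp.single p a) = loopPow k (Additive.toMul (negUnit p.2 a)) (F.e p.1) :=
  ev_ext fun l => by rw [ev_negPoint, negVal_single]; rfl

theorem negPoint_map (φ : R ⟶ S) (ν : F.N R) :
    (torusLoop k Γ).map φ (F.negPoint ν) = F.negPoint (F.mapN φ ν) := by
  refine ev_ext fun l => ?_
  rw [ev_map, ev_negPoint, ev_negPoint]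
  induction ν using Finsupp.induction_linear with
  | zero => simp
  | add f g hf hg => rw [map_add, toMul_add, map_mul, hf, hg, map_add, map_add, toMul_add]
  | single p a =>
    rw [mapN_single, negVal_single, negVal_single, toMul_zsmul, toMul_zsmul, map_zpow]
    exact congrArg (· ^ _) (map_negUnit φ p.2 a)

/-- The part of the coordinates of a negative point belonging to one basis vector. -/
def negComp (i : F.ι) : F.N R →+ (ℕ →₀ R) :=
  Finsupp.liftAddHom fun p => if p.1 = i then
    (Finsupp.singleAddHom p.2).comp (nilradical R).subtype.toAddMonoidHom else 0

theorem negComp_single (i : F.ι) (p : F.P) (a : nilradical R) :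
    F.negComp i (Finsupp.single p a) = if p.1 = i then Finsupp.single p.2 (a : R) else 0 := by
  rw [negComp, Finsupp.liftAddHom_apply_single]
  split_ifs <;> rfl

theorem negComp_apply (i : F.ι) (ν : F.N R) (n : ℕ) : F.negComp i ν n = (ν (i, n) : R) := by
  induction ν using Finsupp.induction_linear with
  | zero => simp
  | add f g hf hg => rw [map_add, Finsupp.add_apply, hf, hg]; rfl
  | single p a =>
    rw [negComp_single]
    obtain ⟨j, m⟩ := p
    by_cases h : j = i
    · subst h
      rw [if_pos rfl]
      by_cases h2 : m = n
      · subst h2; simp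
      · rw [Finsupp.single_eq_of_ne (Ne.symm h2), Finsupp.single_eq_of_ne]
        · rfl
        · intro h3
          exact h2 (Prod.ext_iff.1 h3).2.symm
    · rw [if_neg h, Finsupp.single_eq_of_ne]
      · rfl
      · intro h3
        exact h (Prod.ext_iff.1 h3).1.symm

theorem negComp_nilpotent (i : F.ι) (ν : F.N R) (n : ℕ) : IsNilpotent (F.negComp i ν n) := by
  rw [negComp_apply]
  exact (ν (i, n)).2

theorem coe_ev_negPoint_coord (ν : F.N R) (i : F.ι) :
    ((ev (F.negPoint ν) (F.e.coord i) : ((R : Type u)⸨X⸩)ˣ) : (R : Type u)⸨X⸩) =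
      nilExp k (negSeries (F.negComp i ν)) := by
  rw [ev_negPoint]
  induction ν using Finsupp.induction_linear with
  | zero =>
    rw [map_zero (F.negVal _), map_zero (F.negComp i), map_zero negSeries, nilExp_zero]
    rfl
  | add f g hf hg =>
    rw [map_add, toMul_add, Units.val_mul, hf, hg, map_add, map_add,
      nilExp_add k (isNilpotent_negSeries (F.negComp_nilpotent i f))
        (isNilpotent_negSeries (F.negComp_nilpotent i g))]
  | single p a =>
    rw [negVal_single, negComp_single, Module.Basis.coord_apply, Module.Basis.repr_self,
      Finsupp.single_apply]
    split_ifs with h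
    · rw [one_smul, coe_negUnit, negSeries_single]
    · rw [zero_smul, map_zero negSeries, nilExp_zero]; rfl

theorem coe_ev_factor (γ : Γ) (h : (torusArc k Γ).obj R) (ν : F.N R) (i : F.ι) :
    ((ev (loopPow k tUnit γ * (arcLoop k Γ).app R h * F.negPoint ν : (torusLoop k Γ).obj R)
      (F.e.coord i) : ((R : Type u)⸨X⸩)ˣ) : (R : Type u)⸨X⸩) =
    HahnSeries.single (F.e.coord i γ) 1 * HahnSeries.ofPowerSeries ℤ R
      ((ev h (F.e.coord i) : ((R : Type u)⟦X⟧)ˣ) : (R : Type u)⟦X⟧) *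
        nilExp k (negSeries (F.negComp i ν)) := by
  rw [ev_mul, ev_mul, Units.val_mul, Units.val_mul, coe_ev_negPoint_coord, ev_loopPow,
    coe_tUnit_zpow]
  rfl

end Frame

theorem ev_ext_coord {A : CommAlgCat.{u} k ⥤ CommRingCat.{u}} {x y : (torusOver Γ A).obj R}
    (h : ∀ i, ev x (F.e.coord i) = ev y (F.e.coord i)) : x = y := by
  refine ev_ext fun l => ?_
  have hl : l = ∑ i, l (F.e i) • F.e.coord i := F.e.ext fun j => by
    simp
  have hsum : ∀ (z : (torusOver Γ A).obj R) (s : Finset F.ι) (f : F.ι → Module.Dual ℤ Γ),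
      ev z (∑ i ∈ s, f i) = ∏ i ∈ s, ev z (f i) := by
    intro z s f
    induction s using Finset.induction_on with
    | empty =>
      rw [Finset.sum_empty, Finset.prod_empty]
      exact map_one (show Multiplicative (Module.Dual ℤ Γ) →* (A.obj R)ˣ from z)
    | insert a s ha ih => rw [Finset.sum_insert ha, Finset.prod_insert ha, ev_add, ih]
  rw [hl, hsum, hsum]
  exact Finset.prod_congr rfl fun i _ => by rw [ev_zsmul, ev_zsmul, h]

namespace Frame

theorem exists_factor {x : (torusLoop k Γ).obj R} {γ : Γ}
    (hx : ∀ i, HasValuation (R := R) ((ev x (F.e.coord i) : ((R : Type u)⸨X⸩)ˣ) : (R : Type u)⸨X⸩)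
      (F.e.coord i γ)) :
    ∃ (h : (torusArc k Γ).obj R) (ν : F.N R),
      x = loopPow k tUnit γ * (arcLoop k Γ).app R h * F.negPoint ν := by
  choose h ν hν hfac using fun i => (hx i).exists_factor k
  let ν' : F.ι → (ℕ →₀ nilradical R) := fun i =>
    Finsupp.onFinset (ν i).support (fun n => ⟨ν i n, hν i n⟩) fun n hn =>
      Finsupp.mem_support_iff.2 fun h0 => hn (Subtype.ext h0)
  let μ : F.N R := ∑ i, (ν' i).mapDomain (Prod.mk i)
  have hμ : ∀ i, F.negComp i μ = ν i := by
    intro i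
    ext n
    rw [negComp_apply, Finsupp.finsetSum_apply, Finset.sum_eq_single i]
    · rw [Finsupp.mapDomain_apply (Prod.mk_right_injective i)]
      rfl
    · intro j _ hji
      refine Finsupp.mapDomain_of_notMem_range _ _ ?_
      rintro ⟨m, hm⟩
      exact hji (Prod.ext_iff.1 hm).1
    · intro hi
      exact absurd (Finset.mem_univ i) hi
  refine ⟨mkPoint (A := arcRing k) (fun l => ∏ i, h i ^ l (F.e i)) fun l l' => ?_, μ, ?_⟩
  · rw [← Finset.prod_mul_distrib]
    exact Finset.prod_congr rfl fun i _ => zpow_add _ _ _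
  · refine ev_ext_coord F fun i => Units.ext ?_
    rw [coe_ev_factor, hμ, hfac i, ev_mkPoint]
    have h1 : ∏ j, h j ^ F.e.coord i (F.e j) = h i := by
      rw [Finset.prod_eq_single i]
      · simp
      · intro j _ hj
        simp [hj]
      · intro hi
        exact absurd (Finset.mem_univ i) hi
    rw [h1]

theorem exists_factor_of_hasDegree {x : (torusLoop k Γ).obj R} {γ : Γ} (hx : HasDegree k x γ) :
    ∃ (h : (torusArc k Γ).obj R) (ν : F.N R),
      x = loopPow k tUnit γ * (arcLoop k Γ).app R h * F.negPoint ν :=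
  F.exists_factor fun i => hx (F.e.coord i)

/-- Locally, every point of `T(F)` is the product of some `t^γ`, a point of `T(O)`, and a point of
the negative part. -/
theorem locally_exists_factor (x : (torusLoop k Γ).obj R) :
    LocallyOn R fun S φ => ∃ (γ : Γ) (h : (torusArc k Γ).obj S) (ν : F.N S),
      (torusLoop k Γ).map φ x = loopPow k tUnit γ * (arcLoop k Γ).app S h * F.negPoint ν := by
  refine (LocallyOn.forall (Q := fun i S φ => ∃ n, HasValuation (R := S)
    ((ev ((torusLoop k Γ).map φ x) (F.e.coord i) : ((S : Type u)⸨X⸩)ˣ) : (S : Type u)⸨X⸩) n)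
    fun i p hp => ?_).mono fun S φ h => ?_
  · obtain ⟨r, hr, n, h⟩ := exists_valuation_away (ev x (F.e.coord i)).mul_inv p
    exact ⟨r, hr, fun S φ hu => ⟨n, h S φ.hom.toRingHom hu⟩⟩
  · choose n hn using h
    refine ⟨∑ i, n i • F.e i, F.exists_factor fun i => ?_⟩
    have h1 : F.e.coord i (∑ j, n j • F.e j) = n i := by
      simp [Finsupp.single_apply]
    rw [h1]
    exact hn i

theorem factor_unique [Nontrivial R] {γ γ' : Γ} {h h' : (torusArc k Γ).obj R} {ν ν' : F.N R}
    (heq : (loopPow k tUnit γ * (arcLoop k Γ).app R h * F.negPoint ν : (torusLoop k Γ).obj R) =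
      loopPow k tUnit γ' * (arcLoop k Γ).app R h' * F.negPoint ν') :
    γ = γ' ∧ h = h' ∧ ν = ν' := by
  have key := fun i => laurent_factor_unique k (F.negComp_nilpotent i ν)
    (F.negComp_nilpotent i ν') (by
      rw [← coe_ev_factor, ← coe_ev_factor, heq])
  refine ⟨?_, ?_, ?_⟩
  · exact F.e.repr.injective (Finsupp.ext fun i => (key i).1)
  · exact ev_ext_coord F fun i => (key i).2.1
  · ext ⟨i, n⟩
    rw [← negComp_apply, ← negComp_apply, (key i).2.2]

end Frame

end LoopPoints


/-! ### Commutators in a Heisenberg extension -/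

section Extension

variable {k : Type u} [Field k] [CharZero k] {Γ : Type u} [AddCommGroup Γ]
  {c : Γ →ₗ[ℤ] Γ →ₗ[ℤ] ℤ} {R S : CommAlgCat.{u} k}

/-- The exponential of nilpotent elements as a homomorphism to the group of units. -/
def nilExpUnit (R : CommAlgCat.{u} k) (a : nilradical R) : (R : Type u)ˣ :=
  (isUnit_nilExp k (show IsNilpotent (a : R) from a.2)).unit

theorem coe_nilExpUnit (a : nilradical R) : (nilExpUnit R a : R) = nilExp k (a : R) := rfl

theorem nilExpUnit_add (a b : nilradical R) :
    nilExpUnit R (a + b) = nilExpUnit R a * nilExpUnit R b :=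
  Units.ext (nilExp_add k a.2 b.2)

theorem nilExpUnit_zero : nilExpUnit R 0 = 1 := Units.ext (nilExp_zero k)

theorem nilExpUnit_zsmul (n : ℤ) (a : nilradical R) :
    nilExpUnit R (n • a) = nilExpUnit R a ^ n :=
  congrArg Additive.toMul (map_zsmul (⟨⟨fun a => Additive.ofMul (nilExpUnit R a),
    congrArg Additive.ofMul nilExpUnit_zero⟩, fun a b =>
    congrArg Additive.ofMul (nilExpUnit_add a b)⟩ : nilradical R →+ Additive (R : Type u)ˣ) n a)

theorem map_nilExpUnit (φ : R ⟶ S) (a : nilradical R) :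
    Units.map (φ.hom : (R : Type u) →* S) (nilExpUnit R a) = nilExpUnit S (nilMap φ a) :=
  Units.ext (map_nilExp k φ.hom.toRingHom a.2)

/-- The product of an element of a ring and a nilpotent element. -/
def nilMul (r : R) (a : nilradical R) : nilradical R := r • a

/-- The point `u^γ` of `T(O)`. -/
def arcPow (u : (R : Type u)⟦X⟧ˣ) (γ : Γ) : (torusArc k Γ).obj R :=
  mkPoint (A := arcRing k) (fun l => u ^ l γ) fun _ _ => zpow_add _ _ _

theorem ev_arcPow (u : (R : Type u)⟦X⟧ˣ) (γ : Γ) (l : Module.Dual ℤ Γ) :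
    ev (arcPow (k := k) u γ) l = u ^ l γ := rfl

theorem arcLoop_arcPow (u : (R : Type u)⟦X⟧ˣ) (γ : Γ) :
    (arcLoop k Γ).app R (arcPow u γ) = loopPow k
      (Units.map (HahnSeries.ofPowerSeries ℤ R : (R : Type u)⟦X⟧ →* (R : Type u)⸨X⸩) u) γ :=
  ev_ext fun l => by
    rw [ev_torusOverMap, ev_arcPow, ev_loopPow, map_zpow]
    rfl

/-- The points of `T(O)` are products of the points `u^{e_j}`. -/
theorem arc_induction (F : Frame k c) {Pr : (torusArc k Γ).obj R → Prop} (h1 : Pr 1)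
    (hmul : ∀ x y, Pr x → Pr y → Pr (x * y)) (hpow : ∀ u j, Pr (arcPow u (F.e j)))
    (x : (torusArc k Γ).obj R) : Pr x := by
  let z : Finset F.ι → (torusArc k Γ).obj R := fun s =>
    mkPoint (A := arcRing k) (fun l => ∏ j ∈ s, ev x (F.e.coord j) ^ l (F.e j)) fun l l' => by
      rw [← Finset.prod_mul_distrib]
      exact Finset.prod_congr rfl fun i _ => zpow_add _ _ _
  have hz : ∀ s, Pr (z s) := by
    intro s
    induction s using Finset.induction_on with
    | empty =>
      have : z ∅ = 1 := ev_ext fun l => by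
        rw [ev_mkPoint, ev_one]
        exact Finset.prod_empty
      rwa [this]
    | insert a s ha ih =>
      have : z (insert a s) = arcPow (ev x (F.e.coord a)) (F.e a) * z s :=
        ev_ext fun l => Finset.prod_insert ha
      rw [this]
      exact hmul _ _ (hpow _ _) ih
  have hx : z Finset.univ = x := ev_ext_coord F fun i => by
    rw [ev_mkPoint, Finset.prod_eq_single i]
    · simp
    · intro j _ hj
      simp [hj]
    · intro hi
      exact absurd (Finset.mem_univ i) hi
  rw [← hx]
  exact hz _

/-- Coordinates of an invertible power series. -/
def arcCoord (u : (R : Type u)⟦X⟧ˣ) : LoopCoord (R : Type u) where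
  order := 0
  lead := Units.map (PowerSeries.constantCoeff (R := R)).toMonoidHom u
  pos := primitive k (dlog u)
  neg := 0
  pos_zero := constantCoeff_primitive k _
  neg_zero := rfl
  neg_nilpotent j := by simp

theorem value_arcCoord (u : (R : Type u)⟦X⟧ˣ) :
    (arcCoord u).value k = HahnSeries.ofPowerSeries ℤ R (u : (R : Type u)⟦X⟧) := by
  have hC : IsUnit (PowerSeries.C (PowerSeries.constantCoeff (u : (R : Type u)⟦X⟧))) :=
    (u.isUnit.map PowerSeries.constantCoeff).map PowerSeries.C
  have h : u = hC.unit * expPrim k (dlog u) := by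
    refine eq_of_dlog_eq k ?_ ?_
    · have h0 : dlog hC.unit = 0 :=
        (congrArg (· * _) (PowerSeries.derivative_C)).trans (zero_mul _)
      rw [dlog_mul, dlog_expPrim, h0, zero_add]
    · rw [Units.val_mul, map_mul, constantCoeff_expPrim, mul_one, IsUnit.unit_spec,
        PowerSeries.constantCoeff_C]
  have h2 : (∑ j ∈ Finset.range ((arcCoord (k := k) u).neg.natDegree + 1),
      HahnSeries.single (-(j : ℤ)) ((arcCoord (k := k) u).neg.coeff j) : (R : Type u)⸨X⸩) = 0 := by
    refine Finset.sum_eq_zero fun j _ => ?_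
    rw [show (arcCoord (k := k) u).neg.coeff j = 0 from Polynomial.coeff_zero j, map_zero]
  rw [LoopCoord.value, h2, nilExp_zero, mul_one]
  conv_rhs => rw [h, Units.val_mul, map_mul, IsUnit.unit_spec, HahnSeries.ofPowerSeries_C]
  rfl

/-- Coordinates of the uniformizer. -/
def tCoord (R : Type u) [CommRing R] : LoopCoord R where
  order := 1
  lead := 1
  pos := 0
  neg := 0
  pos_zero := map_zero _
  neg_zero := rfl
  neg_nilpotent j := by simp

theorem pexp_zero {R : Type u} [CommRing R] [Algebra k R] : pexp k (0 : R⟦X⟧) = 1 := by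
  have h : (0 : R⟦X⟧) = primitive k 0 := by
    ext n
    cases n with
    | zero => simp
    | succ n => rw [coeff_succ_primitive]; simp
  rw [h, ← coe_expPrim]
  refine congrArg Units.val (eq_of_dlog_eq k (v := 1) ?_ ?_)
  · rw [dlog_expPrim]
    exact (congrArg Multiplicative.toAdd (map_one (dlogHom (R := R)))).symm
  · rw [constantCoeff_expPrim, Units.val_one, map_one]

theorem value_tCoord :
    (tCoord (R : Type u)).value k = ((tUnit : (R : Type u)⸨X⸩ˣ) : (R : Type u)⸨X⸩) := by
  have h2 : (∑ j ∈ Finset.range ((tCoord (R : Type u)).neg.natDegree + 1),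
      HahnSeries.single (-(j : ℤ)) ((tCoord (R : Type u)).neg.coeff j) : (R : Type u)⸨X⸩) = 0 := by
    refine Finset.sum_eq_zero fun j _ => ?_
    rw [show (tCoord (R : Type u)).neg.coeff j = 0 from Polynomial.coeff_zero j, map_zero]
  have h3 : (PowerSeries.exp k).subst (tCoord (R : Type u)).pos = (1 : (R : Type u)⟦X⟧) :=
    pexp_zero
  rw [LoopCoord.value, h2, nilExp_zero, mul_one, h3, map_one, mul_one]
  rfl

/-- Coordinates of `exp(a t^(-(n+1)))`. -/
def negCoord (n : ℕ) (a : nilradical R) : LoopCoord (R : Type u) where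
  order := 0
  lead := 1
  pos := 0
  neg := Polynomial.monomial (n + 1) (a : R)
  pos_zero := map_zero _
  neg_zero := by rw [Polynomial.coeff_monomial, if_neg n.succ_ne_zero]
  neg_nilpotent j := by
    rw [Polynomial.coeff_monomial]
    split_ifs
    · exact a.2
    · exact IsNilpotent.zero

/-- A sum weighted by the coefficients of a monomial. -/
theorem sum_monomial {R : Type u} [CommRing R] {W : Type*} [AddCommMonoid W] (n : ℕ) (a : R)
    (f : ℕ → R → W) (hf : ∀ j, f j 0 = 0) :
    ∑ j ∈ Finset.range ((Polynomial.monomial n a).natDegree + 1),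
      f j ((Polynomial.monomial n a).coeff j) = f n a := by
  by_cases ha : a = 0
  · rw [ha]
    simp [hf]
  · rw [Polynomial.natDegree_monomial_eq n ha, Finset.sum_eq_single n]
    · rw [Polynomial.coeff_monomial_same]
    · intro j _ hj
      rw [Polynomial.coeff_monomial_of_ne _ hj, hf]
    · intro h
      exact absurd (Finset.mem_range.2 (Nat.lt_succ_self n)) h

theorem value_negCoord (n : ℕ) (a : nilradical R) :
    (negCoord n a).value k =
      ((Additive.toMul (negUnit n a) : (R : Type u)⸨X⸩ˣ) : (R : Type u)⸨X⸩) := by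
  have h3 : (PowerSeries.exp k).subst (negCoord n a).pos = (1 : (R : Type u)⟦X⟧) := pexp_zero
  have h2 : (∑ j ∈ Finset.range ((negCoord n a).neg.natDegree + 1),
      HahnSeries.single (-(j : ℤ)) ((negCoord n a).neg.coeff j) : (R : Type u)⸨X⸩) =
      HahnSeries.single (-((n : ℤ) + 1)) (a : R) := by
    refine (sum_monomial (n + 1) (a : R) (fun j r => (HahnSeries.single (-(j : ℤ)) r :
      (R : Type u)⸨X⸩)) fun j => map_zero _).trans ?_
    rw [Nat.cast_succ]
  rw [LoopCoord.value, h2, h3, map_one, mul_one, coe_negUnit]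
  exact one_mul _

namespace HeisenbergExtension

variable (H : HeisenbergExtension k c)

theorem proj_map (φ : R ⟶ S) (g : H.G.obj R) :
    H.proj.app S (H.G.map φ g) = (torusLoop k Γ).map φ (H.proj.app R g) :=
  congrArg (fun f => f.hom g) (H.proj.naturality φ)

theorem splitting_map (φ : R ⟶ S) (x : (torusArc k Γ).obj R) :
    H.splitting.app S ((torusArc k Γ).map φ x) = H.G.map φ (H.splitting.app R x) :=
  congrArg (fun f => f.hom x) (H.splitting.naturality φ)

theorem proj_splitting_apply (x : (torusArc k Γ).obj R) :
    H.proj.app R (H.splitting.app R x) = (arcLoop k Γ).app R x :=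
  congrArg (fun η => (η.app R).hom x) H.splitting_proj

theorem proj_scalar (a : (R : Type u)ˣ) : H.proj.app R (H.scalar R a) = 1 :=
  (H.proj_eq_one_iff R _).2 ⟨a, rfl⟩

theorem map_map {T : CommAlgCat.{u} k} (φ : R ⟶ S) (ψ : S ⟶ T) (g : H.G.obj R) :
    H.G.map ψ (H.G.map φ g) = H.G.map (φ ≫ ψ) g := by
  rw [H.G.map_comp]
  rfl

theorem exists_scalar {g g' : H.G.obj R} (h : H.proj.app R g = H.proj.app R g') :
    ∃ a, g = H.scalar R a * g' := by
  have h1 : H.proj.app R (g * g'⁻¹) = 1 := by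
    refine (map_mul (H.proj.app R).hom g g'⁻¹).trans ?_
    rw [map_inv]
    exact mul_inv_eq_one.2 h
  obtain ⟨a, ha⟩ := (H.proj_eq_one_iff R _).1 h1
  exact ⟨a, by rw [ha, inv_mul_cancel_right]⟩

/-- `g h = u h g` for a scalar `u`. -/
def Comm (g h : H.G.obj R) (u : (R : Type u)ˣ) : Prop := g * h = H.scalar R u * (h * g)

variable {H}

theorem Comm.mul_right {g h h' : H.G.obj R} {u u' : (R : Type u)ˣ} (h1 : H.Comm g h u)
    (h2 : H.Comm g h' u') : H.Comm g (h * h') (u * u') := by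
  unfold Comm at *
  calc g * (h * h') = H.scalar R u * (h * (g * h')) := by
        rw [← mul_assoc, h1, mul_assoc, mul_assoc]
    _ = H.scalar R u * ((h * H.scalar R u') * (h' * g)) := by rw [h2, mul_assoc]
    _ = _ := by rw [← H.scalar_central, map_mul]; simp only [mul_assoc]

theorem Comm.symm {g h : H.G.obj R} {u : (R : Type u)ˣ} (h1 : H.Comm g h u) :
    H.Comm h g u⁻¹ := by
  unfold Comm at *
  rw [h1, ← mul_assoc, ← map_mul, inv_mul_cancel, map_one, one_mul]

theorem Comm.mul_left {g g' h : H.G.obj R} {u u' : (R : Type u)ˣ} (h1 : H.Comm g h u)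
    (h2 : H.Comm g' h u') : H.Comm (g * g') h (u * u') := by
  have := (h1.symm.mul_right h2.symm).symm
  rwa [← mul_inv, inv_inv] at this

theorem comm_one_right (g : H.G.obj R) : H.Comm g 1 1 := by
  unfold Comm
  rw [map_one, mul_one, one_mul, one_mul]

variable (H)

/-- The commutator of lifts of `f₁^γ₁` and `f₂^γ₂` when `f₂` has valuation zero, so that the sign
rule contributes nothing. -/
theorem comm_of_coord (d₁ d₂ : LoopCoord R) {f₁ f₂ : (R : Type u)⸨X⸩ˣ} {γ₁ γ₂ : Γ}
    {g₁ g₂ : H.G.obj R} (hf₁ : (f₁ : (R : Type u)⸨X⸩) = d₁.value k)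
    (hf₂ : (f₂ : (R : Type u)⸨X⸩) = d₂.value k) (h₁ : H.proj.app R g₁ = loopPow k f₁ γ₁)
    (h₂ : H.proj.app R g₂ = loopPow k f₂ γ₂) (hd : d₂.order = 0) :
    H.Comm g₁ g₂ ((d₁.symbol k d₂) ^ (-c γ₁ γ₂)) := by
  have h := H.commutator R d₁ d₂ f₁ f₂ γ₁ γ₂ g₁ g₂ hf₁ hf₂ h₁ h₂
  rw [hd, zero_smul, map_zero, mul_zero, zpow_zero, one_mul] at h
  exact h

theorem comm_t_arc (F : Frame k c) {γ : Γ} {g : H.G.obj R}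
    (hg : H.proj.app R g = loopPow k tUnit γ) (x : (torusArc k Γ).obj R) :
    H.Comm g (H.splitting.app R x) (ev ((arcConst k Γ).app R x) (c γ)) := by
  refine arc_induction F (Pr := fun x =>
    H.Comm g (H.splitting.app R x) (ev ((arcConst k Γ).app R x) (c γ))) ?_ ?_ ?_ x
  · rw [map_one, map_one]
    exact comm_one_right g
  · intro x y hx hy
    rw [map_mul, map_mul]
    exact hx.mul_right hy
  · intro u j
    have h := H.comm_of_coord (tCoord (R : Type u)) (arcCoord (k := k) u)
      (value_tCoord (k := k)).symm (value_arcCoord (k := k) u).symm hg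
      ((H.proj_splitting_apply _).trans (arcLoop_arcPow u (F.e j))) rfl
    refine (congrArg (H.Comm _ _) ?_).mp h
    have hres : (tCoord (R : Type u)).res (arcCoord (k := k) u) = 0 := by
      simp [LoopCoord.res, tCoord, arcCoord]
    have hsym : (tCoord (R : Type u)).symbol k (arcCoord (k := k) u) = (Units.map
        (PowerSeries.constantCoeff (R := R)).toMonoidHom u)⁻¹ := by
      refine Units.ext ?_
      rw [LoopCoord.symbol, Units.val_mul, IsUnit.unit_spec, hres, nilExp_zero, mul_one]
      simp [tCoord, arcCoord]
    rw [hsym, inv_zpow', neg_neg, ev_torusOverMap, ev_arcPow, map_zpow]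
    rfl

/-- Lifts of the negative part commute with `T(O)` up to the exponential of a residue, which is
linear in the logarithmic coordinate of the point of `T(O)`. -/
theorem comm_neg_arc (F : Frame k c) {p : F.P} {a : nilradical R} {g : H.G.obj R}
    (hg : H.proj.app R g = F.negPoint (Finsupp.single p a)) (x : (torusArc k Γ).obj R) :
    H.Comm g (H.splitting.app R x) (nilExpUnit R (-nilMul (F.logCoord x p) a)) := by
  rw [F.negPoint_single] at hg
  refine arc_induction F (Pr := fun x =>
    H.Comm g (H.splitting.app R x) (nilExpUnit R (-nilMul (F.logCoord x p) a))) ?_ ?_ ?_ x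
  · rw [map_one, F.logCoord_one]
    have : -nilMul (R := R) ((0 : F.P → R) p) a = 0 := by
      rw [nilMul, Pi.zero_apply, zero_smul, neg_zero]
    rw [this, nilExpUnit_zero]
    exact comm_one_right g
  · intro x y hx hy
    have : -nilMul (F.logCoord (x * y) p) a =
        -nilMul (F.logCoord x p) a + -nilMul (F.logCoord y p) a := by
      rw [F.logCoord_mul, nilMul, nilMul, nilMul, Pi.add_apply, add_smul, neg_add]
    rw [map_mul, this, nilExpUnit_add]
    exact hx.mul_right hy
  · intro u j
    have h := H.comm_of_coord (negCoord p.2 a) (arcCoord (k := k) u)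
      (value_negCoord p.2 a).symm (value_arcCoord (k := k) u).symm hg
      ((H.proj_splitting_apply _).trans (arcLoop_arcPow u (F.e j))) rfl
    refine (congrArg (H.Comm _ _) ?_).mp h
    have hres : (negCoord p.2 a).res (arcCoord (k := k) u) =
        PowerSeries.coeff p.2 (dlog u) * (a : R) := by
      have h1 := sum_monomial (p.2 + 1) (a : R) (fun j r =>
        (j : R) * (r * PowerSeries.coeff j (primitive k (dlog u)))) fun j => by simp
      rw [LoopCoord.res]
      refine (congrArg₂ (· - ·) h1 (Finset.sum_eq_zero fun j _ => ?_)).trans ?_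
      · simp [arcCoord]
      · rw [sub_zero, coeff_succ_primitive, mul_smul_comm, mul_smul_comm, Algebra.smul_def]
        have h2 : algebraMap k R ((p.2 : k) + 1)⁻¹ * ((p.2 : R) + 1) = 1 := by
          have : ((p.2 : R) + 1) = algebraMap k R ((p.2 : k) + 1) := by simp
          rw [this, ← map_mul, inv_mul_cancel₀ (Nat.cast_add_one_ne_zero p.2), map_one]
        push_cast
        linear_combination ((a : R) * PowerSeries.coeff p.2 (dlog u)) * h2
    have hsym : (negCoord p.2 a).symbol k (arcCoord (k := k) u) =
        nilExpUnit R (nilMul (PowerSeries.coeff p.2 (dlog u)) a) := by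
      refine Units.ext ?_
      rw [LoopCoord.symbol, Units.val_mul, IsUnit.unit_spec, hres]
      simp only [negCoord, arcCoord, mul_zero, zpow_zero, neg_zero, mul_one,
        Units.val_one, one_mul]
      rfl
    rw [hsym, ← nilExpUnit_zsmul]
    congr 1
    rw [Frame.logCoord, ev_arcPow, dlog_zpow, map_zsmul, nilMul, nilMul, neg_smul, smul_assoc]

/-- Lifts of points of the negative part commute: a product of negative powers of `t` with the
derivative of another one has no residue. -/
theorem comm_neg_neg (F : Frame k c) {p q : F.P} {a b : nilradical R} {g h : H.G.obj R}
    (hg : H.proj.app R g = F.negPoint (Finsupp.single p a))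
    (hh : H.proj.app R h = F.negPoint (Finsupp.single q b)) : g * h = h * g := by
  rw [F.negPoint_single] at hg hh
  have h1 := H.comm_of_coord (negCoord p.2 a) (negCoord q.2 b)
      (value_negCoord p.2 a).symm (value_negCoord q.2 b).symm hg hh rfl
  have hsym : (negCoord p.2 a).symbol k (negCoord q.2 b) = 1 := by
    have hres : (negCoord p.2 a).res (negCoord q.2 b) = 0 := by
      simp [LoopCoord.res, negCoord]
    refine Units.ext ?_
    rw [LoopCoord.symbol, Units.val_mul, IsUnit.unit_spec, hres, nilExp_zero]
    simp [negCoord]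
  unfold Comm at h1
  rwa [hsym, one_zpow, map_one, one_mul] at h1

theorem comm_t_neg (F : Frame k c) {γ : Γ} {p : F.P} {a : nilradical R} {g h : H.G.obj R}
    (hg : H.proj.app R g = loopPow k tUnit γ)
    (hh : H.proj.app R h = F.negPoint (Finsupp.single p a)) : g * h = h * g := by
  rw [F.negPoint_single] at hh
  have h1 := H.comm_of_coord (tCoord (R : Type u)) (negCoord p.2 a)
      (value_tCoord (k := k)).symm (value_negCoord p.2 a).symm hg hh rfl
  have hsym : (tCoord (R : Type u)).symbol k (negCoord p.2 a) = 1 := by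
    have hres : (tCoord (R : Type u)).res (negCoord p.2 a) = 0 := by
      simp [LoopCoord.res, negCoord, tCoord]
    refine Units.ext ?_
    rw [LoopCoord.symbol, Units.val_mul, IsUnit.unit_spec, hres, nilExp_zero]
    simp [negCoord, tCoord]
  unfold Comm at h1
  rwa [hsym, one_zpow, map_one, one_mul] at h1

/-- Over a nilpotent thickening of the base field every point of `T(F)` lifts. -/
theorem exists_lift (φ : R ⟶ CommAlgCat.of k k) (hφ : ∀ r, φ.hom r = 0 → IsNilpotent r)
    (x : (torusLoop k Γ).obj R) : ∃ g, H.proj.app R g = x := by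
  obtain ⟨n, r, hr, h⟩ := H.proj_surjective R x
  have hex : ∃ i, φ.hom (r i) ≠ 0 := by
    by_contra hcon
    push Not at hcon
    have h1 : (1 : R) ∈ Ideal.span (Set.range r) := by rw [hr]; trivial
    have h2 : Ideal.span (Set.range r) ≤ RingHom.ker φ.hom := by
      rw [Ideal.span_le]
      rintro _ ⟨i, rfl⟩
      exact hcon i
    have h3 : φ.hom (1 : R) = 0 := h2 h1
    rw [map_one] at h3
    exact one_ne_zero (α := k) h3
  obtain ⟨i, hi⟩ := hex
  have hu : IsUnit (r i) := by
    have h0 : IsNilpotent (r i - algebraMap k R (φ.hom (r i))) := by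
      refine hφ _ ?_
      rw [map_sub, sub_eq_zero]
      exact (φ.hom.commutes (φ.hom (r i))).symm
    have h1 : IsUnit (algebraMap k R (φ.hom (r i))) :=
      (IsUnit.mk0 (φ.hom (r i) : k) hi).map (algebraMap k R)
    have h2 := h0.isUnit_add_left_of_commute h1 (Commute.all _ _)
    rwa [add_sub_cancel] at h2
  obtain ⟨g, hg⟩ := h i
  refine ⟨H.G.map (awayLift (𝟙 R) hu) g, ?_⟩
  rw [H.proj_map, hg]
  have := congrArg (fun f => (torusLoop k Γ).map f x) (locMap_awayLift (𝟙 R) hu)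
  rw [(torusLoop k Γ).map_id, (torusLoop k Γ).map_comp] at this
  exact this

end HeisenbergExtension

end Extension


/-! ### One-parameter subgroups of a Heisenberg extension -/

section Truncated

variable {k : Type u} [Field k] {R S T : CommAlgCat.{u} k}

/-- The truncated polynomial algebra `R[x]/(x^N)`. -/
def trunc (R : CommAlgCat.{u} k) (N : ℕ) : CommAlgCat.{u} k :=
  CommAlgCat.of k (AdjoinRoot (Polynomial.X ^ N : (R : Type u)[X]))

/-- The class of a polynomial in `R[x]/(x^N)`. -/
def truncMk (R : CommAlgCat.{u} k) (N : ℕ) : (R : Type u)[X] →+* trunc R N :=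
  AdjoinRoot.mk (Polynomial.X ^ N : (R : Type u)[X])

theorem truncMk_surjective (N : ℕ) : Function.Surjective (truncMk R N) :=
  AdjoinRoot.mk_surjective

theorem truncMk_eq_zero {N : ℕ} {p : (R : Type u)[X]} :
    truncMk R N p = 0 ↔ ∀ i < N, p.coeff i = 0 :=
  AdjoinRoot.mk_eq_zero.trans Polynomial.X_pow_dvd_iff

theorem truncMk_X_pow (N : ℕ) : truncMk R N Polynomial.X ^ N = 0 := by
  rw [← map_pow]
  exact AdjoinRoot.mk_self

/-- The class of the variable of `R[x]/(x^N)`. -/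
def truncRoot (R : CommAlgCat.{u} k) (N : ℕ) : nilradical (trunc R N) :=
  ⟨truncMk R N Polynomial.X, N, truncMk_X_pow N⟩

/-- The inclusion `R → R[x]/(x^N)`. -/
def truncConst (R : CommAlgCat.{u} k) (N : ℕ) : R ⟶ trunc R N :=
  CommAlgCat.ofHom (AdjoinRoot.ofAlgHom k (Polynomial.X ^ N : (R : Type u)[X]))

/-- The morphism from `R[x]/(x^N)` given by a morphism on `R` and the image of `x`. -/
def truncLift {N : ℕ} (f : R ⟶ S) (s : S) (hs : s ^ N = 0) : trunc R N ⟶ S :=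
  CommAlgCat.ofHom (AdjoinRoot.liftAlgHom _ f.hom s (by
    rw [Polynomial.eval₂_pow, Polynomial.eval₂_X, hs]))

theorem truncLift_mk {N : ℕ} (f : R ⟶ S) (s : S) (hs : s ^ N = 0) (p : (R : Type u)[X]) :
    (truncLift f s hs).hom (truncMk R N p) = p.eval₂ f.hom.toRingHom s := rfl

theorem truncLift_root {N : ℕ} (f : R ⟶ S) (s : S) (hs : s ^ N = 0) :
    (truncLift f s hs).hom (truncRoot R N : trunc R N) = s :=
  Polynomial.eval₂_X _ _

theorem trunc_hom_ext {N : ℕ} {f g : trunc R N ⟶ S} (h : truncConst R N ≫ f = truncConst R N ≫ g)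
    (hr : f.hom (truncRoot R N : trunc R N) = g.hom (truncRoot R N : trunc R N)) : f = g :=
  CommAlgCat.hom_ext (AdjoinRoot.algHom_ext' (congrArg CommAlgCat.Hom.hom h) hr)

theorem truncConst_lift {N : ℕ} (f : R ⟶ S) (s : S) (hs : s ^ N = 0) :
    truncConst R N ≫ truncLift f s hs = f :=
  CommAlgCat.hom_ext (AlgHom.ext fun _ => Polynomial.eval₂_C _ _)

/-- The algebra of dual numbers `R[ε]`. -/
def dual (R : CommAlgCat.{u} k) : CommAlgCat.{u} k := CommAlgCat.of k (DualNumber (R : Type u))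

/-- The inclusion `R → R[ε]`. -/
def dualInl (R : CommAlgCat.{u} k) : R ⟶ dual R :=
  CommAlgCat.ofHom (TrivSqZeroExt.inlAlgHom k (R : Type u) (R : Type u))

/-- The projection `R[ε] → R`. -/
def dualFst (R : CommAlgCat.{u} k) : dual R ⟶ R :=
  CommAlgCat.ofHom (TrivSqZeroExt.fstHom k (R : Type u) (R : Type u))

/-- The element `ε` of `R[ε]`. -/
def dualEps (R : CommAlgCat.{u} k) : dual R := (DualNumber.eps : DualNumber (R : Type u))

theorem dualEps_sq : dualEps R ^ 2 = 0 :=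
  (pow_two _).trans (DualNumber.eps_mul_eps (R := (R : Type u)))

theorem dual_eq (x : dual R) : x = (dualInl R).hom ((dualFst R).hom x) +
    (dualInl R).hom (TrivSqZeroExt.snd (show DualNumber (R : Type u) from x)) * dualEps R := by
  refine TrivSqZeroExt.ext ?_ ?_
  · change TrivSqZeroExt.fst (show DualNumber (R : Type u) from x) = _ + _ * 0
    rw [mul_zero, add_zero]
    rfl
  · change TrivSqZeroExt.snd (show DualNumber (R : Type u) from x) =
      0 + ((TrivSqZeroExt.snd (show DualNumber (R : Type u) from x)) • (1 : R) +
        MulOpposite.op (0 : R) • (0 : R))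
    simp

theorem dualInl_mul_eps_injective {a b : R}
    (h : (dualInl R).hom a * dualEps R = (dualInl R).hom b * dualEps R) : a = b := by
  have h1 : ∀ a : R, TrivSqZeroExt.snd (R := (R : Type u)) (M := (R : Type u))
      ((dualInl R).hom a * dualEps R) = a := fun a => by
    change a • (1 : R) + MulOpposite.op (0 : R) • (0 : R) = a
    simp
  rw [← h1 a, h, h1]

/-- The morphism from `R[ε]` given by a morphism on `R` and the image of `ε`. -/
def dualLift (f : R ⟶ S) (s : S) (hs : s ^ 2 = 0) : dual R ⟶ S :=
  CommAlgCat.ofHom (DualNumber.lift ⟨(f.hom, s), (pow_two s).symm.trans hs,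
    fun _ => Commute.all _ _⟩)

theorem dualLift_eps (f : R ⟶ S) (s : S) (hs : s ^ 2 = 0) :
    (dualLift f s hs).hom (dualEps R) = s := by
  exact DualNumber.lift_apply_eps _

theorem dualInl_lift (f : R ⟶ S) (s : S) (hs : s ^ 2 = 0) : dualInl R ≫ dualLift f s hs = f :=
  CommAlgCat.hom_ext (DualNumber.lift_comp_inlHom _)

theorem dualInl_lift_apply (f : R ⟶ S) (s : S) (hs : s ^ 2 = 0) (r : R) :
    (dualLift f s hs).hom ((dualInl R).hom r) = f.hom r :=
  DualNumber.lift_apply_inl _ _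

theorem dual_hom_ext {f g : dual R ⟶ S} (h : dualInl R ≫ f = dualInl R ≫ g)
    (he : f.hom (dualEps R) = g.hom (dualEps R)) : f = g := by
  have key : ∀ (f : dual R ⟶ S) x, f.hom x = (dualInl R ≫ f).hom ((dualFst R).hom x) +
      (dualInl R ≫ f).hom (TrivSqZeroExt.snd (show DualNumber (R : Type u) from x)) *
        f.hom (dualEps R) := fun f x => by
    conv_lhs => rw [dual_eq x]
    rw [map_add, map_mul]
    rfl
  exact CommAlgCat.hom_ext (AlgHom.ext fun x => by rw [key f, key g, h, he])

theorem const_hom_ext (f g : CommAlgCat.of k k ⟶ S) : f = g :=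
  CommAlgCat.hom_ext (AlgHom.ext fun r => (f.hom.commutes r).trans (g.hom.commutes r).symm)

/-- The structure morphism `k → R`. -/
def structHom (R : CommAlgCat.{u} k) : CommAlgCat.of k k ⟶ R := CommAlgCat.ofHom (Algebra.ofId k R)

variable (R)

/-- The morphism `R[x]/(x^(N+1)) → (R[x]/(x^N))[ε]`, `x ↦ x`. -/
def truncIncl (N : ℕ) : trunc R (N + 1) ⟶ dual (trunc R N) :=
  truncLift (truncConst R N ≫ dualInl _) ((dualInl _).hom (truncRoot R N : trunc R N)) (by
    rw [← map_pow, pow_succ]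
    exact congrArg _ ((congrArg (· * _) (truncMk_X_pow N)).trans (zero_mul _)) |>.trans
      (map_zero _))

/-- The morphism `R[x]/(x^(N+1)) → (R[x]/(x^N))[ε]`, `x ↦ x + ε`. -/
def truncShift (N : ℕ) : trunc R (N + 1) ⟶ dual (trunc R N) :=
  truncLift (truncConst R N ≫ dualInl _)
    ((dualInl _).hom (truncRoot R N : trunc R N) + dualEps _) (by
    have h0 : (truncRoot R N : trunc R N) ^ N = 0 := truncMk_X_pow N
    have h1 := (Polynomial.X ^ (N + 1) : (dual (trunc R N))[X]).eval_add_of_sq_eq_zero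
      ((dualInl _).hom (truncRoot R N : trunc R N)) (dualEps _) dualEps_sq
    rw [Polynomial.eval_pow, Polynomial.eval_X] at h1
    rw [h1, Polynomial.derivative_X_pow, Nat.add_sub_cancel, Polynomial.eval_mul,
      Polynomial.eval_pow, Polynomial.eval_pow, Polynomial.eval_X, ← map_pow, ← map_pow, h0,
      pow_succ, h0, zero_mul, map_zero, mul_zero, zero_mul, add_zero])

/-- The morphism `R[x]/(x^(N+1)) → R`, `x ↦ 0`. -/
def truncZero (N : ℕ) : trunc R (N + 1) ⟶ R := truncLift (𝟙 R) 0 (zero_pow N.succ_ne_zero)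

theorem truncZero_root (N : ℕ) :
    (truncZero R N).hom (truncRoot R (N + 1) : trunc R (N + 1)) = 0 := truncLift_root _ _ _

theorem truncIncl_root (N : ℕ) : (truncIncl R N).hom (truncRoot R (N + 1) : trunc R (N + 1)) =
    (dualInl _).hom (truncRoot R N : trunc R N) := truncLift_root _ _ _

theorem truncShift_root (N : ℕ) : (truncShift R N).hom (truncRoot R (N + 1) : trunc R (N + 1)) =
    (dualInl _).hom (truncRoot R N : trunc R N) + dualEps _ := truncLift_root _ _ _

theorem truncConst_zero (N : ℕ) : truncConst R (N + 1) ≫ truncZero R N = 𝟙 R :=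
  truncConst_lift _ _ _

theorem truncConst_incl (N : ℕ) : truncConst R (N + 1) ≫ truncIncl R N =
    truncConst R N ≫ dualInl _ := truncConst_lift _ _ _

theorem truncConst_shift (N : ℕ) : truncConst R (N + 1) ≫ truncShift R N =
    truncConst R N ≫ dualInl _ := truncConst_lift _ _ _

variable {R}

theorem truncShift_mk (N : ℕ) (p : (R : Type u)[X]) :
    (truncShift R N).hom (truncMk R (N + 1) p) = (truncIncl R N).hom (truncMk R (N + 1) p) +
      (dualInl _).hom (truncMk R N p.derivative) * dualEps _ := by
  have h0 : (dualInl (trunc R N)).hom (truncMk R N p.derivative) = p.derivative.eval₂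
      (truncConst R N ≫ dualInl _).hom.toRingHom
      ((dualInl _).hom (truncRoot R N : trunc R N)) := by
    have h1 : truncMk R N p.derivative = p.derivative.eval₂ (truncConst R N).hom.toRingHom
        (truncRoot R N : trunc R N) := by
      have h2 : truncLift (truncConst R N) (truncRoot R N : trunc R N) (truncMk_X_pow N) = 𝟙 _ :=
        trunc_hom_ext (truncConst_lift _ _ _) (truncLift_root _ _ _)
      rw [← truncLift_mk (truncConst R N) (truncRoot R N : trunc R N) (truncMk_X_pow N), h2]
      rfl
    rw [h1]
    exact Polynomial.hom_eval₂ _ _ (dualInl (trunc R N)).hom.toRingHom _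
  rw [h0, truncShift, truncIncl, truncLift_mk, truncLift_mk, Polynomial.eval₂_eq_eval_map,
    Polynomial.eval₂_eq_eval_map, Polynomial.eval₂_eq_eval_map,
    Polynomial.eval_add_of_sq_eq_zero _ _ _ dualEps_sq, Polynomial.derivative_map]

variable [CharZero k]

/-- An element of `R[x]/(x^(N+1))` with vanishing derivative is determined by its value at `0`. -/
theorem eq_one_of_truncShift {N : ℕ} {w : trunc R (N + 1)}
    (h : (truncShift R N).hom w = (truncIncl R N).hom w)
    (h0 : (truncZero R N).hom w = 1) : w = 1 := by
  obtain ⟨p, rfl⟩ := truncMk_surjective (N + 1) w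
  rw [truncShift_mk, add_eq_left] at h
  have h1 : truncMk R N p.derivative = 0 :=
      dualInl_mul_eps_injective (by rw [h, map_zero, zero_mul])
  rw [truncMk_eq_zero] at h1
  rw [← map_one (truncMk R (N + 1)), ← sub_eq_zero, ← map_sub, truncMk_eq_zero]
  intro i hi
  rw [Polynomial.coeff_sub]
  cases i with
  | zero =>
    rw [truncZero, truncLift_mk, Polynomial.eval₂_at_zero] at h0
    rw [Polynomial.coeff_one_zero]
    exact sub_eq_zero.2 h0
  | succ i =>
    have h2 := h1 i (Nat.lt_of_succ_lt_succ hi)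
    rw [Polynomial.coeff_derivative] at h2
    have h3 : IsUnit ((i : R) + 1) := by
      have : ((i : R) + 1) = algebraMap k R ((i : k) + 1) := by simp
      rw [this]
      exact (IsUnit.mk0 _ (Nat.cast_add_one_ne_zero i)).map _
    rw [h3.mul_left_eq_zero.1 h2, Polynomial.coeff_one, if_neg i.succ_ne_zero, sub_zero]

/-- Nilpotent primitives of elements of `R[x]/(x^N)`. -/
theorem exists_truncPrimitive {N : ℕ} (v : trunc R N) :
    ∃ w : trunc R (N + 1), IsNilpotent w ∧
      (truncShift R N).hom w = (truncIncl R N).hom w + (dualInl _).hom v * dualEps _ := by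
  obtain ⟨p, rfl⟩ := truncMk_surjective N v
  induction p using Polynomial.induction_on' with
  | add p q hp hq =>
    obtain ⟨w, hw, h⟩ := hp
    obtain ⟨w', hw', h'⟩ := hq
    refine ⟨w + w', Commute.isNilpotent_add (Commute.all _ _) hw hw', ?_⟩
    simp only [map_add, h, h', add_mul]
    abel
  | monomial n a =>
    refine ⟨truncMk R (N + 1) (Polynomial.monomial (n + 1) (algebraMap k R ((n : k) + 1)⁻¹ * a)),
      ?_, ?_⟩
    · rw [← Polynomial.C_mul_X_pow_eq_monomial, map_mul, pow_succ,
        map_mul (truncMk R (N + 1)) (Polynomial.X ^ n)]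
      exact Commute.isNilpotent_mul_left (Commute.all _ _)
        (Commute.isNilpotent_mul_left (Commute.all _ _) (truncRoot R (N + 1)).2)
    · rw [truncShift_mk, Polynomial.derivative_monomial]
      congr 5
      have : ((n : R) + 1) = algebraMap k R ((n : k) + 1) := by simp
      rw [Nat.cast_succ, this, mul_right_comm, ← map_mul,
        inv_mul_cancel₀ (Nat.cast_add_one_ne_zero n), map_one, one_mul]

end Truncated

section OneParameter

variable {k : Type u} [Field k] [CharZero k] {Γ : Type u} [AddCommGroup Γ]
  {c : Γ →ₗ[ℤ] Γ →ₗ[ℤ] ℤ} {R S : CommAlgCat.{u} k} (F : Frame k c) (H : HeisenbergExtension k c)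

/-- A lift of a one-parameter formal subgroup of the negative part of `T(F)` to `T(F)~`. -/
structure NegLift (p : F.P) where
  toFun : ∀ R : CommAlgCat.{u} k, nilradical R → H.G.obj R
  map_add : ∀ {R : CommAlgCat.{u} k} (a b : nilradical R), toFun R (a + b) = toFun R a * toFun R b
  natural : ∀ {R S : CommAlgCat.{u} k} (φ : R ⟶ S) (a : nilradical R),
    H.G.map φ (toFun R a) = toFun S (nilMap φ a)
  proj : ∀ {R : CommAlgCat.{u} k} (a : nilradical R),
    H.proj.app R (toFun R a) = F.negPoint (Finsupp.single p a)

namespace HeisenbergExtension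

variable {F H}

theorem proj_map_neg {p : F.P} {a : nilradical R} {g : H.G.obj R}
    (hg : H.proj.app R g = F.negPoint (Finsupp.single p a)) (φ : R ⟶ S) :
    H.proj.app S (H.G.map φ g) = F.negPoint (Finsupp.single p (nilMap φ a)) := by
  rw [proj_map, hg, F.negPoint_map, F.mapN_single]

/-- A point of `T(F)` that is trivial at a base point has a lift that is trivial there. -/
theorem exists_lift_normalized (φ : R ⟶ CommAlgCat.of k k)
    (hφ : ∀ r, φ.hom r = 0 → IsNilpotent r) (x : (torusLoop k Γ).obj R)
    (hx : (torusLoop k Γ).map φ x = 1) : ∃ g, H.proj.app R g = x ∧ H.G.map φ g = 1 := by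
  obtain ⟨g, hg⟩ := H.exists_lift φ hφ x
  have h1 : H.proj.app _ (H.G.map φ g) = 1 := by rw [proj_map, hg, hx]
  obtain ⟨a, ha⟩ := (H.proj_eq_one_iff _ _).1 h1
  refine ⟨H.scalar R (Units.map ((structHom R).hom : k →* R) a)⁻¹ * g, ?_, ?_⟩
  · rw [map_mul, proj_scalar, hg]
    exact point_one_mul x
  · rw [map_mul, H.scalar_natural, ← ha, ← map_mul, map_inv, inv_mul_eq_one.2, map_one]
    refine Units.ext ?_
    exact φ.hom.commutes (a : k)

variable (F H)

theorem exists_infinitesimal (p : F.P) : ∃ g : H.G.obj (dual (CommAlgCat.of k k)),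
    H.proj.app _ g = F.negPoint (Finsupp.single p
      (⟨dualEps _, 2, dualEps_sq⟩ : nilradical (dual (CommAlgCat.of k k)))) ∧
    H.G.map (dualFst _) g = 1 := by
  refine exists_lift_normalized (dualFst _) (fun r hr => ?_) _ ?_
  · refine ⟨2, ?_⟩
    rw [dual_eq r, hr, map_zero, zero_add, mul_pow, dualEps_sq, mul_zero]
  · rw [F.negPoint_map, F.mapN_single]
    have : nilMap (dualFst (CommAlgCat.of k k)) ⟨dualEps _, 2, dualEps_sq⟩ = 0 := Subtype.ext rfl
    rw [this, Finsupp.single_zero, F.negPoint_zero]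

/-- A chosen lift of the point of the negative part with coordinate `s`, where `s² = 0`. -/
def infPoint (p : F.P) (s : R) (hs : s ^ 2 = 0) : H.G.obj R :=
  H.G.map (dualLift (structHom R) s hs) (H.exists_infinitesimal F p).choose

theorem map_infPoint (p : F.P) (s : R) (hs : s ^ 2 = 0) (φ : R ⟶ S) :
    H.G.map φ (H.infPoint F p s hs) =
      H.infPoint F p (φ.hom s) (by rw [← map_pow, hs, map_zero]) := by
  rw [infPoint, map_map, infPoint]
  refine congrArg (fun f => H.G.map f _) ?_
  refine dual_hom_ext (const_hom_ext (k := k) _ _) ?_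
  rw [dualLift_eps]
  exact congrArg φ.hom (dualLift_eps _ s hs)

theorem proj_infPoint (p : F.P) (s : R) (hs : s ^ 2 = 0) :
    H.proj.app R (H.infPoint F p s hs) =
      F.negPoint (Finsupp.single p (⟨s, 2, hs⟩ : nilradical R)) := by
  rw [infPoint, proj_map_neg (H.exists_infinitesimal F p).choose_spec.1]
  congr 2
  exact Subtype.ext (dualLift_eps (structHom R) s hs)

theorem infPoint_zero (p : F.P) : H.infPoint F p (0 : R) (zero_pow two_ne_zero) = 1 := by
  have h : dualLift (structHom R) (0 : R) (zero_pow two_ne_zero) =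
      dualFst (CommAlgCat.of k k) ≫ structHom R := by
    refine dual_hom_ext (const_hom_ext (k := k) _ _) ?_
    rw [dualLift_eps]
    exact (map_zero (structHom R).hom).symm
  rw [infPoint, h, ← map_map, (H.exists_infinitesimal F p).choose_spec.2, map_one]

/-- The flow equation `g(x + ε) = g(x) g(ε)`. -/
def IsFlow (p : F.P) {N : ℕ} (g : H.G.obj (trunc R (N + 1))) : Prop :=
  H.G.map (truncShift R N) g = H.G.map (truncIncl R N) g * H.infPoint F p (dualEps _) dualEps_sq

variable {F H}

/-- A solution of the flow equation with given projection is determined by its value at `0`: the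
quotient of two solutions is a scalar with vanishing derivative. -/
theorem IsFlow.unique {p : F.P} {N : ℕ} {g g' : H.G.obj (trunc R (N + 1))} (hg : H.IsFlow F p g)
    (hg' : H.IsFlow F p g') (h : H.proj.app _ g = H.proj.app _ g')
    (h0 : H.G.map (truncZero R N) g = H.G.map (truncZero R N) g') : g = g' := by
  obtain ⟨u, rfl⟩ := exists_scalar H h
  have hu : u = 1 := by
    refine Units.ext (eq_one_of_truncShift ?_ ?_)
    · unfold IsFlow at hg hg'
      rw [map_mul, map_mul, hg', H.scalar_natural, H.scalar_natural, mul_assoc] at hg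
      exact congrArg Units.val (H.scalar_injective _ (mul_right_cancel hg))
    · rw [map_mul, H.scalar_natural, mul_eq_right, ← map_one (H.scalar R)] at h0
      exact congrArg Units.val (H.scalar_injective _ h0)
  rw [hu, map_one, one_mul]

variable (F H)

/-- Any lift of the point `x` satisfies the flow equation up to a scalar `1 + v ε`; multiplication
by the exponential of a primitive of `-v` corrects it. -/
theorem exists_flow (p : F.P) (N : ℕ) : ∃ g : H.G.obj (trunc (CommAlgCat.of k k) (N + 1)),
    H.IsFlow F p g ∧ H.proj.app _ g = F.negPoint (Finsupp.single p (truncRoot _ _)) ∧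
      H.G.map (truncZero _ N) g = 1 := by
  have hz : nilMap (truncZero (CommAlgCat.of k k) N) (truncRoot _ _) = 0 :=
    Subtype.ext (truncLift_root _ _ _)
  obtain ⟨g, hg, hg0⟩ := exists_lift_normalized (H := H) (truncZero (CommAlgCat.of k k) N)
    (fun r hr => by
      obtain ⟨q, rfl⟩ := truncMk_surjective (N + 1) r
      rw [truncZero, truncLift_mk, Polynomial.eval₂_at_zero] at hr
      have hq : q.coeff 0 = 0 := hr
      rw [← Polynomial.X_dvd_iff] at hq
      obtain ⟨q, rfl⟩ := hq
      rw [map_mul]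
      exact Commute.isNilpotent_mul_right (Commute.all _ _) (truncRoot _ (N + 1)).2)
    (F.negPoint (Finsupp.single p (truncRoot _ _)))
    (by rw [F.negPoint_map, F.mapN_single, hz, Finsupp.single_zero, F.negPoint_zero])
  have hadd : nilMap (truncShift (CommAlgCat.of k k) N) (truncRoot _ _) =
      nilMap (truncIncl (CommAlgCat.of k k) N) (truncRoot _ _) + ⟨dualEps _, 2, dualEps_sq⟩ := by
    refine Subtype.ext ((truncShift_root _ _).trans ?_)
    exact congrArg (· + _) (truncIncl_root _ _).symm
  obtain ⟨v, hv⟩ := exists_scalar H (g := H.G.map (truncShift _ N) g)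
    (g' := H.G.map (truncIncl _ N) g * H.infPoint F p (dualEps _) dualEps_sq) (by
      rw [proj_map_neg hg, map_mul, proj_map_neg hg, proj_infPoint, hadd, Finsupp.single_add,
        F.negPoint_add])
  -- At `ε = 0` the two sides agree, so the discrepancy is `1 + v₁ ε`.
  have hcomp : truncShift (CommAlgCat.of k k) N ≫ dualFst _ =
      truncIncl (CommAlgCat.of k k) N ≫ dualFst _ := by
    refine trunc_hom_ext (const_hom_ext (k := k) _ _) ?_
    refine (congrArg (dualFst _).hom (truncShift_root _ _)).trans ?_
    refine Eq.trans ?_ (congrArg (dualFst _).hom (truncIncl_root _ _)).symm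
    rw [map_add]
    exact add_zero _
  have hv1 : (dualFst _).hom (v : dual (trunc (CommAlgCat.of k k) N)) = 1 := by
    have h1 := congrArg (H.G.map (dualFst _)) hv
    have h2 : (dualFst (trunc (CommAlgCat.of k k) N)).hom (dualEps _) = 0 := rfl
    rw [map_mul, map_mul, map_map, map_map, hcomp, map_infPoint, H.scalar_natural] at h1
    have h3 : H.infPoint F p ((dualFst (trunc (CommAlgCat.of k k) N)).hom (dualEps _))
        (by rw [h2]; exact zero_pow two_ne_zero) = 1 := H.infPoint_zero F p
    rw [h3, mul_one, right_eq_mul, ← map_one (H.scalar _)] at h1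
    exact congrArg Units.val (H.scalar_injective _ h1)
  set v₁ : trunc (CommAlgCat.of k k) N := TrivSqZeroExt.snd (show DualNumber _ from v.1)
  have hv2 : (v : dual (trunc (CommAlgCat.of k k) N)) = 1 + (dualInl _).hom v₁ * dualEps _ := by
    rw [← map_one (dualInl _).hom, ← hv1]
    exact dual_eq _
  obtain ⟨w, hw, hw'⟩ := exists_truncPrimitive (-v₁)
  set u := nilExpUnit (trunc (CommAlgCat.of k k) (N + 1)) ⟨w, hw⟩
  have hε : ((dualInl _).hom (-v₁) * dualEps (trunc (CommAlgCat.of k k) N)) ^ 2 = 0 := by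
    rw [mul_pow, dualEps_sq, mul_zero]
  refine ⟨H.scalar _ u * g, ?_, ?_, ?_⟩
  · have hu :
        Units.map ((truncShift (CommAlgCat.of k k) N).hom : trunc (CommAlgCat.of k k) (N + 1) →* _) u * v =
        Units.map ((truncIncl (CommAlgCat.of k k) N).hom : trunc (CommAlgCat.of k k) (N + 1) →* _) u := by
      refine Units.ext ?_
      change (truncShift _ N).hom.toRingHom (nilExp k w) * (v : dual _) =
        (truncIncl _ N).hom.toRingHom (nilExp k w)
      rw [map_nilExp k _ hw, map_nilExp k _ hw]
      refine (congrArg (nilExp k · * _) hw').trans ?_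
      rw [nilExp_add k (hw.map (truncIncl (CommAlgCat.of k k) N).hom) ⟨2, hε⟩,
        nilExp_of_sq_eq_zero k hε, hv2, map_neg]
      have h3 := dualEps_sq (R := trunc (CommAlgCat.of k k) N)
      refine (?_ : _ = nilExp k ((truncIncl (CommAlgCat.of k k) N).hom w))
      linear_combination (-nilExp k ((truncIncl (CommAlgCat.of k k) N).hom w) *
        ((dualInl _).hom v₁) ^ 2) * h3
    unfold IsFlow
    rw [map_mul, map_mul, H.scalar_natural, H.scalar_natural, hv, ← mul_assoc, ← map_mul, hu,
      mul_assoc]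
  · rw [map_mul, proj_scalar, hg]
    exact point_one_mul _
  · have h4 : (truncZero (CommAlgCat.of k k) N).hom w = 0 := (hw.map _).eq_zero
    have h5 : Units.map ((truncZero (CommAlgCat.of k k) N).hom :
        trunc (CommAlgCat.of k k) (N + 1) →* (CommAlgCat.of k k)) u = 1 := by
      refine Units.ext ?_
      change (truncZero _ N).hom.toRingHom (nilExp k w) = 1
      rw [map_nilExp k _ hw]
      refine (congrArg (nilExp k) h4).trans (nilExp_zero k)
    rw [map_mul, H.scalar_natural, h5, map_one, hg0, one_mul]

variable {F} in
/-- The chosen one-parameter subgroup over `k[x]/(x^(N+1))`. -/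
def flow (p : F.P) (N : ℕ) : H.G.obj (trunc (CommAlgCat.of k k) (N + 1)) :=
  (H.exists_flow F p N).choose

variable {F}

theorem flow_spec (p : F.P) (N : ℕ) : H.IsFlow F p (H.flow p N) ∧
    H.proj.app _ (H.flow p N) = F.negPoint (Finsupp.single p (truncRoot _ _)) ∧
      H.G.map (truncZero _ N) (H.flow p N) = 1 := (H.exists_flow F p N).choose_spec

/-- The point `x` of the one-parameter subgroup, where `x^(N+1) = 0`. -/
def flowAt (p : F.P) (N : ℕ) (x : R) (hx : x ^ (N + 1) = 0) : H.G.obj R :=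
  H.G.map (truncLift (structHom R) x hx) (H.flow p N)

theorem map_flowAt (p : F.P) (N : ℕ) (x : R) (hx : x ^ (N + 1) = 0) (φ : R ⟶ S) :
    H.G.map φ (H.flowAt p N x hx) = H.flowAt p N (φ.hom x) (by rw [← map_pow, hx, map_zero]) := by
  rw [flowAt, map_map, flowAt]
  refine congrArg (fun f => H.G.map f _) ?_
  refine trunc_hom_ext (const_hom_ext (k := k) _ _) ?_
  rw [truncLift_root]
  exact congrArg φ.hom (truncLift_root (structHom R) x hx)

theorem proj_flowAt (p : F.P) (N : ℕ) (x : R) (hx : x ^ (N + 1) = 0) :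
    H.proj.app R (H.flowAt p N x hx) =
      F.negPoint (Finsupp.single p (⟨x, N + 1, hx⟩ : nilradical R)) := by
  rw [flowAt, proj_map_neg (H.flow_spec p N).2.1]
  congr 2
  exact Subtype.ext (truncLift_root (structHom R) x hx)

theorem flowAt_zero (p : F.P) (N : ℕ) :
    H.flowAt p N (0 : R) (zero_pow N.succ_ne_zero) = 1 := by
  have h : truncLift (structHom R) (0 : R) (zero_pow N.succ_ne_zero) =
      truncZero (CommAlgCat.of k k) N ≫ structHom R := by
    refine trunc_hom_ext (const_hom_ext (k := k) _ _) ?_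
    rw [truncLift_root]
    refine Eq.trans ?_ (congrArg (structHom R).hom (truncZero_root _ N)).symm
    rw [map_zero]
  rw [flowAt, h, ← map_map, (H.flow_spec p N).2.2, map_one]

theorem flowAt_add_sq (p : F.P) (N : ℕ) (x s : R) (hx : x ^ N = 0) (hs : s ^ 2 = 0)
    (hx' : x ^ (N + 1) = 0) (hxs : (x + s) ^ (N + 1) = 0) :
    H.flowAt p N (x + s) hxs = H.flowAt p N x hx' * H.infPoint F p s hs := by
  let ψ := dualLift (truncLift (structHom R) x hx) s hs
  have h := congrArg (H.G.map ψ) (H.flow_spec p N).1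
  have h1 : truncShift (CommAlgCat.of k k) N ≫ ψ = truncLift (structHom R) (x + s) hxs := by
    refine trunc_hom_ext (const_hom_ext (k := k) _ _) ?_
    rw [truncLift_root]
    refine (congrArg ψ.hom (truncShift_root _ N)).trans ?_
    rw [map_add, dualLift_eps, dualInl_lift_apply, truncLift_root]
  have h2 : truncIncl (CommAlgCat.of k k) N ≫ ψ = truncLift (structHom R) x hx' := by
    refine trunc_hom_ext (const_hom_ext (k := k) _ _) ?_
    rw [truncLift_root]
    refine (congrArg ψ.hom (truncIncl_root _ N)).trans ?_
    rw [dualInl_lift_apply, truncLift_root]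
  rw [map_mul, map_map, map_map, h1, h2, map_infPoint] at h
  refine h.trans ?_
  congr 2
  exact dualLift_eps _ _ _

theorem flow_truncation (p : F.P) {N M : ℕ} (h : N ≤ M) (x : R) (hx : x ^ (N + 1) = 0)
    (hx' : x ^ (M + 1) = 0) : H.flowAt p M x hx' = H.flowAt p N x hx := by
  have hr : ∀ N, (truncRoot (CommAlgCat.of k k) N : trunc (CommAlgCat.of k k) N) ^ N = 0 :=
    fun N => truncMk_X_pow N
  have hr' : ∀ N, N ≤ M → (truncRoot (CommAlgCat.of k k) N : trunc (CommAlgCat.of k k) N) ^ M = 0 :=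
    fun N hN => pow_eq_zero_of_le hN (hr N)
  have key : H.flowAt p M (truncRoot (CommAlgCat.of k k) (N + 1) : trunc (CommAlgCat.of k k) (N + 1))
      (pow_eq_zero_of_le (Nat.succ_le_succ h) (hr _)) = H.flow p N := by
    refine IsFlow.unique (H := H) ?_ (H.flow_spec p N).1 ?_ ?_
    · have hroot : (dualInl _).hom (truncRoot (CommAlgCat.of k k) N : trunc (CommAlgCat.of k k) N) ^ M
          = 0 := by rw [← map_pow, hr' N h, map_zero]
      unfold IsFlow
      rw [map_flowAt, map_flowAt]
      have h0 := hroot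
      have h1 := flowAt_add_sq H p M _ (dualEps _) hroot dualEps_sq
        (by rw [pow_succ, hroot, zero_mul]) (by
          rw [← truncShift_root, ← map_pow,
            pow_eq_zero_of_le (Nat.succ_le_succ h) (hr (N + 1)), map_zero])
      refine Eq.trans ?_ (h1.trans ?_)
      · congr 1
        exact truncShift_root _ N
      · congr 2
        exact (truncIncl_root _ N).symm
    · rw [proj_flowAt, (H.flow_spec p N).2.1]
    · rw [map_flowAt, (H.flow_spec p N).2.2]
      refine Eq.trans ?_ (H.flowAt_zero p M)
      congr 1
      exact truncZero_root _ N
  have h2 := congrArg (H.G.map (truncLift (structHom R) x hx)) key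
  rw [map_flowAt] at h2
  refine Eq.trans ?_ h2
  congr 1
  exact (truncLift_root _ _ _).symm

theorem flowAt_congr (p : F.P) {N M : ℕ} {x y : R} (h : x = y) (hx : x ^ (N + 1) = 0)
    (hx' : y ^ (M + 1) = 0) : H.flowAt p N x hx = H.flowAt p M y hx' := by
  subst h
  rcases le_total N M with hNM | hNM
  · exact (H.flow_truncation p hNM x hx hx').symm
  · exact H.flow_truncation p hNM x hx' hx

/-- The flow is additive, since both sides satisfy the flow equation in `x`. -/
theorem flowAt_add (p : F.P) {N M L : ℕ} (x y : R) (hx : x ^ (N + 1) = 0) (hy : y ^ (M + 1) = 0)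
    (hxy : (x + y) ^ (L + 1) = 0) :
    H.flowAt p L (x + y) hxy = H.flowAt p N x hx * H.flowAt p M y hy := by
  let r : trunc R (N + 1) := (truncRoot R (N + 1) : trunc R (N + 1))
  let y' : trunc R (N + 1) := (truncConst R (N + 1)).hom y
  have hr : r ^ (N + 1) = 0 := truncMk_X_pow _
  have hy' : y' ^ (M + 1) = 0 := by rw [← map_pow, hy, map_zero]
  have hry : (r + y') ^ (N + M + 1 + 1) = 0 :=
    (Commute.all r y').add_pow_eq_zero_of_add_le_succ_of_pow_eq_zero hr hy' (by omega)
  have key : H.flowAt p (N + M + 1) (r + y') hry = H.flowAt p N r hr * H.flowAt p M y' hy' := by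
    let a : dual (trunc R N) := (dualInl _).hom (truncRoot R N : trunc R N)
    let b : dual (trunc R N) := (dualInl _).hom ((truncConst R N).hom y)
    have ha : a ^ N = 0 :=
      (map_pow (dualInl (trunc R N)).hom _ _).symm.trans
        ((congrArg _ (truncMk_X_pow N)).trans (map_zero _))
    have ha' : a ^ (N + 1) = 0 := by rw [pow_succ, ha, zero_mul]
    have hb : b ^ (M + 1) = 0 := by rw [← map_pow, ← map_pow, hy, map_zero, map_zero]
    have hsr : (truncShift R N).hom r = a + dualEps _ := truncShift_root R N
    have hir : (truncIncl R N).hom r = a := truncIncl_root R N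
    have hsy : (truncShift R N).hom y' = b := congrArg (fun f => f.hom y) (truncConst_shift R N)
    have hiy : (truncIncl R N).hom y' = b := congrArg (fun f => f.hom y) (truncConst_incl R N)
    have hab : (a + b) ^ (N + M + 1) = 0 :=
      (Commute.all a b).add_pow_eq_zero_of_add_le_succ_of_pow_eq_zero ha hb (by omega)
    have hae : (a + dualEps _) ^ (N + 1) = 0 := by rw [← hsr, ← map_pow, hr, map_zero]
    have habe : (a + b + dualEps _) ^ (N + M + 1 + 1) = 0 := by
      rw [add_right_comm, ← hsr, ← hsy, ← map_add, ← map_pow, hry, map_zero]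
    refine IsFlow.unique (H := H) (p := p) ?_ ?_ ?_ ?_
    · unfold IsFlow
      rw [map_flowAt, map_flowAt]
      refine Eq.trans ?_ ((H.flowAt_add_sq p (N + M + 1) (a + b) (dualEps _) hab dualEps_sq
        (by rw [pow_succ, hab, zero_mul]) habe).trans ?_)
      · refine H.flowAt_congr p ?_ _ _
        rw [map_add, hsr, hsy, add_right_comm]
      · congr 1
        refine H.flowAt_congr p ?_ _ _
        rw [map_add, hir, hiy]
    · unfold IsFlow
      rw [map_mul, map_mul, map_flowAt, map_flowAt, map_flowAt, map_flowAt,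
        H.flowAt_congr p hsr _ hae, H.flowAt_congr p hsy _ hb, H.flowAt_congr p hir _ ha',
        H.flowAt_congr p hiy _ hb, H.flowAt_add_sq p N a (dualEps _) ha dualEps_sq ha' hae,
        mul_assoc, mul_assoc,
        H.comm_neg_neg F (H.proj_infPoint F p (dualEps _) dualEps_sq) (H.proj_flowAt p M b hb)]
    · rw [map_mul, proj_flowAt, proj_flowAt, proj_flowAt, ← F.negPoint_add, ← Finsupp.single_add]
      rfl
    · have h0 : (truncZero R N).hom r = 0 := truncZero_root R N
      have h1 : (truncZero R N).hom y' = y :=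
        congrArg (fun f => f.hom y) (truncConst_zero R N)
      rw [map_mul, map_flowAt, map_flowAt, map_flowAt,
        H.flowAt_congr p h0 _ (zero_pow N.succ_ne_zero), flowAt_zero, one_mul]
      refine H.flowAt_congr p ?_ _ _
      rw [map_add, h0, h1, zero_add]
  have h2 := congrArg (H.G.map (truncLift (𝟙 R) x hx)) key
  have h3 : (truncLift (𝟙 R) x hx).hom r = x := truncLift_root _ _ _
  have h4 : (truncLift (𝟙 R) x hx).hom y' = y :=
    congrArg (fun f => f.hom y) (truncConst_lift (N := N + 1) (𝟙 R) x hx)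
  rw [map_mul, map_flowAt, map_flowAt, map_flowAt, H.flowAt_congr p h3 _ hx,
    H.flowAt_congr p h4 _ hy] at h2
  rw [← h2]
  refine H.flowAt_congr p ?_ _ _
  rw [map_add, h3, h4]

/-- The negative part of `T(F)` lifts coordinatewise to one-parameter subgroups of `T(F)~`. -/
theorem exists_negLift (p : F.P) : Nonempty (NegLift F H p) := by
  have hn : ∀ {R : CommAlgCat.{u} k} (a : nilradical R),
      (a : R) ^ ((show IsNilpotent (a : R) from a.2).choose + 1) = 0 := fun a => by
    rw [pow_succ, (show IsNilpotent _ from a.2).choose_spec, zero_mul]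
  exact ⟨{ toFun := fun R a => H.flowAt p _ (a : R) (hn a)
           map_add := fun a b => H.flowAt_add p _ _ _ _ (hn (a + b))
           natural := fun φ a => by
             rw [map_flowAt]
             exact H.flowAt_congr p rfl _ _
           proj := fun a => H.proj_flowAt p _ _ _ }⟩

end HeisenbergExtension

end OneParameter


/-! ### Normal forms in a Heisenberg extension -/

section Lifts

variable {k : Type u} [Field k] [CharZero k] {Γ : Type u} [AddCommGroup Γ]
  {c : Γ →ₗ[ℤ] Γ →ₗ[ℤ] ℤ} {R S : CommAlgCat.{u} k} (F : Frame k c)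

namespace Frame

/-- The pairing `∑ ν_p y_p` of negative coordinates with coordinates of `T(𝔪)`. -/
def pair (y : F.P → R) : F.N R →+ nilradical R :=
  Finsupp.liftAddHom fun p => AddMonoidHom.mk' (fun a => nilMul (y p) a) fun a b => smul_add _ a b

theorem pair_single (y : F.P → R) (p : F.P) (a : nilradical R) :
    F.pair y (Finsupp.single p a) = nilMul (y p) a :=
  Finsupp.liftAddHom_apply_single _ _ _

theorem pair_add (y y' : F.P → R) (ν : F.N R) :
    F.pair (y + y') ν = F.pair y ν + F.pair y' ν := by
  rw [← AddMonoidHom.add_apply]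
  congr 1
  refine Finsupp.addHom_ext fun p a => ?_
  rw [AddMonoidHom.add_apply, pair_single, pair_single, pair_single]
  exact add_smul _ _ a

theorem pair_map (φ : R ⟶ S) (y : F.P → R) (ν : F.N R) :
    F.pair (fun p => φ.hom (y p)) (F.mapN φ ν) = nilMap φ (F.pair y ν) := by
  induction ν using Finsupp.induction_linear with
  | zero => simp only [map_zero]
  | add f g hf hg => simp only [map_add, hf, hg]
  | single p a =>
    rw [F.mapN_single, pair_single, pair_single]
    exact Subtype.ext (map_mul φ.hom _ _).symm

end Frame

variable (H : HeisenbergExtension k c)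

/-- Lifts to `T(F)~` of the negative part of `T(F)`, as a homomorphism, and of the points
`t^γ`. -/
structure Lifts where
  neg : ∀ R : CommAlgCat.{u} k, F.N R → H.G.obj R
  neg_add : ∀ {R : CommAlgCat.{u} k} (ν ν' : F.N R), neg R (ν + ν') = neg R ν * neg R ν'
  neg_natural : ∀ {R S : CommAlgCat.{u} k} (φ : R ⟶ S) (ν : F.N R),
    H.G.map φ (neg R ν) = neg S (F.mapN φ ν)
  neg_proj : ∀ {R : CommAlgCat.{u} k} (ν : F.N R), H.proj.app R (neg R ν) = F.negPoint ν
  base : Γ → H.G.obj (CommAlgCat.of k k)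
  base_zero : base 0 = 1
  base_proj : ∀ γ, H.proj.app _ (base γ) = loopPow k tUnit γ

theorem loopPow_zero (f : (R : Type u)⸨X⸩ˣ) : loopPow k f (0 : Γ) = 1 :=
  ev_ext fun l => by rw [ev_loopPow, map_zero, zpow_zero, ev_one]

theorem loopPow_add (f : (R : Type u)⸨X⸩ˣ) (γ γ' : Γ) :
    loopPow k f (γ + γ') = (loopPow k f γ * loopPow k f γ' : (torusLoop k Γ).obj R) :=
  ev_ext fun l => by rw [ev_loopPow, map_add, zpow_add, ev_mul, ev_loopPow, ev_loopPow]

theorem loopPow_map (φ : R ⟶ S) (γ : Γ) :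
    (torusLoop k Γ).map φ (loopPow k tUnit γ) = loopPow k tUnit γ := by
  have h : Units.map (laurentMap φ.hom.toRingHom : (R : Type u)⸨X⸩ →* (S : Type u)⸨X⸩) tUnit =
      tUnit := by
    refine Units.ext ?_
    change HahnSeries.map (HahnSeries.single 1 (1 : R)) φ.hom.toRingHom = HahnSeries.single 1 1
    ext n
    rw [HahnSeries.map_coeff, HahnSeries.coeff_single, HahnSeries.coeff_single]
    split_ifs
    · exact map_one φ.hom
    · exact map_zero φ.hom
  exact ev_ext fun l => by
    rw [ev_map, ev_loopPow, ev_loopPow, map_zpow]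
    exact congrArg (· ^ _) h

theorem exists_lifts : Nonempty (Lifts F H) := by
  classical
  have E : ∀ p : F.P, NegLift F H p := fun p => (H.exists_negLift p).some
  have hcomm : ∀ R : CommAlgCat.{u} k, ∀ g ∈ {g | ∃ p a, (E p).toFun R a = g},
      ∀ h ∈ {g | ∃ p a, (E p).toFun R a = g}, g * h = h * g := by
    rintro R _ ⟨p, a, rfl⟩ _ ⟨q, b, rfl⟩
    exact H.comm_neg_neg F ((E p).proj a) ((E q).proj b)
  let C : ∀ R : CommAlgCat.{u} k, Subgroup (H.G.obj R) := fun R =>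
    Subgroup.closure {g | ∃ p a, (E p).toFun R a = g}
  have hC : ∀ R (x y : C R), x * y = y * x := fun R =>
    (Subgroup.isMulCommutative_closure (hcomm R)).is_comm.comm
  let inst : ∀ R, CommGroup (C R) := fun R => { mul_comm := hC R }
  let n : ∀ R : CommAlgCat.{u} k, F.N R →+ Additive (C R) := fun R =>
    Finsupp.liftAddHom fun p => AddMonoidHom.mk'
      (fun a => Additive.ofMul (⟨(E p).toFun R a, Subgroup.subset_closure ⟨p, a, rfl⟩⟩ : C R))
      fun a b => congrArg Additive.ofMul (Subtype.ext ((E p).map_add a b))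
  have hn : ∀ R p a, ((Additive.toMul (n R (Finsupp.single p a)) : C R) : H.G.obj R) =
      (E p).toFun R a := fun R p a => by
    rw [Finsupp.liftAddHom_apply_single]
    rfl
  have hn0 : ∀ R, ((Additive.toMul (n R 0) : C R) : H.G.obj R) = 1 := fun R => by
    rw [map_zero]
    rfl
  have hadd : ∀ R ν ν', ((Additive.toMul (n R (ν + ν')) : C R) : H.G.obj R) =
      (Additive.toMul (n R ν) : C R) * (Additive.toMul (n R ν') : C R) := fun R ν ν' => by
    rw [map_add]
    rfl
  have hb : ∀ γ : Γ, ∃ g, H.proj.app (CommAlgCat.of k k) g = loopPow k tUnit γ ∧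
      (γ = 0 → g = 1) := fun γ => by
    by_cases h : γ = 0
    · exact ⟨1, by rw [map_one, h, loopPow_zero], fun _ => rfl⟩
    · obtain ⟨g, hg⟩ := H.exists_lift (𝟙 _) (fun r hr => ⟨1, by rw [pow_one]; exact hr⟩)
        (loopPow k tUnit γ)
      exact ⟨g, hg, fun h0 => absurd h0 h⟩
  choose base hb1 hb2 using hb
  refine ⟨{ neg := fun R ν => (Additive.toMul (n R ν) : C R), neg_add := fun ν ν' => hadd _ ν ν',
            neg_natural := ?_, neg_proj := ?_, base := base, base_zero := hb2 0 rfl,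
            base_proj := hb1 }⟩
  · intro R S φ ν
    induction ν using Finsupp.induction_linear with
    | zero => rw [hn0, map_one, map_zero, hn0]
    | add f g hf hg => rw [hadd, map_mul, hf, hg, map_add, hadd]
    | single p a => rw [hn, (E p).natural, F.mapN_single, hn]
  · intro R ν
    induction ν using Finsupp.induction_linear with
    | zero => rw [hn0, map_one, F.negPoint_zero]
    | add f g hf hg => rw [hadd, map_mul, hf, hg, F.negPoint_add]
    | single p a => rw [hn, (E p).proj]

namespace Lifts

variable {F H} (L : Lifts F H)

theorem neg_zero : L.neg R 0 = 1 := by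
  have h := L.neg_add (R := R) 0 0
  rw [add_zero] at h
  exact left_eq_mul.1 h

variable (R) in
/-- The lift of `t^γ` over any algebra. -/
def t (γ : Γ) : H.G.obj R := H.G.map (structHom R) (L.base γ)

theorem t_map (φ : R ⟶ S) (γ : Γ) : H.G.map φ (L.t R γ) = L.t S γ := by
  rw [t, H.map_map, t, const_hom_ext (structHom R ≫ φ) (structHom S)]

theorem t_proj (γ : Γ) : H.proj.app R (L.t R γ) = loopPow k tUnit γ := by
  rw [t, H.proj_map, L.base_proj, loopPow_map]

theorem t_zero : L.t R 0 = 1 := by rw [t, L.base_zero, map_one]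

/-- The lifts of the points `t^γ` are multiplicative up to scalars. -/
theorem exists_cocycle (γ γ' : Γ) : ∃ a : kˣ, L.base γ * L.base γ' =
    H.scalar (CommAlgCat.of k k) a * L.base (γ + γ') :=
  H.exists_scalar (g := L.base γ * L.base γ') (g' := L.base (γ + γ')) (by
    rw [map_mul, L.base_proj γ, L.base_proj γ', L.base_proj (γ + γ'), loopPow_add])

/-- The cocycle of the lifts of the points `t^γ`. -/
def κ (γ γ' : Γ) : kˣ := (L.exists_cocycle γ γ').choose

variable (R) in
/-- The cocycle in an algebra. -/
def κR (γ γ' : Γ) : (R : Type u)ˣ := Units.map ((structHom R).hom : k →* R) (L.κ γ γ')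

theorem map_κR (φ : R ⟶ S) (γ γ' : Γ) :
    Units.map (φ.hom : (R : Type u) →* S) (L.κR R γ γ') = L.κR S γ γ' := by
  rw [κR, κR, ← const_hom_ext (structHom R ≫ φ) (structHom S)]
  rfl

theorem t_mul (γ γ' : Γ) : L.t R γ * L.t R γ' = H.scalar R (L.κR R γ γ') * L.t R (γ + γ') := by
  rw [t, t, ← map_mul, (L.exists_cocycle γ γ').choose_spec, map_mul, H.scalar_natural]
  rfl

theorem κR_zero_right (γ : Γ) : L.κR R γ 0 = 1 := by
  have h := L.t_mul (R := R) γ 0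
  rw [t_zero, mul_one, add_zero, right_eq_mul, ← map_one (H.scalar R)] at h
  exact H.scalar_injective R h

theorem κR_zero_left (γ : Γ) : L.κR R 0 γ = 1 := by
  have h := L.t_mul (R := R) 0 γ
  rw [t_zero, one_mul, zero_add, right_eq_mul, ← map_one (H.scalar R)] at h
  exact H.scalar_injective R h

theorem κR_assoc (γ γ' δ : Γ) :
    L.κR R γ γ' * L.κR R (γ + γ') δ = L.κR R γ' δ * L.κR R γ (γ' + δ) := by
  have h := mul_assoc (L.t R γ) (L.t R γ') (L.t R δ)
  rw [t_mul, mul_assoc, t_mul, t_mul, ← mul_assoc (L.t R γ), ← H.scalar_central, mul_assoc, t_mul,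
    ← mul_assoc, ← mul_assoc, ← map_mul, ← map_mul, add_assoc] at h
  exact H.scalar_injective R (mul_right_cancel h)

theorem t_arc (γ : Γ) (x : (torusArc k Γ).obj R) :
    H.Comm (L.t R γ) (H.splitting.app R x) (ev ((arcConst k Γ).app R x) (c γ)) :=
  H.comm_t_arc F (L.t_proj γ) x

theorem neg_arc (ν : F.N R) (x : (torusArc k Γ).obj R) :
    H.Comm (L.neg R ν) (H.splitting.app R x) (nilExpUnit R (-F.pair (F.logCoord x) ν)) := by
  induction ν using Finsupp.induction_linear with
  | zero =>
    rw [neg_zero, map_zero, _root_.neg_zero, nilExpUnit_zero]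
    have := (H.comm_one_right (H.splitting.app R x)).symm
    rwa [inv_one] at this
  | add f g hf hg =>
    rw [neg_add, map_add, _root_.neg_add, nilExpUnit_add]
    exact hf.mul_left hg
  | single p a =>
    rw [F.pair_single]
    exact H.comm_neg_arc F (L.neg_proj _) x

theorem t_neg (γ : Γ) (ν : F.N R) : L.t R γ * L.neg R ν = L.neg R ν * L.t R γ := by
  induction ν using Finsupp.induction_linear with
  | zero => rw [neg_zero, mul_one, one_mul]
  | add f g hf hg => rw [neg_add, ← mul_assoc, hf, mul_assoc, hg, mul_assoc]
  | single p a => exact H.comm_t_neg F (L.t_proj γ) (L.neg_proj _)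

/-- The element `a t^γ x ν` of `T(F)~`. -/
def nf (a : (R : Type u)ˣ) (γ : Γ) (x : (torusArc k Γ).obj R) (ν : F.N R) : H.G.obj R :=
  H.scalar R a * (L.t R γ * H.splitting.app R x * L.neg R ν)

theorem nf_map (φ : R ⟶ S) (a : (R : Type u)ˣ) (γ : Γ) (x : (torusArc k Γ).obj R) (ν : F.N R) :
    H.G.map φ (L.nf a γ x ν) = L.nf (Units.map (φ.hom : (R : Type u) →* S) a) γ
      ((torusArc k Γ).map φ x) (F.mapN φ ν) := by
  rw [nf, map_mul, map_mul, map_mul, H.scalar_natural, t_map, ← H.splitting_map, L.neg_natural]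
  rfl

theorem nf_proj (a : (R : Type u)ˣ) (γ : Γ) (x : (torusArc k Γ).obj R) (ν : F.N R) :
    H.proj.app R (L.nf a γ x ν) = loopPow k tUnit γ * (arcLoop k Γ).app R x * F.negPoint ν := by
  rw [nf, map_mul, map_mul, map_mul, H.proj_scalar, t_proj, H.proj_splitting_apply, L.neg_proj]
  exact point_one_mul _

theorem nf_scalar (a : (R : Type u)ˣ) : L.nf a 0 1 0 = H.scalar R a := by
  rw [nf, map_one, t_zero, neg_zero, mul_one, mul_one, mul_one]

theorem nf_t (γ : Γ) : L.nf (R := R) 1 γ 1 0 = L.t R γ := by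
  rw [nf, map_one, map_one, neg_zero, one_mul, mul_one, mul_one]

theorem nf_arc (x : (torusArc k Γ).obj R) : L.nf 1 0 x 0 = H.splitting.app R x := by
  rw [nf, map_one, t_zero, neg_zero, one_mul, mul_one, one_mul]

theorem nf_neg (ν : F.N R) : L.nf 1 0 1 ν = L.neg R ν := by
  rw [nf, map_one, map_one, t_zero, one_mul, one_mul, one_mul]

theorem _root_.Heis.mul_of_commutators {A G : Type*} [CommGroup A] [Group G] {z : A →* G}
    (hz : ∀ a g, z a * g = g * z a) {a a' u e κ : A} {t t' s i i' n n' : G}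
    (h1 : i * t' = z u * (t' * i)) (h2 : n * i' = z e * (i' * n)) (h3 : t * t' = z κ * s)
    (h4 : t' * n = n * t') :
    z a * (t * i * n) * (z a' * (t' * i' * n')) =
      z (a * a' * κ * u * e) * (s * (i * i') * (n * n')) := by
  have pull : ∀ b g h, g * (z b * h) = z b * (g * h) := fun b g h => by
    rw [← mul_assoc, ← hz, mul_assoc]
  calc z a * (t * i * n) * (z a' * (t' * i' * n'))
      = z a * (z a' * (t * ((i * t') * ((n * i') * n')))) := by
        rw [pull, mul_assoc (z a), ← pull a']
        simp only [mul_assoc]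
        rw [← mul_assoc n t', ← h4]
        simp only [mul_assoc]
    _ = z a * (z a' * (z u * (z e * ((t * t') * (i * i' * (n * n')))))) := by
        rw [h1, h2, mul_assoc (z u), mul_assoc (z e), pull e, pull u, pull e]
        simp only [mul_assoc]
    _ = _ := by
        simp only [h3, map_mul, mul_assoc]
        rw [pull κ (z e), pull κ (z u), pull κ (z a')]

/-- The multiplication of normal forms. -/
theorem nf_mul (a a' : (R : Type u)ˣ) (γ γ' : Γ) (x x' : (torusArc k Γ).obj R) (ν ν' : F.N R) :
    L.nf a γ x ν * L.nf a' γ' x' ν' =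
      L.nf (a * a' * L.κR R γ γ' * (ev ((arcConst k Γ).app R x) (c γ'))⁻¹ *
        nilExpUnit R (-F.pair (F.logCoord x') ν)) (γ + γ') (x * x') (ν + ν') := by
  have h1 := (L.t_arc γ' x).symm
  have h2 := L.neg_arc ν x'
  unfold HeisenbergExtension.Comm at h1 h2
  rw [nf, nf, nf, L.neg_add, map_mul (H.splitting.app R).hom]
  exact mul_of_commutators (H.scalar_central R) h1 h2 (L.t_mul γ γ') (L.t_neg γ' ν)

theorem exists_nf {g : H.G.obj R} {γ : Γ} {x : (torusArc k Γ).obj R} {ν : F.N R}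
    (h : H.proj.app R g = loopPow k tUnit γ * (arcLoop k Γ).app R x * F.negPoint ν) :
    ∃ a, g = L.nf a γ x ν := by
  obtain ⟨a, ha⟩ := H.exists_scalar (g := g) (g' := L.nf 1 γ x ν) (by rw [h, nf_proj])
  refine ⟨a, ha.trans ?_⟩
  rw [nf, nf, map_one, one_mul]

theorem nf_unique [Nontrivial R] {a a' : (R : Type u)ˣ} {γ γ' : Γ} {x x' : (torusArc k Γ).obj R}
    {ν ν' : F.N R} (h : L.nf a γ x ν = L.nf a' γ' x' ν') :
    a = a' ∧ γ = γ' ∧ x = x' ∧ ν = ν' := by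
  obtain ⟨rfl, rfl, rfl⟩ := F.factor_unique ((L.nf_proj a γ x ν).symm.trans
    ((congrArg _ h).trans (L.nf_proj a' γ' x' ν')))
  exact ⟨H.scalar_injective R (mul_right_cancel h), rfl, rfl, rfl⟩

/-- Locally, every point of `T(F)~` has a normal form. -/
theorem locally_nf (g : H.G.obj R) :
    LocallyOn R fun S φ => ∃ a γ x ν, H.G.map φ g = L.nf (R := S) a γ x ν := by
  refine (F.locally_exists_factor (H.proj.app R g)).mono fun S φ h => ?_
  obtain ⟨γ, x, ν, h⟩ := h
  rw [← H.proj_map] at h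
  obtain ⟨a, ha⟩ := L.exists_nf h
  exact ⟨a, γ, x, ν, ha⟩

end Lifts

end Lifts


/-! ### Representations of group functors: general facts -/

section Representations

variable {k : Type u} [Field k] {G : CommAlgCat.{u} k ⥤ GrpCat.{u}} {R S : CommAlgCat.{u} k}

namespace FRep

variable (M : FRep G)

/-- The value at `1 ⊗ m` of the action of a point. -/
def coact (g : G.obj R) : M.V →ₗ[k] (R : Type u) ⊗[k] M.V :=
  ((M.act R g).restrictScalars k).comp (TensorProduct.mk k (R : Type u) M.V 1)

theorem coact_apply (g : G.obj R) (m : M.V) : M.coact g m = M.act R g ((1 : R) ⊗ₜ m) := rfl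

theorem act_tmul (g : G.obj R) (r : R) (m : M.V) :
    M.act R g (r ⊗ₜ m) = r • M.coact g m := by
  rw [coact_apply, ← map_smul, TensorProduct.smul_tmul', smul_eq_mul, mul_one]

theorem bmap_coact (φ : R ⟶ S) (g : G.obj R) (m : M.V) :
    bmap M.V φ (M.coact g m) = M.coact (G.map φ g) m := by
  rw [coact_apply, coact_apply, bmap, M.natural, LinearMap.rTensor_tmul]
  exact congrArg (fun r => M.act S _ (r ⊗ₜ m)) (map_one φ.hom)

theorem coact_mul (g h : G.obj R) (m : M.V) :
    M.coact (g * h) m = M.act R g (M.coact h m) := by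
  rw [coact_apply, map_mul, Module.End.mul_apply, coact_apply]

theorem coact_one (m : M.V) : M.coact (1 : G.obj R) m = (1 : R) ⊗ₜ m := by
  rw [coact_apply, map_one, Module.End.one_apply]

variable {M}

/-- A linear map is equivariant for a point as soon as it is on vectors of `V`. -/
theorem equivariant_of_coact {N : FRep G} {f : M.V →ₗ[k] N.V} {g : G.obj R}
    (h : ∀ m, f.baseChange R (M.coact g m) = N.coact g (f m)) (x : (R : Type u) ⊗[k] M.V) :
    f.baseChange R (M.act R g x) = N.act R g (f.baseChange R x) := by
  induction x using TensorProduct.induction_on with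
  | zero => simp
  | tmul r m => rw [act_tmul, map_smul, h, LinearMap.baseChange_tmul, act_tmul]
  | add a b ha hb => rw [map_add, map_add, ha, hb, map_add, map_add]

theorem hom_coact {N : FRep G} (f : M ⟶ N) (g : G.obj R) (m : M.V) :
    (lin f).baseChange R (M.coact g m) = N.coact g (lin f m) :=
  (Hom.equivariant (show Hom M N from f) R g _).trans
    (congrArg (N.act R g) (LinearMap.baseChange_tmul ..))

theorem bmap_baseChange {V W : Type u} [AddCommGroup V] [Module k V] [AddCommGroup W] [Module k W]
    (f : V →ₗ[k] W) (φ : R ⟶ S) (x : (R : Type u) ⊗[k] V) :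
    bmap W φ (f.baseChange R x) = f.baseChange S (bmap V φ x) := by
  induction x using TensorProduct.induction_on with
  | zero => simp
  | tmul r m => rfl
  | add a b ha hb => simp only [map_add, ha, hb]

variable (M)

/-- The operator on `V` given by a `k`-point. -/
def kact (g : G.obj (CommAlgCat.of k k)) : M.V →ₗ[k] M.V :=
  (TensorProduct.lid k M.V).toLinearMap.comp (M.coact g)

theorem one_tmul_kact (g : G.obj (CommAlgCat.of k k)) (m : M.V) :
    (1 : k) ⊗ₜ[k] M.kact g m = M.coact g m :=
  (TensorProduct.lid k M.V).symm_apply_apply (M.coact g m)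

theorem coact_map (g : G.obj (CommAlgCat.of k k)) (m : M.V) :
    M.coact (G.map (structHom R) g) m = (1 : R) ⊗ₜ M.kact g m := by
  rw [← bmap_coact, ← one_tmul_kact, bmap_tmul]
  exact congrArg (· ⊗ₜ M.kact g m) (map_one (structHom R).hom)

theorem act_map (g : G.obj (CommAlgCat.of k k)) :
    M.act R (G.map (structHom R) g) = (M.kact g).baseChange R := by
  refine LinearMap.ext fun x => ?_
  induction x using TensorProduct.induction_on with
  | zero => simp
  | tmul r m =>
    rw [act_tmul, coact_map, TensorProduct.smul_tmul', smul_eq_mul, mul_one,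
      LinearMap.baseChange_tmul]
  | add a b ha hb => simp only [map_add, ha, hb]

theorem kact_mul (g h : G.obj (CommAlgCat.of k k)) (m : M.V) :
    M.kact (g * h) m = M.kact g (M.kact h m) := by
  have h1 := M.coact_mul g h m
  rw [← one_tmul_kact, ← one_tmul_kact, ← coact_apply, ← one_tmul_kact] at h1
  exact (TensorProduct.lid k M.V).symm.injective h1

theorem kact_one (m : M.V) : M.kact 1 m = m := by
  have h1 := M.coact_one (R := CommAlgCat.of k k) m
  rw [← one_tmul_kact] at h1
  exact (TensorProduct.lid k M.V).symm.injective h1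

variable {M} in
theorem hom_kact {N : FRep G} (f : M ⟶ N) (g : G.obj (CommAlgCat.of k k)) (m : M.V) :
    lin f (M.kact g m) = N.kact g (lin f m) := by
  have h := hom_coact f g m
  rw [← one_tmul_kact, ← one_tmul_kact, LinearMap.baseChange_tmul] at h
  exact (TensorProduct.lid k N.V).symm.injective h

end FRep

/-! ### Weight decompositions -/

variable (k) in
/-- The group algebra `k[D]`. -/
def gAlg (S : CommAlgCat.{u} k) (D : Type u) [AddCommGroup D] : CommAlgCat.{u} k :=
  CommAlgCat.of k (AddMonoidAlgebra (S : Type u) D)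

section GroupAlgebra

variable {D : Type u} [AddCommGroup D]

/-- The universal character of `D`. -/
def gUniv (S : CommAlgCat.{u} k) (D : Type u) [AddCommGroup D] :
    Multiplicative D →* (gAlg k S D : Type u)ˣ :=
  (AddMonoidAlgebra.of (S : Type u) D).toHomUnits

/-- The monomial of degree `d` in `S[D]`. -/
def gMon (S : CommAlgCat.{u} k) (d : D) (s : S) : gAlg k S D :=
  (AddMonoidAlgebra.single d s : AddMonoidAlgebra (S : Type u) D)

theorem coe_gUniv (d : D) : ((gUniv S D (Multiplicative.ofAdd d) : (gAlg k S D : Type u)ˣ) :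
    gAlg k S D) = gMon S d 1 := rfl

theorem gAlg_induction {Pr : gAlg k S D → Prop} (f : gAlg k S D) (h0 : Pr 0)
    (hadd : ∀ f g, Pr f → Pr g → Pr (f + g)) (hmon : ∀ d s, Pr (gMon S d s)) : Pr f :=
  AddMonoidAlgebra.induction_linear (show AddMonoidAlgebra (S : Type u) D from f) h0 hadd hmon

/-- The morphism from `k[D]` given by a character of `D`. -/
def gChar (f : Multiplicative D →* (S : Type u)ˣ) : gAlg k (CommAlgCat.of k k) D ⟶ S :=
  CommAlgCat.ofHom (AddMonoidAlgebra.lift k S D ((Units.coeHom (S : Type u)).comp f))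

theorem gChar_univ (f : Multiplicative D →* (S : Type u)ˣ) :
    (Units.map ((gChar f).hom : _ →* (S : Type u))).comp (gUniv (CommAlgCat.of k k) D) = f := by
  refine MonoidHom.ext fun d => Units.ext ?_
  refine (AddMonoidAlgebra.lift_single (R := k) ((Units.coeHom (S : Type u)).comp f)
    (Multiplicative.toAdd d) (1 : k)).trans ?_
  rw [one_smul]
  rfl

/-- The inclusion `S → S[D]`. -/
def gConst (S : CommAlgCat.{u} k) (D : Type u) [AddCommGroup D] : S ⟶ gAlg k S D :=
  CommAlgCat.ofHom (AddMonoidAlgebra.singleZeroAlgHom (R := k) (A := (S : Type u)) (M := D))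

/-- The coefficient of an element of `S[D] ⊗ V`. -/
def gCoeff (S : CommAlgCat.{u} k) (d : D) (V : Type u) [AddCommGroup V] [Module k V] :
    (gAlg k S D : Type u) ⊗[k] V →ₗ[k] (S : Type u) ⊗[k] V :=
  LinearMap.rTensor V
    { toFun := fun w => (show AddMonoidAlgebra (S : Type u) D from w).coeff d
      map_add' := fun _ _ => rfl
      map_smul' := fun _ _ => rfl }

theorem gMon_mul_const (d : D) (s : S) : gMon S d 1 * (gConst S D).hom s = gMon S d s := by
  refine (AddMonoidAlgebra.single_mul_single d 0 (1 : S) s).trans ?_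
  rw [add_zero, one_mul]
  rfl

theorem gMon_smul_bmap (d : D) (V : Type u) [AddCommGroup V] [Module k V] (s : S) (v : V) :
    gMon S d 1 • bmap V (gConst S D) (s ⊗ₜ v) = gMon S d s ⊗ₜ v := by
  rw [bmap_tmul, TensorProduct.smul_tmul', smul_eq_mul, gMon_mul_const]

variable [DecidableEq D]

theorem gCoeff_tmul (d d' : D) (V : Type u) [AddCommGroup V] [Module k V] (s : S) (v : V) :
    gCoeff S d V (gMon S d' s ⊗ₜ v) = if d' = d then s ⊗ₜ v else 0 := by
  have h : gCoeff S d V (gMon S d' s ⊗ₜ v) = (Finsupp.single d' s d) ⊗ₜ v := rfl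
  rw [h, Finsupp.single_apply]
  split_ifs
  · rfl
  · rw [TensorProduct.zero_tmul]

theorem gCoeff_smul (d d' : D) (V : Type u) [AddCommGroup V] [Module k V]
    (w : (S : Type u) ⊗[k] V) :
    gCoeff S d V (gMon S d' 1 • bmap V (gConst S D) w) = if d' = d then w else 0 := by
  induction w using TensorProduct.induction_on with
  | zero => simp
  | tmul s v => rw [gMon_smul_bmap, gCoeff_tmul]
  | add a b ha hb =>
    rw [map_add, smul_add, map_add, ha, hb]
    split_ifs
    · rfl
    · rw [add_zero]

theorem gAlg_expand (V : Type u) [AddCommGroup V] [Module k V]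
    (w : (gAlg k S D : Type u) ⊗[k] V) :
    ∃ s : Finset D, w = ∑ d ∈ s, gMon S d 1 • bmap V (gConst S D) (gCoeff S d V w) := by
  let term : D → (gAlg k S D : Type u) ⊗[k] V →+ (gAlg k S D : Type u) ⊗[k] V := fun d =>
    (DistribSMul.toAddMonoidHom _ (gMon S d 1)).comp
        ((bmap V (gConst S D)).toAddMonoidHom.comp (gCoeff S d V).toAddMonoidHom)
  have hterm : ∀ d w, term d w = gMon S d 1 • bmap V (gConst S D) (gCoeff S d V w) :=
    fun _ _ => rfl
  suffices h : ∃ s : Finset D, ∀ s', s ⊆ s' → w = ∑ d ∈ s', term d w by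
    obtain ⟨s, hs⟩ := h
    exact ⟨s, hs s le_rfl⟩
  have hadd : ∀ a b, (∃ s : Finset D, ∀ s', s ⊆ s' → a = ∑ d ∈ s', term d a) →
      (∃ s : Finset D, ∀ s', s ⊆ s' → b = ∑ d ∈ s', term d b) →
      ∃ s : Finset D, ∀ s', s ⊆ s' → a + b = ∑ d ∈ s', term d (a + b) := by
    rintro a b ⟨s, hs⟩ ⟨s', hs'⟩
    refine ⟨s ∪ s', fun t ht => ?_⟩
    simp only [map_add, Finset.sum_add_distrib]
    rw [← hs t (Finset.union_subset_left ht), ← hs' t (Finset.union_subset_right ht)]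
  induction w using TensorProduct.induction_on with
  | zero => exact ⟨∅, fun s' _ => by simp⟩
  | add a b ha hb => exact hadd a b ha hb
  | tmul f v =>
    refine gAlg_induction (Pr := fun f => ∃ s : Finset D, ∀ s', s ⊆ s' →
      f ⊗ₜ[k] v = ∑ d ∈ s', term d (f ⊗ₜ v)) f ?_ (fun f g hf hg => ?_) fun d r => ?_
    · exact ⟨∅, fun s' _ => by rw [TensorProduct.zero_tmul]; simp⟩
    · rw [TensorProduct.add_tmul]
      exact hadd _ _ hf hg
    · refine ⟨{d}, fun t ht => ?_⟩
      rw [Finset.sum_eq_single d]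
      · rw [hterm, gCoeff_tmul, if_pos rfl, gMon_smul_bmap]
      · intro d' _ hne
        rw [hterm, gCoeff_tmul, if_neg hne.symm, map_zero, smul_zero]
      · intro h
        exact absurd (ht (Finset.mem_singleton_self d)) h

end GroupAlgebra

/-- A homomorphism to `G` from the diagonalizable group with character group `D`. -/
structure DiagPoint (D : Type u) [AddCommGroup D]
    (G : CommAlgCat.{u} k ⥤ GrpCat.{u}) where
  toFun : ∀ S : CommAlgCat.{u} k, (Multiplicative D →* (S : Type u)ˣ) →* G.obj S
  natural : ∀ {R S : CommAlgCat.{u} k} (φ : R ⟶ S) (f : Multiplicative D →* (R : Type u)ˣ),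
    G.map φ (toFun R f) = toFun S ((Units.map (φ.hom : (R : Type u) →* S)).comp f)

namespace DiagPoint

variable {D : Type u} [AddCommGroup D] (η : DiagPoint D G) (M : FRep G)

/-- The weight spaces of a representation under a diagonalizable group. -/
def weight (d : D) : Submodule k M.V where
  carrier := {m | ∀ (S : CommAlgCat.{u} k) (f : Multiplicative D →* (S : Type u)ˣ),
    M.coact (η.toFun S f) m = (f (Multiplicative.ofAdd d) : S) ⊗ₜ m}
  zero_mem' := by intro S f; simp
  add_mem' := by
    intro a b ha hb S f
    rw [map_add, ha, hb, TensorProduct.tmul_add]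
  smul_mem' := by
    intro r a ha S f
    rw [map_smul, ha, TensorProduct.tmul_smul]

/-- The projection to a weight space. -/
def proj (d : D) : M.V →ₗ[k] M.V :=
  (TensorProduct.lid k M.V).toLinearMap.comp ((gCoeff (CommAlgCat.of k k) d M.V).comp
    (M.coact (η.toFun _ (gUniv (CommAlgCat.of k k) D))))

theorem one_tmul_proj (d : D) (m : M.V) : (1 : k) ⊗ₜ[k] η.proj M d m =
    gCoeff (CommAlgCat.of k k) d M.V (M.coact (η.toFun _ (gUniv (CommAlgCat.of k k) D)) m) :=
  (TensorProduct.lid k M.V).symm_apply_apply _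

/-- Every vector is a sum of weight components, and a point acts through its values on the
weights. -/
theorem exists_expand [DecidableEq D] (m : M.V) : ∃ s : Finset D,
    ∀ (S : CommAlgCat.{u} k) (f : Multiplicative D →* (S : Type u)ˣ),
      M.coact (η.toFun S f) m =
        ∑ d ∈ s, (f (Multiplicative.ofAdd d) : S) ⊗ₜ η.proj M d m := by
  obtain ⟨s, hs⟩ := gAlg_expand M.V (M.coact (η.toFun _ (gUniv (CommAlgCat.of k k) D)) m)
  refine ⟨s, fun S f => ?_⟩
  have h1 := congrArg (bmap M.V (gChar f)) hs
  rw [M.bmap_coact, η.natural, gChar_univ, map_sum] at h1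
  rw [h1]
  refine Finset.sum_congr rfl fun d _ => ?_
  rw [bmap_smul, ← one_tmul_proj, bmap_tmul, bmap_tmul]
  have h2 : (gChar f).hom ((gConst (CommAlgCat.of k k) D).hom (1 : k)) = 1 :=
    (congrArg (gChar f).hom (map_one _)).trans (map_one _)
  have h3 := congrArg (fun g => ((g (Multiplicative.ofAdd d) : (S : Type u)ˣ) : S)) (gChar_univ f)
  refine (congrArg₂ (fun a b : S => a • b ⊗ₜ[k] η.proj M d m) h3 h2).trans ?_
  rw [TensorProduct.smul_tmul', smul_eq_mul, mul_one]

theorem proj_mem (d : D) (m : M.V) : η.proj M d m ∈ η.weight M d := by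
  classical
  intro S f
  obtain ⟨s, hs⟩ := η.exists_expand M m
  let fT := (Units.map ((gConst S D).hom : (S : Type u) →* (gAlg k S D : Type u))).comp f
  have h1 := M.coact_mul (η.toFun _ fT) (η.toFun _ (gUniv S D)) m
  rw [← map_mul, hs, hs, map_sum] at h1
  have h2 : ∀ d, M.act _ (η.toFun _ fT)
      (((gUniv S D (Multiplicative.ofAdd d) : (gAlg k S D : Type u)ˣ) : gAlg k S D) ⊗ₜ
        η.proj M d m) = gMon S d 1 •
        bmap M.V (gConst S D) (M.coact (η.toFun S f) (η.proj M d m)) := fun d => by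
    rw [M.act_tmul, M.bmap_coact, η.natural]
    rfl
  have h3 : ∀ d, ((((fT * gUniv S D) (Multiplicative.ofAdd d) : (gAlg k S D : Type u)ˣ) :
      gAlg k S D) ⊗ₜ[k] η.proj M d m) = gMon S d 1 •
        bmap M.V (gConst S D) ((f (Multiplicative.ofAdd d) : S) ⊗ₜ η.proj M d m) := fun d => by
    rw [bmap_tmul, TensorProduct.smul_tmul']
    congr 1
    exact mul_comm _ _
  rw [Finset.sum_congr rfl fun d _ => h2 d, Finset.sum_congr rfl fun d _ => h3 d] at h1
  by_cases hd : d ∈ s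
  · have h4 := congrArg (gCoeff S d M.V) h1
    simp only [map_sum, gCoeff_smul, Finset.sum_ite_eq', if_pos hd] at h4
    exact h4.symm
  · have h5 : η.proj M d m = 0 := by
      have h6 : (1 : k) ⊗ₜ[k] η.proj M d m = 0 := by
        rw [one_tmul_proj, hs, map_sum]
        refine Finset.sum_eq_zero fun d' hd' => ?_
        rw [coe_gUniv, gCoeff_tmul, if_neg (fun h : d' = d => hd (h ▸ hd'))]
      exact (TensorProduct.lid k M.V).symm.injective (h6.trans (map_zero _).symm)
    rw [h5, map_zero, TensorProduct.tmul_zero]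

theorem exists_sum_proj (m : M.V) : ∃ s : Finset D, m = ∑ d ∈ s, η.proj M d m := by
  classical
  obtain ⟨s, hs⟩ := η.exists_expand M m
  refine ⟨s, ?_⟩
  have h := hs (CommAlgCat.of k k) 1
  rw [map_one, M.coact_one] at h
  refine (TensorProduct.lid k M.V).symm.injective (h.trans ?_)
  rw [map_sum]
  rfl

theorem iSup_weight : ⨆ d, η.weight M d = ⊤ := by
  refine top_unique fun m _ => ?_
  obtain ⟨s, hs⟩ := η.exists_sum_proj M m
  rw [hs]
  exact sum_mem fun d _ => Submodule.mem_iSup_of_mem d (η.proj_mem M d m)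

variable {M}

theorem proj_of_mem [DecidableEq D] {d d' : D} {m : M.V} (hm : m ∈ η.weight M d') :
    η.proj M d m = if d' = d then m else 0 := by
  refine (TensorProduct.lid k M.V).symm.injective ?_
  refine (one_tmul_proj η M d m).trans ?_
  rw [hm, coe_gUniv, gCoeff_tmul]
  split_ifs
  · rfl
  · rw [map_zero]

end DiagPoint

end Representations


section Diagonalizable

variable {k : Type u} [Field k] {Γ : Type u} [AddCommGroup Γ]

variable (k Γ) in
/-- The inclusion of `T` in `T(O)`. -/
def torusDiag : DiagPoint (Module.Dual ℤ Γ) (torusArc k Γ) where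
  toFun S := ((constArc k Γ).app S).hom
  natural φ f := (congrArg (fun g => g.hom f) ((constArc k Γ).naturality φ)).symm

variable (c : Γ →ₗ[ℤ] Γ →ₗ[ℤ] ℤ)

variable (k) in
/-- The group `Z^c` as the diagonalizable group with character group `Γ^∨/c(Γ)`. -/
def zcDiag : DiagPoint (CharQuot c) (Zc k c) where
  toFun S :=
    { toFun := fun f => ⟨f.comp (AddMonoidHom.toMultiplicative
        (LinearMap.range c).mkQ.toAddMonoidHom), by
          refine MonoidHom.ext fun γ => ?_
          have h : (LinearMap.range c).mkQ (c (Multiplicative.toAdd γ)) = 0 :=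
            (Submodule.Quotient.mk_eq_zero _).2 ⟨_, rfl⟩
          exact (congrArg (fun d => f (Multiplicative.ofAdd d)) h).trans (map_one f)⟩
      map_one' := rfl
      map_mul' := fun _ _ => rfl }
  natural φ f := rfl

theorem exists_zcDiag {S : CommAlgCat.{u} k} (z : (Zc k c).obj S) :
    ∃ f, (zcDiag k c).toFun S f = z := by
  let z' : Module.Dual ℤ Γ →+ Additive (S : Type u)ˣ :=
    AddMonoidHom.mk' (fun l => Additive.ofMul (ev ((zcTorus k c).app S z) l)) fun l l' =>
      congrArg Additive.ofMul (ev_add _ l l')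
  have hz : ∀ l ∈ (LinearMap.range c).toAddSubgroup, z' l = 0 := by
    rintro _ ⟨γ, rfl⟩
    have h : levelHom k c S z.1 = 1 := z.2
    exact congrArg (fun f : Multiplicative Γ →* (S : Type u)ˣ =>
      Additive.ofMul (f (Multiplicative.ofAdd γ))) h
  refine ⟨⟨⟨fun d => Additive.toMul (QuotientAddGroup.lift _ z' hz (Multiplicative.toAdd d)),
    ?_⟩, ?_⟩, ?_⟩
  · exact congrArg Additive.toMul (map_zero (QuotientAddGroup.lift _ z' hz))
  · intro a b
    exact congrArg Additive.toMul (map_add (QuotientAddGroup.lift _ z' hz) _ _)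
  · exact Subtype.ext (MonoidHom.ext fun l => rfl)

theorem weight_zcDiag (V : ZcMod k c) (l : Module.Dual ℤ Γ) :
    (zcDiag k c).weight V ((LinearMap.range c).mkQ l) = isotypic V l := by
  refine le_antisymm (fun v hv S z => ?_) fun v hv S f => hv S ((zcDiag k c).toFun S f)
  obtain ⟨f, rfl⟩ := exists_zcDiag c z
  exact hv S f

end Diagonalizable

/-! ### The Heisenberg algebra acting on a module -/

section Heisenberg

variable {k : Type u} [Field k] {R S : CommAlgCat.{u} k}
  {V : Type u} [AddCommGroup V] [Module k V]

/-- The coefficient of `ε`. -/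
def dualSnd (R : CommAlgCat.{u} k) (V : Type u) [AddCommGroup V] [Module k V] :
    (dual R : Type u) ⊗[k] V →ₗ[k] (R : Type u) ⊗[k] V :=
  LinearMap.rTensor V (TrivSqZeroExt.sndHom (R : Type u) (R : Type u) |>.restrictScalars k)

theorem dualSnd_inl (w : (R : Type u) ⊗[k] V) : dualSnd R V (bmap V (dualInl R) w) = 0 := by
  induction w using TensorProduct.induction_on with
  | zero => simp
  | tmul r v => exact TensorProduct.zero_tmul _ v
  | add a b ha hb => rw [map_add, map_add, ha, hb, add_zero]

theorem dualSnd_eps (w : (R : Type u) ⊗[k] V) :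
    dualSnd R V (dualEps R • bmap V (dualInl R) w) = w := by
  induction w using TensorProduct.induction_on with
  | zero => simp
  | tmul r v =>
    rw [bmap_tmul, TensorProduct.smul_tmul']
    refine congrArg (· ⊗ₜ[k] v) ?_
    change (0 : R) • (0 : R) + MulOpposite.op r • (1 : R) = r
    simp
  | add a b ha hb => rw [map_add, smul_add, map_add, ha, hb]

theorem dual_expand (w : (dual R : Type u) ⊗[k] V) :
    w = bmap V (dualInl R) (bmap V (dualFst R) w) +
      dualEps R • bmap V (dualInl R) (dualSnd R V w) := by
  induction w using TensorProduct.induction_on with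
  | zero => simp
  | tmul x v =>
    have h : dualSnd R V (x ⊗ₜ v) =
        (TrivSqZeroExt.snd (show DualNumber (R : Type u) from x)) ⊗ₜ v := rfl
    rw [h, bmap_tmul, bmap_tmul, bmap_tmul, TensorProduct.smul_tmul', smul_eq_mul,
      ← TensorProduct.add_tmul, mul_comm (dualEps R), ← dual_eq]
  | add a b ha hb =>
    simp only [map_add, smul_add]
    conv_lhs => rw [ha, hb]
    abel

variable [CharZero k]

/-- A vector over `R[x]/(x^(N+1))` with vanishing derivative is determined by its value at `0`. -/
theorem eq_of_truncShift_bmap {N : ℕ} {w : (trunc R (N + 1) : Type u) ⊗[k] V}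
    (h : bmap V (truncShift R N) w = bmap V (truncIncl R N) w) :
    w = bmap V (truncConst R (N + 1)) (bmap V (truncZero R N) w) := by
  let b := Module.Basis.ofVectorSpace k V
  refine (b.baseChange (trunc R (N + 1) : Type u)).repr.injective (Finsupp.ext fun i => ?_)
  rw [repr_bmap, repr_bmap]
  have h1 := congrArg (fun z => (b.baseChange (dual (trunc R N) : Type u)).repr z i) h
  simp only [repr_bmap] at h1
  set w' := (b.baseChange (trunc R (N + 1) : Type u)).repr w i
  have h2 : ∀ r, (truncShift R N).hom ((truncConst R (N + 1)).hom r) =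
      (truncIncl R N).hom ((truncConst R (N + 1)).hom r) := fun r =>
    congrArg (fun f => f.hom r) ((truncConst_shift R N).trans (truncConst_incl R N).symm)
  have h3 : ∀ r, (truncZero R N).hom ((truncConst R (N + 1)).hom r) = r := fun r =>
    congrArg (fun f => f.hom r) (truncConst_zero R N)
  have h4 := eq_one_of_truncShift (w := 1 + (w' - (truncConst R (N + 1)).hom
    ((truncZero R N).hom w'))) (by simp only [map_add, map_sub, map_one, h1, h2])
    (by simp only [map_add, map_sub, map_one, h3, sub_self, add_zero])
  rw [add_eq_left] at h4
  exact sub_eq_zero.1 h4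

variable {Γ : Type u} [AddCommGroup Γ] {c : Γ →ₗ[ℤ] Γ →ₗ[ℤ] ℤ} {F : Frame k c}
  {H : HeisenbergExtension k c}

theorem act_scalar (M : HeisMod H) (a : (R : Type u)ˣ) (x : (R : Type u) ⊗[k] M.obj.V) :
    M.obj.act R (H.scalar R a) x = (a : R) • x := M.property R a x

/-- Negative coordinates supported at `p` with a value of square zero. -/
def Frame.sq (p : F.P) (s : R) (hs : s ^ 2 = 0) : F.N R := Finsupp.single p ⟨s, 2, hs⟩

theorem Frame.mapN_sq (φ : R ⟶ S) (p : F.P) (s : R) (hs : s ^ 2 = 0) :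
    F.mapN φ (F.sq p s hs) = F.sq p (φ.hom s) (by rw [← map_pow, hs, map_zero]) :=
  F.mapN_single φ p _

theorem Frame.sq_zero (p : F.P) : F.sq p (0 : R) (zero_pow two_ne_zero) = 0 :=
  Finsupp.single_zero p

theorem Frame.sq_congr (p : F.P) {s s' : R} (h : s = s') (hs : s ^ 2 = 0) (hs' : s' ^ 2 = 0) :
    F.sq p s hs = F.sq p s' hs' := by
  subst h
  rfl

theorem bmap_one_tmul (φ : R ⟶ S) (v : V) : bmap V φ (1 ⊗ₜ v) = 1 ⊗ₜ v :=
  congrArg (· ⊗ₜ v) (map_one φ.hom)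

theorem smul_one_tmul (s : R) (v : V) : s • ((1 : R) ⊗ₜ[k] v) = s ⊗ₜ v := by
  rw [TensorProduct.smul_tmul', smul_eq_mul, mul_one]

namespace Lifts

variable (L : Lifts F H) (M : HeisMod H)

/-- The infinitesimal generator of a negative one-parameter subgroup. -/
def b (p : F.P) : M.obj.V →ₗ[k] M.obj.V :=
  (TensorProduct.lid k M.obj.V).toLinearMap.comp ((dualSnd (CommAlgCat.of k k) M.obj.V).comp
    (M.obj.coact (L.neg (dual (CommAlgCat.of k k)) (F.sq p (dualEps _) dualEps_sq))))

theorem coact_neg_sq (p : F.P) (s : R) (hs : s ^ 2 = 0) (m : M.obj.V) :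
    M.obj.coact (L.neg R (F.sq p s hs)) m = (1 : R) ⊗ₜ m + s • ((1 : R) ⊗ₜ L.b M p m) := by
  have h1 : (1 : k) ⊗ₜ[k] L.b M p m = dualSnd (CommAlgCat.of k k) M.obj.V (M.obj.coact
      (L.neg (dual (CommAlgCat.of k k)) (F.sq p (dualEps _) dualEps_sq)) m) :=
    (TensorProduct.lid k M.obj.V).symm_apply_apply _
  have h2 := dual_expand (M.obj.coact
    (L.neg (dual (CommAlgCat.of k k)) (F.sq p (dualEps _) dualEps_sq)) m)
  have h0 : F.mapN (dualFst (CommAlgCat.of k k)) (F.sq p (dualEps _) dualEps_sq) = 0 :=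
    (F.mapN_sq _ _ _ _).trans ((F.sq_congr p rfl _ _).trans (F.sq_zero p))
  rw [← h1, M.obj.bmap_coact, L.neg_natural, h0, L.neg_zero, M.obj.coact_one] at h2
  have h3 := congrArg (bmap M.obj.V (dualLift (structHom R) s hs)) h2
  have h4 : F.mapN (dualLift (structHom R) s hs) (F.sq p (dualEps _) dualEps_sq) = F.sq p s hs :=
    (F.mapN_sq _ _ _ _).trans (F.sq_congr p (dualLift_eps _ s hs) _ _)
  rw [M.obj.bmap_coact, L.neg_natural, h4, map_add, bmap_smul, ← bmap_comp, ← bmap_comp,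
    dualInl_lift, dualLift_eps] at h3
  refine h3.trans ?_
  congr 1
  · exact bmap_one_tmul (structHom R) m
  · exact congrArg (s • ·) (bmap_one_tmul (structHom R) _)

theorem act_neg_sq (p : F.P) (s : R) (hs : s ^ 2 = 0) (x : (R : Type u) ⊗[k] M.obj.V) :
    M.obj.act R (L.neg R (F.sq p s hs)) x = x + s • (L.b M p).baseChange R x := by
  induction x using TensorProduct.induction_on with
  | zero => simp
  | tmul r m =>
    rw [FRep.act_tmul, coact_neg_sq, smul_add, smul_one_tmul, smul_comm, smul_one_tmul,
      LinearMap.baseChange_tmul]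
  | add a b ha hb =>
    simp only [map_add, ha, hb, smul_add]
    abel

theorem coact_splitting_map (φ : R ⟶ S) (x : (torusArc k Γ).obj R) (m : M.obj.V) :
    M.obj.coact (H.splitting.app S ((torusArc k Γ).map φ x)) m =
      bmap M.obj.V φ (M.obj.coact (H.splitting.app R x) m) := by
  rw [M.obj.bmap_coact, ← H.splitting_map]

theorem one_sub_mul_smul_add_smul {A X : Type*} [CommRing A] [AddCommGroup X] [Module A X] {e : A}
    (he : e * e = 0) (y : A) (v w : X) :
    (1 - y * e) • (v + e • w) = v + e • w - e • y • v := by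
  rw [sub_smul, one_smul, smul_add, smul_smul _ e, mul_assoc, he, mul_zero, zero_smul, add_zero,
    smul_smul, mul_comm e]

theorem eq_add_of_dual_eq {C C' D : (R : Type u) ⊗[k] V} {u : dual R} {y : R}
    (hu : u = 1 - (dualInl R).hom y * dualEps R)
    (h : bmap V (dualInl R) C + dualEps R • bmap V (dualInl R) D =
      u • (bmap V (dualInl R) C + dualEps R • bmap V (dualInl R) C')) : C' = D + y • C := by
  have h7 : dualEps R * dualEps R = 0 := (pow_two _).symm.trans dualEps_sq
  have h6 : u • (bmap V (dualInl R) C + dualEps R • bmap V (dualInl R) C') =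
      bmap V (dualInl R) C + dualEps R • bmap V (dualInl R) C' -
        dualEps R • bmap V (dualInl R) (y • C) := by
    rw [hu, bmap_smul]
    exact one_sub_mul_smul_add_smul h7 _ _ _
  rw [h6] at h
  have h5 := congrArg (dualSnd R V) h
  rw [map_sub, map_add, map_add, dualSnd_inl, dualSnd_eps, dualSnd_eps, dualSnd_eps, zero_add,
    zero_add] at h5
  rw [h5, sub_add_cancel]

theorem coe_nilExpUnit_pair_sq (p : F.P) (x : (torusArc k Γ).obj R) :
    ((nilExpUnit (dual R) (-F.pair (F.logCoord ((torusArc k Γ).map (dualInl R) x))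
      (F.sq p (dualEps R) dualEps_sq)) : (dual R : Type u)ˣ) : dual R) =
      1 - (dualInl R).hom (F.logCoord x p) * dualEps R := by
  have h3 : ((-F.pair (F.logCoord ((torusArc k Γ).map (dualInl R) x))
      (F.sq p (dualEps R) dualEps_sq) : nilradical (dual R)) : dual R) =
      -((dualInl R).hom (F.logCoord x p) * dualEps R) := by
    rw [Frame.sq, F.pair_single, F.logCoord_map]
    rfl
  rw [coe_nilExpUnit, h3, nilExp_of_sq_eq_zero, sub_eq_add_neg]
  rw [neg_sq, mul_pow, dualEps_sq, mul_zero]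

theorem act_neg_sq_coact_arc (p : F.P) (x : (torusArc k Γ).obj R) (m : M.obj.V) :
    M.obj.coact (L.neg _ (F.sq p (dualEps R) dualEps_sq) *
      H.splitting.app _ ((torusArc k Γ).map (dualInl R) x)) m =
      bmap M.obj.V (dualInl R) (M.obj.coact (H.splitting.app R x) m) + dualEps R •
        bmap M.obj.V (dualInl R) ((L.b M p).baseChange R (M.obj.coact (H.splitting.app R x) m)) := by
  rw [M.obj.coact_mul, coact_splitting_map, L.act_neg_sq, ← FRep.bmap_baseChange]

theorem act_arc_coact_neg_sq (p : F.P) (x : (torusArc k Γ).obj R) (m : M.obj.V) :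
    M.obj.coact (H.splitting.app _ ((torusArc k Γ).map (dualInl R) x) *
      L.neg _ (F.sq p (dualEps R) dualEps_sq)) m =
      bmap M.obj.V (dualInl R) (M.obj.coact (H.splitting.app R x) m) + dualEps R •
        bmap M.obj.V (dualInl R) (M.obj.coact (H.splitting.app R x) (L.b M p m)) := by
  rw [M.obj.coact_mul, L.coact_neg_sq, map_add, map_smul, ← M.obj.coact_apply,
    ← M.obj.coact_apply, coact_splitting_map, coact_splitting_map]

/-- The translation `b_p ↦ b_p + y_p` of the generators by `T(O)`. -/
theorem act_arc_b (p : F.P) (x : (torusArc k Γ).obj R) (m : M.obj.V) :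
    M.obj.coact (H.splitting.app R x) (L.b M p m) =
      (L.b M p).baseChange R (M.obj.coact (H.splitting.app R x) m) +
        F.logCoord x p • M.obj.coact (H.splitting.app R x) m := by
  refine eq_add_of_dual_eq (coe_nilExpUnit_pair_sq (F := F) p x) ?_
  rw [← L.act_neg_sq_coact_arc, ← L.act_arc_coact_neg_sq, ← act_scalar, ← FRep.coact_mul,
    L.neg_arc]

theorem kact_b (p : F.P) (γ : Γ) (m : M.obj.V) :
    L.b M p (M.obj.kact (L.base γ) m) = M.obj.kact (L.base γ) (L.b M p m) := by
  have h1 := congrArg (fun g => M.obj.coact g m)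
    (L.t_neg γ (F.sq p (dualEps (CommAlgCat.of k k)) dualEps_sq))
  simp only [M.obj.coact_mul, t] at h1
  rw [M.obj.coact_map, ← M.obj.coact_apply, coact_neg_sq, coact_neg_sq, map_add, M.obj.act_map,
    map_smul, LinearMap.baseChange_tmul, LinearMap.baseChange_tmul] at h1
  have h3 := congrArg (dualSnd (CommAlgCat.of k k) M.obj.V) (add_left_cancel h1)
  rw [← bmap_one_tmul (dualInl (CommAlgCat.of k k)), ← bmap_one_tmul (dualInl (CommAlgCat.of k k)),
    dualSnd_eps, dualSnd_eps] at h3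
  exact ((TensorProduct.lid k M.obj.V).symm.injective h3).symm

theorem coact_neg_sq_mul (p q : F.P) (m : M.obj.V) (s₁ s₂ : R) (hs₁ : s₁ ^ 2 = 0)
    (hs₂ : s₂ ^ 2 = 0) : M.obj.coact (L.neg R (F.sq p s₁ hs₁) * L.neg R (F.sq q s₂ hs₂)) m =
      (1 : R) ⊗ₜ m + s₂ • ((1 : R) ⊗ₜ L.b M q m) + s₁ • ((1 : R) ⊗ₜ L.b M p m) +
        s₁ • s₂ • ((1 : R) ⊗ₜ L.b M p (L.b M q m)) := by
  have h : (L.b M p).baseChange R ((1 : R) ⊗ₜ m + s₂ • ((1 : R) ⊗ₜ L.b M q m)) =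
      (1 : R) ⊗ₜ L.b M p m + s₂ • ((1 : R) ⊗ₜ L.b M p (L.b M q m)) := by
    rw [map_add ((L.b M p).baseChange R), map_smul ((L.b M p).baseChange R),
      LinearMap.baseChange_tmul, LinearMap.baseChange_tmul]
  rw [M.obj.coact_mul, coact_neg_sq, act_neg_sq, h, smul_add, ← add_assoc]

theorem smul_smul_b_comm (p q : F.P) (m : M.obj.V) (s₁ s₂ : R) (hs₁ : s₁ ^ 2 = 0)
    (hs₂ : s₂ ^ 2 = 0) : s₂ • s₁ • ((1 : R) ⊗ₜ[k] L.b M p (L.b M q m)) =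
      s₂ • s₁ • ((1 : R) ⊗ₜ[k] L.b M q (L.b M p m)) := by
  have h1 : L.neg R (F.sq p s₁ hs₁) * L.neg R (F.sq q s₂ hs₂) =
      L.neg R (F.sq q s₂ hs₂) * L.neg R (F.sq p s₁ hs₁) := by
    rw [← L.neg_add, ← L.neg_add, add_comm]
  have h2 := congrArg (fun g => M.obj.coact g m) h1
  beta_reduce at h2
  rw [coact_neg_sq_mul, coact_neg_sq_mul, add_right_comm ((1 : R) ⊗ₜ[k] m), add_right_inj,
    smul_comm s₁ s₂] at h2
  exact h2

theorem b_comm (p q : F.P) (m : M.obj.V) : L.b M p (L.b M q m) = L.b M q (L.b M p m) := by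
  have h5 : ∀ v : M.obj.V, dualSnd (CommAlgCat.of k k) M.obj.V (dualSnd (dual (CommAlgCat.of k k))
      M.obj.V (dualEps (dual (CommAlgCat.of k k)) • (dualInl (dual (CommAlgCat.of k k))).hom
        (dualEps (CommAlgCat.of k k)) • ((1 : dual (dual (CommAlgCat.of k k))) ⊗ₜ v))) =
          (1 : k) ⊗ₜ v := fun v => by
    rw [← bmap_one_tmul (dualInl (dual (CommAlgCat.of k k))), ← bmap_smul, dualSnd_eps,
      ← bmap_one_tmul (dualInl (CommAlgCat.of k k)), dualSnd_eps]
  have h3 := L.smul_smul_b_comm M p q m ((dualInl (dual (CommAlgCat.of k k))).hom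
    (dualEps (CommAlgCat.of k k))) (dualEps (dual (CommAlgCat.of k k)))
    (by rw [← map_pow, dualEps_sq, map_zero]) dualEps_sq
  have h7 := congrArg (fun z => dualSnd (CommAlgCat.of k k) M.obj.V
    (dualSnd (dual (CommAlgCat.of k k)) M.obj.V z)) h3
  simp only [h5] at h7
  exact (TensorProduct.lid k M.obj.V).symm.injective h7

end Lifts

end Heisenberg


/-! ### Recognizing morphisms of modules -/

section Criterion

variable {k : Type u} [Field k] [CharZero k] {Γ : Type u} [AddCommGroup Γ]
  {c : Γ →ₗ[ℤ] Γ →ₗ[ℤ] ℤ} {F : Frame k c} {H : HeisenbergExtension k c}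
  {R S : CommAlgCat.{u} k}

theorem FRep.act_mul_apply {G : CommAlgCat.{u} k ⥤ GrpCat.{u}} (M : FRep G) (g h : G.obj R)
    (x : (R : Type u) ⊗[k] M.V) : M.act R (g * h) x = M.act R g (M.act R h x) := by
  rw [map_mul, Module.End.mul_apply]

theorem FRep.act_one_apply {G : CommAlgCat.{u} k ⥤ GrpCat.{u}} (M : FRep G)
    (x : (R : Type u) ⊗[k] M.V) : M.act R 1 x = x := by
  rw [map_one, Module.End.one_apply]

namespace Lifts

variable (L : Lifts F H) {M N : HeisMod H} {f : M.obj.V →ₗ[k] N.obj.V}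

theorem act_neg_sq_baseChange (hb : ∀ p m, f (L.b M p m) = L.b N p (f m)) (p : F.P) (s : R)
    (hs : s ^ 2 = 0) (x : (R : Type u) ⊗[k] M.obj.V) :
    f.baseChange R (M.obj.act R (L.neg R (F.sq p s hs)) x) =
      N.obj.act R (L.neg R (F.sq p s hs)) (f.baseChange R x) := by
  have h : (L.b N p).comp f = f.comp (L.b M p) := LinearMap.ext fun m => (hb p m).symm
  rw [act_neg_sq, act_neg_sq, map_add (f.baseChange R), map_smul (f.baseChange R),
    ← LinearMap.comp_apply ((L.b N p).baseChange R), ← LinearMap.baseChange_comp, h,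
    LinearMap.baseChange_comp, LinearMap.comp_apply]

/-- The conjugate of `f` by the lift of the negative point `ν`. -/
def conjNeg (f : M.obj.V →ₗ[k] N.obj.V) (ν : F.N R) (m : M.obj.V) : (R : Type u) ⊗[k] N.obj.V :=
  N.obj.act R (L.neg R (-ν)) (f.baseChange R (M.obj.coact (L.neg R ν) m))

theorem bmap_conjNeg (φ : R ⟶ S) (f : M.obj.V →ₗ[k] N.obj.V) (ν : F.N R) (m : M.obj.V) :
    bmap N.obj.V φ (L.conjNeg f ν m) = L.conjNeg f (F.mapN φ ν) m := by
  rw [conjNeg, conjNeg, ← L.neg_natural, ← M.obj.bmap_coact, ← FRep.bmap_baseChange, ← map_neg,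
    ← L.neg_natural]
  exact N.obj.natural _ _ _

theorem conjNeg_zero (f : M.obj.V →ₗ[k] N.obj.V) (m : M.obj.V) :
    L.conjNeg f (0 : F.N R) m = (1 : R) ⊗ₜ f m := by
  rw [conjNeg, _root_.neg_zero, L.neg_zero, FRep.act_one_apply, M.obj.coact_one,
    LinearMap.baseChange_tmul]

theorem conjNeg_add_sq (hb : ∀ p m, f (L.b M p m) = L.b N p (f m)) (ν : F.N R) (p : F.P) (s : R)
    (hs : s ^ 2 = 0) (m : M.obj.V) : L.conjNeg f (ν + F.sq p s hs) m = L.conjNeg f ν m := by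
  have h1 : -(ν + F.sq p s hs) + F.sq p s hs = -ν := by abel
  have h2 : L.neg R (ν + F.sq p s hs) = L.neg R (F.sq p s hs) * L.neg R ν :=
    (congrArg (L.neg R) (add_comm _ _)).trans (L.neg_add _ _)
  have h3 : L.neg R (-(ν + F.sq p s hs)) * L.neg R (F.sq p s hs) = L.neg R (-ν) :=
    (L.neg_add _ _).symm.trans (congrArg (L.neg R) h1)
  rw [conjNeg, conjNeg, h2, M.obj.coact_mul, L.act_neg_sq_baseChange hb, ← FRep.act_mul_apply, h3]

/-- The conjugate of `f` has vanishing derivative along the one-parameter subgroup, hence is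
constant. -/
theorem conjNeg_root (hb : ∀ p m, f (L.b M p m) = L.b N p (f m)) (p : F.P) (n : ℕ) (m : M.obj.V) :
    L.conjNeg f (Finsupp.single p (truncRoot (CommAlgCat.of k k) (n + 1)) : F.N _) m =
      1 ⊗ₜ f m := by
  have h0 : nilMap (truncZero (CommAlgCat.of k k) n) (truncRoot _ _) = 0 :=
    Subtype.ext (truncZero_root _ n)
  have h1 : F.mapN (truncShift (CommAlgCat.of k k) n) (Finsupp.single p (truncRoot _ _)) =
      F.mapN (truncIncl _ n) (Finsupp.single p (truncRoot _ _)) +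
        F.sq p (dualEps _) dualEps_sq := by
    rw [F.mapN_single, F.mapN_single, Frame.sq, ← Finsupp.single_add]
    exact congrArg _ (Subtype.ext ((truncShift_root _ n).trans
      (congrArg (· + _) (truncIncl_root _ n).symm)))
  refine (eq_of_truncShift_bmap (N := n) ?_).trans ?_
  · rw [bmap_conjNeg, bmap_conjNeg, h1, L.conjNeg_add_sq hb]
  · rw [bmap_conjNeg, F.mapN_single, h0, Finsupp.single_zero, conjNeg_zero, bmap_one_tmul]

theorem conjNeg_eq (hb : ∀ p m, f (L.b M p m) = L.b N p (f m)) (p : F.P) (a : nilradical R)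
    (m : M.obj.V) : L.conjNeg f (Finsupp.single p a) m = (1 : R) ⊗ₜ f m := by
  obtain ⟨n, hn⟩ := a.2
  have h1 : (a : R) ^ (n + 1) = 0 := by rw [pow_succ, hn, zero_mul]
  have h2 := congrArg (bmap N.obj.V (truncLift (structHom R) (a : R) h1))
    (L.conjNeg_root hb p n m)
  have h3 : nilMap (truncLift (structHom R) (a : R) h1) (truncRoot _ _) = a :=
    Subtype.ext (truncLift_root _ _ _)
  rwa [bmap_conjNeg, F.mapN_single, h3, bmap_one_tmul] at h2

theorem baseChange_coact_neg (hb : ∀ p m, f (L.b M p m) = L.b N p (f m)) (ν : F.N R)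
    (m : M.obj.V) : f.baseChange R (M.obj.coact (L.neg R ν) m) = N.obj.coact (L.neg R ν) (f m) := by
  induction ν using Finsupp.induction_linear generalizing m with
  | zero =>
    rw [L.neg_zero, FRep.coact_one, FRep.coact_one, LinearMap.baseChange_tmul]
  | add ν ν' h h' =>
    rw [L.neg_add, FRep.coact_mul, FRep.equivariant_of_coact h, h', FRep.coact_mul]
  | single p a =>
    have h1 := congrArg (N.obj.act R (L.neg R (Finsupp.single p a))) (L.conjNeg_eq hb p a m)
    rw [conjNeg, ← FRep.act_mul_apply, ← L.neg_add, add_neg_cancel, L.neg_zero,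
      FRep.act_one_apply] at h1
    exact h1

theorem coact_nf (M : HeisMod H) (a : (R : Type u)ˣ) (γ : Γ) (x : (torusArc k Γ).obj R)
    (ν : F.N R) (m : M.obj.V) : M.obj.coact (L.nf a γ x ν) m =
      (a : R) • (M.obj.kact (L.base γ)).baseChange R
        (M.obj.act R (H.splitting.app R x) (M.obj.coact (L.neg R ν) m)) := by
  rw [nf, FRep.coact_mul, act_scalar, FRep.coact_mul, FRep.act_mul_apply, ← FRep.act_map]
  rfl

theorem baseChange_kact (ht : ∀ γ m, f (M.obj.kact (L.base γ) m) = N.obj.kact (L.base γ) (f m))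
    (γ : Γ) (x : (R : Type u) ⊗[k] M.obj.V) :
    f.baseChange R ((M.obj.kact (L.base γ)).baseChange R x) =
      (N.obj.kact (L.base γ)).baseChange R (f.baseChange R x) := by
  have h : (N.obj.kact (L.base γ)).comp f = f.comp (M.obj.kact (L.base γ)) :=
    LinearMap.ext fun m => (ht γ m).symm
  rw [← LinearMap.comp_apply ((N.obj.kact (L.base γ)).baseChange R), ← LinearMap.baseChange_comp,
    h, LinearMap.baseChange_comp, LinearMap.comp_apply]

theorem baseChange_coact_nf (hb : ∀ p m, f (L.b M p m) = L.b N p (f m))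
    (ht : ∀ γ m, f (M.obj.kact (L.base γ) m) = N.obj.kact (L.base γ) (f m))
    (hi : ∀ (R : CommAlgCat.{u} k) (x : (torusArc k Γ).obj R) m,
      f.baseChange R (M.obj.coact (H.splitting.app R x) m) =
        N.obj.coact (H.splitting.app R x) (f m)) (a : (R : Type u)ˣ) (γ : Γ)
    (x : (torusArc k Γ).obj R) (ν : F.N R) (m : M.obj.V) :
    f.baseChange R (M.obj.coact (L.nf a γ x ν) m) = N.obj.coact (L.nf a γ x ν) (f m) := by
  rw [coact_nf, coact_nf, map_smul (f.baseChange R), L.baseChange_kact ht,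
    FRep.equivariant_of_coact (hi R x), L.baseChange_coact_neg hb]

/-- A linear map is a morphism of `T(F)~`-modules if it commutes with `T(O)`, with the lifts of
`t^γ`, and with the infinitesimal generators of the negative part. -/
theorem equivariant (hb : ∀ p m, f (L.b M p m) = L.b N p (f m))
    (ht : ∀ γ m, f (M.obj.kact (L.base γ) m) = N.obj.kact (L.base γ) (f m))
    (hi : ∀ (R : CommAlgCat.{u} k) (x : (torusArc k Γ).obj R) m,
      f.baseChange R (M.obj.coact (H.splitting.app R x) m) =
        N.obj.coact (H.splitting.app R x) (f m)) (g : H.G.obj R)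
    (x : (R : Type u) ⊗[k] M.obj.V) :
    f.baseChange R (M.obj.act R g x) = N.obj.act R g (f.baseChange R x) := by
  refine FRep.equivariant_of_coact (fun m => ?_) x
  refine eq_of_locally_bmap ((L.locally_nf g).mono fun S φ h => ?_)
  obtain ⟨a, γ, y, ν, h⟩ := h
  rw [FRep.bmap_baseChange, FRep.bmap_coact, FRep.bmap_coact, h]
  exact L.baseChange_coact_nf hb ht hi a γ y ν m

/-- The morphism of `T(F)~`-modules given by a map that commutes with generators. -/
def homMk (f : M.obj.V →ₗ[k] N.obj.V) (hb : ∀ p m, f (L.b M p m) = L.b N p (f m))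
    (ht : ∀ γ m, f (M.obj.kact (L.base γ) m) = N.obj.kact (L.base γ) (f m))
    (hi : ∀ (R : CommAlgCat.{u} k) (x : (torusArc k Γ).obj R) m,
      f.baseChange R (M.obj.coact (H.splitting.app R x) m) =
        N.obj.coact (H.splitting.app R x) (f m)) : M ⟶ N :=
  ⟨FRep.Hom.mk f fun _ g x => L.equivariant hb ht hi g x⟩

theorem hom_b (f : M ⟶ N) (p : F.P) (m : M.obj.V) :
    FRep.lin f.hom (L.b M p m) = L.b N p (FRep.lin f.hom m) := by
  have h := FRep.hom_coact f.hom (L.neg _ (F.sq p (dualEps (CommAlgCat.of k k)) dualEps_sq)) m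
  rw [coact_neg_sq, coact_neg_sq, map_add, map_smul, LinearMap.baseChange_tmul,
    LinearMap.baseChange_tmul] at h
  have h3 := congrArg (dualSnd (CommAlgCat.of k k) N.obj.V) (add_left_cancel h)
  rw [← bmap_one_tmul (dualInl (CommAlgCat.of k k)), ← bmap_one_tmul (dualInl (CommAlgCat.of k k)),
    dualSnd_eps, dualSnd_eps] at h3
  exact (TensorProduct.lid k N.obj.V).symm.injective h3

end Lifts

end Criterion


/-! ### Invariants of `T(𝔪)` generate -/

section Contract

variable {k : Type u} [Field k] {R S : CommAlgCat.{u} k}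
  {V W : Type u} [AddCommGroup V] [Module k V] [AddCommGroup W] [Module k W]

variable (k) in
/-- The polynomial algebra on a set. -/
def poly (σ : Type u) : CommAlgCat.{u} k := CommAlgCat.of k (MvPolynomial σ k)

/-- The variables of a polynomial algebra. -/
def pX {σ : Type u} (p : σ) : poly k σ := (MvPolynomial.X p : MvPolynomial σ k)

/-- The morphism from a polynomial algebra given by the images of the variables. -/
def pLift {σ : Type u} (f : σ → S) : poly k σ ⟶ S :=
  CommAlgCat.ofHom (MvPolynomial.aeval f)

theorem pLift_X {σ : Type u} (f : σ → S) (p : σ) : (pLift f).hom (pX p) = f p :=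
  MvPolynomial.aeval_X f p

theorem poly_hom_ext {σ E : Type u} [Semiring E] [Algebra k E]
    {f g : (poly k σ : Type u) →ₐ[k] E} (h : ∀ p, f (pX p) = g (pX p)) : f = g :=
  MvPolynomial.algHom_ext h

theorem poly_induction {σ : Type u} {Pr : poly k σ → Prop} (f : poly k σ)
    (hC : ∀ a : k, Pr (algebraMap k (poly k σ) a)) (hadd : ∀ f g, Pr f → Pr g → Pr (f + g))
    (hX : ∀ f p, Pr f → Pr (f * pX p)) : Pr f :=
  MvPolynomial.induction_on (motive := Pr) f hC (fun f g hf hg => hadd f g hf hg)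
    fun f p hf => hX f p hf

open scoped IsMulCommutative in
/-- The evaluation of polynomials at a commuting family of elements of an algebra. -/
theorem exists_commAeval {σ : Type u} {E : Type u} [Semiring E] [Algebra k E] (b : σ → E)
    (hb : ∀ p q, b p * b q = b q * b p) :
    ∃ f : (poly k σ : Type u) →ₐ[k] E, ∀ p, f (pX p) = b p := by
  have h : ∀ x ∈ Set.range b, ∀ y ∈ Set.range b, x * y = y * x := by
    rintro _ ⟨p, rfl⟩ _ ⟨q, rfl⟩
    exact hb p q
  have := Algebra.isMulCommutative_adjoin k h
  let f : MvPolynomial σ k →ₐ[k] Algebra.adjoin k (Set.range b) :=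
    MvPolynomial.aeval fun p => ⟨b p, Algebra.subset_adjoin ⟨p, rfl⟩⟩
  exact ⟨(Algebra.adjoin k (Set.range b)).val.comp f, fun p =>
    congrArg Subtype.val (MvPolynomial.aeval_X (R := k) _ p)⟩

theorem commute_sumElim {σ E : Type*} [Ring E] {β y : σ → E} (hβ : ∀ p q, β p * β q = β q * β p)
    (hy : ∀ p q, y p * y q = y q * y p) (h : ∀ p q, β p * y q = y q * β p) (p q : σ ⊕ σ) :
    Sum.elim (fun p => -β p - y p) y p * Sum.elim (fun p => -β p - y p) y q =
      Sum.elim (fun p => -β p - y p) y q * Sum.elim (fun p => -β p - y p) y p := by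
  have h1 : ∀ p q, Commute (-β p - y p) (y q) := fun p q =>
    (Commute.neg_left (h p q)).sub_left (hy p q)
  have h2 : ∀ p q, Commute (-β p - y p) (β q) := fun p q =>
    (Commute.neg_left (hβ p q)).sub_left (h q p).symm
  rcases p with p | p <;> rcases q with q | q
  · exact ((h2 p q).neg_right).sub_right (h1 p q)
  · exact h1 p q
  · exact (h1 q p).symm
  · exact hy p q

/-- The contraction `s ⊗ v ↦ θ(s) j(v)`. -/
def contract (θ : (S : Type u) →ₐ[k] Module.End k W) (j : V →ₗ[k] W) :
    (S : Type u) ⊗[k] V →ₗ[k] W :=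
  TensorProduct.lift ((LinearMap.lcomp k W j).comp θ.toLinearMap)

theorem contract_tmul (θ : (S : Type u) →ₐ[k] Module.End k W) (j : V →ₗ[k] W) (s : S) (v : V) :
    contract θ j (s ⊗ₜ v) = θ s (j v) := rfl

theorem contract_bmap (φ : R ⟶ S) (θ : (S : Type u) →ₐ[k] Module.End k W) (j : V →ₗ[k] W)
    (x : (R : Type u) ⊗[k] V) :
    contract θ j (bmap V φ x) = contract (S := R) (θ.comp φ.hom) j x := by
  induction x using TensorProduct.induction_on with
  | zero => simp
  | tmul r v => rfl
  | add a b ha hb => simp only [map_add, ha, hb]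

theorem contract_smul (θ : (S : Type u) →ₐ[k] Module.End k W) (j : V →ₗ[k] W) (s : S)
    (x : (S : Type u) ⊗[k] V) : contract θ j (s • x) = θ s (contract θ j x) := by
  induction x using TensorProduct.induction_on with
  | zero => simp
  | tmul r v =>
    rw [TensorProduct.smul_tmul', contract_tmul, contract_tmul, smul_eq_mul, map_mul]
    rfl
  | add a b ha hb => simp only [smul_add, map_add, ha, hb]

theorem contract_lsmul (x : (R : Type u) ⊗[k] V) :
    contract (Algebra.lsmul k k ((R : Type u) ⊗[k] V)) (TensorProduct.mk k (R : Type u) V 1) x =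
      x := by
  induction x using TensorProduct.induction_on with
  | zero => simp
  | tmul r v =>
    change r • ((1 : R) ⊗ₜ[k] v) = r ⊗ₜ v
    rw [TensorProduct.smul_tmul', smul_eq_mul, mul_one]
  | add a b ha hb => rw [map_add, ha, hb]

end Contract

section Vacuum

variable {k : Type u} [Field k] [CharZero k] {Γ : Type u} [AddCommGroup Γ]
  {c : Γ →ₗ[ℤ] Γ →ₗ[ℤ] ℤ} {F : Frame k c} {M : FRep (torusArc k Γ)}
  {R S : CommAlgCat.{u} k}

namespace Frame

variable (F M) in
/-- The universal point of `T(𝔪)` applied to a vector. -/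
def univ (m : M.V) : (poly k F.P : Type u) ⊗[k] M.V := M.coact (F.arcPt pX) m

theorem bmap_univ (y : F.P → R) (m : M.V) :
    bmap M.V (pLift y) (F.univ M m) = M.coact (F.arcPt y) m := by
  rw [univ, M.bmap_coact, F.arcPt_map]
  simp only [pLift_X]

theorem mem_unipotentInvariants {m : M.V} (h : F.univ M m = 1 ⊗ₜ m) :
    m ∈ unipotentInvariants M := by
  intro R x hx
  have h1 := F.arcPt_logCoord x
  rw [hx, map_one, point_one_mul] at h1
  rw [← h1]
  refine (F.bmap_univ _ m).symm.trans ?_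
  rw [h, bmap_one_tmul]

variable (b : F.P → Module.End k M.V)
  {θ θ' : (poly k F.P : Type u) →ₐ[k] Module.End k M.V}

/-- The value at `X = -b` of the universal point of `T(𝔪)` applied to `m`, for `θ : X ↦ -b`. -/
def vac (F : Frame k c) (θ : (poly k F.P : Type u) →ₐ[k] Module.End k M.V) : M.V →ₗ[k] M.V :=
  (contract θ LinearMap.id).comp (M.coact (F.arcPt pX))

theorem vac_apply (m : M.V) : F.vac θ m = contract θ LinearMap.id (F.univ M m) := rfl

/-- The variables of the first of two copies. -/
def inlP (F : Frame k c) : poly k F.P ⟶ poly k (F.P ⊕ F.P) := pLift fun p => pX (Sum.inl p)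

/-- The variables of the second of two copies. -/
def inrP (F : Frame k c) : poly k F.P ⟶ poly k (F.P ⊕ F.P) := pLift fun p => pX (Sum.inr p)

/-- The sums of the variables of two copies. -/
def sumP (F : Frame k c) : poly k F.P ⟶ poly k (F.P ⊕ F.P) :=
  pLift fun p => pX (Sum.inl p) + pX (Sum.inr p)

theorem inlP_X (p : F.P) : F.inlP.hom (pX p) = pX (Sum.inl p) := pLift_X _ p

theorem inrP_X (p : F.P) : F.inrP.hom (pX p) = pX (Sum.inr p) := pLift_X _ p

theorem sumP_X (p : F.P) : F.sumP.hom (pX p) = pX (Sum.inl p) + pX (Sum.inr p) := pLift_X _ p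

theorem bmap_sumP (m : M.V) : bmap M.V F.sumP (F.univ M m) =
    M.act _ (F.arcPt fun p => pX (Sum.inr p)) (bmap M.V F.inlP (F.univ M m)) := by
  rw [sumP, inlP, F.bmap_univ, F.bmap_univ, ← M.coact_mul, ← F.arcPt_add, add_comm]
  rfl

variable {W : Type u} [AddCommGroup W] [Module k W]

theorem contract_sumP (Θ : (poly k (F.P ⊕ F.P) : Type u) →ₐ[k] Module.End k W)
    (j : M.V →ₗ[k] W) (m : M.V) :
    contract (S := poly k F.P) (Θ.comp F.sumP.hom) j (F.univ M m) =
      contract (S := poly k F.P) (Θ.comp F.inlP.hom)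
        ((contract (S := poly k F.P) (Θ.comp F.inrP.hom) j).comp (M.coact (F.arcPt pX)))
        (F.univ M m) := by
  rw [← contract_bmap, bmap_sumP]
  generalize F.univ M m = x
  induction x using TensorProduct.induction_on with
  | zero => simp
  | tmul f v =>
    rw [bmap_tmul, M.act_tmul, contract_smul, contract_tmul]
    refine congrArg (Θ (F.inlP.hom f)) ?_
    refine Eq.trans ?_ (contract_bmap F.inrP Θ j (F.univ M v))
    rw [inrP, F.bmap_univ]
  | add a b ha hb => simp only [map_add, ha, hb]

/-- Every vector is a combination of images of vectors in the range of `vac` under polynomials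
in the operators `b`. -/
theorem contract_vac {b : F.P → Module.End k M.V} (hcomm : ∀ p q, b p * b q = b q * b p)
    (hθ : ∀ p, θ (pX p) = -b p) (hθ' : ∀ p, θ' (pX p) = b p) (m : M.V) :
    contract θ' (F.vac θ) (F.univ M m) = m := by
  obtain ⟨Θ, hΘ⟩ := exists_commAeval (k := k) (σ := F.P ⊕ F.P) (Sum.elim b fun p => -b p) (by
    rintro (p | p) (q | q) <;>
      simp only [Sum.elim_inl, Sum.elim_inr, neg_mul, mul_neg, neg_neg, neg_inj] <;>
      exact hcomm p q)
  have h1 : Θ.comp F.inlP.hom = θ' := poly_hom_ext fun p => by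
    rw [AlgHom.comp_apply, inlP_X, hθ']
    exact hΘ _
  have h2 : Θ.comp F.inrP.hom = θ := poly_hom_ext fun p => by
    rw [AlgHom.comp_apply, inrP_X, hθ]
    exact hΘ _
  have h3 : Θ.comp F.sumP.hom = (Algebra.ofId k (Module.End k M.V)).comp
      (pLift (S := CommAlgCat.of k k) fun _ : F.P => 0).hom := poly_hom_ext fun p => by
    rw [AlgHom.comp_apply, sumP_X, AlgHom.comp_apply, pLift_X, map_zero, map_add]
    exact (congrArg₂ (· + ·) (hΘ _) (hΘ _)).trans (add_neg_cancel (b p))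
  have h4 := F.contract_sumP Θ LinearMap.id m
  rw [h1, h2, h3] at h4
  refine h4.symm.trans ((contract_bmap (S := CommAlgCat.of k k) (pLift fun _ : F.P => 0)
    (Algebra.ofId k (Module.End k M.V)) LinearMap.id (F.univ M m)).symm.trans ?_)
  rw [F.bmap_univ]
  have h5 : F.arcPt (fun _ => 0 : F.P → CommAlgCat.of k k) = 1 := F.arcPt_zero
  rw [h5, M.coact_one, contract_tmul, map_one]
  rfl

/-- The values of `vac` are invariant: a point of `T(𝔪)` translates both the universal point and
the operators `b`, and the two translations cancel at `X = -b`. -/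
theorem vac_mem {b : F.P → Module.End k M.V} (hcomm : ∀ p q, b p * b q = b q * b p)
    (hb : ∀ (R : CommAlgCat.{u} k) (x : (torusArc k Γ).obj R) (p : F.P) (m : M.V),
      M.coact x (b p m) = (b p).baseChange R (M.coact x m) + F.logCoord x p • M.coact x m)
    (hθ : ∀ p, θ (pX p) = -b p) (m : M.V) : F.vac θ m ∈ unipotentInvariants M := by
  refine F.mem_unipotentInvariants ?_
  let A := poly k F.P
  let y : F.P → Module.End k ((A : Type u) ⊗[k] M.V) := fun p =>
    Algebra.lsmul k k ((A : Type u) ⊗[k] M.V) (pX p : A)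
  let β : F.P → Module.End k ((A : Type u) ⊗[k] M.V) := fun p => (b p).lTensor A
  have hyy : ∀ p q, y p * y q = y q * y p := fun p q => by
    rw [← map_mul, ← map_mul, mul_comm]
  have hββ : ∀ p q, β p * β q = β q * β p := fun p q => by
    rw [Module.End.mul_eq_comp, Module.End.mul_eq_comp, ← LinearMap.lTensor_comp,
      ← LinearMap.lTensor_comp]
    exact congrArg _ (hcomm p q)
  have hβy : ∀ p q, β p * y q = y q * β p := fun p q => by
    refine TensorProduct.ext' fun a v => ?_
    exact rfl
  obtain ⟨Θ, hΘ⟩ := exists_commAeval (k := k) (σ := F.P ⊕ F.P)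
    (Sum.elim (fun p => -β p - y p) y) fun p q => by
      exact commute_sumElim (E := Module.End k ((A : Type u) ⊗[k] M.V)) hββ hyy hβy p q
  have h2 : Θ.comp F.inrP.hom = Algebra.lsmul k k _ := poly_hom_ext fun p => by
    rw [AlgHom.comp_apply, inrP_X]
    exact hΘ _
  have h4 := F.contract_sumP Θ (TensorProduct.mk k (A : Type u) M.V 1) m
  rw [h2] at h4
  have h5 : (contract (S := A) (Algebra.lsmul k k ((A : Type u) ⊗[k] M.V))
      (TensorProduct.mk k (A : Type u) M.V 1)).comp (M.coact (F.arcPt pX)) =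
        M.coact (F.arcPt pX) := LinearMap.ext fun v => contract_lsmul _
  rw [h5] at h4
  -- Both sides of `h4` are evaluations of the universal point: at `-b`, and at `-b - Y`.
  have h6 : ∀ (f : A), (Θ.comp F.sumP.hom) f = (θ f).lTensor A := by
    let lT : Module.End k M.V →ₐ[k] Module.End k ((A : Type u) ⊗[k] M.V) :=
      Module.End.lTensorAlgHom k M.V (A : Type u)
    have h : Θ.comp F.sumP.hom = lT.comp θ := poly_hom_ext fun p => by
      rw [AlgHom.comp_apply, sumP_X, AlgHom.comp_apply, hθ, map_add, map_neg]
      exact (congrArg₂ (· + ·) (hΘ _) (hΘ _)).trans (sub_add_cancel (-β p) (y p))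
    exact fun f => congrArg (fun g => g f) h
  have h7 : ∀ (f : A) (v : M.V), (Θ.comp F.inlP.hom) f (M.coact (F.arcPt pX) v) =
      M.coact (F.arcPt pX) (θ f v) := by
    intro f
    refine poly_induction (Pr := fun f => ∀ v, (Θ.comp F.inlP.hom) f (M.coact (F.arcPt pX) v) =
      M.coact (F.arcPt pX) (θ f v)) f (fun a v => ?_) (fun f g hf hg v => ?_) fun f p hf v => ?_
    · rw [AlgHom.commutes, AlgHom.commutes]
      exact (map_smul (M.coact (F.arcPt pX)) a v).symm
    · rw [map_add, map_add, LinearMap.add_apply, LinearMap.add_apply, map_add, hf, hg]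
    · have h8 : (Θ.comp F.inlP.hom) (pX p) (M.coact (F.arcPt pX) v) =
          M.coact (F.arcPt pX) (-b p v) := by
        have h9 : (Θ.comp F.inlP.hom) (pX p) = -β p - y p := by
          rw [AlgHom.comp_apply, inlP_X]
          exact hΘ _
        rw [h9, map_neg, hb, F.logCoord_arcPt, neg_add]
        rfl
      rw [map_mul, map_mul, Module.End.mul_apply, h8, hf, hθ]
      rfl
  have h8 : contract (S := A) (Θ.comp F.sumP.hom) (TensorProduct.mk k (A : Type u) M.V 1)
      (F.univ M m) = 1 ⊗ₜ F.vac θ m := by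
    rw [vac_apply]
    generalize F.univ M m = x
    induction x using TensorProduct.induction_on with
    | zero => simp
    | tmul f v => rw [contract_tmul, h6, contract_tmul]; rfl
    | add a b ha hb => simp only [map_add, ha, hb, TensorProduct.tmul_add]
  have h9 : contract (S := A) (Θ.comp F.inlP.hom) (M.coact (F.arcPt pX)) (F.univ M m) =
      F.univ M (F.vac θ m) := by
    rw [vac_apply]
    generalize F.univ M m = x
    induction x using TensorProduct.induction_on with
    | zero => simp [univ]
    | tmul f v => rw [contract_tmul, h7, contract_tmul]; rfl
    | add a b ha hb =>
      rw [map_add, ha, hb, map_add]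
      exact (map_add (M.coact (F.arcPt pX)) _ _).symm
  exact h9.symm.trans (h4.symm.trans h8)

end Frame

end Vacuum


section Generation

variable {k : Type u} [Field k] [CharZero k] {Γ : Type u} [AddCommGroup Γ]
  {c : Γ →ₗ[ℤ] Γ →ₗ[ℤ] ℤ} {R S : CommAlgCat.{u} k}

/-- The vectors on which `T(O)` acts through the character `l` of `T`. -/
def charSpace (M : FRep (torusArc k Γ)) (l : Module.Dual ℤ Γ) : Submodule k M.V :=
  weightSpace M l ⊓ unipotentInvariants M

theorem exists_ker_mul {A B : Type*} [Group A] [Group B] (f : A →* B) (g : B →* A)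
    (h : ∀ y, f (g y) = y) (x : A) : ∃ y, f y = 1 ∧ g (f x) * y = x :=
  ⟨(g (f x))⁻¹ * x, by rw [map_mul, map_inv, h, inv_mul_cancel], mul_inv_cancel_left _ _⟩

theorem coact_of_mem_charSpace {M : FRep (torusArc k Γ)} {l : Module.Dual ℤ Γ} {m : M.V}
    (hm : m ∈ charSpace M l) (x : (torusArc k Γ).obj R) :
    M.coact x m = (ev ((arcConst k Γ).app R x) l : R) ⊗ₜ m := by
  obtain ⟨y, hy, hxy⟩ := exists_ker_mul ((arcConst k Γ).app R).hom ((constArc k Γ).app R).hom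
    arcConst_constArc x
  have h2 : M.coact y m = 1 ⊗ₜ m := hm.2 R _ hy
  have h3 := M.coact_mul (((constArc k Γ).app R).hom (((arcConst k Γ).app R).hom x)) y m
  rw [hxy, h2] at h3
  exact h3.trans (hm.1 R _)

theorem mem_charSpace {M : FRep (torusArc k Γ)} {l : Module.Dual ℤ Γ} {m : M.V}
    (h : ∀ (R : CommAlgCat.{u} k) (x : (torusArc k Γ).obj R),
      M.coact x m = (ev ((arcConst k Γ).app R x) l : R) ⊗ₜ m) : m ∈ charSpace M l := by
  refine ⟨fun R x => ?_, fun R x hx => ?_⟩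
  · refine (h R _).trans ?_
    rw [arcConst_constArc]
    rfl
  · refine (h R x).trans ?_
    rw [hx]
    rfl

theorem map_mem_charSpace {M N : FRep (torusArc k Γ)} (f : M ⟶ N) {l : Module.Dual ℤ Γ} {m : M.V}
    (hm : m ∈ charSpace M l) : FRep.lin f m ∈ charSpace N l :=
  mem_charSpace fun R x => by
    rw [← FRep.hom_coact, coact_of_mem_charSpace hm, LinearMap.baseChange_tmul]

/-- The components of a `T(𝔪)`-invariant vector in the weight spaces of `T` are invariant. -/
theorem proj_mem_charSpace {M : FRep (torusArc k Γ)} {m : M.V} (hm : m ∈ unipotentInvariants M) :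
    ∃ s : Finset (Module.Dual ℤ Γ), m = ∑ l ∈ s, (torusDiag k Γ).proj M l m ∧
      ∀ l ∈ s, (torusDiag k Γ).proj M l m ∈ charSpace M l := by
  obtain ⟨s, hs⟩ := (torusDiag k Γ).exists_sum_proj M m
  refine ⟨s, hs, fun l hl => ⟨(torusDiag k Γ).proj_mem M l m, ?_⟩⟩
  refine mem_of_sum_mem M id Function.injective_id s (fun l => (torusDiag k Γ).proj M l m)
    (fun l => (torusDiag k Γ).proj_mem M l m) ?_ l hl
  rwa [← hs]

theorem eSpace_eq_iSup (s : LevelSection c) (M : FRep (torusArc k Γ)) :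
    eSpace s M = ⨆ χ, charSpace M (s.1 χ) := by
  refine le_antisymm (fun m hm => ?_) (iSup_le fun χ m hm => ⟨?_, hm.2⟩)
  · obtain ⟨f, hf, hsum⟩ := (Submodule.mem_iSup_iff_exists_finsupp _ _).1 hm.1
    have hinj : Function.Injective s.1 := fun χ ψ h => by rw [← s.2 χ, ← s.2 ψ, h]
    have hmem : ∀ χ ∈ f.support, f χ ∈ unipotentInvariants M := by
      refine mem_of_sum_mem M s.1 hinj f.support f hf ?_
      have := hm.2
      rw [← hsum] at this
      exact this
    rw [← hsum]
    exact sum_mem fun χ hχ => Submodule.mem_iSup_of_mem χ ⟨hf χ, hmem χ hχ⟩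
  · exact Submodule.mem_iSup_of_mem χ hm.1

namespace Lifts

variable {F : Frame k c} {H : HeisenbergExtension k c} (L : Lifts F H) (M : HeisMod H)

theorem kact_base_base (γ γ' : Γ) (m : M.obj.V) :
    M.obj.kact (L.base γ) (M.obj.kact (L.base γ') m) =
      (L.κ γ γ' : k) • M.obj.kact (L.base (γ + γ')) m := by
  have h1 := (L.exists_cocycle γ γ').choose_spec
  have h2 := congrArg (fun g => M.obj.coact g m) h1
  rw [← M.obj.kact_mul]
  refine (TensorProduct.lid k M.obj.V).symm.injective ?_
  refine (M.obj.one_tmul_kact _ m).trans (h2.trans ?_)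
  rw [M.obj.coact_mul, act_scalar, ← M.obj.one_tmul_kact]
  exact (TensorProduct.tmul_smul (L.κ γ γ' : k) (1 : k) (M.obj.kact (L.base (γ + γ')) m)).symm

theorem kact_base_zero (m : M.obj.V) : M.obj.kact (L.base 0) m = m := by
  rw [L.base_zero, M.obj.kact_one]

/-- Elements of `T(O)` commute with the lifts of `t^γ` up to a character. -/
theorem coact_arc_kact (γ : Γ) (x : (torusArc k Γ).obj R) (m : M.obj.V) :
    M.obj.coact (H.splitting.app R x) (M.obj.kact (L.base γ) m) =
      (((ev ((arcConst k Γ).app R x) (c γ))⁻¹ : (R : Type u)ˣ) : R) •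
        (M.obj.kact (L.base γ)).baseChange R (M.obj.coact (H.splitting.app R x) m) := by
  have h := congrArg (fun g => M.obj.coact g m) (L.t_arc γ x).symm
  beta_reduce at h
  rw [M.obj.coact_mul, M.obj.coact_mul, act_scalar, M.obj.coact_mul, t, M.obj.coact_map,
    M.obj.act_map] at h
  exact h

/-- The lifts of `t^γ` shift the weights of `T` by `-c(γ)`. -/
theorem kact_mem_charSpace {γ : Γ} {l : Module.Dual ℤ Γ} {m : M.obj.V}
    (hm : m ∈ charSpace ((resArc H).obj M) l) :
    M.obj.kact (L.base γ) m ∈ charSpace ((resArc H).obj M) (l - c γ) := by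
  refine mem_charSpace fun R x => (L.coact_arc_kact M γ x m).trans ?_
  have h := coact_of_mem_charSpace hm x
  refine (congrArg (fun z => _ • (M.obj.kact (L.base γ)).baseChange R z) h).trans ?_
  have h2 : (ev ((arcConst k Γ).app R x) (c γ))⁻¹ * ev ((arcConst k Γ).app R x) l =
      ev ((arcConst k Γ).app R x) (l - c γ) := by
    rw [sub_eq_neg_add, ev_add, ← neg_one_zsmul, ev_zsmul, zpow_neg_one]
  rw [← h2, Units.val_mul]
  exact TensorProduct.smul_tmul' _ _ _

/-- A subspace stable under the generators of the negative part and the lifts of `t^γ` is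
everything as soon as it contains the subspaces on which `T(O)` acts by the characters `s(χ)`. -/
theorem eq_top_of_stable (s : LevelSection c) {K : Submodule k M.obj.V}
    (hb : ∀ p, ∀ m ∈ K, L.b M p m ∈ K) (ht : ∀ γ, ∀ m ∈ K, M.obj.kact (L.base γ) m ∈ K)
    (hK : ∀ χ, charSpace ((resArc H).obj M) (s.1 χ) ≤ K) : K = ⊤ := by
  have h1 : ∀ l, charSpace ((resArc H).obj M) l ≤ K := fun l m hm => by
    obtain ⟨γ, hγ⟩ : l - s.1 ((LinearMap.range c).mkQ l) ∈ LinearMap.range c := by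
      rw [← Submodule.Quotient.mk_eq_zero, Submodule.Quotient.mk_sub, sub_eq_zero]
      exact (s.2 _).symm
    have h2 := L.kact_mem_charSpace M (γ := γ) hm
    rw [hγ, sub_sub_cancel] at h2
    have h3 := ht (-γ) _ (hK _ h2)
    rw [L.kact_base_base M (-γ) γ m, neg_add_cancel, L.kact_base_zero M m] at h3
    exact (Submodule.smul_mem_iff K (L.κ (-γ) γ).ne_zero).1 h3
  have h2 : unipotentInvariants ((resArc H).obj M) ≤ K := fun m hm => by
    obtain ⟨t, h3, h4⟩ := proj_mem_charSpace hm
    rw [h3]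
    exact sum_mem fun l hl => h1 l (h4 l hl)
  have hcomm : ∀ p q, (L.b M p * L.b M q : Module.End k M.obj.V) = L.b M q * L.b M p :=
    fun p q => LinearMap.ext fun m => L.b_comm M p q m
  obtain ⟨θ', hθ'⟩ := exists_commAeval (k := k) (L.b M) hcomm
  obtain ⟨θ, hθ⟩ := exists_commAeval (k := k) (fun p => -L.b M p : F.P → Module.End k M.obj.V)
    fun p q => by
      have := Commute.neg_left (Commute.neg_right (hcomm p q))
      exact this
  have h3 : ∀ f, ∀ m ∈ K, θ' f m ∈ K := fun f => by
    refine poly_induction (Pr := fun f => ∀ m ∈ K, θ' f m ∈ K) f (fun a m hm => ?_)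
      (fun f g hf hg m hm => ?_) fun f p hf m hm => ?_
    · rw [AlgHom.commutes]
      exact Submodule.smul_mem K a hm
    · rw [map_add]
      exact K.add_mem (hf m hm) (hg m hm)
    · rw [map_mul, hθ']
      exact hf _ (hb p m hm)
  refine top_unique fun m _ => ?_
  have h4 := F.contract_vac (M := (resArc H).obj M) hcomm hθ hθ' m
  rw [← h4]
  generalize F.univ ((resArc H).obj M) m = z
  induction z using TensorProduct.induction_on with
  | zero => rw [map_zero]; exact K.zero_mem
  | tmul f v =>
    exact h3 f _ (h2 (F.vac_mem (M := (resArc H).obj M) hcomm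
      (fun R x p m => L.act_arc_b M p x m) hθ v))
  | add a b ha hb => rw [map_add]; exact K.add_mem ha hb

end Lifts

end Generation


/-! ### Modules defined by normal forms -/

section NormalFormModules

variable {k : Type u} [Field k] [CharZero k] {Γ : Type u} [AddCommGroup Γ]
  {c : Γ →ₗ[ℤ] Γ →ₗ[ℤ] ℤ} {F : Frame k c} {H : HeisenbergExtension k c}
  {R S : CommAlgCat.{u} k}

/-- An action on `V` of the points of `T(F)~` that have a normal form. -/
structure NfAction (L : Lifts F H) (V : Type u) [AddCommGroup V] [Module k V] where
  op : ∀ (R : CommAlgCat.{u} k) (_ : (R : Type u)ˣ) (_ : Γ) (_ : (torusArc k Γ).obj R) (_ : F.N R),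
    Module.End R ((R : Type u) ⊗[k] V)
  map_op : ∀ {R S : CommAlgCat.{u} k} (φ : R ⟶ S) (a : (R : Type u)ˣ) (γ : Γ)
    (x : (torusArc k Γ).obj R) (ν : F.N R) (w : (R : Type u) ⊗[k] V),
    bmap V φ (op R a γ x ν w) = op S (Units.map (φ.hom : (R : Type u) →* S) a) γ
      ((torusArc k Γ).map φ x) (F.mapN φ ν) (bmap V φ w)
  op_mul : ∀ {R : CommAlgCat.{u} k} (a a' : (R : Type u)ˣ) (γ γ' : Γ)
    (x x' : (torusArc k Γ).obj R) (ν ν' : F.N R),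
    op R a γ x ν * op R a' γ' x' ν' =
      op R (a * a' * L.κR R γ γ' * (ev ((arcConst k Γ).app R x) (c γ'))⁻¹ *
        nilExpUnit R (-F.pair (F.logCoord x') ν)) (γ + γ') (x * x') (ν + ν')
  op_scalar : ∀ (R : CommAlgCat.{u} k) (a : (R : Type u)ˣ) (w : (R : Type u) ⊗[k] V),
    op R a 0 1 0 w = (a : R) • w

namespace NfAction

variable {L : Lifts F H} {V : Type u} [AddCommGroup V] [Module k V] (T : NfAction L V)

/-- The points that have a normal form. -/
def IsNf (L : Lifts F H) (g : H.G.obj R) : Prop := ∃ a γ x ν, g = L.nf a γ x ν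

open scoped Classical in
/-- The operator of a point that has a normal form, and a junk value for other points. -/
def opNf (g : H.G.obj R) : Module.End R ((R : Type u) ⊗[k] V) :=
  if h : ∃ f, ∃ a γ x ν, g = L.nf a γ x ν ∧ f = T.op R a γ x ν then h.choose else 0

theorem opNf_nf (a : (R : Type u)ˣ) (γ : Γ) (x : (torusArc k Γ).obj R) (ν : F.N R) :
    T.opNf (L.nf a γ x ν) = T.op R a γ x ν := by
  have h : ∃ f, ∃ a' γ' x' ν', L.nf a γ x ν = L.nf a' γ' x' ν' ∧ f = T.op R a' γ' x' ν' :=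
    ⟨_, a, γ, x, ν, rfl, rfl⟩
  rw [opNf, dif_pos h]
  obtain ⟨a', γ', x', ν', h1, h2⟩ := h.choose_spec
  rw [h2]
  -- Normal forms are unique only over nontrivial algebras.
  rcases subsingleton_or_nontrivial (R : Type u) with hR | hR
  · have := Module.subsingleton (R : Type u) ((R : Type u) ⊗[k] V)
    exact LinearMap.ext fun w => Subsingleton.elim _ _
  · obtain ⟨rfl, rfl, rfl, rfl⟩ := L.nf_unique h1
    rfl

theorem bmap_opNf {g : H.G.obj R} (hg : IsNf L g) (φ : R ⟶ S) (w : (R : Type u) ⊗[k] V) :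
    bmap V φ (T.opNf g w) = T.opNf (H.G.map φ g) (bmap V φ w) := by
  obtain ⟨a, γ, x, ν, rfl⟩ := hg
  rw [L.nf_map, opNf_nf, opNf_nf, T.map_op]

theorem opNf_mul {g h : H.G.obj R} (hg : IsNf L g) (hh : IsNf L h) (w : (R : Type u) ⊗[k] V) :
    T.opNf (g * h) w = T.opNf g (T.opNf h w) := by
  obtain ⟨a, γ, x, ν, rfl⟩ := hg
  obtain ⟨a', γ', x', ν', rfl⟩ := hh
  rw [L.nf_mul, opNf_nf, opNf_nf, opNf_nf, ← T.op_mul, Module.End.mul_apply]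

/-- The operators of local normal forms glue. -/
theorem exists_act (g : H.G.obj R) (w : (R : Type u) ⊗[k] V) :
    ∃ v : (R : Type u) ⊗[k] V, ∀ (S : CommAlgCat.{u} k) (φ : R ⟶ S), IsNf L (H.G.map φ g) →
      bmap V φ v = T.opNf (H.G.map φ g) (bmap V φ w) :=
  exists_glue_bmap (Q := fun S φ => IsNf L (H.G.map φ g)) (L.locally_nf g)
    (fun S φ => T.opNf (H.G.map φ g) (bmap V φ w)) fun S φ S' ψ h => by
      rw [T.bmap_opNf h, H.map_map, bmap_comp]

/-- The operator of an arbitrary point, glued from local normal forms. -/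
def actFun (g : H.G.obj R) (w : (R : Type u) ⊗[k] V) : (R : Type u) ⊗[k] V :=
  (T.exists_act g w).choose

theorem bmap_actFun {g : H.G.obj R} {φ : R ⟶ S} (h : IsNf L (H.G.map φ g))
    (w : (R : Type u) ⊗[k] V) :
    bmap V φ (T.actFun g w) = T.opNf (H.G.map φ g) (bmap V φ w) :=
  (T.exists_act g w).choose_spec S φ h

theorem actFun_eq {g : H.G.obj R} {v w : (R : Type u) ⊗[k] V}
    (h : ∀ (S : CommAlgCat.{u} k) (φ : R ⟶ S), IsNf L (H.G.map φ g) →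
      bmap V φ v = T.opNf (H.G.map φ g) (bmap V φ w)) : T.actFun g w = v :=
  eq_of_locally_bmap ((L.locally_nf g).mono fun S φ hφ => by
    rw [T.bmap_actFun hφ, h S φ hφ])

theorem actFun_nf (a : (R : Type u)ˣ) (γ : Γ) (x : (torusArc k Γ).obj R) (ν : F.N R)
    (w : (R : Type u) ⊗[k] V) : T.actFun (L.nf a γ x ν) w = T.op R a γ x ν w :=
  T.actFun_eq fun S φ _ => by
    rw [← T.bmap_opNf ⟨a, γ, x, ν, rfl⟩, opNf_nf]

theorem actFun_one (w : (R : Type u) ⊗[k] V) : T.actFun (1 : H.G.obj R) w = w := by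
  rw [← map_one (H.scalar R), ← L.nf_scalar, actFun_nf, T.op_scalar, Units.val_one, one_smul]

theorem actFun_mul (g h : H.G.obj R) (w : (R : Type u) ⊗[k] V) :
    T.actFun (g * h) w = T.actFun g (T.actFun h w) := by
  refine eq_of_locally_bmap (((L.locally_nf g).and (L.locally_nf h)).mono fun S φ hφ => ?_)
  have hg : IsNf L (H.G.map φ g) := hφ.1
  have hh : IsNf L (H.G.map φ h) := hφ.2
  have hgh : IsNf L (H.G.map φ (g * h)) := by
    obtain ⟨a, γ, x, ν, h1⟩ := hg
    obtain ⟨a', γ', x', ν', h2⟩ := hh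
    rw [map_mul, h1, h2, L.nf_mul]
    exact ⟨_, _, _, _, rfl⟩
  rw [T.bmap_actFun hgh, T.bmap_actFun hg, T.bmap_actFun hh, map_mul, T.opNf_mul hg hh]

theorem actFun_add (g : H.G.obj R) (w w' : (R : Type u) ⊗[k] V) :
    T.actFun g (w + w') = T.actFun g w + T.actFun g w' :=
  T.actFun_eq fun S φ hφ => by
    rw [map_add, map_add, map_add, T.bmap_actFun hφ, T.bmap_actFun hφ]

theorem actFun_smul (g : H.G.obj R) (r : R) (w : (R : Type u) ⊗[k] V) :
    T.actFun g (r • w) = r • T.actFun g w :=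
  T.actFun_eq fun S φ hφ => by
    rw [bmap_smul, bmap_smul, map_smul, T.bmap_actFun hφ]

theorem bmap_actFun_natural (φ : R ⟶ S) (g : H.G.obj R) (w : (R : Type u) ⊗[k] V) :
    bmap V φ (T.actFun g w) = T.actFun (H.G.map φ g) (bmap V φ w) := by
  refine (T.actFun_eq fun S' ψ hψ => ?_).symm
  rw [H.map_map] at hψ
  rw [← bmap_comp, T.bmap_actFun hψ, H.map_map, bmap_comp]

/-- The module over `T(F)~` given by an action of the points that have a normal form. -/
def toMod : HeisMod H :=
  ⟨{  V := V
      act := fun R =>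
        { toFun := fun g =>
            { toFun := T.actFun g
              map_add' := T.actFun_add g
              map_smul' := T.actFun_smul g }
          map_one' := LinearMap.ext T.actFun_one
          map_mul' := fun g h => LinearMap.ext (T.actFun_mul g h) }
      natural := T.bmap_actFun_natural }, fun R a x => by
    refine Eq.trans ?_ (T.op_scalar R a x)
    rw [← T.actFun_nf, L.nf_scalar]
    rfl⟩

theorem toMod_act_nf (a : (R : Type u)ˣ) (γ : Γ) (x : (torusArc k Γ).obj R) (ν : F.N R)
    (w : (R : Type u) ⊗[k] V) : T.toMod.obj.act R (L.nf a γ x ν) w = T.op R a γ x ν w :=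
  T.actFun_nf a γ x ν w

end NfAction

end NormalFormModules


/-! ### The model modules -/

section Model

variable {k : Type u} [Field k] [CharZero k] {Γ : Type u} [AddCommGroup Γ]
  {c : Γ →ₗ[ℤ] Γ →ₗ[ℤ] ℤ} {F : Frame k c} {H : HeisenbergExtension k c}
  {R S : CommAlgCat.{u} k}

/-- The operator `single d q ↦ single (σ d) (u_d τ(q))`. -/
def monoOp {A Q D : Type*} [CommRing A] [CommRing Q] [Algebra A Q] (σ : D → D) (u : D → Q)
    (τ : Q →ₐ[A] Q) : Module.End A (D →₀ Q) :=
  Finsupp.lsum A fun d => (Finsupp.lsingle (σ d)).comp ((LinearMap.mulLeft A (u d)).comp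
    τ.toLinearMap)

theorem monoOp_single {A Q D : Type*} [CommRing A] [CommRing Q] [Algebra A Q] (σ : D → D)
    (u : D → Q) (τ : Q →ₐ[A] Q) (d : D) (q : Q) :
    monoOp σ u τ (Finsupp.single d q) = Finsupp.single (σ d) (u d * τ q) := by
  rw [monoOp, Finsupp.lsum_single]
  rfl

theorem monoOp_mul {A Q D : Type*} [CommRing A] [CommRing Q] [Algebra A Q] (σ σ' : D → D)
    (u u' : D → Q) (τ τ' : Q →ₐ[A] Q) :
    monoOp σ u τ * monoOp σ' u' τ' =
      monoOp (fun d => σ (σ' d)) (fun d => u (σ' d) * τ (u' d)) (τ.comp τ') := by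
  refine Finsupp.lhom_ext fun d q => ?_
  rw [Module.End.mul_apply, monoOp_single, monoOp_single, monoOp_single, map_mul, mul_assoc]
  rfl

variable (F R) in
/-- Polynomials in the generators of the negative part. -/
abbrev negPoly : CommAlgCat.{u} k := CommAlgCat.of k (MvPolynomial F.P (R : Type u))

variable (F R) in
/-- Constant polynomials. -/
def negConst : R ⟶ negPoly F R :=
  CommAlgCat.ofHom (IsScalarTower.toAlgHom k (R : Type u) (MvPolynomial F.P (R : Type u)))

/-- The translation `X ↦ X + y` of polynomials. -/
def transl (y : F.P → R) :
    MvPolynomial F.P (R : Type u) →ₐ[(R : Type u)] MvPolynomial F.P (R : Type u) :=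
  MvPolynomial.aeval fun p => MvPolynomial.X p + MvPolynomial.C (y p)

theorem transl_X (y : F.P → R) (p : F.P) :
    transl y (MvPolynomial.X p) = MvPolynomial.X p + MvPolynomial.C (y p) :=
  MvPolynomial.aeval_X _ p

theorem transl_C (y : F.P → R) (r : R) : transl y (MvPolynomial.C r) = MvPolynomial.C r :=
  (transl y).commutes r

theorem transl_comp (y y' : F.P → R) : (transl y).comp (transl y') = transl (y + y') :=
  MvPolynomial.algHom_ext fun p => by
    rw [AlgHom.comp_apply, transl_X, transl_X, map_add, transl_X, transl_C, Pi.add_apply,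
      MvPolynomial.C_add, add_assoc]

theorem transl_zero : transl (0 : F.P → R) = AlgHom.id _ _ :=
  MvPolynomial.algHom_ext fun p => by
    rw [transl_X, Pi.zero_apply, MvPolynomial.C_0, add_zero]
    rfl

/-- Translation as a morphism of algebras. -/
def translHom (y : F.P → R) : negPoly F R ⟶ negPoly F R :=
  CommAlgCat.ofHom ((transl y).restrictScalars k)

theorem map_transl (φ : R ⟶ S) (y : F.P → R) (q : MvPolynomial F.P (R : Type u)) :
    MvPolynomial.map φ.hom.toRingHom (transl y q) =
      transl (fun p => φ.hom (y p)) (MvPolynomial.map φ.hom.toRingHom q) := by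
  induction q using MvPolynomial.induction_on with
  | C a => rw [transl_C, MvPolynomial.map_C, transl_C]
  | add f g hf hg => simp only [map_add, hf, hg]
  | mul_X f p hf =>
    rw [map_mul, map_mul, map_mul, map_mul, hf, transl_X, MvPolynomial.map_X, transl_X, map_add,
      MvPolynomial.map_X, MvPolynomial.map_C]
    rfl

/-- The nilpotent polynomial `∑ ν_p X_p`. -/
def negLin (ν : F.N R) : nilradical (negPoly F R) :=
  F.pair (fun p => (MvPolynomial.X p : MvPolynomial F.P (R : Type u)))
    (F.mapN (negConst F R) ν)

/-- The polynomial `exp(∑ ν_p X_p)`. -/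
def negExp (ν : F.N R) : (negPoly F R : Type u)ˣ := nilExpUnit (negPoly F R) (negLin ν)

theorem negExp_add (ν ν' : F.N R) : negExp (ν + ν') = negExp ν * negExp ν' := by
  rw [negExp, negLin, map_add, map_add, nilExpUnit_add]
  rfl

theorem negExp_zero : negExp (0 : F.N R) = 1 := by
  rw [negExp, negLin, map_zero, map_zero, nilExpUnit_zero]

theorem mapN_comp {T : CommAlgCat.{u} k} (φ : R ⟶ S) (ψ : S ⟶ T) (ν : F.N R) :
    F.mapN ψ (F.mapN φ ν) = F.mapN (φ ≫ ψ) ν := by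
  refine Finsupp.ext fun p => Subtype.ext ?_
  rw [F.coe_mapN_apply, F.coe_mapN_apply, F.coe_mapN_apply]
  rfl

/-- The map of polynomials induced by a map of coefficients. -/
def negMap (φ : R ⟶ S) : negPoly F R ⟶ negPoly F S :=
  CommAlgCat.ofHom (MvPolynomial.mapAlgHom φ.hom)

theorem negConst_map (φ : R ⟶ S) : negConst F R ≫ negMap φ = φ ≫ negConst F S := by
  refine CommAlgCat.hom_ext (AlgHom.ext fun r => ?_)
  exact MvPolynomial.map_C φ.hom.toRingHom r

theorem map_negExp (φ : R ⟶ S) (ν : F.N R) :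
    Units.map ((negMap (F := F) φ).hom : (negPoly F R : Type u) →* (negPoly F S : Type u))
      (negExp ν) =
      negExp (F.mapN φ ν) := by
  rw [negExp, map_nilExpUnit, negExp, negLin, negLin, ← F.pair_map, mapN_comp, mapN_comp,
    negConst_map]
  congr 2
  refine congrArg F.pair (funext fun p => ?_)
  exact MvPolynomial.map_X φ.hom.toRingHom p

theorem transl_negExp (y : F.P → R) (ν : F.N R) :
    Units.map ((translHom y).hom : (negPoly F R : Type u) →* (negPoly F R : Type u)) (negExp ν) =
      negExp ν * Units.map ((negConst F R).hom : (R : Type u) →* (negPoly F R : Type u))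
        (nilExpUnit R (F.pair y ν)) := by
  have h1 : negConst F R ≫ translHom y = negConst F R :=
    CommAlgCat.hom_ext (AlgHom.ext fun r => transl_C y r)
  rw [negExp, map_nilExpUnit, map_nilExpUnit, negLin, ← F.pair_map, mapN_comp, h1,
    ← nilExpUnit_add, ← F.pair_map, ← F.pair_add]
  congr 2
  exact congrArg F.pair (funext fun p => transl_X y p)

variable {B : Type u} (l : B → Module.Dual ℤ Γ) (L : Lifts F H)

/-- The scalar part of the coefficient by which `a t^γ x ν` acts on the summand `d` of the
model. -/
def modelScalar (a : (R : Type u)ˣ) (γ : Γ) (x : (torusArc k Γ).obj R) (ν : F.N R) (d : B × Γ) :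
    (R : Type u)ˣ :=
  a * L.κR R γ d.2 * ev ((arcConst k Γ).app R x) (l d.1 - c d.2) *
    nilExpUnit R (F.pair (F.logCoord x) ν)

/-- The coefficient by which `a t^γ x ν` acts on the summand `d` of the model. -/
def modelCoeff (a : (R : Type u)ˣ) (γ : Γ) (x : (torusArc k Γ).obj R) (ν : F.N R) (d : B × Γ) :
    (negPoly F R : Type u)ˣ :=
  Units.map ((negConst F R).hom : (R : Type u) →* (negPoly F R : Type u))
    (modelScalar l L a γ x ν d) * negExp ν

theorem map_modelScalar (φ : R ⟶ S) (a : (R : Type u)ˣ) (γ : Γ) (x : (torusArc k Γ).obj R)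
    (ν : F.N R) (d : B × Γ) :
    Units.map (φ.hom : (R : Type u) →* S) (modelScalar l L a γ x ν d) =
      modelScalar l L (Units.map (φ.hom : (R : Type u) →* S) a) γ ((torusArc k Γ).map φ x)
        (F.mapN φ ν) d := by
  have h : F.logCoord ((torusArc k Γ).map φ x) = fun p => φ.hom (F.logCoord x p) :=
    funext fun p => F.logCoord_map φ x p
  rw [modelScalar, modelScalar, map_mul, map_mul, map_mul, L.map_κR, map_nilExpUnit, h,
    F.pair_map, Frame.arcConst_map, ev_map]
  rfl

theorem map_modelCoeff (φ : R ⟶ S) (a : (R : Type u)ˣ) (γ : Γ) (x : (torusArc k Γ).obj R)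
    (ν : F.N R) (d : B × Γ) :
    Units.map ((negMap (F := F) φ).hom : (negPoly F R : Type u) →* (negPoly F S : Type u))
      (modelCoeff l L a γ x ν d) =
      modelCoeff l L (Units.map (φ.hom : (R : Type u) →* S) a) γ ((torusArc k Γ).map φ x)
        (F.mapN φ ν) d := by
  rw [modelCoeff, modelCoeff, map_mul, map_negExp, ← map_modelScalar]
  congr 1
  refine Units.ext ?_
  exact MvPolynomial.map_C φ.hom.toRingHom _

theorem modelScalar_mul (a a' : (R : Type u)ˣ) (γ γ' : Γ) (x x' : (torusArc k Γ).obj R)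
    (ν ν' : F.N R) (d : B × Γ) :
    modelScalar l L a γ x ν (d.1, γ' + d.2) *
        (nilExpUnit R (F.pair (F.logCoord x) ν') * modelScalar l L a' γ' x' ν' d) =
      modelScalar l L (a * a' * L.κR R γ γ' * (ev ((arcConst k Γ).app R x) (c γ'))⁻¹ *
        nilExpUnit R (-F.pair (F.logCoord x') ν)) (γ + γ') (x * x') (ν + ν') d := by
  have h1 := L.κR_assoc (R := R) γ γ' d.2
  have h2 : ev ((arcConst k Γ).app R (x * x')) (l d.1 - c d.2) =
      ev ((arcConst k Γ).app R x) (l d.1 - c d.2) *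
        ev ((arcConst k Γ).app R x') (l d.1 - c d.2) := by
    rw [map_mul]
    exact ev_mul _ _ _
  have h3 : ev ((arcConst k Γ).app R x) (l d.1 - c d.2) =
      ev ((arcConst k Γ).app R x) (l d.1 - c (γ' + d.2)) *
        ev ((arcConst k Γ).app R x) (c γ') := by
    rw [← ev_add, map_add]
    congr 1
    abel
  have h4 : nilExpUnit R (F.pair (F.logCoord (x * x')) (ν + ν')) =
      nilExpUnit R (F.pair (F.logCoord x) ν) * nilExpUnit R (F.pair (F.logCoord x) ν') *
        (nilExpUnit R (F.pair (F.logCoord x') ν) * nilExpUnit R (F.pair (F.logCoord x') ν')) := by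
    rw [F.logCoord_mul, F.pair_add, nilExpUnit_add, map_add, map_add, nilExpUnit_add,
      nilExpUnit_add]
  have h5 : nilExpUnit R (-F.pair (F.logCoord x') ν) =
      (nilExpUnit R (F.pair (F.logCoord x') ν))⁻¹ := by
    rw [eq_inv_iff_mul_eq_one, ← nilExpUnit_add, neg_add_cancel, nilExpUnit_zero]
  unfold modelScalar
  rw [h2, h3, h4, h5]
  generalize nilExpUnit R (F.pair (F.logCoord x') ν) = e₁
  generalize nilExpUnit R (F.pair (F.logCoord x) ν') = e₂
  generalize nilExpUnit R (F.pair (F.logCoord x) ν) = e₃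
  generalize nilExpUnit R (F.pair (F.logCoord x') ν') = e₄
  generalize ev ((arcConst k Γ).app R x) (c γ') = e₅
  generalize ev ((arcConst k Γ).app R x) (l d.1 - c (γ' + d.2)) = e₆
  generalize ev ((arcConst k Γ).app R x') (l d.1 - c d.2) = e₇
  change a * L.κR R γ (γ' + d.2) * e₆ * e₃ * (e₂ * (a' * L.κR R γ' d.2 * e₇ * e₄)) = _
  generalize L.κR R γ γ' = κ₁ at *
  generalize L.κR R (γ + γ') d.2 = κ₂ at *
  generalize L.κR R γ' d.2 = κ₃ at *
  generalize L.κR R γ (γ' + d.2) = κ₄ at *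
  calc a * κ₄ * e₆ * e₃ * (e₂ * (a' * κ₃ * e₇ * e₄))
      = a * a' * (κ₃ * κ₄) * e₆ * e₇ * e₂ * e₃ * e₄ * (e₁⁻¹ * e₁) * (e₅⁻¹ * e₅) := by
        rw [inv_mul_cancel, inv_mul_cancel, mul_one, mul_one]
        ac_rfl
    _ = _ := by
        rw [← h1]
        ac_rfl

theorem mul_rearrange {A : Type*} [CommMonoid A] (a e b e' n : A) :
    a * e * (b * (e' * n)) = a * (n * b) * (e * e') := by
  ac_rfl

theorem modelCoeff_mul (a a' : (R : Type u)ˣ) (γ γ' : Γ) (x x' : (torusArc k Γ).obj R)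
    (ν ν' : F.N R) (d : B × Γ) :
    modelCoeff l L a γ x ν (d.1, γ' + d.2) *
      Units.map ((translHom (F.logCoord x)).hom : (negPoly F R : Type u) →* (negPoly F R : Type u))
        (modelCoeff l L a' γ' x' ν' d) =
      modelCoeff l L (a * a' * L.κR R γ γ' * (ev ((arcConst k Γ).app R x) (c γ'))⁻¹ *
        nilExpUnit R (-F.pair (F.logCoord x') ν)) (γ + γ') (x * x') (ν + ν') d := by
  have h : Units.map ((translHom (F.logCoord x)).hom : (negPoly F R : Type u) →* negPoly F R)
      (Units.map ((negConst F R).hom : (R : Type u) →* (negPoly F R : Type u))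
        (modelScalar l L a' γ' x' ν' d)) =
      Units.map ((negConst F R).hom : (R : Type u) →* (negPoly F R : Type u))
        (modelScalar l L a' γ' x' ν' d) := Units.ext (transl_C _ _)
  rw [modelCoeff, modelCoeff, modelCoeff, ← modelScalar_mul, map_mul, h, transl_negExp,
    negExp_add, map_mul, map_mul]
  exact mul_rearrange _ _ _ _ _

end Model


section ModelModule

variable {k : Type u} [Field k] [CharZero k] {Γ : Type u} [AddCommGroup Γ]
  {c : Γ →ₗ[ℤ] Γ →ₗ[ℤ] ℤ} {F : Frame k c} {H : HeisenbergExtension k c}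
  {R S : CommAlgCat.{u} k} {B : Type u}

variable (F B) in
/-- The space of the model: a copy of the polynomials in the generators of the negative part for
every basis vector and every `t^γ`. -/
abbrev ModelSpace : Type u := (B × Γ) →₀ MvPolynomial F.P k

open scoped Classical in
variable (F B R) in
/-- The base change of the space of the model. -/
def modelEquiv : (R : Type u) ⊗[k] ModelSpace F B ≃ₗ[(R : Type u)]
    ((B × Γ) →₀ MvPolynomial F.P (R : Type u)) :=
  (TensorProduct.finsuppRight k (R : Type u) (R : Type u) (MvPolynomial F.P k) (B × Γ)).trans
    (Finsupp.mapRange.linearEquiv (MvPolynomial.algebraTensorAlgEquiv k (R : Type u)).toLinearEquiv)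

theorem modelEquiv_tmul_single (r : R) (d : B × Γ) (q : MvPolynomial F.P k) :
    modelEquiv F R B (r ⊗ₜ Finsupp.single d q) =
      Finsupp.single d (r • MvPolynomial.map (algebraMap k R) q) := by
  classical
  rw [modelEquiv, LinearEquiv.trans_apply, TensorProduct.finsuppRight_tmul_single]
  refine (Finsupp.mapRange_single (hf := map_zero _)).trans ?_
  exact congrArg _ (MvPolynomial.algebraTensorAlgEquiv_tmul k (A := (R : Type u)) r q)

theorem modelEquiv_bmap (φ : R ⟶ S) (w : (R : Type u) ⊗[k] ModelSpace F B) :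
    modelEquiv F S B (bmap _ φ w) =
      Finsupp.mapRange.addMonoidHom (MvPolynomial.map φ.hom.toRingHom).toAddMonoidHom
        (modelEquiv F R B w) := by
  induction w using TensorProduct.induction_on with
  | zero => simp
  | add a b ha hb => simp only [map_add, ha, hb]
  | tmul r f =>
    induction f using Finsupp.induction_linear with
    | zero => simp
    | add f g hf hg => simp only [TensorProduct.tmul_add, map_add, hf, hg]
    | single d q =>
      rw [bmap_tmul, modelEquiv_tmul_single, modelEquiv_tmul_single]
      refine Eq.trans ?_ (Finsupp.mapRange_single (hf := map_zero _)).symm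
      refine congrArg _ ?_
      change _ = MvPolynomial.map φ.hom.toRingHom (r • MvPolynomial.map (algebraMap k R) q)
      rw [MvPolynomial.smul_eq_C_mul, MvPolynomial.smul_eq_C_mul, map_mul, MvPolynomial.map_C,
        MvPolynomial.map_map]
      congr 2
      have h : algebraMap k (S : Type u) = φ.hom.toRingHom.comp (algebraMap k (R : Type u)) :=
        RingHom.ext fun a => (φ.hom.commutes a).symm
      rw [h]

variable (l : B → Module.Dual ℤ Γ) (L : Lifts F H)

/-- The operator of `a t^γ x ν` on the model. -/
def modelOp (a : (R : Type u)ˣ) (γ : Γ) (x : (torusArc k Γ).obj R) (ν : F.N R) :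
    Module.End (R : Type u) ((B × Γ) →₀ MvPolynomial F.P (R : Type u)) :=
  monoOp (fun d => (d.1, γ + d.2))
    (fun d => ((modelCoeff l L a γ x ν d : (negPoly F R : Type u)ˣ) : negPoly F R))
    (transl (F.logCoord x))

theorem modelOp_single (a : (R : Type u)ˣ) (γ : Γ) (x : (torusArc k Γ).obj R) (ν : F.N R)
    (d : B × Γ) (q : MvPolynomial F.P (R : Type u)) :
    modelOp l L a γ x ν (Finsupp.single d q) = Finsupp.single (d.1, γ + d.2)
      (((modelCoeff l L a γ x ν d : (negPoly F R : Type u)ˣ) : negPoly F R) *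
        transl (F.logCoord x) q) :=
  monoOp_single _ _ _ _ _

theorem modelOp_mul (a a' : (R : Type u)ˣ) (γ γ' : Γ) (x x' : (torusArc k Γ).obj R)
    (ν ν' : F.N R) : modelOp l L a γ x ν * modelOp l L a' γ' x' ν' =
      modelOp l L (a * a' * L.κR R γ γ' * (ev ((arcConst k Γ).app R x) (c γ'))⁻¹ *
        nilExpUnit R (-F.pair (F.logCoord x') ν)) (γ + γ') (x * x') (ν + ν') := by
  rw [modelOp, modelOp, modelOp, monoOp_mul, transl_comp, ← F.logCoord_mul]
  congr 1
  · exact funext fun d => Prod.ext rfl (add_assoc _ _ _).symm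
  · exact funext fun d => congrArg Units.val (modelCoeff_mul l L a a' γ γ' x x' ν ν' d)

theorem modelOp_scalar (a : (R : Type u)ˣ) (f : (B × Γ) →₀ MvPolynomial F.P (R : Type u)) :
    modelOp l L a 0 1 0 f = (a : R) • f := by
  have h : ∀ d, ((modelCoeff l L a 0 1 0 d : (negPoly F R : Type u)ˣ) : negPoly F R) =
      MvPolynomial.C (a : R) := fun d => by
    rw [modelCoeff, negExp_zero, mul_one, modelScalar, L.κR_zero_left, map_one, map_zero,
      nilExpUnit_zero]
    exact congrArg (fun z : (R : Type u)ˣ => (MvPolynomial.C (z : R) : MvPolynomial F.P R))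
      ((congrArg₂ (· * ·) ((congrArg₂ (· * ·) (mul_one a) rfl).trans (mul_one a)) rfl).trans
        (mul_one a))
  induction f using Finsupp.induction_linear with
  | zero => rw [map_zero, smul_zero]
  | add f g hf hg => rw [map_add, hf, hg, smul_add]
  | single d q =>
    rw [modelOp_single, h, F.logCoord_one, transl_zero, zero_add, Finsupp.smul_single,
      MvPolynomial.smul_eq_C_mul]
    rfl

theorem map_modelOp (φ : R ⟶ S) (a : (R : Type u)ˣ) (γ : Γ) (x : (torusArc k Γ).obj R)
    (ν : F.N R) (f : (B × Γ) →₀ MvPolynomial F.P (R : Type u)) :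
    Finsupp.mapRange.addMonoidHom (MvPolynomial.map φ.hom.toRingHom).toAddMonoidHom
        (modelOp l L a γ x ν f) =
      modelOp l L (Units.map (φ.hom : (R : Type u) →* S) a) γ ((torusArc k Γ).map φ x)
        (F.mapN φ ν)
        (Finsupp.mapRange.addMonoidHom (MvPolynomial.map φ.hom.toRingHom).toAddMonoidHom f) := by
  induction f using Finsupp.induction_linear with
  | zero => simp only [map_zero]
  | add f g hf hg => simp only [map_add, hf, hg]
  | single d q =>
    have h : F.logCoord ((torusArc k Γ).map φ x) = fun p => φ.hom (F.logCoord x p) :=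
      funext fun p => F.logCoord_map φ x p
    have hs : ∀ (d : B × Γ) (q : MvPolynomial F.P (R : Type u)),
        Finsupp.mapRange.addMonoidHom (MvPolynomial.map φ.hom.toRingHom).toAddMonoidHom
          (Finsupp.single d q) = Finsupp.single d (MvPolynomial.map φ.hom.toRingHom q) :=
      fun d q => Finsupp.mapRange_single (hf := map_zero _)
    rw [modelOp_single, hs, hs, modelOp_single, map_mul, map_transl, h]
    have h2 := congrArg Units.val (map_modelCoeff l L φ a γ x ν d)
    exact congrArg (fun z : MvPolynomial F.P (S : Type u) => Finsupp.single _ (z * _)) h2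

/-- The action of normal forms on the model. -/
def modelAction : NfAction L (ModelSpace F B) where
  op R a γ x ν := (modelEquiv F R B).symm.toLinearMap.comp
    ((modelOp l L a γ x ν).comp (modelEquiv F R B).toLinearMap)
  map_op {R S} φ a γ x ν w := by
    refine (modelEquiv F S B).injective ?_
    rw [modelEquiv_bmap]
    simp only [LinearMap.comp_apply, LinearEquiv.coe_coe, LinearEquiv.apply_symm_apply]
    rw [map_modelOp, modelEquiv_bmap]
  op_mul {R} a a' γ γ' x x' ν ν' := by
    rw [← modelOp_mul]
    refine LinearMap.ext fun w => ?_
    simp only [Module.End.mul_apply, LinearMap.comp_apply, LinearEquiv.coe_coe,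
      LinearEquiv.apply_symm_apply]
  op_scalar R a w := by
    simp only [LinearMap.comp_apply, LinearEquiv.coe_coe]
    rw [modelOp_scalar, map_smul, LinearEquiv.symm_apply_apply]

/-- The `T(F)~`-module freely generated by vectors `v_b`, `b ∈ B`, on which `T(O)` acts through
the characters `l b` of `T`. -/
def model : HeisMod H := (modelAction l L).toMod

theorem modelEquiv_act_nf (a : (R : Type u)ˣ) (γ : Γ) (x : (torusArc k Γ).obj R) (ν : F.N R)
    (w : (R : Type u) ⊗[k] ModelSpace F B) :
    modelEquiv F R B ((model l L).obj.act R (L.nf a γ x ν) w) =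
      modelOp l L a γ x ν (modelEquiv F R B w) :=
  (congrArg (modelEquiv F R B) ((modelAction l L).toMod_act_nf a γ x ν w)).trans
    ((modelEquiv F R B).apply_symm_apply _)

end ModelModule


section ModelProperties

variable {k : Type u} [Field k] [CharZero k] {Γ : Type u} [AddCommGroup Γ]
  {c : Γ →ₗ[ℤ] Γ →ₗ[ℤ] ℤ} {F : Frame k c} {H : HeisenbergExtension k c}
  {R S : CommAlgCat.{u} k} {B : Type u} (l : B → Module.Dual ℤ Γ) (L : Lifts F H)

theorem coe_modelCoeff (a : (R : Type u)ˣ) (γ : Γ) (x : (torusArc k Γ).obj R) (d : B × Γ) :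
    ((modelCoeff l L a γ x 0 d : (negPoly F R : Type u)ˣ) : negPoly F R) =
      MvPolynomial.C ((a * L.κR R γ d.2 * ev ((arcConst k Γ).app R x) (l d.1 - c d.2) :
        (R : Type u)ˣ) : R) := by
  rw [modelCoeff, negExp_zero, mul_one, modelScalar, map_zero, nilExpUnit_zero, mul_one]
  rfl

/-- The element of the model given by a polynomial in the summand `d`. -/
def modelSingle (d : B × Γ) (q : MvPolynomial F.P k) : (model l L).obj.V :=
  (Finsupp.single d q : ModelSpace F B)

theorem smul_modelSingle (a : k) (d : B × Γ) (q : MvPolynomial F.P k) :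
    a • modelSingle l L d q = modelSingle l L d (MvPolynomial.C a * q) :=
  (Finsupp.smul_single a d q).trans
    (congrArg (Finsupp.single d) (MvPolynomial.smul_eq_C_mul q a))

theorem model_act_single (a : (R : Type u)ˣ) (γ : Γ) (x : (torusArc k Γ).obj R) (ν : F.N R)
    (d : B × Γ) (q : MvPolynomial F.P k) :
    modelEquiv F R B ((model l L).obj.coact (L.nf a γ x ν) (modelSingle l L d q)) =
      Finsupp.single (d.1, γ + d.2)
        (((modelCoeff l L a γ x ν d : (negPoly F R : Type u)ˣ) : negPoly F R) *
          transl (F.logCoord x) (MvPolynomial.map (algebraMap k R) q)) := by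
  refine (modelEquiv_act_nf l L a γ x ν _).trans ?_
  refine (congrArg (modelOp l L a γ x ν) (modelEquiv_tmul_single (1 : R) d q)).trans ?_
  rw [one_smul, modelOp_single]

theorem model_kact_single (γ δ : Γ) (b : B) (q : MvPolynomial F.P k) :
    (model l L).obj.kact (L.base γ) (modelSingle l L (b, δ) q) =
      (L.κ γ δ : k) • modelSingle l L (b, γ + δ) q := by
  have h := model_act_single l L (R := CommAlgCat.of k k) 1 γ 1 0 (b, δ) q
  rw [L.nf_t, Lifts.t, FRep.coact_map, coe_modelCoeff, map_one, ev_one, one_mul, mul_one,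
    F.logCoord_one, transl_zero] at h
  rw [smul_modelSingle]
  refine (TensorProduct.lid k (model l L).obj.V).symm.injective
    ((modelEquiv F (CommAlgCat.of k k) B).injective
    (h.trans ?_))
  refine Eq.trans ?_ (modelEquiv_tmul_single (R := CommAlgCat.of k k) 1 (b, γ + δ) _).symm
  rw [one_smul, map_mul, MvPolynomial.map_C]
  rfl

theorem smul_one_tmul_injective {V : Type u} [AddCommGroup V] [Module k V] {v w : V}
    (h : dualEps (CommAlgCat.of k k) • ((1 : dual (CommAlgCat.of k k)) ⊗ₜ[k] v) =
      dualEps (CommAlgCat.of k k) • ((1 : dual (CommAlgCat.of k k)) ⊗ₜ[k] w)) : v = w := by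
  have h3 := congrArg (dualSnd (CommAlgCat.of k k) V) h
  rw [← bmap_one_tmul (dualInl (CommAlgCat.of k k)), ← bmap_one_tmul (dualInl (CommAlgCat.of k k)),
    dualSnd_eps, dualSnd_eps] at h3
  exact (TensorProduct.lid k V).symm.injective h3

theorem coe_modelCoeff_sq (p : F.P) (s : R) (hs : s ^ 2 = 0) (d : B × Γ) :
    ((modelCoeff l L 1 0 1 (F.sq p s hs) d : (negPoly F R : Type u)ˣ) : negPoly F R) =
      1 + MvPolynomial.C s * MvPolynomial.X p := by
  have h1 : ((negLin (F.sq p s hs) : nilradical (negPoly F R)) : negPoly F R) =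
      MvPolynomial.C s * MvPolynomial.X p := by
    rw [negLin, F.mapN_sq, Frame.sq, F.pair_single, mul_comm]
    rfl
  have h2 : modelScalar l L 1 0 1 (F.sq p s hs) d = 1 := by
    rw [modelScalar, L.κR_zero_left, map_one, F.logCoord_one, ev_one]
    have h3 : F.pair (0 : F.P → R) (F.sq p s hs) = 0 := by
      rw [Frame.sq, F.pair_single]
      exact zero_smul _ _
    rw [h3, nilExpUnit_zero, mul_one, mul_one, mul_one]
  rw [modelCoeff, h2, map_one, one_mul, negExp, coe_nilExpUnit, h1, nilExp_of_sq_eq_zero]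
  rw [mul_pow, ← map_pow, hs, map_zero, zero_mul]

theorem model_b_single (p : F.P) (d : B × Γ) (q : MvPolynomial F.P k) :
    L.b (model l L) p (modelSingle l L d q) = modelSingle l L d (MvPolynomial.X p * q) := by
  have h := model_act_single l L (R := dual (CommAlgCat.of k k)) 1 0 1
    (F.sq p (dualEps _) dualEps_sq) d q
  rw [L.nf_neg, L.coact_neg_sq] at h
  rw [coe_modelCoeff_sq, F.logCoord_one, transl_zero, zero_add] at h
  have h2 : modelEquiv F (dual (CommAlgCat.of k k)) B
      ((1 : dual (CommAlgCat.of k k)) ⊗ₜ[k] (Finsupp.single d q : ModelSpace F B) +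
        dualEps (CommAlgCat.of k k) •
        ((1 : dual (CommAlgCat.of k k)) ⊗ₜ[k]
          (Finsupp.single d (MvPolynomial.X p * q) : ModelSpace F B))) = Finsupp.single d
      ((1 + MvPolynomial.C (dualEps (CommAlgCat.of k k)) * MvPolynomial.X p) *
        MvPolynomial.map (algebraMap k (dual (CommAlgCat.of k k))) q) := by
    rw [map_add, map_smul, modelEquiv_tmul_single, modelEquiv_tmul_single, one_smul, one_smul,
      Finsupp.smul_single, ← Finsupp.single_add, map_mul,
      MvPolynomial.map_X, MvPolynomial.smul_eq_C_mul, add_mul, one_mul, mul_assoc]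
  exact smul_one_tmul_injective (k := k) (V := (model l L).obj.V)
    (add_left_cancel ((modelEquiv F _ B).injective (h.trans h2.symm)))

theorem model_coact_arc (d : B × Γ) (x : (torusArc k Γ).obj R) :
    (model l L).obj.coact (H.splitting.app R x) (modelSingle l L d 1) =
      (ev ((arcConst k Γ).app R x) (l d.1 - c d.2) : R) ⊗ₜ modelSingle l L d 1 := by
  have h := model_act_single l L 1 0 x 0 d 1
  rw [L.nf_arc, coe_modelCoeff, L.κR_zero_left, map_one, map_one, mul_one, one_mul, one_mul,
    zero_add] at h
  refine (modelEquiv F R B).injective (h.trans ?_)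
  refine Eq.trans ?_ (modelEquiv_tmul_single _ d 1).symm
  rw [MvPolynomial.smul_eq_C_mul, map_one, mul_one]

/-- The generators `v_b` of the model. -/
def modelVec (b : B) : (model l L).obj.V := modelSingle l L (b, 0) 1

theorem modelSingle_mem_charSpace (d : B × Γ) :
    modelSingle l L d 1 ∈ charSpace ((resArc H).obj (model l L)) (l d.1 - c d.2) :=
  mem_charSpace fun _ x => model_coact_arc l L d x

theorem modelVec_mem_charSpace (b : B) :
    modelVec l L b ∈ charSpace ((resArc H).obj (model l L)) (l b) := by
  have h := modelSingle_mem_charSpace l L (b, 0)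
  rwa [map_zero, sub_zero] at h

theorem model_kact_zero (γ : Γ) (b : B) (q : MvPolynomial F.P k) :
    (model l L).obj.kact (L.base γ) (modelSingle l L (b, 0) q) = modelSingle l L (b, γ) q := by
  have h : L.κ γ 0 = 1 := by
    have h1 := L.κR_zero_right (R := CommAlgCat.of k k) γ
    exact Units.ext (congrArg (Units.val (α := k)) h1)
  rw [model_kact_single, h, Units.val_one, one_smul, add_zero]

theorem model_eq_top {K : Submodule k (model l L).obj.V}
    (hb : ∀ p, ∀ m ∈ K, L.b (model l L) p m ∈ K)
    (ht : ∀ γ, ∀ m ∈ K, (model l L).obj.kact (L.base γ) m ∈ K)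
    (hv : ∀ b, modelVec l L b ∈ K) : K = ⊤ := by
  have h0 : ∀ b q, modelSingle l L (b, 0) q ∈ K := fun b q => by
    induction q using MvPolynomial.induction_on with
    | C a =>
      have h : modelSingle l L (b, 0) (MvPolynomial.C a) = a • modelVec l L b := by
        rw [modelVec, smul_modelSingle, mul_one]
      rw [h]
      exact K.smul_mem a (hv b)
    | add f g hf hg =>
      have h : modelSingle l L (b, 0) (f + g) =
          modelSingle l L (b, 0) f + modelSingle l L (b, 0) g := Finsupp.single_add _ _ _
      rw [h]
      exact K.add_mem hf hg
    | mul_X f p hf =>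
      rw [mul_comm, ← model_b_single]
      exact hb p _ hf
  refine top_unique fun f _ => ?_
  refine Finsupp.induction_linear (motive := fun f : ModelSpace F B => (f : (model l L).obj.V) ∈ K)
    f K.zero_mem (fun f g hf hg => K.add_mem hf hg) fun d q => ?_
  have h := ht d.2 _ (h0 d.1 q)
  rw [model_kact_zero] at h
  exact h

end ModelProperties


section ModelUniversal

variable {k : Type u} [Field k] [CharZero k] {Γ : Type u} [AddCommGroup Γ]
  {c : Γ →ₗ[ℤ] Γ →ₗ[ℤ] ℤ} {F : Frame k c} {H : HeisenbergExtension k c}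
  {R S : CommAlgCat.{u} k} {B : Type u} (l : B → Module.Dual ℤ Γ) (L : Lifts F H)

/-- The vectors on which a linear map commutes with `T(O)`. -/
def arcEqualizer {M N : HeisMod H} (f : M.obj.V →ₗ[k] N.obj.V) : Submodule k M.obj.V :=
  ⨅ (R : CommAlgCat.{u} k) (x : (torusArc k Γ).obj R), LinearMap.eqLocus
    (((f.baseChange R).restrictScalars k).comp (M.obj.coact (H.splitting.app R x)))
    ((N.obj.coact (H.splitting.app R x)).comp f)

theorem mem_arcEqualizer {M N : HeisMod H} {f : M.obj.V →ₗ[k] N.obj.V} {m : M.obj.V} :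
    m ∈ arcEqualizer f ↔ ∀ (R : CommAlgCat.{u} k) (x : (torusArc k Γ).obj R),
      f.baseChange R (M.obj.coact (H.splitting.app R x) m) =
        N.obj.coact (H.splitting.app R x) (f m) := by
  simp only [arcEqualizer, Submodule.mem_iInf]
  rfl

namespace Lifts

theorem b_mem_arcEqualizer {M N : HeisMod H} {f : M.obj.V →ₗ[k] N.obj.V}
    (hb : ∀ p m, f (L.b M p m) = L.b N p (f m)) (p : F.P) {m : M.obj.V}
    (hm : m ∈ arcEqualizer f) : L.b M p m ∈ arcEqualizer f := by
  rw [mem_arcEqualizer] at hm ⊢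
  intro R x
  have h1 : ∀ y : (R : Type u) ⊗[k] M.obj.V, f.baseChange R ((L.b M p).baseChange R y) =
      (L.b N p).baseChange R (f.baseChange R y) := fun y => by
    have h2 : f.comp (L.b M p) = (L.b N p).comp f := LinearMap.ext (hb p)
    rw [← LinearMap.comp_apply, ← LinearMap.comp_apply ((L.b N p).baseChange R),
      ← LinearMap.baseChange_comp, ← LinearMap.baseChange_comp, h2]
  rw [L.act_arc_b, map_add (f.baseChange R), map_smul (f.baseChange R), h1, hm R x, hb,
    L.act_arc_b]

theorem kact_mem_arcEqualizer {M N : HeisMod H} {f : M.obj.V →ₗ[k] N.obj.V}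
    (ht : ∀ γ m, f (M.obj.kact (L.base γ) m) = N.obj.kact (L.base γ) (f m)) (γ : Γ) {m : M.obj.V}
    (hm : m ∈ arcEqualizer f) : M.obj.kact (L.base γ) m ∈ arcEqualizer f := by
  rw [mem_arcEqualizer] at hm ⊢
  intro R x
  rw [L.coact_arc_kact, map_smul (f.baseChange R), L.baseChange_kact ht, hm R x, ht,
    L.coact_arc_kact]

end Lifts

theorem mem_arcEqualizer_of_mem_charSpace {M N : HeisMod H} {f : M.obj.V →ₗ[k] N.obj.V}
    {m : M.obj.V} {χ : Module.Dual ℤ Γ} (hm : m ∈ charSpace ((resArc H).obj M) χ)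
    (hn : f m ∈ charSpace ((resArc H).obj N) χ) : m ∈ arcEqualizer f := by
  rw [mem_arcEqualizer]
  intro R x
  have h1 : M.obj.coact (H.splitting.app R x) m = _ := coact_of_mem_charSpace hm x
  have h2 : N.obj.coact (H.splitting.app R x) (f m) = _ := coact_of_mem_charSpace hn x
  rw [h1, h2]
  exact LinearMap.baseChange_tmul ..

/-- The linear map from the model that sends `v_b` to `n_b` and commutes with the generators. -/
def modelMap (N : HeisMod H) (θ : (poly k F.P : Type u) →ₐ[k] Module.End k N.obj.V)
    (n : B → N.obj.V) : (model l L).obj.V →ₗ[k] N.obj.V :=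
  Finsupp.lsum k fun d : B × Γ =>
    (N.obj.kact (L.base d.2)).comp ((LinearMap.applyₗ (n d.1)).comp θ.toLinearMap)

theorem modelMap_single (N : HeisMod H) (θ : (poly k F.P : Type u) →ₐ[k] Module.End k N.obj.V)
    (n : B → N.obj.V) (d : B × Γ) (q : MvPolynomial F.P k) :
    modelMap l L N θ n (modelSingle l L d q) =
      N.obj.kact (L.base d.2) (θ (show poly k F.P from q) (n d.1)) :=
  Finsupp.lsum_single ..

theorem model_lhom_ext {W : Type*} [AddCommGroup W] [Module k W]
    {g g' : (model l L).obj.V →ₗ[k] W}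
    (h : ∀ d q, g (modelSingle l L d q) = g' (modelSingle l L d q)) : g = g' :=
  Finsupp.lhom_ext h

theorem modelMap_b {N : HeisMod H} {θ : (poly k F.P : Type u) →ₐ[k] Module.End k N.obj.V}
    (hθ : ∀ p, θ (pX p) = L.b N p) (n : B → N.obj.V) (p : F.P) (m : (model l L).obj.V) :
    modelMap l L N θ n (L.b (model l L) p m) = L.b N p (modelMap l L N θ n m) := by
  refine LinearMap.congr_fun (f := (modelMap l L N θ n).comp (L.b (model l L) p))
    (g := (L.b N p).comp (modelMap l L N θ n)) (model_lhom_ext l L fun d q => ?_) m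
  rw [LinearMap.comp_apply, LinearMap.comp_apply, model_b_single, modelMap_single,
    modelMap_single, L.kact_b]
  refine congrArg _ ((LinearMap.congr_fun (map_mul θ (pX p) q) (n d.1)).trans ?_)
  rw [hθ]
  rfl

theorem modelMap_kact {N : HeisMod H} (θ : (poly k F.P : Type u) →ₐ[k] Module.End k N.obj.V)
    (n : B → N.obj.V) (γ : Γ) (m : (model l L).obj.V) :
    modelMap l L N θ n ((model l L).obj.kact (L.base γ) m) =
      N.obj.kact (L.base γ) (modelMap l L N θ n m) := by
  refine LinearMap.congr_fun
    (f := (modelMap l L N θ n).comp ((model l L).obj.kact (L.base γ)))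
    (g := (N.obj.kact (L.base γ)).comp (modelMap l L N θ n)) (model_lhom_ext l L fun d q => ?_) m
  rw [LinearMap.comp_apply, LinearMap.comp_apply, model_kact_single, map_smul, modelMap_single,
    modelMap_single, L.kact_base_base]

theorem modelMap_vec (N : HeisMod H) (θ : (poly k F.P : Type u) →ₐ[k] Module.End k N.obj.V)
    (n : B → N.obj.V) (b : B) : modelMap l L N θ n (modelVec l L b) = n b := by
  refine (modelMap_single l L N θ n (b, 0) 1).trans ?_
  rw [L.kact_base_zero]
  exact LinearMap.congr_fun (map_one θ) (n b)

/-- The universal property of the model. -/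
theorem exists_model_hom {N : HeisMod H} (n : B → N.obj.V)
    (hn : ∀ b, n b ∈ charSpace ((resArc H).obj N) (l b)) :
    ∃ f : model l L ⟶ N, ∀ b, FRep.lin f.hom (modelVec l L b) = n b := by
  obtain ⟨θ, hθ⟩ := exists_commAeval (k := k) (L.b N) fun p q =>
    LinearMap.ext fun m => L.b_comm N p q m
  have hK : arcEqualizer (modelMap l L N θ n) = ⊤ := by
    refine model_eq_top l L (fun p m hm => L.b_mem_arcEqualizer (modelMap_b l L hθ n) p hm)
      (fun γ m hm => L.kact_mem_arcEqualizer (modelMap_kact l L θ n) γ hm) fun b => ?_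
    refine mem_arcEqualizer_of_mem_charSpace (modelVec_mem_charSpace l L b) ?_
    have h := hn b
    rwa [← modelMap_vec l L N θ n b] at h
  exact ⟨L.homMk (modelMap l L N θ n) (modelMap_b l L hθ n) (modelMap_kact l L θ n)
    fun R x m => mem_arcEqualizer.1 (hK ▸ Submodule.mem_top) R x, modelMap_vec l L N θ n⟩

/-- Morphisms from the model are determined by the images of the generators. -/
theorem model_hom_ext {N : HeisMod H} {f g : model l L ⟶ N}
    (h : ∀ b, FRep.lin f.hom (modelVec l L b) = FRep.lin g.hom (modelVec l L b)) : f = g := by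
  have h1 : LinearMap.eqLocus (FRep.lin f.hom) (FRep.lin g.hom) = ⊤ := by
    refine model_eq_top l L (fun p m hm => ?_) (fun γ m hm => ?_) h
    · change FRep.lin f.hom _ = FRep.lin g.hom _
      rw [L.hom_b, L.hom_b, show FRep.lin f.hom m = FRep.lin g.hom m from hm]
    · change FRep.lin f.hom _ = FRep.lin g.hom _
      rw [FRep.hom_kact, FRep.hom_kact, show FRep.lin f.hom m = FRep.lin g.hom m from hm]
  refine ObjectProperty.hom_ext _ (FRep.hom_ext (LinearMap.ext fun m => ?_))
  have h2 : m ∈ LinearMap.eqLocus (FRep.lin f.hom) (FRep.lin g.hom) := h1 ▸ Submodule.mem_top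
  exact h2

end ModelUniversal

section ModelInvariants

variable {k : Type u} [Field k] [CharZero k] {Γ : Type u} [AddCommGroup Γ]
  {c : Γ →ₗ[ℤ] Γ →ₗ[ℤ] ℤ} {F : Frame k c} {H : HeisenbergExtension k c}
  {R S : CommAlgCat.{u} k} {B : Type u} (l : B → Module.Dual ℤ Γ) (L : Lifts F H)

theorem modelOp_apply_of_const {x : (torusArc k Γ).obj R} (hx : (arcConst k Γ).app R x = 1)
    (g : (B × Γ) →₀ MvPolynomial F.P (R : Type u)) (d : B × Γ) :
    modelOp l L 1 0 x 0 g d = transl (F.logCoord x) (g d) := by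
  classical
  induction g using Finsupp.induction_linear with
  | zero => rw [map_zero, Finsupp.zero_apply, map_zero]
  | add f g hf hg => rw [map_add, Finsupp.add_apply, hf, hg, Finsupp.add_apply, map_add]
  | single e q =>
    have h : ((modelCoeff l L 1 0 x 0 e : (negPoly F R : Type u)ˣ) : negPoly F R) = 1 := by
      rw [coe_modelCoeff, hx, L.κR_zero_left, ev_one, mul_one, mul_one]
      exact map_one MvPolynomial.C
    rw [modelOp_single, h, one_mul, zero_add, Finsupp.single_apply, Finsupp.single_apply]
    split_ifs
    · rfl
    · rw [map_zero]

/-- A polynomial that is invariant under the universal translation is constant. -/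
theorem eq_C_of_transl {σ A : Type*} [CommRing A] {q : MvPolynomial σ A}
    (h : MvPolynomial.aeval (fun p => MvPolynomial.X p + MvPolynomial.C (MvPolynomial.X p) :
        σ → MvPolynomial σ (MvPolynomial σ A)) q =
      MvPolynomial.map (algebraMap A (MvPolynomial σ A)) q) :
    q = MvPolynomial.C (MvPolynomial.constantCoeff q) := by
  have h1 := congrArg (MvPolynomial.constantCoeff (σ := σ) (R := MvPolynomial σ A)) h
  rw [MvPolynomial.constantCoeff_map] at h1
  have h2 : MvPolynomial.constantCoeff (σ := σ) (R := MvPolynomial σ A)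
      (MvPolynomial.aeval (fun p => MvPolynomial.X p + MvPolynomial.C (MvPolynomial.X p) :
        σ → MvPolynomial σ (MvPolynomial σ A)) q) = q := by
    have h3 : ((MvPolynomial.constantCoeff (σ := σ) (R := MvPolynomial σ A)).comp
        (MvPolynomial.aeval (R := A)
          (fun p => MvPolynomial.X p + MvPolynomial.C (MvPolynomial.X p) :
          σ → MvPolynomial σ (MvPolynomial σ A))).toRingHom) = RingHom.id _ := by
      refine MvPolynomial.ringHom_ext (fun a => ?_) fun p => ?_
      · change MvPolynomial.constantCoeff (MvPolynomial.aeval _ (MvPolynomial.C a)) = _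
        rw [MvPolynomial.aeval_C]
        exact MvPolynomial.constantCoeff_C (σ := σ) _
      · change MvPolynomial.constantCoeff (MvPolynomial.aeval _ (MvPolynomial.X p)) = _
        rw [MvPolynomial.aeval_X]
        simp
    exact RingHom.congr_fun h3 q
  rw [h2] at h1
  exact h1

theorem transl_map (y : F.P → R) (q : MvPolynomial F.P k) :
    transl y (MvPolynomial.map (algebraMap k R) q) =
      MvPolynomial.aeval (fun p => MvPolynomial.X p + MvPolynomial.C (y p) :
        F.P → MvPolynomial F.P (R : Type u)) q := by
  rw [transl, MvPolynomial.aeval_map_algebraMap]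

theorem modelEquiv_one_tmul_apply (f : ModelSpace F B) (d : B × Γ) :
    modelEquiv F R B ((1 : R) ⊗ₜ[k] f) d = MvPolynomial.map (algebraMap k R) (f d) := by
  classical
  induction f using Finsupp.induction_linear with
  | zero => rw [TensorProduct.tmul_zero, map_zero, Finsupp.zero_apply, Finsupp.zero_apply, map_zero]
  | add f g hf hg =>
    rw [TensorProduct.tmul_add, map_add, Finsupp.add_apply, hf, hg, Finsupp.add_apply, map_add]
  | single e q =>
    rw [modelEquiv_tmul_single, one_smul, Finsupp.single_apply, Finsupp.single_apply]
    split_ifs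
    · rfl
    · rw [map_zero]

/-- The `T(𝔪)`-invariants of the model are the constant polynomials. -/
theorem apply_eq_C_of_invariant {f : ModelSpace F B}
    (hf : f ∈ unipotentInvariants ((resArc H).obj (model l L))) (d : B × Γ) :
    f d = MvPolynomial.C (MvPolynomial.constantCoeff (f d)) := by
  have h1 : (model l L).obj.coact (H.splitting.app (poly k F.P) (F.arcPt pX)) f =
      (1 : poly k F.P) ⊗ₜ[k] f := hf _ _ (F.arcConst_arcPt pX)
  have h2 := congrArg (modelEquiv F (poly k F.P) B) h1
  rw [← L.nf_arc] at h2
  have h3 := DFunLike.congr_fun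
    ((modelEquiv_act_nf l L 1 0 (F.arcPt pX) 0 ((1 : poly k F.P) ⊗ₜ[k] f)).symm.trans h2) d
  rw [modelOp_apply_of_const l L (F.arcConst_arcPt pX), modelEquiv_one_tmul_apply f,
    F.logCoord_arcPt, transl_map] at h3
  exact eq_C_of_transl h3

theorem eq_sum_of_invariant {f : ModelSpace F B}
    (hf : f ∈ unipotentInvariants ((resArc H).obj (model l L))) :
    (f : (model l L).obj.V) =
      ∑ d ∈ f.support, MvPolynomial.constantCoeff (f d) • modelSingle l L d 1 := by
  refine (Finsupp.sum_single f).symm.trans (Finset.sum_congr rfl fun d _ => ?_)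
  rw [smul_modelSingle, mul_one, ← apply_eq_C_of_invariant l L hf d]
  rfl

/-- The vectors of the model on which `T(O)` acts by the character `s(χ)` are combinations of the
generators. -/
theorem charSpace_model_le (hc : Function.Injective c) (s : LevelSection c) {χ : B → CharQuot c}
    (hl : ∀ b, l b = s.1 (χ b)) (ψ : CharQuot c) :
    charSpace ((resArc H).obj (model l L)) (s.1 ψ) ≤
      Submodule.span k (Set.range (modelVec l L)) := by
  classical
  intro f hf
  have h1 := eq_sum_of_invariant l L (f := f) hf.2
  let P : (model l L).obj.V →ₗ[k] (model l L).obj.V :=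
    (torusDiag k Γ).proj ((resArc H).obj (model l L)) (s.1 ψ)
  have hP : ∀ (l' : Module.Dual ℤ Γ) (m : (model l L).obj.V),
      m ∈ charSpace ((resArc H).obj (model l L)) l' → P m = if l' = s.1 ψ then m else 0 :=
    fun l' m hm => (torusDiag k Γ).proj_of_mem (M := (resArc H).obj (model l L)) hm.1
  have h2 : P f = f := (hP _ _ hf).trans (if_pos rfl)
  have h3 : ∀ d, P (modelSingle l L d 1) ∈ Submodule.span k (Set.range (modelVec l L)) :=
      fun d => by
    rw [hP _ _ (modelSingle_mem_charSpace l L d)]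
    by_cases h : l d.1 - c d.2 = s.1 ψ
    · rw [if_pos h]
      have h4 : χ d.1 = ψ := by
        have h5 := congrArg (LinearMap.range c).mkQ h
        have h6 : (LinearMap.range c).mkQ (c d.2) = 0 :=
          (Submodule.Quotient.mk_eq_zero _).2 ⟨_, rfl⟩
        rwa [map_sub, h6, sub_zero, hl, s.2, s.2] at h5
      rw [hl, h4, sub_eq_self, map_eq_zero_iff c hc] at h
      exact Submodule.subset_span ⟨d.1, congrArg (fun δ => modelSingle l L (d.1, δ) 1) h.symm⟩
    · rw [if_neg h]
      exact Submodule.zero_mem _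
  have h4 : f = _ := h2.symm.trans ((congrArg P h1).trans (map_sum P _ _))
  rw [h4]
  refine sum_mem fun d _ => ?_
  rw [map_smul]
  exact Submodule.smul_mem _ _ (h3 d)

theorem linearIndependent_modelVec : LinearIndependent k (modelVec l L) := by
  have h := Finsupp.linearIndependent_single (R := k) (ι := B × Γ)
    (fun _ (_ : Unit) => (1 : MvPolynomial F.P k)) fun _ =>
      LinearIndependent.of_subsingleton () one_ne_zero
  refine (h.comp (fun b : B => ⟨(b, 0), ()⟩) fun b b' hb => ?_ : _)
  simpa using hb

end ModelInvariants


/-! ### Generalities on representations -/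

section RepresentationGeneralities

variable {k : Type u} [Field k] {G : CommAlgCat.{u} k ⥤ GrpCat.{u}} {R : CommAlgCat.{u} k}

namespace FRep

/-- A linear map is a morphism of representations as soon as it is equivariant on a spanning
set. -/
theorem exists_hom_of_span {M N : FRep G} (f : M.V →ₗ[k] N.V) {S : Set M.V}
    (hS : Submodule.span k S = ⊤)
    (h : ∀ (R : CommAlgCat.{u} k) (g : G.obj R), ∀ m ∈ S,
      f.baseChange R (M.coact g m) = N.coact g (f m)) : ∃ φ : M ⟶ N, lin φ = f := by
  have h1 : ∀ (R : CommAlgCat.{u} k) (g : G.obj R) (m : M.V),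
      f.baseChange R (M.coact g m) = N.coact g (f m) := fun R g m => by
    refine LinearMap.congr_fun (f := ((f.baseChange R).restrictScalars k).comp (M.coact g))
      (g := (N.coact g).comp f) (LinearMap.ext_on hS fun m hm => ?_) m
    exact h R g m hm
  exact ⟨Hom.mk f fun R g x => equivariant_of_coact (h1 R g) x, rfl⟩

theorem isIso_of_bijective {M N : FRep G} (f : M ⟶ N) (hf : Function.Bijective (lin f)) :
    IsIso f := by
  let e := LinearEquiv.ofBijective (lin f) hf
  have he : (lin f).comp e.symm.toLinearMap = LinearMap.id :=
    LinearMap.ext fun x => e.apply_symm_apply x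
  have he' : e.symm.toLinearMap.comp (lin f) = LinearMap.id :=
    LinearMap.ext fun x => e.symm_apply_apply x
  obtain ⟨g, hg⟩ := exists_hom_of_span (M := N) (N := M) e.symm.toLinearMap
    (S := Set.univ) Submodule.span_univ fun R g m _ => by
      have h1 := hom_coact f g (e.symm m)
      have h2 : lin f (e.symm m) = m := e.apply_symm_apply m
      rw [h2] at h1
      rw [← h1, ← LinearMap.comp_apply, ← LinearMap.baseChange_comp, he', LinearMap.baseChange_id]
      rfl
  exact ⟨g, hom_ext ((congrArg (fun z => z.comp (lin f)) hg).trans he'),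
    hom_ext ((congrArg (fun z => (lin f).comp z) hg).trans he)⟩

theorem mem_baseChange_ker {V W : Type u} [AddCommGroup V] [Module k V] [AddCommGroup W]
    [Module k W] {f : V →ₗ[k] W} {x : (R : Type u) ⊗[k] V} (hx : f.baseChange R x = 0) :
    x ∈ (LinearMap.ker f).baseChange R := by
  have h1 : ∀ y : (R : Type u) ⊗[k] LinearMap.ker f,
      (LinearMap.ker f).subtype.lTensor (R : Type u) y ∈ (LinearMap.ker f).baseChange R :=
          fun y => by
    induction y using TensorProduct.induction_on with
    | zero => rw [map_zero]; exact Submodule.zero_mem _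
    | tmul r v => exact Submodule.tmul_mem_baseChange_of_mem _ v.2
    | add a b ha hb => rw [map_add]; exact Submodule.add_mem _ ha hb
  obtain ⟨y, rfl⟩ :=
    (Module.Flat.lTensor_exact (R : Type u) (LinearMap.exact_subtype_ker_map f) x).1 hx
  exact h1 y

theorem isInvariant_ker {M N : FRep G} (f : M ⟶ N) : M.IsInvariant (LinearMap.ker (lin f)) :=
  fun R g m hm => mem_baseChange_ker (by
    have h := hom_coact f g m
    rwa [LinearMap.mem_ker.1 hm, map_zero] at h)

theorem coact_sub {M : FRep G} {N : Submodule k M.V} (hN : M.IsInvariant N) (g : G.obj R) (m : N) :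
    N.subtype.baseChange R ((sub hN).coact g m) = M.coact g (m : M.V) :=
  hom_coact (subIncl hN) g m

end FRep

/-- A linearly independent family adapted to a family of subspaces. -/
theorem exists_adapted_basis {V ι : Type u} [AddCommGroup V] [Module k V]
    (W : ι → Submodule k V) : ∃ (B : Type u) (v : B → V) (χ : B → ι), LinearIndependent k v ∧
      (∀ b, v b ∈ W (χ b)) ∧ Submodule.span k (Set.range v) = ⨆ i, W i := by
  obtain ⟨b, hb, hspan, hli⟩ := exists_linearIndependent k (⋃ i, (W i : Set V))
  have h : ∀ x : b, ∃ i, (x : V) ∈ W i := fun x => by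
    simpa using hb x.2
  choose χ hχ using h
  refine ⟨b, fun x => x, χ, hli, hχ, ?_⟩
  rw [Subtype.range_coe_subtype, Set.ofPred_mem_eq, hspan, Submodule.span_iUnion]
  simp only [Submodule.span_eq]

end RepresentationGeneralities

section ActsThrough

variable {k : Type u} [Field k] [CharZero k] {Γ : Type u} [AddCommGroup Γ]
  {c : Γ →ₗ[ℤ] Γ →ₗ[ℤ] ℤ} {R : CommAlgCat.{u} k}

theorem mem_charSpace_sub {M : FRep (torusArc k Γ)} {N : Submodule k M.V} (hN : M.IsInvariant N)
    {l : Module.Dual ℤ Γ} {m : (FRep.sub hN).V} (hm : N.subtype m ∈ charSpace M l) :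
    m ∈ charSpace (FRep.sub hN) l :=
  mem_charSpace fun R x => by
    refine FRep.baseChange_subtype_injective (N := N) R ?_
    refine (FRep.coact_sub hN x m).trans ((coact_of_mem_charSpace hm x).trans ?_)
    exact (LinearMap.baseChange_tmul ..).symm

theorem iSup_charSpace_eArc (s : LevelSection c) (M : FRep (torusArc k Γ)) :
    ⨆ χ, charSpace ((eArc s).obj M) (s.1 χ) = ⊤ := by
  let J : ((eArc s).obj M).V →ₗ[k] M.V := (eSpace s M).subtype
  have h1 : ⨆ χ, charSpace M (s.1 χ) ≤ (⨆ χ, charSpace ((eArc s).obj M) (s.1 χ)).map J := by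
    rw [Submodule.map_iSup]
    refine iSup_mono fun χ m hm => ?_
    have h2 : m ∈ eSpace s M := by
      rw [eSpace_eq_iSup]
      exact Submodule.mem_iSup_of_mem χ hm
    exact ⟨(⟨m, h2⟩ : eSpace s M), mem_charSpace_sub (eSpace_invariant s M) hm, rfl⟩
  refine top_unique fun m _ => ?_
  have h2 : J m ∈ eSpace s M := Subtype.property (p := fun m => m ∈ eSpace s M) m
  rw [eSpace_eq_iSup] at h2
  obtain ⟨m', h3, h4⟩ := h1 h2
  exact Submodule.subtype_injective (eSpace s M) h4 ▸ h3

theorem charSpace_le_isotypic (W : FRep (torusArc k Γ)) (l : Module.Dual ℤ Γ) :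
    charSpace W l ≤ isotypic ((resZc k c).obj W) l := fun _ hm R z => hm.1 R ((zcTorus k c).app R z)

/-- A `T(O)`-module on which `T(O)` acts through the characters `s(χ)` of `T`. -/
theorem actsThrough_of_iSup {s : LevelSection c} {W : FRep (torusArc k Γ)}
    (h : ⨆ χ, charSpace W (s.1 χ) = ⊤) : ActsThrough s W := by
  classical
  refine ⟨top_unique (h ▸ iSup_le fun χ => inf_le_right), fun χ m hm => ?_⟩
  let P : W.V →ₗ[k] W.V := (zcDiag k c).proj ((resZc k c).obj W) χ
  have hP : ∀ ψ (v : W.V), v ∈ isotypic ((resZc k c).obj W) (s.1 ψ) →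
      P v = if ψ = χ then v else 0 := fun ψ v hv => by
    rw [← weight_zcDiag, s.2] at hv
    exact (zcDiag k c).proj_of_mem hv
  have h1 : ∀ v, P v ∈ charSpace W (s.1 χ) := fun v => by
    have h2 : (⨆ χ, charSpace W (s.1 χ)) ≤ (charSpace W (s.1 χ)).comap P :=
      iSup_le fun ψ v hv => by
        rw [Submodule.mem_comap, hP ψ v (charSpace_le_isotypic W _ hv)]
        split_ifs with h3
        · exact h3 ▸ hv
        · exact Submodule.zero_mem _
    exact h2 (h ▸ Submodule.mem_top)
  have h2 : P m = m := (hP χ m hm).trans (if_pos rfl)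
  exact h2 ▸ (h1 m).1

theorem ActsThrough.isotypic_eq {s : LevelSection c} {W : FRep (torusArc k Γ)}
    (h : ActsThrough s W) (χ : CharQuot c) :
    isotypic ((resZc k c).obj W) (s.1 χ) = charSpace W (s.1 χ) :=
  le_antisymm (fun _ hm => ⟨h.2 χ hm, h.1 ▸ Submodule.mem_top⟩) (charSpace_le_isotypic W _)

theorem iSup_isotypic (s : LevelSection c) (V : ZcMod k c) : ⨆ χ, isotypic V (s.1 χ) = ⊤ := by
  rw [← (zcDiag k c).iSup_weight V]
  refine iSup_congr fun χ => ?_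
  rw [← weight_zcDiag, s.2]

theorem map_mem_isotypic {V V' : ZcMod k c} (f : V ⟶ V') {l : Module.Dual ℤ Γ} {v : V.V}
    (hv : v ∈ isotypic V l) : FRep.lin f v ∈ isotypic V' l := fun R z => by
  refine (FRep.hom_coact f z v).symm.trans ?_
  have h : V.coact z v = _ := hv R z
  rw [h]
  exact LinearMap.baseChange_tmul ..

/-- On modules on which `T(O)` acts through the characters `s(χ)`, morphisms of `Z^c`-modules are
morphisms of `T(O)`-modules. -/
theorem ActsThrough.exists_hom {s : LevelSection c} {W W' : FRep (torusArc k Γ)}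
    (h : ActsThrough s W) (h' : ActsThrough s W')
    (f : (resZc k c).obj W ⟶ (resZc k c).obj W') : ∃ g : W ⟶ W', (resZc k c).map g = f := by
  let f' : W.V →ₗ[k] W'.V :=
    FRep.lin (M := (resZc k c).obj W) (N := (resZc k c).obj W') f
  have hS : Submodule.span k (⋃ χ, (charSpace W (s.1 χ) : Set W.V)) = ⊤ := by
    rw [Submodule.span_iUnion]
    simp only [Submodule.span_eq]
    exact (iSup_congr fun χ => (h.isotypic_eq χ).symm).trans (iSup_isotypic s ((resZc k c).obj W))
  obtain ⟨g, hg⟩ := FRep.exists_hom_of_span (M := W) (N := W') f' hS fun R x m hm => by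
    obtain ⟨χ, hm⟩ := Set.mem_iUnion.1 hm
    have h1 : f' m ∈ charSpace W' (s.1 χ) := by
      rw [← h'.isotypic_eq]
      exact map_mem_isotypic f (charSpace_le_isotypic W _ hm)
    rw [coact_of_mem_charSpace hm, coact_of_mem_charSpace h1, LinearMap.baseChange_tmul]
  exact ⟨g, FRep.Hom.ext hg⟩

end ActsThrough


/-! ### Modules are induced -/

section Induced

variable {k : Type u} [Field k] [CharZero k] {Γ : Type u} [AddCommGroup Γ]
  {c : Γ →ₗ[ℤ] Γ →ₗ[ℤ] ℤ} {F : Frame k c} {H : HeisenbergExtension k c}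
  (s : LevelSection c)

/-- The kernel of a morphism of modules. -/
def kerMod {M N : HeisMod H} (f : M ⟶ N) : HeisMod H :=
  ⟨FRep.sub (FRep.isInvariant_ker f.hom), fun R a x => by
    refine FRep.baseChange_subtype_injective (N := LinearMap.ker (FRep.lin f.hom)) R ?_
    refine (FRep.subAct_spec (FRep.isInvariant_ker f.hom) R (H.scalar R a) x).trans ?_
    refine (M.property R a _).trans ?_
    exact (LinearMap.map_smul ((LinearMap.ker (FRep.lin f.hom)).subtype.baseChange R) _ _).symm⟩

/-- The inclusion of the kernel. -/
def kerIncl {M N : HeisMod H} (f : M ⟶ N) : kerMod f ⟶ M :=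
  ⟨FRep.subIncl (FRep.isInvariant_ker f.hom)⟩

theorem kerIncl_injective {M N : HeisMod H} (f : M ⟶ N) :
    Function.Injective (FRep.lin (kerIncl f).hom) :=
  Submodule.subtype_injective (LinearMap.ker (FRep.lin f.hom))

theorem lin_kerIncl {M N : HeisMod H} (f : M ⟶ N) (m : (kerMod f).obj.V) :
    FRep.lin f.hom (FRep.lin (kerIncl f).hom m) = 0 :=
  Subtype.property (p := fun m => m ∈ LinearMap.ker (FRep.lin f.hom)) m

/-- A morphism of modules is injective as soon as it is on the vectors on which `T(O)` acts
through the characters `s(χ)`. -/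
theorem injective_of_charSpace (L : Lifts F H) {M N : HeisMod H} (f : M ⟶ N)
    (h : ∀ χ, ∀ m ∈ charSpace ((resArc H).obj M) (s.1 χ), FRep.lin f.hom m = 0 → m = 0) :
    Function.Injective (FRep.lin f.hom) := by
  have h1 : (⊥ : Submodule k (kerMod f).obj.V) = ⊤ :=
    L.eq_top_of_stable (kerMod f) s
      (fun p m hm => by rw [(Submodule.mem_bot k).1 hm, map_zero]; exact Submodule.zero_mem _)
      (fun γ m hm => by rw [(Submodule.mem_bot k).1 hm, map_zero]; exact Submodule.zero_mem _)
      fun χ m hm => by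
        have h2 : FRep.lin (kerIncl f).hom (show (kerMod f).obj.V from m) = 0 :=
          h χ _ (map_mem_charSpace ((resArc H).map (kerIncl f)) hm) (lin_kerIncl f m)
        exact kerIncl_injective f (h2.trans (map_zero (FRep.lin (kerIncl f).hom)).symm)
  refine (injective_iff_map_eq_zero _).2 fun m hm => ?_
  have h2 : (⟨m, hm⟩ : LinearMap.ker (FRep.lin f.hom)) ∈
      (⊥ : Submodule k (LinearMap.ker (FRep.lin f.hom))) :=
    (show (⊥ : Submodule k (LinearMap.ker (FRep.lin f.hom))) = ⊤ from h1) ▸ Submodule.mem_top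
  exact congrArg Subtype.val ((Submodule.mem_bot k).1 h2)

theorem isIso_of_bijective {M N : HeisMod H} (f : M ⟶ N)
    (hf : Function.Bijective (FRep.lin f.hom)) : IsIso f := by
  have h1 : IsIso ((ObjectProperty.ι _).map f) := FRep.isIso_of_bijective f.hom hf
  exact isIso_of_reflects_iso f (ObjectProperty.ι _)

theorem eIncl_mem_charSpace (M : HeisMod H) {l : Module.Dual ℤ Γ} {m : ((eO H s).obj M).V}
    (hm : m ∈ charSpace ((eO H s).obj M) l) :
    FRep.lin ((eIncl H s).app M) m ∈ charSpace ((resArc H).obj M) l :=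
  map_mem_charSpace ((eIncl H s).app M) hm

theorem eIncl_injective (M : HeisMod H) :
    Function.Injective (FRep.lin ((eIncl H s).app M)) :=
  Submodule.subtype_injective (eSpace s ((resArc H).obj M))

theorem charSpace_le_range_eIncl (M : HeisMod H) (χ : CharQuot c) :
    charSpace ((resArc H).obj M) (s.1 χ) ≤ LinearMap.range (FRep.lin ((eIncl H s).app M)) := by
  intro m hm
  have h2 : m ∈ eSpace s ((resArc H).obj M) := by
    rw [eSpace_eq_iSup]
    exact Submodule.mem_iSup_of_mem χ hm
  exact ⟨(⟨m, h2⟩ : eSpace s ((resArc H).obj M)), rfl⟩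

/-- Every module is isomorphic to a model whose generators form a basis of `e_s(M)`. -/
theorem exists_model_iso (L : Lifts F H) (hc : Function.Injective c) (M : HeisMod H) :
    ∃ (B : Type u) (v : B → ((eO H s).obj M).V) (χ : B → CharQuot c)
      (Φ : model (fun b => s.1 (χ b)) L ⟶ M), IsIso Φ ∧
      Submodule.span k (Set.range v) = ⊤ ∧
      (∀ b, v b ∈ charSpace ((eO H s).obj M) (s.1 (χ b))) ∧
      ∀ b, FRep.lin Φ.hom (modelVec _ L b) = FRep.lin ((eIncl H s).app M) (v b) := by
  obtain ⟨B, v, χ, hli, hv, hspan⟩ :=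
    exists_adapted_basis fun χ => charSpace ((eO H s).obj M) (s.1 χ)
  have hspan := hspan.trans (iSup_charSpace_eArc s ((resArc H).obj M))
  obtain ⟨Φ, hΦ⟩ := exists_model_hom (fun b => s.1 (χ b)) L (N := M)
    (fun b => FRep.lin ((eIncl H s).app M) (v b)) fun b => eIncl_mem_charSpace s M (hv b)
  refine ⟨B, v, χ, Φ, isIso_of_bijective Φ ⟨?_, ?_⟩, hspan, hv, hΦ⟩
  · refine injective_of_charSpace s L Φ fun ψ m hm h0 => ?_
    have h1 := charSpace_model_le (fun b => s.1 (χ b)) L hc s (fun _ => rfl) ψ hm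
    let J : ((eO H s).obj M).V →ₗ[k] M.obj.V := FRep.lin ((eIncl H s).app M)
    have hJ : LinearIndependent k (J ∘ v) :=
      hli.map' J (LinearMap.ker_eq_bot.2 (eIncl_injective s M))
    have hJΦ : J ∘ v = FRep.lin Φ.hom ∘ modelVec _ L := funext fun b => (hΦ b).symm
    rw [hJΦ] at hJ
    obtain ⟨a, ha⟩ := (Finsupp.mem_span_range_iff_exists_finsupp (R := k)
      (M := (model (fun b => s.1 (χ b)) L).obj.V)).1 h1
    have h2 : Finsupp.linearCombination k (modelVec (fun b => s.1 (χ b)) L) a = m := ha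
    have h3 : Finsupp.linearCombination k (FRep.lin Φ.hom ∘ modelVec _ L) a = 0 := by
      rw [← Finsupp.apply_linearCombination, h2]
      exact h0
    have h4 : a = 0 := linearIndependent_iff.1 hJ a h3
    rw [← h2, h4]
    exact map_zero (Finsupp.linearCombination k (modelVec (fun b => s.1 (χ b)) L))
  · rw [← LinearMap.range_eq_top]
    refine L.eq_top_of_stable M s ?_ ?_ fun ψ => ?_
    · rintro p _ ⟨m, rfl⟩
      exact ⟨_, L.hom_b Φ p m⟩
    · rintro γ _ ⟨m, rfl⟩
      exact ⟨_, FRep.hom_kact Φ.hom _ m⟩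
    · refine (charSpace_le_range_eIncl s M ψ).trans ?_
      let J : ((eO H s).obj M).V →ₗ[k] M.obj.V := FRep.lin ((eIncl H s).app M)
      change LinearMap.range J ≤ LinearMap.range (FRep.lin Φ.hom)
      rw [LinearMap.range_eq_map, ← hspan, Submodule.map_span_le]
      rintro _ ⟨b, rfl⟩
      exact ⟨_, hΦ b⟩

/-- Every module is induced from `e_s(M)`, since this holds for the models. -/
theorem isInduced_eIncl (L : Lifts F H) (hc : Function.Injective c) (M : HeisMod H) :
    IsInduced H ((eIncl H s).app M) := by
  intro N f
  obtain ⟨B, v, χ, Φ, hΦ, hspan, hv, hvec⟩ := exists_model_iso s L hc M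
  obtain ⟨Ψ, hΨ⟩ := exists_model_hom (fun b => s.1 (χ b)) L (N := N)
    (fun b => FRep.lin f (v b)) fun b => map_mem_charSpace f (hv b)
  refine ⟨inv Φ ≫ Ψ, ?_, fun g hg => ?_⟩
  · refine FRep.hom_ext (LinearMap.ext_on hspan ?_)
    rintro _ ⟨b, rfl⟩
    change FRep.lin (inv Φ ≫ Ψ).hom (FRep.lin ((eIncl H s).app M) (v b)) = FRep.lin f (v b)
    rw [← hvec, ← hΨ]
    have h1 : Φ ≫ inv Φ ≫ Ψ = Ψ := IsIso.hom_inv_id_assoc Φ Ψ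
    exact congrArg (fun z : model (fun b => s.1 (χ b)) L ⟶ N => FRep.lin z.hom (modelVec _ L b)) h1
  · rw [← cancel_epi Φ, IsIso.hom_inv_id_assoc]
    refine model_hom_ext _ L fun b => ?_
    rw [hΨ, ← hg]
    exact congrArg (FRep.lin g.hom) (hvec b)

theorem actsThrough_eO (M : HeisMod H) : ActsThrough s ((eO H s).obj M) :=
  actsThrough_of_iSup (iSup_charSpace_eArc s ((resArc H).obj M))

end Induced


/-! ### The equivalence -/

section Equivalence

variable {k : Type u} [Field k] [CharZero k] {Γ : Type u} [AddCommGroup Γ]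
  {c : Γ →ₗ[ℤ] Γ →ₗ[ℤ] ℤ} {F : Frame k c} {H : HeisenbergExtension k c}
  (s : LevelSection c)

theorem eFunctor_faithful (L : Lifts F H) (hc : Function.Injective c) :
    (eFunctor H s).Faithful where
  map_injective {M N f g} h := by
    have h1 : (eIncl H s).app M ≫ (resArc H).map f = (eIncl H s).app M ≫ (resArc H).map g := by
      rw [← (eIncl H s).naturality, ← (eIncl H s).naturality]
      exact congrArg (· ≫ (eIncl H s).app N) (FRep.hom_ext
        (congrArg (fun φ : (eFunctor H s).obj M ⟶ (eFunctor H s).obj N => FRep.lin φ) h))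
    exact (isInduced_eIncl s L hc M N _).unique h1 rfl

theorem eFunctor_full (L : Lifts F H) (hc : Function.Injective c) : (eFunctor H s).Full where
  map_surjective {M N} φ := by
    obtain ⟨f, hf⟩ := (actsThrough_eO s M).exists_hom (actsThrough_eO s N) φ
    obtain ⟨g, hg, -⟩ := isInduced_eIncl s L hc M N (f ≫ (eIncl H s).app N)
    refine ⟨g, ?_⟩
    have h1 : (eO H s).map g ≫ (eIncl H s).app N = f ≫ (eIncl H s).app N :=
      ((eIncl H s).naturality g).trans hg
    have h2 : (eO H s).map g = f := FRep.hom_ext (LinearMap.ext fun m =>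
      eIncl_injective s N (LinearMap.congr_fun (congrArg FRep.lin h1) m))
    exact (congrArg (resZc k c).map h2).trans hf

theorem exists_mem_charSpace_eO (M : HeisMod H) {χ : CharQuot c} {m : ((resArc H).obj M).V}
    (hm : m ∈ charSpace ((resArc H).obj M) (s.1 χ)) :
    ∃ m' ∈ charSpace ((eO H s).obj M) (s.1 χ), FRep.lin ((eIncl H s).app M) m' = m := by
  have h2 : m ∈ eSpace s ((resArc H).obj M) := by
    rw [eSpace_eq_iSup]
    exact Submodule.mem_iSup_of_mem χ hm
  exact ⟨(⟨m, h2⟩ : eSpace s ((resArc H).obj M)), mem_charSpace_sub _ hm, rfl⟩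

/-- A `Z^c`-module is `e_s` of the model on a basis of its isotypical components. -/
theorem eFunctor_essSurj (L : Lifts F H) (hc : Function.Injective c) :
    (eFunctor H s).EssSurj where
  mem_essImage V := by
    obtain ⟨B, v, χ, hli, hv, hspan⟩ := exists_adapted_basis fun χ => isotypic V (s.1 χ)
    have hspan := hspan.trans (iSup_isotypic s V)
    let l : B → Module.Dual ℤ Γ := fun b => s.1 (χ b)
    let N : HeisMod H := model l L
    let J : ((eO H s).obj N).V →ₗ[k] N.obj.V := FRep.lin ((eIncl H s).app N)
    choose w hw hJw using fun b => exists_mem_charSpace_eO s N (modelVec_mem_charSpace l L b)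
    have hJw' : J ∘ w = modelVec l L := funext hJw
    have hwli : LinearIndependent k w := by
      refine LinearIndependent.of_comp J ?_
      rw [hJw']
      exact linearIndependent_modelVec l L
    have hwspan : ⊤ ≤ Submodule.span k (Set.range w) := by
      rw [← iSup_charSpace_eArc s ((resArc H).obj N)]
      refine iSup_le fun ψ m hm => ?_
      have h1 : J m ∈ Submodule.span k (Set.range (modelVec l L)) :=
        charSpace_model_le l L hc s (fun _ => rfl) ψ (eIncl_mem_charSpace s N hm)
      rw [← hJw', Set.range_comp, ← Submodule.map_span] at h1
      obtain ⟨m', h2, h3⟩ := h1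
      exact eIncl_injective s N h3 ▸ h2
    let e : ((eO H s).obj N).V ≃ₗ[k] V.V :=
      (Module.Basis.mk hwli hwspan).equiv (Module.Basis.mk hli hspan.ge) (Equiv.refl B)
    have he : ∀ b, e (w b) = v b := fun b => by
      have h1 := (Module.Basis.mk hwli hwspan).equiv_apply b (Module.Basis.mk hli hspan.ge)
        (Equiv.refl B)
      rwa [Module.Basis.mk_apply, Equiv.refl_apply, Module.Basis.mk_apply] at h1
    let e' : ((eFunctor H s).obj N).V →ₗ[k] V.V := e.toLinearMap
    have he' : ∀ b, e' (w b) = v b := he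
    obtain ⟨φ, hφ⟩ := FRep.exists_hom_of_span (M := (eFunctor H s).obj N) (N := V) e'
      (S := Set.range w) (top_unique hwspan) fun R z m hm => by
        obtain ⟨b, rfl⟩ := hm
        have h1 : ((eFunctor H s).obj N).coact z (w b) = _ :=
          charSpace_le_isotypic _ _ (hw b) R z
        have h2 : V.coact z (v b) = _ := hv b R z
        rw [h1, he', h2]
        exact (LinearMap.baseChange_tmul ..).trans (congrArg _ (he' b))
    have h3 : IsIso φ := FRep.isIso_of_bijective φ (by rw [hφ]; exact e.bijective)
    exact ⟨N, ⟨asIso φ⟩⟩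

theorem eFunctor_isEquivalence (L : Lifts F H) (hc : Function.Injective c) :
    (eFunctor H s).IsEquivalence where
  faithful := eFunctor_faithful s L hc
  full := eFunctor_full s L hc
  essSurj := eFunctor_essSurj s L hc

/-- An inverse of `e_s` is given by induction. -/
theorem exists_induction (L : Lifts F H) (hc : Function.Injective c) :
    ∃ (W : ZcMod k c ⥤ FRep (torusArc k Γ)) (Ind : ZcMod k c ⥤ HeisMod H)
      (j : W ⟶ Ind ⋙ resArc H), Nonempty (W ⋙ resZc k c ≅ 𝟭 _) ∧
      (∀ V, ActsThrough s (W.obj V) ∧ IsInduced H (j.app V)) ∧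
      Nonempty (eFunctor H s ⋙ Ind ≅ 𝟭 _) ∧ Nonempty (Ind ⋙ eFunctor H s ≅ 𝟭 _) := by
  have := eFunctor_isEquivalence s L hc
  let E := (eFunctor H s).asEquivalence
  exact ⟨E.inverse ⋙ eO H s, E.inverse, Functor.whiskerLeft E.inverse (eIncl H s),
    ⟨E.counitIso⟩, fun V => ⟨actsThrough_eO s _, isInduced_eIncl s L hc _⟩,
    ⟨E.unitIso.symm⟩, ⟨E.counitIso⟩⟩

end Equivalence


/-! ### Parity -/

section Parity

variable {k : Type u} [Field k] [CharZero k] {Γ : Type u} [AddCommGroup Γ]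
  {c : Γ →ₗ[ℤ] Γ →ₗ[ℤ] ℤ} {F : Frame k c} {H : HeisenbergExtension k c}
  {R : CommAlgCat.{u} k}

theorem hasDegree_loopPow (γ : Γ) : HasDegree k (loopPow k (tUnit (R := (R : Type u))) γ) γ := by
  intro l
  have h : ((ev (loopPow k (tUnit (R := (R : Type u))) γ) l : (R : Type u)⸨X⸩ˣ) :
      (R : Type u)⸨X⸩) = HahnSeries.single (l γ) 1 := by
    rw [ev_loopPow, coe_tUnit_zpow]
  change HasValuation ((ev (loopPow k (tUnit (R := (R : Type u))) γ) l : (R : Type u)⸨X⸩ˣ) :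
      (R : Type u)⸨X⸩) (l γ)
  rw [h]
  refine ⟨?_, fun j hj => ?_⟩
  · rw [HahnSeries.coeff_single_same]
    exact isUnit_one
  · rw [HahnSeries.coeff_single_of_ne hj.ne]
    exact IsNilpotent.zero

theorem hasDegree_negPoint (ν : F.N R) : HasDegree k (F.negPoint ν) 0 := by
  intro l
  -- Modulo the nilradical the point becomes trivial.
  let S : CommAlgCat.{u} k := CommAlgCat.of k ((R : Type u) ⧸ nilradical (R : Type u))
  let φ : R ⟶ S := CommAlgCat.ofHom (Ideal.Quotient.mkₐ k (nilradical (R : Type u)))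
  have h0 : F.mapN φ ν = 0 := Finsupp.ext fun p => Subtype.ext
    (Ideal.Quotient.eq_zero_iff_mem.2 (ν p).2)
  have h1 : (torusLoop k Γ).map φ (F.negPoint ν) = 1 := by
    rw [F.negPoint_map, h0, F.negPoint_zero]
  have h2 : ∀ j, φ.hom (((ev (F.negPoint ν) l : (R : Type u)⸨X⸩ˣ) : (R : Type u)⸨X⸩).coeff j) =
      (1 : (S : Type u)⸨X⸩).coeff j := fun j => by
    have h3 := congrArg (fun x => ((ev x l : (S : Type u)⸨X⸩ˣ) : (S : Type u)⸨X⸩).coeff j) h1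
    beta_reduce at h3
    rw [ev_map, ev_one] at h3
    exact h3
  have h4 : ∀ r : R, φ.hom r = 0 → IsNilpotent r := fun r hr =>
    mem_nilradical.1 (Ideal.Quotient.eq_zero_iff_mem.1 hr)
  rw [map_zero]
  change HasValuation ((ev (F.negPoint ν) l : (R : Type u)⸨X⸩ˣ) : (R : Type u)⸨X⸩) 0
  refine ⟨?_, fun j hj => h4 _ ?_⟩
  · have h5 : IsNilpotent
        (((ev (F.negPoint ν) l : (R : Type u)⸨X⸩ˣ) : (R : Type u)⸨X⸩).coeff 0 - 1) := by
      refine h4 _ ?_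
      rw [map_sub, h2, map_one, HahnSeries.coeff_one, if_pos rfl, sub_self]
    have h6 := h5.isUnit_one_add
    rwa [add_sub_cancel] at h6
  · rw [h2, HahnSeries.coeff_one, if_neg hj.ne]

theorem SuperHeisMod.parity_kact (L : Lifts F H) (M : SuperHeisMod H) (γ : Γ) (m : M.mod.obj.V) :
    M.parity (M.mod.obj.kact (L.base γ) m) =
      (-1 : kˣ) ^ c γ γ • M.mod.obj.kact (L.base γ) (M.parity m) := by
  have h := M.parity_act (CommAlgCat.of k k) (L.base γ) γ
    (by rw [L.base_proj]; exact hasDegree_loopPow γ) ((1 : k) ⊗ₜ m)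
  have h1 : M.mod.obj.act (CommAlgCat.of k k) (L.base γ) ((1 : k) ⊗ₜ m) =
      (1 : k) ⊗ₜ M.mod.obj.kact (L.base γ) m := (M.mod.obj.one_tmul_kact _ m).symm
  have h2 : M.mod.obj.act (CommAlgCat.of k k) (L.base γ) ((1 : k) ⊗ₜ M.parity m) =
      (1 : k) ⊗ₜ M.mod.obj.kact (L.base γ) (M.parity m) := (M.mod.obj.one_tmul_kact _ _).symm
  have h3 : M.parity.baseChange k ((1 : k) ⊗ₜ[k] M.mod.obj.kact (L.base γ) m) =
      (-1 : kˣ) ^ c γ γ • ((1 : k) ⊗ₜ[k] M.mod.obj.kact (L.base γ) (M.parity m)) := by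
    rw [← h1, ← h2]
    exact h.trans (congrArg (fun z => (-1 : kˣ) ^ c γ γ • M.mod.obj.act _ (L.base γ) z)
      (LinearMap.baseChange_tmul ..))
  rw [LinearMap.baseChange_tmul] at h3
  refine (TensorProduct.lid k M.mod.obj.V).symm.injective (h3.trans ?_)
  exact (TensorProduct.tmul_smul (((-1 : kˣ) ^ c γ γ : kˣ) : k) (1 : k)
    (M.mod.obj.kact (L.base γ) (M.parity m))).symm

/-- The parity commutes with the infinitesimal generators, the negative part having valuation
zero. -/
theorem SuperHeisMod.parity_b (L : Lifts F H) (M : SuperHeisMod H) (p : F.P) (m : M.mod.obj.V) :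
    M.parity (L.b M.mod p m) = L.b M.mod p (M.parity m) := by
  have h := M.parity_act _ (L.neg _ (F.sq p (dualEps (CommAlgCat.of k k)) dualEps_sq)) 0
    (by rw [L.neg_proj]; exact hasDegree_negPoint _) (1 ⊗ₜ m)
  have h0 : (-1 : (dual (CommAlgCat.of k k) : Type u)ˣ) ^ c (0 : Γ) (0 : Γ) = 1 := by simp
  rw [h0, one_smul, LinearMap.baseChange_tmul, ← FRep.coact_apply, ← FRep.coact_apply,
    L.coact_neg_sq, L.coact_neg_sq, map_add (M.parity.baseChange _),
    map_smul (M.parity.baseChange _), LinearMap.baseChange_tmul, LinearMap.baseChange_tmul] at h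
  exact smul_one_tmul_injective (add_left_cancel h)

/-- The diagonal of a symmetric form modulo two is linear, hence is represented by a vector. -/
theorem exists_diagonal [Module.Free ℤ Γ] [Module.Finite ℤ Γ] (hsymm : ∀ x y, c x y = c y x) :
    ∃ δ : Γ, ∀ γ, Even (c γ γ - c γ δ) := by
  let V := ZMod 2 ⊗[ℤ] Γ
  let A : V →ₗ[ZMod 2] V →ₗ[ZMod 2] ZMod 2 := LinearMap.BilinForm.baseChange (ZMod 2) c
  have hA : ∀ a b x y, A (a ⊗ₜ x) (b ⊗ₜ y) = a * b * (c x y : ZMod 2) := fun a b x y =>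
    (LinearMap.BilinForm.baseChange_tmul (A := ZMod 2) c a x b y).trans
      (by rw [zsmul_eq_mul, mul_comm])
  have hrep : ∀ v : V, ∃ γ : Γ, v = (1 : ZMod 2) ⊗ₜ γ := fun v => by
    induction v using TensorProduct.induction_on with
    | zero => exact ⟨0, (TensorProduct.tmul_zero _ _).symm⟩
    | tmul a γ =>
      refine ⟨(a.val : ℤ) • γ, ?_⟩
      rw [TensorProduct.tmul_smul, TensorProduct.smul_tmul', zsmul_one]
      simp
    | add a b ha hb =>
      obtain ⟨γ, rfl⟩ := ha
      obtain ⟨γ', rfl⟩ := hb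
      exact ⟨γ + γ', (TensorProduct.tmul_add _ _ _).symm⟩
  have hAsymm : ∀ v w, A v w = A w v := fun v w => by
    obtain ⟨γ, rfl⟩ := hrep v
    obtain ⟨γ', rfl⟩ := hrep w
    rw [hA, hA, hsymm]
  let q : V →ₗ[ZMod 2] ZMod 2 :=
    { toFun := fun v => A v v
      map_add' := fun v w => by
        rw [map_add, map_add, LinearMap.add_apply, LinearMap.add_apply, hAsymm w v]
        linear_combination A v w * (CharTwo.two_eq_zero : (2 : ZMod 2) = 0)
      map_smul' := fun a v => by
        rw [map_smul, map_smul, LinearMap.smul_apply, smul_smul, RingHom.id_apply]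
        congr 1
        generalize A v v = y
        revert a
        decide }
  have hq : q ∈ LinearMap.range (A.dualMap.comp (Module.Dual.eval (ZMod 2) V)) := by
    have h1 : LinearMap.range (A.dualMap.comp (Module.Dual.eval (ZMod 2) V)) =
        (LinearMap.ker A).dualAnnihilator := by
      rw [LinearMap.range_comp, LinearMap.range_eq_top.2 (Module.bijective_dual_eval (ZMod 2) V).2,
        Submodule.map_top, LinearMap.range_dualMap_eq_dualAnnihilator_ker]
    rw [h1, Submodule.mem_dualAnnihilator]
    intro v hv
    change A v v = 0
    rw [LinearMap.mem_ker.1 hv, LinearMap.zero_apply]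
  obtain ⟨v, hv⟩ := hq
  obtain ⟨δ, rfl⟩ := hrep v
  refine ⟨δ, fun γ => ?_⟩
  have h1 : A (1 ⊗ₜ γ) (1 ⊗ₜ δ) = A (1 ⊗ₜ γ) (1 ⊗ₜ γ) :=
    LinearMap.congr_fun hv ((1 : ZMod 2) ⊗ₜ γ)
  rw [hA, hA, one_mul, one_mul, one_mul] at h1
  rw [← ZMod.intCast_eq_zero_iff_even, Int.cast_sub, h1, sub_self]

end Parity


/-! ### Super modules -/

section SignElement

variable {k : Type u} [Field k] [CharZero k] {Γ : Type u} [AddCommGroup Γ]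
  {c : Γ →ₗ[ℤ] Γ →ₗ[ℤ] ℤ} {F : Frame k c} (H : HeisenbergExtension k c)
  (R : CommAlgCat.{u} k) {S : CommAlgCat.{u} k}

/-- The point `(-1)^δ` of `T`. -/
def signTorus (δ : Γ) : (torus k Γ).obj R :=
  (zpowersHom (R : Type u)ˣ (-1)).comp
    (AddMonoidHom.toMultiplicative (Module.Dual.eval ℤ Γ δ).toAddMonoidHom)

variable {R}

theorem ev_signTorus (δ : Γ) (l : Module.Dual ℤ Γ) :
    ev (signTorus (k := k) R δ) l = (-1) ^ l δ := rfl

theorem signTorus_map (φ : R ⟶ S) (δ : Γ) :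
    (torus k Γ).map φ (signTorus R δ) = signTorus S δ :=
  ev_ext fun l => by
    rw [ev_map, ev_signTorus, ev_signTorus, map_zpow]
    congr 1
    exact Units.ext ((map_neg φ.hom 1).trans (congrArg _ (map_one φ.hom)))

theorem signTorus_mul_self (δ : Γ) : signTorus (k := k) R δ * signTorus R δ = 1 :=
  ev_ext fun l => by
    rw [ev_mul, ev_signTorus, ev_one, ← mul_zpow, neg_one_mul, neg_neg, one_zpow]

variable (R) in
/-- The point `(-1)^δ` of `T(F)~`. -/
def signPt (δ : Γ) : H.G.obj R := H.splitting.app R ((constArc k Γ).app R (signTorus R δ))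

theorem signPt_map (φ : R ⟶ S) (δ : Γ) : H.G.map φ (signPt H R δ) = signPt H S δ := by
  have h : (torusArc k Γ).map φ ((constArc k Γ).app R (signTorus R δ)) =
      (constArc k Γ).app S ((torus k Γ).map φ (signTorus R δ)) :=
    (congrArg (fun g => g.hom (signTorus R δ)) ((constArc k Γ).naturality φ)).symm
  rw [signPt, ← H.splitting_map, h, signTorus_map, signPt]

theorem signPt_mul_self (δ : Γ) : signPt H R δ * signPt H R δ = 1 := by
  rw [signPt, ← map_mul, ← map_mul, signTorus_mul_self, map_one, map_one]

variable {H}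

theorem comm_nf_signPt (L : Lifts F H) (a : (R : Type u)ˣ) (γ δ : Γ) (x : (torusArc k Γ).obj R)
    (ν : F.N R) : H.Comm (L.nf a γ x ν) (signPt H R δ) ((-1) ^ c γ δ) := by
  have h1 : H.Comm (L.t R γ) (signPt H R δ) ((-1) ^ c γ δ) := by
    have h := L.t_arc γ ((constArc k Γ).app R (signTorus R δ))
    rwa [arcConst_constArc, ev_signTorus] at h
  have h2 : H.Comm (L.neg R ν) (signPt H R δ) 1 := by
    have h := L.neg_arc ν ((constArc k Γ).app R (signTorus R δ))
    have h0 : F.pair (0 : F.P → R) ν = 0 := by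
      have h00 := F.pair_add (0 : F.P → R) 0 ν
      rwa [add_zero, left_eq_add] at h00
    rwa [F.logCoord_constArc, h0, neg_zero, nilExpUnit_zero] at h
  have h3 : H.Comm (H.splitting.app R x) (signPt H R δ) 1 := by
    unfold HeisenbergExtension.Comm
    rw [map_one, one_mul, signPt, ← map_mul, torusArc_comm, map_mul]
  have h4 : H.Comm (H.scalar R a) (signPt H R δ) 1 := by
    unfold HeisenbergExtension.Comm
    rw [map_one, one_mul, H.scalar_central]
  have h5 := h4.mul_left ((h1.mul_left h3).mul_left h2)
  rwa [mul_one, mul_one, one_mul] at h5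

theorem comm_signPt (L : Lifts F H) {g : H.G.obj R} {γ : Γ} (hg : HasDegree k (H.proj.app R g) γ)
    (δ : Γ) : H.Comm g (signPt H R δ) ((-1) ^ c γ δ) := by
  obtain ⟨x, ν, h⟩ := F.exists_factor_of_hasDegree hg
  obtain ⟨a, rfl⟩ := L.exists_nf h
  exact comm_nf_signPt L a γ δ x ν

theorem neg_one_zpow_congr {A : Type*} [Ring A] {m n : ℤ} (h : Even (m - n)) :
    (-1 : Aˣ) ^ m = (-1) ^ n := by
  rw [← sub_add_cancel m n, zpow_add, h.neg_one_zpow, one_mul]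

theorem inv_neg_one_zpow_congr {A : Type*} [Ring A] {m n : ℤ} (h : Even (m - n)) :
    ((-1 : Aˣ) ^ n)⁻¹ = (-1) ^ m := by
  rw [neg_one_zpow_congr h, ← inv_zpow, inv_neg, inv_one]

theorem signPt_mul (L : Lifts F H) {δ : Γ} (hδ : ∀ γ, Even (c γ γ - c γ δ)) {g : H.G.obj R} {γ : Γ}
    (hg : HasDegree k (H.proj.app R g) γ) :
    signPt H R δ * g = H.scalar R ((-1) ^ c γ γ) * (g * signPt H R δ) := by
  have h := (comm_signPt L hg δ).symm
  rw [inv_neg_one_zpow_congr (hδ γ)] at h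
  exact h

theorem act_signPt (M : HeisMod H) (δ : Γ) :
    M.obj.act R (signPt H R δ) = (M.obj.kact (signPt H _ δ)).baseChange R := by
  rw [← FRep.act_map, signPt_map]

/-- The operator of the point `(-1)^δ` is a parity for the points of `T(F)~`. -/
theorem sign_act (L : Lifts F H) {δ : Γ} (hδ : ∀ γ, Even (c γ γ - c γ δ)) (M : HeisMod H)
    {g : H.G.obj R} {γ : Γ} (hg : HasDegree k (H.proj.app R g) γ) (x : (R : Type u) ⊗[k] M.obj.V) :
    (M.obj.kact (signPt H _ δ)).baseChange R (M.obj.act R g x) =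
      (-1 : (R : Type u)ˣ) ^ c γ γ • M.obj.act R g
        ((M.obj.kact (signPt H _ δ)).baseChange R x) := by
  rw [← act_signPt]
  refine (M.obj.act_mul_apply (signPt H R δ) g x).symm.trans ?_
  rw [signPt_mul L hδ hg, M.obj.act_mul_apply, act_scalar, M.obj.act_mul_apply]
  generalize M.obj.act R g (M.obj.act R (signPt H R δ) x) = y
  exact (Units.smul_def ((-1 : (R : Type u)ˣ) ^ c γ γ) y).symm

end SignElement

section SuperEquivalence

variable {k : Type u} [Field k] [CharZero k] {Γ : Type u} [AddCommGroup Γ]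
  {c : Γ →ₗ[ℤ] Γ →ₗ[ℤ] ℤ} {F : Frame k c} {H : HeisenbergExtension k c}
  (s : LevelSection c)

theorem kact_signPt_sq (M : HeisMod H) (δ : Γ) (m : M.obj.V) :
    M.obj.kact (signPt H _ δ) (M.obj.kact (signPt H _ δ) m) = m := by
  rw [← FRep.kact_mul, signPt_mul_self, FRep.kact_one]

/-- The operator of the point `(-1)^δ` commutes with `T(O)`. -/
def signArc (M : HeisMod H) (δ : Γ) : (resArc H).obj M ⟶ (resArc H).obj M :=
  FRep.Hom.mk (M.obj.kact (signPt H _ δ)) fun R x w => by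
    have h : signPt H R δ * H.splitting.app R x = H.splitting.app R x * signPt H R δ := by
      rw [signPt, ← map_mul, torusArc_comm, map_mul]
    have h1 : ∀ w : (R : Type u) ⊗[k] M.obj.V,
        (M.obj.kact (signPt H _ δ)).baseChange R (M.obj.act R (H.splitting.app R x) w) =
        M.obj.act R (H.splitting.app R x) ((M.obj.kact (signPt H _ δ)).baseChange R w) :=
            fun w => by
      rw [← FRep.act_map, signPt_map, ← FRep.act_mul_apply, ← FRep.act_mul_apply, h]
    exact h1 w

theorem signArc_sq (M : HeisMod H) (δ : Γ) : signArc M δ ≫ signArc M δ = 𝟙 _ :=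
  FRep.hom_ext (LinearMap.ext fun m => kact_signPt_sq M δ m)

theorem signArc_comm {M N : HeisMod H} (f : M ⟶ N) (δ : Γ) :
    (resArc H).map f ≫ signArc N δ = signArc M δ ≫ (resArc H).map f :=
  FRep.hom_ext (LinearMap.ext fun m => (FRep.hom_kact f.hom (signPt H _ δ) m).symm)

/-- The super module given by an involution of a module. -/
def superOfInvolution (L : Lifts F H) {δ : Γ} (hδ : ∀ γ, Even (c γ γ - c γ δ)) (M : HeisMod H)
    (P : M ⟶ M) (hP : P ≫ P = 𝟙 M) : SuperHeisMod H where
  mod := M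
  parity := (FRep.lin P.hom).comp (M.obj.kact (signPt H _ δ))
  parity_sq := LinearMap.ext fun m => by
    have h : ∀ m, FRep.lin P.hom (FRep.lin P.hom m) = m := fun m =>
      congrArg (fun f : M ⟶ M => FRep.lin f.hom m) hP
    change FRep.lin P.hom (M.obj.kact _ (FRep.lin P.hom (M.obj.kact _ m))) = m
    rw [← FRep.hom_kact, h, kact_signPt_sq]
  parity_act R g γ hg x := by
    have h1 : ∀ y, (FRep.lin P.hom).baseChange R (M.obj.act R g y) =
        M.obj.act R g ((FRep.lin P.hom).baseChange R y) :=
      FRep.Hom.equivariant (show FRep.Hom M.obj M.obj from P.hom) R g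
    rw [LinearMap.baseChange_comp, LinearMap.comp_apply, LinearMap.comp_apply,
      sign_act L hδ M hg, Units.smul_def, map_smul ((FRep.lin P.hom).baseChange R), h1,
      Units.smul_def]

theorem eSuper_faithful (L : Lifts F H) (hc : Function.Injective c) :
    (eSuper H s).Faithful where
  map_injective {M N f g} h := by
    have := eFunctor_faithful s L hc
    exact SuperHeisMod.Hom.ext ((eFunctor H s).map_injective (congrArg SuperFRep.Hom.hom h))

theorem lin_eIncl_parity (M : SuperHeisMod H) (m : ((eO H s).obj M.mod).V) :
    FRep.lin ((eIncl H s).app M.mod) (FRep.lin ((eSuper H s).obj M).parity m) =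
      M.parity (FRep.lin ((eIncl H s).app M.mod) m) := rfl

theorem eSuper_full (L : Lifts F H) (hc : Function.Injective c) : (eSuper H s).Full where
  map_surjective {M N} φ := by
    have := eFunctor_full (H := H) s L hc
    obtain ⟨g, hg⟩ := (eFunctor H s).map_surjective φ.hom
    have hcomm : LinearMap.eqLocus ((FRep.lin g.hom).comp M.parity)
        (N.parity.comp (FRep.lin g.hom)) = ⊤ := by
      refine L.eq_top_of_stable M.mod s (fun p m hm => ?_) (fun γ m hm => ?_) fun χ m hm => ?_
      · have hm' : FRep.lin g.hom (M.parity m) = N.parity (FRep.lin g.hom m) := hm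
        change FRep.lin g.hom (M.parity _) = N.parity (FRep.lin g.hom _)
        rw [M.parity_b, L.hom_b, L.hom_b, N.parity_b, hm']
      · have hm' : FRep.lin g.hom (M.parity m) = N.parity (FRep.lin g.hom m) := hm
        change FRep.lin g.hom (M.parity _) = N.parity (FRep.lin g.hom _)
        rw [M.parity_kact, FRep.hom_kact, N.parity_kact, Units.smul_def, map_smul, FRep.hom_kact,
          hm', Units.smul_def]
      · obtain ⟨m', -, rfl⟩ := exists_mem_charSpace_eO s M.mod hm
        have h1 := congrArg (fun f : ((eSuper H s).obj M).rep ⟶ ((eSuper H s).obj N).rep =>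
          FRep.lin f m') φ.comm
        rw [← hg] at h1
        exact congrArg (FRep.lin ((eIncl H s).app N.mod)) h1
    refine ⟨⟨g, LinearMap.ext fun m => ?_⟩, SuperFRep.Hom.ext hg⟩
    have h1 : m ∈ LinearMap.eqLocus ((FRep.lin g.hom).comp M.parity)
        (N.parity.comp (FRep.lin g.hom)) := hcomm ▸ Submodule.mem_top
    exact h1

theorem comp_comp_self {C : Type*} [Category C] {X : C} {p z : X ⟶ X} (hp : p ≫ p = 𝟙 X)
    (hz : z ≫ z = 𝟙 X) (h : p ≫ z = z ≫ p) : (z ≫ p) ≫ z ≫ p = 𝟙 X := by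
  rw [Category.assoc, reassoc_of% h, hp, Category.comp_id, hz]

theorem conj_comp_hom {C : Type*} [Category C] {X Y : C} (e : X ≅ Y) (p : Y ⟶ Y) :
    (e.hom ≫ p ≫ e.inv) ≫ e.hom = e.hom ≫ p := by
  simp

theorem inv_comp_conj {C : Type*} [Category C] {X Y : C} (e : X ≅ Y) (p : Y ⟶ Y) :
    e.inv ≫ e.hom ≫ p ≫ e.inv = p ≫ e.inv := by
  simp

/-- Let `e_s(M)` be isomorphic to `V`, with the parity `p` of `V` transported to it. For the
operator `ζ` of the point `(-1)^δ`, the composite of `ζ` and `p` comes from an involution `P` of the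
`T(F)~`-module `M`, and the composite of `P` and `ζ` is a parity on `M` that restricts to `p`. -/
theorem eSuper_essSurj (L : Lifts F H) (hc : Function.Injective c) {δ : Γ}
    (hδ : ∀ γ, Even (c γ γ - c γ δ)) : (eSuper H s).EssSurj where
  mem_essImage V := by
    have := eFunctor_isEquivalence (H := H) s L hc
    let M := (eFunctor H s).objPreimage V.rep
    let e : (eFunctor H s).obj M ≅ V.rep := (eFunctor H s).objObjPreimageIso V.rep
    obtain ⟨p, hp⟩ := (eFunctor H s).map_surjective (e.hom ≫ V.parity ≫ e.inv)
    let E := eArc s ⋙ resZc k c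
    let ζ : (eFunctor H s).obj M ⟶ (eFunctor H s).obj M := E.map (signArc M δ)
    have hζ : ζ ≫ ζ = 𝟙 _ := by
      refine (E.map_comp _ _).symm.trans ?_
      rw [signArc_sq]
      exact E.map_id _
    have hζp : (eFunctor H s).map p ≫ ζ = ζ ≫ (eFunctor H s).map p :=
      (E.map_comp _ _).symm.trans ((congrArg E.map (signArc_comm p δ)).trans (E.map_comp _ _))
    obtain ⟨P, hP⟩ := (eFunctor H s).map_surjective (ζ ≫ (eFunctor H s).map p)
    have hpp : (eFunctor H s).map p ≫ (eFunctor H s).map p = 𝟙 _ := by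
      rw [hp]
      simp only [Category.assoc, Iso.inv_hom_id_assoc]
      rw [reassoc_of% V.parity_sq, Iso.hom_inv_id]
    have hPP : P ≫ P = 𝟙 M := (eFunctor H s).map_injective (by
      rw [CategoryTheory.Functor.map_comp, CategoryTheory.Functor.map_id, hP]
      exact comp_comp_self hpp hζ hζp)
    have hpar : ((eSuper H s).obj (superOfInvolution L hδ M P hPP)).parity =
        e.hom ≫ V.parity ≫ e.inv := by
      have h1 : ((eSuper H s).obj (superOfInvolution L hδ M P hPP)).parity =
          ζ ≫ (eFunctor H s).map P := rfl
      rw [h1, hP, reassoc_of% hζ, hp]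
    refine ⟨superOfInvolution L hδ M P hPP, ⟨⟨⟨e.hom, ?_⟩, ⟨e.inv, ?_⟩, ?_, ?_⟩⟩⟩
    · exact (congrArg (· ≫ e.hom) hpar).trans (conj_comp_hom e V.parity)
    · exact (inv_comp_conj e V.parity).symm.trans (congrArg (e.inv ≫ ·) hpar.symm)
    · exact SuperFRep.Hom.ext e.hom_inv_id
    · exact SuperFRep.Hom.ext e.inv_hom_id

theorem eSuper_isEquivalence (L : Lifts F H) (hc : Function.Injective c) {δ : Γ}
    (hδ : ∀ γ, Even (c γ γ - c γ δ)) : (eSuper H s).IsEquivalence where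
  faithful := eSuper_faithful s L hc
  full := eSuper_full s L hc
  essSurj := eSuper_essSurj s L hc hδ

end SuperEquivalence


/-! ### Change of section -/

section ChangeOfSection

variable {k : Type u} [Field k] [CharZero k] {Γ : Type u} [AddCommGroup Γ]
  {c : Γ →ₗ[ℤ] Γ →ₗ[ℤ] ℤ} {F : Frame k c} {H : HeisenbergExtension k c}
  {s s' : LevelSection c}

/-- The points `h χ` of `T(F)~` map the vectors on which `T(O)` acts by `s(χ)` to vectors on which
it acts by `s'(χ)`. -/
def IsShift (H : HeisenbergExtension k c) (s s' : LevelSection c)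
    (h : CharQuot c → H.G.obj (CommAlgCat.of k k)) : Prop :=
  ∀ (M : HeisMod H) (χ : CharQuot c) (m : M.obj.V),
    m ∈ charSpace ((resArc H).obj M) (s.1 χ) →
      M.obj.kact (h χ) m ∈ charSpace ((resArc H).obj M) (s'.1 χ)

theorem LevelSection.injective (s : LevelSection c) : Function.Injective s.1 := fun χ ψ h => by
  rw [← s.2 χ, ← s.2 ψ, h]

theorem isotypic_congr (V : ZcMod k c) (s s' : LevelSection c) (χ : CharQuot c) :
    isotypic V (s.1 χ) = isotypic V (s'.1 χ) := by
  rw [← weight_zcDiag, ← weight_zcDiag, s.2, s'.2]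

/-- A linear map acting by `h χ` on the weight space of `s(χ)`; finiteness of the set of `χ` makes
the sum over all `χ` meaningful. -/
theorem exists_shiftMap [Finite (CharQuot c)] (s : LevelSection c) (M : HeisMod H)
    (h : CharQuot c → H.G.obj (CommAlgCat.of k k)) :
    ∃ A : M.obj.V →ₗ[k] M.obj.V, ∀ χ (m : M.obj.V),
      m ∈ charSpace ((resArc H).obj M) (s.1 χ) → A m = M.obj.kact (h χ) m := by
  classical
  have := Fintype.ofFinite (CharQuot c)
  let P : CharQuot c → M.obj.V →ₗ[k] M.obj.V := fun ψ =>
    (torusDiag k Γ).proj ((resArc H).obj M) (s.1 ψ)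
  refine ⟨∑ ψ, (M.obj.kact (h ψ)).comp (P ψ), fun χ m hm => ?_⟩
  have hP : ∀ ψ, P ψ m = if s.1 χ = s.1 ψ then m else 0 := fun ψ =>
    (torusDiag k Γ).proj_of_mem (M := (resArc H).obj M) hm.1
  rw [LinearMap.sum_apply, Finset.sum_eq_single χ]
  · rw [LinearMap.comp_apply, hP, if_pos rfl]
  · intro ψ _ hne
    rw [LinearMap.comp_apply, hP, if_neg fun h => hne (s.injective h).symm, map_zero]
  · exact fun hn => absurd (Finset.mem_univ χ) hn

theorem exists_shift [Finite (CharQuot c)] {h : CharQuot c → H.G.obj (CommAlgCat.of k k)}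
    (hh : IsShift H s s' h) (M : HeisMod H) :
    ∃ η : (eFunctor H s).obj M ⟶ (eFunctor H s').obj M,
      ∀ χ, ∀ m ∈ charSpace ((eO H s).obj M) (s.1 χ),
        FRep.lin ((eIncl H s').app M) (FRep.lin η m) =
          M.obj.kact (h χ) (FRep.lin ((eIncl H s).app M) m) := by
  obtain ⟨A, hA⟩ := exists_shiftMap s M h
  have hmem : ∀ m ∈ eSpace s ((resArc H).obj M), A m ∈ eSpace s' ((resArc H).obj M) :=
      fun m hm => by
    have h1 : (⨆ χ, charSpace ((resArc H).obj M) (s.1 χ)) ≤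
        (eSpace s' ((resArc H).obj M)).comap (show ((resArc H).obj M).V →ₗ[k] ((resArc H).obj M).V
          from A) := iSup_le fun χ v hv => by
      rw [eSpace_eq_iSup]
      refine Submodule.mem_iSup_of_mem χ ?_
      exact (hA χ v hv).symm ▸ hh M χ v hv
    rw [eSpace_eq_iSup] at hm
    exact h1 hm
  let f : ((eO H s).obj M).V →ₗ[k] ((eO H s').obj M).V :=
    LinearMap.restrict (p := eSpace s ((resArc H).obj M)) (q := eSpace s' ((resArc H).obj M)) A hmem
  have hf : ∀ m, FRep.lin ((eIncl H s').app M) (f m) = A (FRep.lin ((eIncl H s).app M) m) :=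
    fun _ => rfl
  have hf' : ∀ χ, ∀ m ∈ charSpace ((eO H s).obj M) (s.1 χ),
      f m ∈ charSpace ((eO H s').obj M) (s'.1 χ) := fun χ m hm => by
    refine mem_charSpace_sub (eSpace_invariant s' ((resArc H).obj M)) ?_
    have h1 := hh M χ _ (eIncl_mem_charSpace s M hm)
    rw [← hA χ _ (eIncl_mem_charSpace s M hm)] at h1
    exact h1
  let f' : ((eFunctor H s).obj M).V →ₗ[k] ((eFunctor H s').obj M).V := f
  have hS : Submodule.span k (⋃ χ, (charSpace ((eO H s).obj M) (s.1 χ) :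
      Set ((eO H s).obj M).V)) = ⊤ := by
    rw [Submodule.span_iUnion]
    simp only [Submodule.span_eq]
    exact iSup_charSpace_eArc s ((resArc H).obj M)
  obtain ⟨η, hη⟩ := FRep.exists_hom_of_span (M := (eFunctor H s).obj M)
    (N := (eFunctor H s').obj M) f' hS fun R z m hm => by
      obtain ⟨χ, hm⟩ := Set.mem_iUnion.1 hm
      have h1 : ((eFunctor H s).obj M).coact z m = _ := charSpace_le_isotypic _ _ hm R z
      have h2 : f' m ∈ isotypic ((eFunctor H s').obj M) (s.1 χ) := by
        rw [isotypic_congr _ s s']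
        exact charSpace_le_isotypic ((eO H s').obj M) _ (hf' χ m hm)
      have h3 : ((eFunctor H s').obj M).coact z (f' m) = _ := h2 R z
      rw [h1, h3]
      exact LinearMap.baseChange_tmul ..
  refine ⟨η, fun χ m hm => ?_⟩
  rw [hη]
  exact hA χ _ (eIncl_mem_charSpace s M hm)

theorem eFunctor_lhom_ext {M : HeisMod H} {W : Type*} [AddCommGroup W] [Module k W]
    {f g : ((eO H s).obj M).V →ₗ[k] W}
    (h : ∀ χ, ∀ m ∈ charSpace ((eO H s).obj M) (s.1 χ), f m = g m) : f = g := by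
  have h1 : (⨆ χ, charSpace ((eO H s).obj M) (s.1 χ)) ≤ LinearMap.eqLocus f g :=
    iSup_le fun χ m hm => h χ m hm
  have h2 := iSup_charSpace_eArc s ((resArc H).obj M)
  exact LinearMap.ext fun m => h1 (h2.symm ▸ Submodule.mem_top)

/-- The natural transformation given by a shift. -/
theorem exists_shift_natTrans [Finite (CharQuot c)]
    {h : CharQuot c → H.G.obj (CommAlgCat.of k k)} (hh : IsShift H s s' h) :
    ∃ η : eFunctor H s ⟶ eFunctor H s', ∀ (M : HeisMod H) χ,
      ∀ m ∈ charSpace ((eO H s).obj M) (s.1 χ),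
        FRep.lin ((eIncl H s').app M) (FRep.lin (η.app M) m) =
          M.obj.kact (h χ) (FRep.lin ((eIncl H s).app M) m) := by
  choose η hη using exists_shift hh
  refine ⟨⟨η, fun M N f => FRep.hom_ext (eFunctor_lhom_ext (s := s) fun χ m hm => ?_)⟩, hη⟩
  have hm' : FRep.lin ((eO H s).map f) m ∈ charSpace ((eO H s).obj N) (s.1 χ) :=
    map_mem_charSpace ((eO H s).map f) hm
  refine eIncl_injective s' N ((hη N χ _ hm').trans ?_)
  refine Eq.trans ?_ (congrArg (FRep.lin f.hom) (hη M χ m hm)).symm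
  exact (FRep.hom_kact f.hom (h χ) (FRep.lin ((eIncl H s).app M) m)).symm

theorem shift_mem {h : CharQuot c → H.G.obj (CommAlgCat.of k k)} (hh : IsShift H s s' h)
    {M : HeisMod H} {χ : CharQuot c} {m : ((eO H s).obj M).V}
    (hm : m ∈ charSpace ((eO H s).obj M) (s.1 χ)) {m' : ((eO H s').obj M).V}
    (h' : FRep.lin ((eIncl H s').app M) m' = M.obj.kact (h χ) (FRep.lin ((eIncl H s).app M) m)) :
    m' ∈ charSpace ((eO H s').obj M) (s'.1 χ) := by
  refine mem_charSpace_sub (eSpace_invariant s' ((resArc H).obj M)) ?_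
  have h1 := hh M χ _ (eIncl_mem_charSpace s M hm)
  rw [← h'] at h1
  exact h1

theorem kact_inv_kact (M : HeisMod H) (g : H.G.obj (CommAlgCat.of k k)) (m : M.obj.V) :
    M.obj.kact g⁻¹ (M.obj.kact g m) = m := by
  rw [← FRep.kact_mul, inv_mul_cancel, FRep.kact_one]

theorem kact_kact_inv (M : HeisMod H) (g : H.G.obj (CommAlgCat.of k k)) (m : M.obj.V) :
    M.obj.kact g (M.obj.kact g⁻¹ m) = m := by
  rw [← FRep.kact_mul, mul_inv_cancel, FRep.kact_one]

/-- The natural isomorphism given by a shift. -/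
theorem exists_shift_natIso [Finite (CharQuot c)]
    {h : CharQuot c → H.G.obj (CommAlgCat.of k k)} (hh : IsShift H s s' h)
    (hh' : IsShift H s' s fun χ => (h χ)⁻¹) :
    ∃ α : eFunctor H s ≅ eFunctor H s', ∀ (M : HeisMod H) χ,
      ∀ m ∈ charSpace ((eO H s).obj M) (s.1 χ),
        FRep.lin ((eIncl H s').app M) (FRep.lin (α.hom.app M) m) =
          M.obj.kact (h χ) (FRep.lin ((eIncl H s).app M) m) := by
  obtain ⟨η, hη⟩ := exists_shift_natTrans hh
  obtain ⟨η', hη'⟩ := exists_shift_natTrans hh'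
  refine ⟨⟨η, η', ?_, ?_⟩, hη⟩
  · refine NatTrans.ext (funext fun M => FRep.hom_ext (eFunctor_lhom_ext (s := s) fun χ m hm => ?_))
    refine eIncl_injective s M ((hη' M χ _ (shift_mem hh hm (hη M χ m hm))).trans ?_)
    refine (congrArg (M.obj.kact (h χ)⁻¹) (hη M χ m hm)).trans ?_
    exact kact_inv_kact M (h χ) _
  · refine NatTrans.ext (funext fun M => FRep.hom_ext
      (eFunctor_lhom_ext (s := s') fun χ m hm => ?_))
    refine eIncl_injective s' M ((hη M χ _ (shift_mem hh' hm (hη' M χ m hm))).trans ?_)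
    refine (congrArg (M.obj.kact (h χ)) (hη' M χ m hm)).trans ?_
    exact kact_kact_inv M (h χ) _

/-- The inverses of the lifts of `t^γ` shift the weights of `T` by `c(γ)`. -/
theorem kact_inv_mem_charSpace (L : Lifts F H) (M : HeisMod H) {γ : Γ} {l : Module.Dual ℤ Γ}
    {m : M.obj.V} (hm : m ∈ charSpace ((resArc H).obj M) l) :
    M.obj.kact (L.base γ)⁻¹ m ∈ charSpace ((resArc H).obj M) (l + c γ) := by
  have h1 : M.obj.kact (L.base γ)⁻¹ m =
      ((L.κ γ (-γ))⁻¹ : k) • M.obj.kact (L.base (-γ)) m := by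
    have h2 := L.kact_base_base M γ (-γ) m
    rw [add_neg_cancel, L.kact_base_zero] at h2
    have h3 := congrArg (M.obj.kact (L.base γ)⁻¹) h2
    rw [← FRep.kact_mul, inv_mul_cancel, FRep.kact_one, map_smul] at h3
    rw [h3, inv_smul_smul₀ (L.κ γ (-γ)).ne_zero]
  have h2 := L.kact_mem_charSpace M (γ := -γ) hm
  rw [map_neg, sub_neg_eq_add] at h2
  rw [h1]
  exact Submodule.smul_mem _ _ h2

/-- For two sections the functors are isomorphic, with prescribed parities. -/
theorem exists_natIso (L : Lifts F H) (hc : Function.Injective c) [Finite (CharQuot c)]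
    (s s' : LevelSection c) : ∃ α : eFunctor H s ≅ eFunctor H s',
      ∀ (M : SuperHeisMod H) (χ : CharQuot c) (γ : Γ), c γ = s'.1 χ - s.1 χ →
        ∀ m ∈ isotypic ((eFunctor H s).obj M.mod) (s.1 χ),
          FRep.lin ((eSuper H s').obj M).parity (FRep.lin (α.hom.app M.mod) m) =
            (-1 : kˣ) ^ c γ γ •
              FRep.lin (α.hom.app M.mod) (FRep.lin ((eSuper H s).obj M).parity m) := by
  have hγ : ∀ χ, ∃ γ, c γ = s.1 χ - s'.1 χ := fun χ => by
    have h : s.1 χ - s'.1 χ ∈ LinearMap.range c := by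
      rw [← Submodule.Quotient.mk_eq_zero, Submodule.Quotient.mk_sub, sub_eq_zero]
      exact (s.2 χ).trans (s'.2 χ).symm
    exact h
  choose γ hγ using hγ
  have hh : IsShift H s s' fun χ => L.base (γ χ) := fun M χ m hm => by
    have h := L.kact_mem_charSpace M (γ := γ χ) hm
    rwa [hγ, sub_sub_cancel] at h
  have hh' : IsShift H s' s fun χ => (L.base (γ χ))⁻¹ := fun M χ m hm => by
    have h := kact_inv_mem_charSpace L M (γ := γ χ) hm
    rwa [hγ, add_sub_cancel] at h
  obtain ⟨α, hα⟩ := exists_shift_natIso hh hh'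
  refine ⟨α, fun M χ γ' hγ' m hm => ?_⟩
  have h1 : γ' = -γ χ := hc (by rw [hγ', map_neg, hγ, neg_sub])
  have h2 : c γ' γ' = c (γ χ) (γ χ) := by
    rw [h1, map_neg, map_neg, LinearMap.neg_apply, neg_neg]
  have hm1 : m ∈ charSpace ((eO H s).obj M.mod) (s.1 χ) := by
    rw [← (actsThrough_eO s M.mod).isotypic_eq]
    exact hm
  have hm2 : FRep.lin ((eSuper H s).obj M).parity m ∈ charSpace ((eO H s).obj M.mod) (s.1 χ) :=
    map_mem_charSpace ((eArc s).map M.parityArc) hm1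
  refine eIncl_injective s' M.mod ?_
  refine (lin_eIncl_parity s' M _).trans ((congrArg M.parity (hα M.mod χ m hm1)).trans ?_)
  refine (M.parity_kact L (γ χ) _).trans ?_
  refine Eq.trans ?_ ((FRep.lin ((eIncl H s').app M.mod)).map_smul
    (((-1 : kˣ) ^ c γ' γ' : kˣ) : k) _).symm
  rw [h2]
  exact congrArg (fun z => (((-1 : kˣ) ^ c (γ χ) (γ χ) : kˣ) : k) • z) (hα M.mod χ _ hm2).symm

end ChangeOfSection

end Heis

end

theorem lemma1p9 {k : Type u} [Field k] [CharZero k] {Γ : Type u} [AddCommGroup Γ]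
    [Module.Free ℤ Γ] [Module.Finite ℤ Γ] (c : Γ →ₗ[ℤ] Γ →ₗ[ℤ] ℤ)
    (hsymm : ∀ x y, c x y = c y x) (hc : c.Nondegenerate) (H : HeisenbergExtension k c) :
    Finite (CharQuot c) ∧
    (∀ s : LevelSection c,
      (eFunctor H s).IsEquivalence ∧
      (eSuper H s).IsEquivalence ∧
      (∀ M : HeisMod H, ActsThrough s ((eO H s).obj M) ∧ IsInduced H ((eIncl H s).app M)) ∧
      ∃ (W : ZcMod k c ⥤ FRep (torusArc k Γ)) (Ind : ZcMod k c ⥤ HeisMod H)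
        (j : W ⟶ Ind ⋙ resArc H),
        Nonempty (W ⋙ resZc k c ≅ 𝟭 _) ∧
        (∀ V, ActsThrough s (W.obj V) ∧ IsInduced H (j.app V)) ∧
        Nonempty (eFunctor H s ⋙ Ind ≅ 𝟭 _) ∧ Nonempty (Ind ⋙ eFunctor H s ≅ 𝟭 _)) ∧
    ∀ s s' : LevelSection c, ∃ α : eFunctor H s ≅ eFunctor H s',
      ∀ (M : SuperHeisMod H) (χ : CharQuot c) (γ : Γ), c γ = s'.1 χ - s.1 χ →
        ∀ m ∈ isotypic ((eFunctor H s).obj M.mod) (s.1 χ),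
          FRep.lin ((eSuper H s').obj M).parity (FRep.lin (α.hom.app M.mod) m) =
            (-1 : kˣ) ^ c γ γ •
              FRep.lin (α.hom.app M.mod) (FRep.lin ((eSuper H s).obj M).parity m) := by
  have hci : Function.Injective c :=
    LinearMap.ker_eq_bot.1 (LinearMap.separatingLeft_iff_ker_eq_bot.1 hc.1)
  have := finite_charQuot hci
  obtain ⟨F⟩ := exists_frame (k := k) hci
  obtain ⟨L⟩ := exists_lifts F H
  obtain ⟨δ, hδ⟩ := exists_diagonal hsymm
  exact ⟨finite_charQuot hci, fun s => ⟨eFunctor_isEquivalence s L hci,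
    eSuper_isEquivalence s L hci hδ, fun M => ⟨actsThrough_eO s M, isInduced_eIncl s L hci M⟩,
    exists_induction s L hci⟩, fun s s' => exists_natIso L hci s s'⟩
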